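/- Call an element $b$ of a semigroup $S$ \emph{regular} if $b=bxb$ for some $x\in S$, and \emph{cyclic} if $b=axa$ for some $a\in S$ and $x\in S^{1}$ (so that $b=a^{2}$ is allowed). A semigroup is \emph{cyclically regular} if each of its cyclic elements is regular. A finite list $\Sigma$ of semigroup identities $u=v$ (where $u,v$ are nonempty words over the countable alphabet $x_0,x_1,x_2,\dots$) is a basis of identities of the variety consisting of all semigroups that satisfy every identity in $\Sigma$; as an input, $\Sigma$ is written as a string over a fixed finite alphabet, the index of each letter being written in binary and delimiters separating letters, sides of identities, and identities. There is a polynomial-time algorithm (a deterministic multi-stack Turing machine whose number of steps is bounded by a polynomial in the length of the input string) that, given such a finite basis of identities $\Sigma$, decides whether all semigroups of the variety defined by $\Sigma$ are cyclically regular. -/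

import Mathlib

universe u

namespace CyclicRegularity

/-- An element `b` of a semigroup is (von Neumann) regular if `b = b x b` for some `x`. -/
def IsRegularElement {S : Type*} [Semigroup S] (b : S) : Prop :=
  ∃ x : S, b = b * x * b

/-- An element `b` of a semigroup `S` is cyclic if `b = a x a` for some `a ∈ S`, `x ∈ S¹`
(so `b = a a` is included). -/
def IsCyclicElement {S : Type*} [Semigroup S] (b : S) : Prop :=
  ∃ (a : S) (x : WithOne S), (b : WithOne S) = a * x * a

/-- A semigroup is cyclically regular if each of its cyclic elements is regular. -/
def IsCyclicallyRegular (S : Type*) [Semigroup S] : Prop :=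
  ∀ b : S, IsCyclicElement b → IsRegularElement b

/-- A semigroup identity `lhs = rhs` between nonempty words; the letters are `0, 1, 2, …`. -/
structure Identity where
  lhs : FreeSemigroup ℕ
  rhs : FreeSemigroup ℕ

/-- The identity holds in `S` under every substitution of elements of `S` for the letters. -/
def Identity.HoldsIn (i : Identity) (S : Type*) [Semigroup S] : Prop :=
  ∀ φ : ℕ → S, FreeSemigroup.lift φ i.lhs = FreeSemigroup.lift φ i.rhs

/-- `S` belongs to the variety of semigroups with the finite basis of identities `B`. -/
def InVariety (B : List Identity) (S : Type*) [Semigroup S] : Prop :=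
  ∀ i ∈ B, i.HoldsIn S

/-- All semigroups of the variety with the basis `B` are cyclically regular. -/
def AllCyclicallyRegular (B : List Identity) : Prop :=
  ∀ (S : Type u) [Semigroup S], InVariety B S → IsCyclicallyRegular S

/-- The finite alphabet in which bases of identities are written down. -/
inductive Symbol
  | bit (b : Bool)
  | letterEnd
  | equals
  | identityEnd
  deriving DecidableEq, Fintype

/-- A letter is written as its index in binary, closed by a delimiter. -/
def encodeLetter (n : ℕ) : List Symbol :=
  (Computability.encodeNat n).map Symbol.bit ++ [Symbol.letterEnd]

/-- A word is written letter by letter. -/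
def encodeWord (w : FreeSemigroup ℕ) : List Symbol :=
  (w.head :: w.tail).flatMap encodeLetter

/-- An identity `u = v` is written as `u`, an equality sign, `v`, and a delimiter. -/
def encodeIdentity (i : Identity) : List Symbol :=
  encodeWord i.lhs ++ [Symbol.equals] ++ encodeWord i.rhs ++ [Symbol.identityEnd]

/-- A finite basis is written identity by identity. -/
def encodeBasis (B : List Identity) : List Symbol :=
  B.flatMap encodeIdentity

end CyclicRegularity

/-! The proof has an algebraic, a combinatorial and an algorithmic half-step: cyclic regularity
fails exactly if one of eight kinds of languages over two letters `x`, `y` is closed under the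
identities; closedness is a condition on occurrences and factors of the two sides of each identity;
and this condition is a fixed first-order formula with modular counting over the positions of the
input.

Algebra. If a language `K` is closed under rewriting by the identities, its syntactic semigroup lies
in the variety. If moreover `K` contains `xyx` but no `xyx s xyx` (or `xx` but no `xx s xx`), the
class of this word is a nonregular cyclic element (`not_allCyclicallyRegular_of_closed`). The
languages used are `{xx}`, the words with one `y`, `{xyx, yxy}`, the words `x⋯xyx` and their mirror
images, and for every `k > 0` the words `xy^qx` and `x⋯xy^qx` with `q ≡ 1` modulo `k`, the latter
also mirrored. Conversely, a language that is not closed yields an equality between a word inside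
and a word outside. The first two languages give index two with a period, and completely regular
local submonoids (`exists_period_of_unsaturated`, `exists_completely_of_unsaturated`). The others
give an identity `xyx = w`. By `LocallyRegular.classify` it makes every `xyx` regular unless `w` is
`yxy`, `x^i y^q x` or `x y^q x^i`, and each exception is removed by the language it belongs to
(`cyclicRegularOn_of_unsaturated`). The recurring tool is `regular_of_two`: in the periodic
situation an element that factors through two disjoint copies of itself is regular. The outcome is
`allCyclicallyRegular_iff`.

Combinatorics. For each language, test substitutions show which cuts of one side of an identity must
have a counterpart on the other side, and these conditions are also sufficient
(`transfers_squareWords`, `BothPowerTransfer.transfers` and similar lemmas). For languages with a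
parameter `k` there are also congruences between occurrence numbers and a divisibility condition,
`Solvable`. All `k` are dealt with at once by the greatest common period `D` of the identities
(`not_closed_power_iff`), which leads to `allCyclicallyRegular_iff_criterion`.

Complexity. The criterion mentions only order, equality of letters and occurrence numbers modulo
numbers that are bounded by the input length and hence represented by positions. So it is a formula
(`Context.criterion`). A machine with a fixed number of pointers, each held as two stacks, evaluates
any such formula by nested loops (`Formula.evaluates_compile`, `Formula.computableInPolyTime`). -/

namespace CyclicRegularity

/-! ### Values of two-letter words in a monoid. -/

section WordsInMonoids

variable {M : Type*} [Monoid M]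

/-- The value of a word in two letters (`true` stands for `x`, `false` for `y`). -/
def wordEval (x y : M) (w : List Bool) : M := (w.map fun c => if c then x else y).prod

@[simp] lemma wordEval_nil (x y : M) : wordEval x y [] = 1 := rfl

@[simp] lemma wordEval_true (x y : M) (w : List Bool) :
    wordEval x y (true :: w) = x * wordEval x y w := by simp [wordEval]

@[simp] lemma wordEval_false (x y : M) (w : List Bool) :
    wordEval x y (false :: w) = y * wordEval x y w := by simp [wordEval]

@[simp] lemma wordEval_append (x y : M) (v w : List Bool) :
    wordEval x y (v ++ w) = wordEval x y v * wordEval x y w := by simp [wordEval]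

@[simp] lemma wordEval_replicate_true (x y : M) (n : ℕ) :
    wordEval x y (List.replicate n true) = x ^ n := by simp [wordEval]

@[simp] lemma wordEval_replicate_false (x y : M) (n : ℕ) :
    wordEval x y (List.replicate n false) = y ^ n := by simp [wordEval]

lemma wordEval_flatten_replicate (x y : M) (n : ℕ) (w : List Bool) :
    wordEval x y (List.replicate n w).flatten = wordEval x y w ^ n := by
  induction n with
  | zero => simp
  | succ n ih => simp [List.replicate_succ, ih, pow_succ']

/-- Substitution of words corresponds to evaluation at their values; this is how an identity is
applied to its own right-hand side. -/
lemma wordEval_flatMap (x y : M) (f : Bool → List Bool) (w : List Bool) :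
    wordEval x y (w.flatMap f) = wordEval (wordEval x y (f true)) (wordEval x y (f false)) w := by
  induction w with
  | nil => simp
  | cons c w ih => cases c <;> simp [ih]

lemma wordEval_map_not (x y : M) (w : List Bool) :
    wordEval x y (w.map not) = wordEval y x w := by
  induction w with
  | nil => simp
  | cons c w ih => cases c <;> simp [ih]

lemma wordEval_op (x y : M) (w : List Bool) :
    wordEval (MulOpposite.op x) (MulOpposite.op y) w.reverse
      = MulOpposite.op (wordEval x y w) := by
  induction w with
  | nil => simp
  | cons c w ih => cases c <;> simp [ih]

end WordsInMonoids

/-! ### Block structure of two-letter words. -/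

section Words

/-- Every maximal block of the letter `c` has length at least two. -/
inductive LongBlocks (c : Bool) : List Bool → Prop
  | nil : LongBlocks c []
  | cons {w} : LongBlocks c w → LongBlocks c ((!c) :: w)
  | block {w} (n : ℕ) : LongBlocks c w → LongBlocks c (List.replicate (n + 2) c ++ w)

lemma exists_replicate_append (c : Bool) (w : List Bool) :
    ∃ n r, w = List.replicate n c ++ r ∧ (r = [] ∨ ∃ r', r = (!c) :: r') := by
  induction w with
  | nil => exact ⟨0, [], by simp⟩
  | cons d w ih =>
    by_cases h : d = c
    · obtain ⟨n, r, h1, h2⟩ := ih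
      exact ⟨n + 1, r, by simp [List.replicate_succ, h, h1], h2⟩
    · exact ⟨0, d :: w, by simp, Or.inr ⟨w, by cases c <;> cases d <;> simp_all⟩⟩

/-- The dichotomy behind the classification: a block that is not long is a single letter, whose
neighbours are `!c` or the ends of the word. The proof strips the leading block. -/
lemma longBlocks_or_single (c : Bool) (w : List Bool) :
    LongBlocks c w ∨ ∃ p q, w = p ++ [c] ++ q ∧ (p = [] ∨ ∃ p', p = p' ++ [!c]) ∧
      (q = [] ∨ ∃ q', q = (!c) :: q') := by
  induction h : w.length using Nat.strong_induction_on generalizing w with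
  | _ n ih =>
    obtain ⟨m, r, rfl, hr⟩ := exists_replicate_append c w
    have key : ∀ r' : List Bool, r'.length < n → ∀ v : List Bool,
        (∃ p q, (!c) :: r' = p ++ [c] ++ q ∧ (∃ p', p = p' ++ [!c]) ∧
          (q = [] ∨ ∃ q', q = (!c) :: q')) ∨ LongBlocks c ((!c) :: r') := by
      intro r' hr' _
      rcases ih _ hr' r' rfl with h | ⟨p, q, h1, h2, h3⟩
      · exact Or.inr h.cons
      · refine Or.inl ⟨(!c) :: p, q, by simp [h1], ?_, h3⟩
        rcases h2 with rfl | ⟨p', rfl⟩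
        · exact ⟨[], rfl⟩
        · exact ⟨(!c) :: p', rfl⟩
    have hrest : (∃ p q, r = p ++ [c] ++ q ∧ (∃ p', p = p' ++ [!c]) ∧
          (q = [] ∨ ∃ q', q = (!c) :: q')) ∨ LongBlocks c r := by
      rcases hr with rfl | ⟨r', rfl⟩
      · exact Or.inr .nil
      · exact key r' (by simp at h; omega) []
    match m with
    | 0 =>
      rcases hrest with ⟨p, q, h1, h2, h3⟩ | h
      · exact Or.inr ⟨p, q, by simpa using h1, Or.inr h2, h3⟩
      · exact Or.inl (by simpa using h)
    -- A leading block of length one is itself the isolated letter.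
    | 1 => exact Or.inr ⟨[], r, by simp, Or.inl rfl, hr⟩
    | m + 2 =>
      rcases hrest with ⟨p, q, h1, ⟨p', rfl⟩, h3⟩ | h
      · exact Or.inr ⟨List.replicate (m + 2) c ++ (p' ++ [!c]), q, by simp [h1],
          Or.inr ⟨List.replicate (m + 2) c ++ p', by simp⟩, h3⟩
      · exact Or.inl (h.block m)

/-- A word containing `y`, `x`, `y` in this order has a factor `y x ⋯ x y`. -/
lemma exists_block_between (a b c d : List Bool) :
    ∃ p n q, a ++ false :: (b ++ true :: (c ++ false :: d))
      = p ++ false :: (List.replicate (n + 1) true ++ false :: q) := by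
  induction h : b.length using Nat.strong_induction_on generalizing a b with
  | _ m ih =>
    obtain ⟨n, r, rfl, hr⟩ := exists_replicate_append true b
    rcases hr with rfl | ⟨r', rfl⟩
    · obtain ⟨n', r', rfl, hr'⟩ := exists_replicate_append true c
      rcases hr' with rfl | ⟨r'', rfl⟩
      · exact ⟨a, n + n', d, by
          rw [show n + n' + 1 = n + (n' + 1) by ring, List.replicate_add, List.replicate_succ]
          simp⟩
      · exact ⟨a, n + n', r'' ++ false :: d, by
          rw [show n + n' + 1 = n + (n' + 1) by ring, List.replicate_add, List.replicate_succ]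
          simp⟩
    -- `b` contains a further `y`, which takes over the role of the first one; what remains of `b`
    -- is shorter.
    · obtain ⟨p, k, q, e⟩ := ih r'.length (by simp at h; omega)
        (a ++ false :: List.replicate n true) r' rfl
      exact ⟨p, k, q, by rw [← e]; simp⟩

end Words

/-! ### Identities `xyx = w` over ideals with completely regular local submonoids. -/

section Core

variable {M : Type*} [Monoid M]

/-- `I` is an ideal of the monoid, its elements have index at most two and period `k`, and the
local submonoids at the idempotents `x ^ (2 * k)` are completely regular. -/
structure LocallyRegular (I : Set M) (k r : ℕ) : Prop where
  mul_left : ∀ a ∈ I, ∀ m, m * a ∈ I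
  mul_right : ∀ a ∈ I, ∀ m, a * m ∈ I
  k_pos : 0 < k
  r_pos : 0 < r
  periodic : ∀ x ∈ I, x ^ (2 + k) = x ^ 2
  completely : ∀ x ∈ I, ∀ y ∈ I, (x ^ (2 * k) * y * x ^ (2 * k)) ^ (1 + r)
    = x ^ (2 * k) * y * x ^ (2 * k)

/-- The identity `xyx = w(x, y)` holds on `I`. -/
def CyclicIdentity (I : Set M) (w : List Bool) : Prop :=
  ∀ x ∈ I, ∀ y ∈ I, x * y * x = wordEval x y w

/-- All elements `xyx` with `x, y ∈ I` are regular. -/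
def CyclicRegularOn (I : Set M) : Prop :=
  ∀ x ∈ I, ∀ y ∈ I, ∃ z, x * y * x = x * y * x * z * (x * y * x)

/-- The image of an ideal in the opposite monoid. -/
def opIdeal (I : Set M) : Set Mᵐᵒᵖ := {a | a.unop ∈ I}

/-- `xyx` is a palindrome, so the opposite monoid only reverses the right-hand side; this halves the
case distinctions. -/
lemma CyclicIdentity.op {I : Set M} {w : List Bool} (h : CyclicIdentity I w) :
    CyclicIdentity (opIdeal I) w.reverse := by
  intro x hx y hy
  have := wordEval_op x.unop y.unop w
  simp only [MulOpposite.op_unop] at this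
  rw [this, ← h _ hx _ hy]
  simp [mul_assoc]

lemma CyclicRegularOn.of_op {I : Set M} (h : CyclicRegularOn (opIdeal I)) :
    CyclicRegularOn I := by
  intro x hx y hy
  obtain ⟨z, hz⟩ := h (MulOpposite.op x) (by simpa [opIdeal]) (MulOpposite.op y)
    (by simpa [opIdeal])
  refine ⟨z.unop, ?_⟩
  have := congrArg MulOpposite.unop hz
  simpa [mul_assoc] using this

namespace LocallyRegular

variable {I : Set M} {k r : ℕ}

lemma op (h : LocallyRegular I k r) : LocallyRegular (opIdeal I) k r where
  mul_left a ha m := h.mul_right _ ha m.unop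
  mul_right a ha m := h.mul_left _ ha m.unop
  k_pos := h.k_pos
  r_pos := h.r_pos
  periodic x hx := by
    apply MulOpposite.unop_injective
    simpa using h.periodic _ hx
  completely x hx y hy := by
    apply MulOpposite.unop_injective
    simpa [mul_assoc] using h.completely _ hx _ hy

variable (h : LocallyRegular I k r)
include h

lemma pow_mem {x : M} (hx : x ∈ I) (n : ℕ) : x ^ (n + 1) ∈ I := by
  rw [pow_succ]; exact h.mul_left _ hx _

lemma pow_add_period {x : M} (hx : x ∈ I) (n m : ℕ) : x ^ (n + 2 + m * k) = x ^ (n + 2) := by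
  induction m with
  | zero => simp
  | succ m ih =>
    rw [show n + 2 + (m + 1) * k = (n + m * k) + (2 + k) by ring, pow_add, h.periodic x hx,
      ← pow_add, ← ih]
    congr 1; ring

lemma pow_mul_sq {x : M} (hx : x ∈ I) (m : ℕ) : x ^ (m * k) * x ^ 2 = x ^ 2 := by
  rw [← pow_add, add_comm]; simpa using h.pow_add_period hx 0 m

lemma sq_mul_pow {x : M} (hx : x ∈ I) (m : ℕ) : x ^ 2 * x ^ (m * k) = x ^ 2 := by
  rw [← pow_add]; simpa using h.pow_add_period hx 0 m

/-- Iterating `b = u b s` puts `u ^ 2` in front of `b`, and `u ^ k` acts there as an identity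
because the index is at most two. -/
lemma pow_mul_of_eq {u b s : M} (hu : u ∈ I) (hb : b = u * b * s) : u ^ k * b = b := by
  have h2 : b = u ^ 2 * b * s ^ 2 := by
    calc b = u * b * s := hb
      _ = u * (u * b * s) * s := by rw [← hb]; exact hb
      _ = _ := by simp [pow_two, mul_assoc]
  calc u ^ k * b = (u ^ k * u ^ 2) * b * s ^ 2 := by
        conv_lhs => rw [h2]
        simp [mul_assoc]
    _ = u ^ 2 * b * s ^ 2 := by rw [show u ^ k * u ^ 2 = u ^ 2 by simpa using h.pow_mul_sq hu 1]
    _ = b := h2.symm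

lemma mul_pow_of_eq {u b p : M} (hu : u ∈ I) (hb : b = p * b * u) : b * u ^ k = b := by
  have := h.op.pow_mul_of_eq (u := MulOpposite.op u) (b := MulOpposite.op b)
    (s := MulOpposite.op p) (by simpa [opIdeal]) (by
      apply MulOpposite.unop_injective; simpa [mul_assoc] using hb)
  have := congrArg MulOpposite.unop this
  simpa using this

/-- An element of `I` which is a multiple of two disjoint copies of itself is regular. -/
lemma regular_of_two {b p q s : M} (hbI : b ∈ I) (hb : b = p * b * q * b * s) :
    ∃ z, b = b * z * b := by
  obtain ⟨n, hn⟩ : ∃ n, k = n + 1 := ⟨k - 1, by have := h.k_pos; omega⟩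
  -- With `v = q b s` the hypothesis reads `b = p b v`, so `v ^ k` is absorbed by `b` on the right.
  have h1 : b * (q * b * s) ^ k = b :=
    h.mul_pow_of_eq (p := p) (h.mul_right _ (h.mul_left _ hbI _) _)
      (by simpa [mul_assoc] using hb)
  -- The last factor of `v ^ k` contains `b` again: `b = u b s`, where `u = b v ^ n q` starts with
  -- `b`.
  have h2 : b = (b * ((q * b * s) ^ n * q)) * b * s := by
    conv_lhs => rw [← h1, hn, pow_succ]
    simp [mul_assoc]
  have h3 := h.pow_mul_of_eq (h.mul_right _ hbI _) h2
  -- In `b = u ^ k b` the first factor `u` starts with `b`; everything between the two copies of `b`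
  -- is the witness.
  refine ⟨((q * b * s) ^ n * q) * (b * ((q * b * s) ^ n * q)) ^ n, ?_⟩
  conv_lhs => rw [← h3, hn, pow_succ']
  simp [mul_assoc]

lemma completely_pow {x y : M} (hx : x ∈ I) (hy : y ∈ I) (n : ℕ) :
    (x ^ (2 * k) * y * x ^ (2 * k)) ^ (1 + n * r) = x ^ (2 * k) * y * x ^ (2 * k) := by
  induction n with
  | zero => simp
  | succ n ih =>
    rw [show 1 + (n + 1) * r = 1 + n * r + r by ring, pow_add, ih]
    have := h.completely x hx y hy
    rwa [pow_add, pow_one] at this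

lemma pow_succ_of_local {x b : M} (hx : x ∈ I) (hb : b ∈ I) (h1 : x ^ (2 * k) * b = b)
    (h2 : b * x ^ (2 * k) = b) (n : ℕ) : b ^ (1 + n * r) = b := by
  have := h.completely_pow hx hb n
  rwa [h1, h2] at this

/-- In the local submonoid `b = b ^ (1 + r) = b * b ^ (r - 1) * b`. -/
lemma regular_of_local {x b : M} (hx : x ∈ I) (hb : b ∈ I) (h1 : x ^ (2 * k) * b = b)
    (h2 : b * x ^ (2 * k) = b) : ∃ z, b = b * z * b := by
  obtain ⟨n, hn⟩ : ∃ n, r = n + 1 := ⟨r - 1, by have := h.r_pos; omega⟩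
  refine ⟨b ^ n, ?_⟩
  conv_lhs => rw [← h.pow_succ_of_local hx hb h1 h2 1, one_mul, hn, add_comm, pow_succ, pow_succ']

lemma cyclic_mem {x y : M} (hx : x ∈ I) : x * y * x ∈ I := h.mul_left _ hx _

/-- In a block of length at least two the substitution raises the exponent by a multiple of `k`,
which is invisible beyond the index. -/
lemma wordEval_longBlocks_true {x y : M} (hx : x ∈ I) (m : ℕ) {w : List Bool}
    (hw : LongBlocks true w) : wordEval (x ^ (m * k + 1)) y w = wordEval x y w := by
  induction hw with
  | nil => simp
  | cons _ ih => simp [ih]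
  | block n _ ih =>
    simp only [wordEval_append, wordEval_replicate_true, ih, ← pow_mul]
    rw [show (m * k + 1) * (n + 2) = n + 2 + (m * (n + 2)) * k by ring, h.pow_add_period hx]

lemma wordEval_longBlocks_false {x y : M} (hy : y ∈ I) (m : ℕ) {w : List Bool}
    (hw : LongBlocks false w) : wordEval x (y ^ (m * k + 1)) w = wordEval x y w := by
  induction hw with
  | nil => simp
  | cons _ ih => simp [ih]
  | block n _ ih =>
    simp only [wordEval_append, wordEval_replicate_false, ih, ← pow_mul]
    rw [show (m * k + 1) * (n + 2) = n + 2 + (m * (n + 2)) * k by ring, h.pow_add_period hy]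

/-- The outer powers have exponents at least two and absorb `x ^ (2 * k)`, so `xyx` lies in the
local submonoid at this idempotent. -/
lemma cyclicRegularOn_of_pow {i j : ℕ} {c : M → M → M}
    (hw : ∀ x ∈ I, ∀ y ∈ I, x * y * x = x ^ (i + 2) * c x y * x ^ (j + 2)) :
    CyclicRegularOn I := by
  intro x hx y hy
  refine h.regular_of_local hx (h.cyclic_mem hx) ?_ ?_
  · rw [hw x hx y hy, ← mul_assoc, ← mul_assoc, ← pow_add, add_comm, h.pow_add_period hx]
  · rw [hw x hx y hy, mul_assoc, ← pow_add, h.pow_add_period hx]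

/-- Replacing `x` by `x ^ (2 * k + 1)` does not affect `w`, hence `xyx = x ^ (2 * k + 1) y x ^ (2 *
k + 1)`. -/
lemma cyclicRegularOn_of_longBlocks {w : List Bool} (hw : CyclicIdentity I w)
    (hl : LongBlocks true w) : CyclicRegularOn I := by
  refine h.cyclicRegularOn_of_pow (i := 2 * k - 1) (j := 2 * k - 1) (c := fun _ y => y) ?_
  intro x hx y hy
  have hk := h.k_pos
  rw [hw x hx y hy, ← h.wordEval_longBlocks_true hx 2 hl, ← hw _ (h.pow_mem hx _) _ hy,
    show 2 * k - 1 + 2 = 2 * k + 1 by omega]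

lemma wordEval_mem {x y : M} (hx : x ∈ I) (hy : y ∈ I) {w : List Bool} (hw : w ≠ []) :
    wordEval x y w ∈ I := by
  cases w with
  | nil => simp at hw
  | cons c w => cases c <;> simp only [wordEval_true, wordEval_false] <;>
      exact h.mul_right _ (by assumption) _

/-- A word with `yxy` as a proper factor. -/
lemma cyclicRegularOn_of_factor {p q : List Bool}
    (hw : CyclicIdentity I (p ++ [false, true, false] ++ q)) (hpq : p ≠ [] ∨ q ≠ []) :
    CyclicRegularOn I := by
  intro x hx y hy
  -- For the pair `y, x ^ (n + 1)` the factor `yxy` of the word becomes `x ^ (n + 1) y x ^ (n + 1)`,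
  -- which contains `xyx`.
  have block : ∀ n, ∃ a b, y * x ^ (n + 1) * y = a * (x * y * x) * b := fun n =>
    ⟨wordEval y (x ^ (n + 1)) p * x ^ n, x ^ n * wordEval y (x ^ (n + 1)) q, by
      rw [hw y hy _ (h.pow_mem hx n)]
      have e1 := pow_succ x n
      have e2 := pow_succ' x n
      generalize x ^ (n + 1) = z at *
      simp only [wordEval_append, wordEval_false, wordEval_true, wordEval_nil, mul_one]
      calc _ = wordEval y z p * (z * y * z) * wordEval y z q := by simp only [mul_assoc]
        _ = wordEval y z p * (x ^ n * x * y * (x * x ^ n)) * wordEval y z q := by rw [← e1, ← e2]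
        _ = _ := by simp only [mul_assoc]⟩
  have pat : ∀ a b c d : List Bool, ∃ α β,
      wordEval x y (a ++ false :: (b ++ true :: (c ++ false :: d))) = α * (x * y * x) * β := by
    intro a b c d
    obtain ⟨p', n, q', e⟩ := exists_block_between a b c d
    obtain ⟨α, β, e'⟩ := block n
    refine ⟨wordEval x y p' * α, β * wordEval x y q', ?_⟩
    rw [e]
    simp only [wordEval_append, wordEval_false, wordEval_replicate_true]
    calc _ = wordEval x y p' * (y * x ^ (n + 1) * y) * wordEval x y q' := by simp [mul_assoc]
      _ = _ := by rw [e']; simp [mul_assoc]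
  -- Repeating a nonempty word together with its image under the exchange of letters creates the
  -- pattern `y`, `x`, `y`.
  have rep : ∀ v : List Bool, v ≠ [] → ∃ α β,
      wordEval x y ((v ++ v.map not) ++ (v ++ v.map not)) = α * (x * y * x) * β := by
    intro v hv
    obtain ⟨c, v, rfl⟩ := List.exists_cons_of_ne_nil hv
    cases c
    · obtain ⟨α, β, e⟩ := pat [] v (v.map not) (v ++ true :: v.map not)
      exact ⟨α, β, by rw [← e]; simp⟩
    · obtain ⟨α, β, e⟩ := pat (true :: v) (v.map not) v (v.map not)
      exact ⟨α, β, by rw [← e]; simp⟩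
  have rep' : ∀ v : List Bool, v ≠ [] → ∃ α β,
      wordEval x y ((v.map not ++ v) ++ (v.map not ++ v)) = α * (x * y * x) * β := by
    intro v hv
    obtain ⟨α, β, e⟩ := rep (v.map not) (by simpa using hv)
    refine ⟨α, β, ?_⟩
    rw [← e]; simp [Function.comp_def]
  -- The identity is applied to `xyx`, then to the factor `yxy` obtained; this returns to `xyx` with
  -- a longer context.
  have hb : x * y * x = wordEval x y (p ++ p.map not) * (x * y * x)
      * wordEval x y (q.map not ++ q) := by
    conv_lhs => rw [hw x hx y hy]
    have e := hw y hy x hx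
    simp only [wordEval_append, wordEval_false, wordEval_true, wordEval_nil, mul_one,
      wordEval_map_not] at e ⊢
    calc _ = wordEval x y p * (y * x * y) * wordEval x y q := by simp [mul_assoc]
      _ = _ := by rw [e]; simp [mul_assoc]
  set P := wordEval x y (p ++ p.map not) with hP
  set Q := wordEval x y (q.map not ++ q) with hQ
  have hb2 : x * y * x = (P * P) * (x * y * x) * (Q * Q) := by
    calc x * y * x = P * (x * y * x) * Q := hb
      _ = P * (P * (x * y * x) * Q) * Q := by rw [← hb]; exact hb
      _ = _ := by simp [mul_assoc]
  rcases hpq with hp | hq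
  · obtain ⟨α, β, e⟩ := rep p hp
    rw [wordEval_append, ← hP] at e
    rw [e] at hb2
    exact h.regular_of_two (h.cyclic_mem hx) (p := α) (q := β) (s := Q * Q)
      (by simpa [mul_assoc] using hb2)
  · obtain ⟨α, β, e⟩ := rep' q hq
    rw [wordEval_append, ← hQ] at e
    rw [e] at hb2
    exact h.regular_of_two (h.cyclic_mem hx) (p := P * P) (q := α) (s := β)
      (by simpa [mul_assoc] using hb2)

/-- A word `⋯ xyx ⋯ y ⋯ x`. -/
lemma cyclicRegularOn_of_single {p q : List Bool}
    (hw : CyclicIdentity I (p ++ [true, false, true] ++ (q ++ [true]))) (hq : false ∈ q) :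
    CyclicRegularOn I := by
  intro x hx y hy
  obtain ⟨a, q₂, hq₂⟩ : ∃ a q₂, q = List.replicate a true ++ false :: q₂ := by
    obtain ⟨a, s, rfl, hs⟩ := exists_replicate_append true q
    rcases hs with rfl | ⟨s, rfl⟩
    · simp [List.mem_replicate] at hq
    · exact ⟨a, s, rfl⟩
  set P := wordEval x y p
  set Q := wordEval x y q
  have hb : x * y * x = P * (x * y * x) * (Q * x) := by
    conv_lhs => rw [hw x hx y hy]
    simp [P, Q, mul_assoc]
  have hb2 : x * y * x = (P * P) * (x * y * x) * ((Q * x) * (Q * x)) := by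
    calc x * y * x = P * (x * y * x) * (Q * x) := hb
      _ = P * (P * (x * y * x) * (Q * x)) * (Q * x) := by rw [← hb]; exact hb
      _ = _ := by simp [mul_assoc]
  -- By `hb2`, `xyx = P P x y' x` for `y' = y x Q x Q`. The identity for the pair `x, y'` then
  -- produces two disjoint copies of `xyx`, since its word has a second `y` in `q`.
  have hy' : y * (x * Q * x * Q) ∈ I := h.mul_right _ hy _
  have e := hw x hx _ hy'
  rw [hq₂] at e
  simp only [wordEval_append, wordEval_false, wordEval_true, wordEval_nil, mul_one,
    wordEval_replicate_true] at e
  set P' := wordEval x (y * (x * Q * x * Q)) p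
  set Q' := wordEval x (y * (x * Q * x * Q)) q₂
  refine h.regular_of_two (h.cyclic_mem hx) (p := P * P * P') (q := Q * x * Q * x ^ a)
    (s := Q * x * Q * (Q' * x)) ?_
  calc x * y * x = (P * P) * (x * (y * (x * Q * x * Q)) * x) := by
        conv_lhs => rw [hb2]
        simp [mul_assoc]
    _ = _ := by
        rw [e]
        have : x ^ a * x = x * x ^ a := by rw [← pow_succ, pow_succ']
        simp only [mul_assoc]
        rw [← mul_assoc x (x ^ a), ← this]
        simp only [mul_assoc]

/-- A word whose `y`-blocks are long and which has a factor `y x ⋯ x y`. -/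
lemma cyclicRegularOn_of_long_false {p q : List Bool} {c : ℕ}
    (hw : CyclicIdentity I (p ++ false :: (List.replicate (c + 1) true ++ false :: q)))
    (hl : LongBlocks false (p ++ false :: (List.replicate (c + 1) true ++ false :: q))) :
    CyclicRegularOn I := by
  intro x hx y hy
  -- Long blocks of `y` do not distinguish `y` from `y ^ (m * k + 1)`.
  have hb : ∀ m, x * y ^ (m * k + 1) * x = x * y * x := fun m => by
    rw [hw x hx _ (h.pow_mem hy _), h.wordEval_longBlocks_false hy m hl, ← hw x hx y hy]
  -- `u` lies in the local submonoid at `y ^ (2 * k)`, so it equals its power with exponent `1 + 3 *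
  -- r ≥ 4`.
  set u := y ^ (2 * k) * (y * x ^ (c + 1)) * y ^ (2 * k) with hu
  have hu' := h.completely_pow hy (h.mul_right _ hy (x ^ (c + 1))) 3
  rw [← hu] at hu'
  obtain ⟨n, hn⟩ : ∃ n, 1 + 3 * r = 4 + n := ⟨3 * r - 3, by have := h.r_pos; omega⟩
  rw [hn, pow_add] at hu'
  -- Adjacent copies of `u` meet in `x y ^ (4 * k + 1) x = xyx`. Of the three junctions in `u ^ 4`
  -- the first and the third are used; consecutive ones may overlap.
  have e4 : u ^ 4 = (y ^ (2 * k) * y * x ^ c) * (x * y * x) * (x ^ c * y ^ (2 * k) * y ^ (2 * k)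
      * y * x ^ c) * (x * y * x) * (x ^ c * y ^ (2 * k)) := by
    rw [← hb 4]
    have e1 : y ^ (4 * k + 1) = y ^ (2 * k) * (y ^ (2 * k) * y) := by
      rw [← mul_assoc, ← pow_add, ← pow_succ]; congr 1; ring
    have ex : x ^ (c + 1) = x ^ c * x := pow_succ x c
    have ex' : x ^ c * x = x * x ^ c := by rw [← pow_succ, pow_succ']
    rw [e1, hu, ex]
    simp only [pow_succ _ 3, pow_succ _ 2, pow_succ _ 1, pow_one, mul_assoc]
    have ex2 : ∀ z, x ^ c * (x * z) = x * (x ^ c * z) := fun z => by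
      rw [← mul_assoc, ex', mul_assoc]
    simp only [ex2]
  set P := wordEval x (y ^ (2 * k + 1)) p
  set Q := wordEval x (y ^ (2 * k + 1)) q
  -- Evaluating the word at `y ^ (2 * k + 1)` exhibits `u` as a factor of `xyx`.
  have e0 : x * y * x = P * u * (y * Q) := by
    rw [← hb 2, hw x hx _ (h.pow_mem hy _)]
    simp only [wordEval_append, wordEval_false, wordEval_replicate_true]
    rw [hu]
    change P * (y ^ (2 * k + 1) * (x ^ (c + 1) * (y ^ (2 * k + 1) * Q))) = _
    simp only [pow_succ y, mul_assoc]
  rw [← hu', e4] at e0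
  exact h.regular_of_two (h.cyclic_mem hx) (p := P * (y ^ (2 * k) * y * x ^ c))
    (q := x ^ c * y ^ (2 * k) * y ^ (2 * k) * y * x ^ c)
    (s := (x ^ c * y ^ (2 * k)) * u ^ n * (y * Q))
    (by simpa only [mul_assoc] using e0)

/-- A word `x ⋯ y ⋯ x ⋯ y ⋯ x`. -/
lemma cyclicRegularOn_of_two_blocks {w a b c d : List Bool} (hw : CyclicIdentity I w)
    (h1 : w = true :: (a ++ false :: (b ++ true :: (c ++ false :: (d ++ [true]))))) :
    CyclicRegularOn I := by
  rcases longBlocks_or_single false w with hl | ⟨p, q, e, hp, hq⟩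
  · obtain ⟨p, n, q, e⟩ := exists_block_between (true :: a) b c (d ++ [true])
    have e' : w = p ++ false :: (List.replicate (n + 1) true ++ false :: q) := by
      rw [h1, ← e]; simp
    rw [e'] at hw hl
    exact h.cyclicRegularOn_of_long_false hw hl
  -- The word begins and ends in `x`, so the isolated `y` has an `x` on either side.
  · obtain ⟨p', rfl⟩ : ∃ p', p = p' ++ [true] := by
      rcases hp with rfl | hp
      · rw [h1] at e; simp at e
      · simpa using hp
    obtain ⟨q', rfl⟩ : ∃ q', q = true :: q' := by
      rcases hq with rfl | hq
      · have := congrArg List.getLast? (h1.symm.trans e)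
        simp [List.getLast?_append, List.getLast?_cons] at this
      · simpa using hq
    -- There are at least two letters `y`, so another one lies to the right or to the left of the
    -- isolated one; the two cases are dual.
    have hcount : 1 ≤ p'.count false + q'.count false := by
      have := congrArg (List.count false) (h1.symm.trans e)
      simp at this
      omega
    by_cases hqf : false ∈ q'
    · obtain ⟨q'', rfl⟩ : ∃ q'', q' = q'' ++ [true] := by
        rcases List.eq_nil_or_concat' q' with rfl | ⟨q'', z, rfl⟩
        · simp at hqf
        · have := congrArg List.getLast? (h1.symm.trans e)
          simp [List.getLast?_append, List.getLast?_cons] at this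
          exact ⟨q'', by rw [this]⟩
      refine h.cyclicRegularOn_of_single (p := p') (q := q'') ?_ (by simpa using hqf)
      rw [e] at hw; simpa using hw
    · have hpf : false ∈ p' := by
        rw [← List.count_pos_iff]
        have := List.count_eq_zero.mpr hqf
        omega
      obtain ⟨p'', rfl⟩ : ∃ p'', p' = true :: p'' := by
        cases p' with
        | nil => simp at hpf
        | cons z p'' =>
          rw [h1] at e; simp at e
          exact ⟨p'', by rw [← e.1]⟩
      apply CyclicRegularOn.of_op
      refine h.op.cyclicRegularOn_of_single (p := q'.reverse) (q := p''.reverse) ?_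
        (by simpa using hpf)
      have := hw.op
      rw [e] at this; simpa using this

/-- A word `s` that begins and ends in `yy` takes values in the local submonoid at `y ^ (2 * k)`. So
`s` may be replaced by `s ^ (r + 1)`, whence `xyx = s ^ r xyx`; as `s` ends in `yy`, the new word
contains `yxy` properly. -/
lemma cyclicRegularOn_of_repeat {s t : List Bool} (hs : s = false :: false :: t)
    (hs' : ∃ t', s = t' ++ [false, false]) {v : List Bool}
    (hw : CyclicIdentity I (s ++ v)) : CyclicRegularOn I := by
  obtain ⟨t', ht'⟩ := hs'
  have key : CyclicIdentity I ((List.replicate r s).flatten ++ [true, false, true]) := by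
    intro x hx y hy
    have hE1 : y ^ (2 * k) * wordEval x y s = wordEval x y s := by
      rw [hs]; simp only [wordEval_false]
      rw [← mul_assoc y y, ← pow_two, ← mul_assoc, h.pow_mul_sq hy]
    have hE2 : wordEval x y s * y ^ (2 * k) = wordEval x y s := by
      rw [ht']; simp only [wordEval_append, wordEval_false, wordEval_nil, mul_one]
      rw [← pow_two, mul_assoc, h.sq_mul_pow hy]
    have hsI : wordEval x y s ∈ I := h.wordEval_mem hx hy (by simp [hs])
    have e := h.pow_succ_of_local hy hsI hE1 hE2 1
    rw [one_mul, add_comm, pow_succ] at e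
    simp only [wordEval_append, wordEval_flatten_replicate, wordEval_true, wordEval_false,
      wordEval_nil, mul_one]
    have e2 := hw x hx y hy
    rw [wordEval_append] at e2
    calc x * y * x = wordEval x y s * wordEval x y v := e2
      _ = wordEval x y s ^ r * (wordEval x y s * wordEval x y v) := by rw [← mul_assoc, e]
      _ = _ := by rw [← e2]; simp [mul_assoc]
  obtain ⟨n, hn⟩ : ∃ n, r = n + 1 := ⟨r - 1, by have := h.r_pos; omega⟩
  rw [hn, List.replicate_succ', List.flatten_append, ht'] at key
  refine h.cyclicRegularOn_of_factor (p := (List.replicate n (t' ++ [false, false])).flatten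
    ++ t' ++ [false]) (q := [true]) ?_ (by simp)
  simpa using key

/-- A word `y x ⋯ x y ⋯ x`. -/
lemma cyclicRegularOn_of_false_true {c : ℕ} {v : List Bool}
    (hw : CyclicIdentity I (false :: (List.replicate (c + 1) true ++ false :: (v ++ [true])))) :
    CyclicRegularOn I := by
  -- `f` encodes the identity for the pair `y, x ^ (c + 1)`. It rewrites the initial factor `y x ⋯ x
  -- y` as a word beginning with `x`.
  set f : Bool → List Bool := fun z => if z then [false] else List.replicate (c + 1) true with hf
  refine h.cyclicRegularOn_of_two_blocks (w := (false :: (List.replicate (c + 1) true ++ false ::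
    (v ++ [true]))).flatMap f ++ (v ++ [true]))
    (a := List.replicate c true) (b := List.replicate c false)
    (c := List.replicate c true ++ v.flatMap f) (d := v) ?_ ?_
  · intro x hx y hy
    have e1 := hw x hx y hy
    have e2 := hw y hy _ (h.pow_mem hx c)
    rw [wordEval_append, wordEval_flatMap]
    simp only [hf, wordEval_false, wordEval_append, wordEval_replicate_true, wordEval_true,
      wordEval_nil, mul_one, if_true, if_false, Bool.false_eq_true] at e1 e2 ⊢
    rw [e1, ← e2]
    simp only [mul_assoc]
  · simp only [hf, List.flatMap_cons, List.flatMap_append, List.flatMap_nil, if_true, if_false,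
      Bool.false_eq_true, List.flatMap_replicate, List.replicate_succ,
      List.cons_append, List.append_assoc, List.append_nil, List.nil_append]
    have : (List.replicate c [false]).flatten = List.replicate c false := by
      induction c with
      | zero => rfl
      | succ c ih => simp [List.replicate_succ]
    simp

/-- A word `y ⋯ yx`. -/
lemma cyclicRegularOn_of_false_end {v : List Bool}
    (hw : CyclicIdentity I (false :: v ++ [true])) (hv : ∃ v', false :: v = v' ++ [false]) :
    CyclicRegularOn I := by
  rcases v with _ | ⟨z, v⟩
  -- The identity is `xyx = yx`; for the pair `yx, x` it gives `yxxyx = xyx`, a word with a block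
  -- `xx` between two `y`.
  · refine h.cyclicRegularOn_of_false_true (c := 1) (v := []) ?_
    intro x hx y hy
    have e1 := hw x hx y hy
    have e2 := hw (y * x) (h.mul_right _ hy _) x hx
    simp only [wordEval_append, wordEval_false, wordEval_true, wordEval_nil, mul_one,
      wordEval_replicate_true, List.nil_append] at e1 e2 ⊢
    have e3 : y * x * x * (y * x) = x * y * x := by rw [e2, mul_assoc]
    rw [← e3]
    simp [pow_succ, mul_assoc]
  cases z
  swap
  · obtain ⟨n, s, e, hs⟩ := exists_replicate_append true v
    obtain ⟨v', hv'⟩ := hv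
    obtain ⟨s', rfl⟩ : ∃ s', s = false :: s' := by
      rcases hs with rfl | hs
      · have := congrArg List.getLast? hv'
        rw [e] at this
        cases n <;> simp [List.getLast?_cons, List.getLast?_append, List.replicate_succ'] at this
      · simpa using hs
    refine h.cyclicRegularOn_of_false_true (c := n) (v := s') ?_
    rw [e] at hw
    simpa [List.replicate_succ] using hw
  obtain ⟨v', hv'⟩ := hv
  rcases List.eq_nil_or_concat' v' with rfl | ⟨v', z, rfl⟩
  · simp at hv'
  cases z
  · exact h.cyclicRegularOn_of_repeat (s := false :: false :: v) rfl ⟨v', by simpa using hv'⟩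
      (v := [true]) (by simpa using hw)
  -- the word ends in `xyx`
  have hw' : CyclicIdentity I (v' ++ [true, false, true]) := by
    rw [hv'] at hw; simpa using hw
  obtain ⟨s, hs⟩ : ∃ s, v' = false :: false :: s := by
    rcases v' with _ | ⟨a, _ | ⟨b, s⟩⟩
    · simp at hv'
    · simp at hv'
    · simp at hv'
      exact ⟨s, by rw [hv'.1, hv'.2.1]⟩
  -- Here `v' = t' z y x ^ n`. If `z` is `y`, the prefix before `x ^ n` begins and ends in `yy`; if
  -- `z` is `x`, there is a proper factor `yxy` for `n = 0` and a second, disjoint `xyx` for `n >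
  -- 0`.
  obtain ⟨n, t, e, ht⟩ := exists_replicate_append true v'.reverse
  obtain ⟨t, rfl⟩ : ∃ t', t = false :: t' := by
    rcases ht with rfl | ht
    · have := congrArg (fun l => false ∈ l) e
      simp [hs, List.mem_replicate] at this
    · simpa using ht
  have e' : v' = t.reverse ++ [false] ++ List.replicate n true := by
    rw [← List.reverse_reverse v', e]; simp
  rcases List.eq_nil_or_concat' t.reverse with h0 | ⟨t', z, ht'⟩
  · rw [h0, hs] at e'
    cases n <;> simp [List.replicate_succ] at e'
  rw [ht'] at e'
  have hst : ∃ s', t' ++ [z] ++ [false] = false :: false :: s' := by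
    rw [hs] at e'
    rcases t' with _ | ⟨a, _ | ⟨b, t'⟩⟩
    · simp at e'; exact ⟨[], by simp [← e'.1]⟩
    · simp at e'; exact ⟨[false], by simp [e'.1, e'.2.1]⟩
    · simp at e'; exact ⟨t' ++ [z, false], by simp [e'.1, e'.2.1]⟩
  cases z
  · obtain ⟨s', hs'⟩ := hst
    refine h.cyclicRegularOn_of_repeat (s := t' ++ [false] ++ [false]) hs' ⟨t', by simp⟩
      (v := List.replicate n true ++ [true, false, true]) ?_
    rw [e'] at hw'; simpa using hw'
  · rcases n with _ | n
    · refine h.cyclicRegularOn_of_factor (p := t' ++ [true]) (q := [true]) ?_ (by simp)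
      rw [e'] at hw'; simpa using hw'
    · intro x hx y hy
      have := hw' x hx y hy
      rw [e'] at this
      simp only [wordEval_append, wordEval_true, wordEval_false, wordEval_nil, mul_one,
        wordEval_replicate_true, pow_succ' x n] at this
      exact h.regular_of_two (h.cyclic_mem hx) (p := wordEval x y t') (q := x ^ n) (s := 1)
        (by simpa only [mul_assoc, mul_one] using this)

/-- Behind a first block of `x` and a first block of `y`, either only the final `x` is left or the
pattern `x ⋯ y ⋯ x ⋯ y ⋯ x` arises. Words beginning with `y` are settled by
`cyclicRegularOn_of_false_end`. -/
lemma classify_of_end {p : List Bool} (hw : CyclicIdentity I (p ++ [false, true])) :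
    CyclicRegularOn I ∨ ∃ i q, p ++ [false, true]
      = List.replicate (i + 1) true ++ List.replicate (q + 1) false ++ [true] := by
  rcases p with _ | ⟨z, p⟩
  · exact Or.inl (h.cyclicRegularOn_of_false_end (v := []) (by simpa using hw) ⟨[], rfl⟩)
  cases z
  · exact Or.inl (h.cyclicRegularOn_of_false_end (v := p ++ [false]) (by simpa using hw)
      ⟨false :: p, rfl⟩)
  obtain ⟨i, s, rfl, hs⟩ := exists_replicate_append true p
  rcases hs with rfl | ⟨s, rfl⟩
  · exact Or.inr ⟨i, 0, by simp [List.replicate_succ]⟩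
  obtain ⟨q, s, rfl, hs⟩ := exists_replicate_append false s
  rcases hs with rfl | ⟨s, rfl⟩
  · exact Or.inr ⟨i, q + 1, by
      rw [List.replicate_succ' (n := q + 1), List.replicate_succ' (n := q)]
      simp [List.replicate_succ, ← List.replicate_succ']
      rw [← List.singleton_append, ← List.append_assoc, ← List.replicate_succ',
        List.replicate_succ]
      simp⟩
  · left
    exact h.cyclicRegularOn_of_two_blocks hw (a := List.replicate i true)
      (b := List.replicate q false) (c := s) (d := []) (by simp)

/-- The possible right-hand sides of an identity `xyx = w` that does not make `xyx` regular. -/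
theorem classify {w : List Bool} (hw : CyclicIdentity I w) :
    CyclicRegularOn I ∨ w = [false, true, false] ∨ (∃ i q, w
      = List.replicate (i + 1) true ++ List.replicate (q + 1) false ++ [true]) ∨
      ∃ i q, w = [true] ++ List.replicate (q + 1) false ++ List.replicate (i + 1) true := by
  rcases longBlocks_or_single true w with hl | ⟨p, q, e, hp, hq⟩
  · exact Or.inl (h.cyclicRegularOn_of_longBlocks hw hl)
  -- The isolated `x` stands at the end, at the beginning, or between two letters `y`; the first two
  -- cases are dual to each other.
  rcases hq with rfl | ⟨q, rfl⟩
  · rcases hp with rfl | ⟨p, rfl⟩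
    · left
      intro x hx y hy
      have := hw x hx y hy
      simp [e] at this
      exact ⟨y, by rw [this, this]⟩
    · subst e
      rcases h.classify_of_end (p := p) (by simpa using hw) with h1 | h1
      · exact Or.inl h1
      · exact Or.inr (Or.inr (Or.inl (by simpa using h1)))
  · rcases hp with rfl | ⟨p, rfl⟩
    · subst e
      rcases h.op.classify_of_end (p := q.reverse) (by simpa using hw.op) with h1 | ⟨i, j, h1⟩
      · exact Or.inl h1.of_op
      · refine Or.inr (Or.inr (Or.inr ⟨i, j, ?_⟩))
        have := congrArg List.reverse h1
        simpa using this
    · subst e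
      by_cases hpq : p = [] ∧ q = []
      · rw [hpq.1, hpq.2]; simp
      · exact Or.inl (h.cyclicRegularOn_of_factor (p := p) (q := q) (by simpa using hw) (by tauto))

end LocallyRegular

end Core

/-! ### Languages whose closedness obstructs cyclic regularity. -/

section ForbiddenSets

/-- The word `xx`. -/
def squareWords : Set (List Bool) := {[true, true]}

/-- The words with exactly one `y`. -/
def linearWords : Set (List Bool) := {w | w.count false = 1}

/-- The words `xyx` and `yxy`. -/
def cyclicWords : Set (List Bool) := {[true, false, true], [false, true, false]}

/-- The words `x ⋯ xyx`. -/
def leftPowerWords : Set (List Bool) := {w | ∃ a, w = List.replicate (a + 1) true ++ [false, true]}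

/-- The words `xy^qx` with `q ≡ 1` modulo `k`. -/
def innerPowerWords (k : ℕ) : Set (List Bool) :=
  {w | ∃ c, k ∣ c ∧ w = true :: (List.replicate (c + 1) false ++ [true])}

/-- The words `x ⋯ xy^qx` with `q ≡ 1` modulo `k`. -/
def bothPowerWords (k : ℕ) : Set (List Bool) :=
  {w | ∃ a c, k ∣ c ∧ w = List.replicate (a + 1) true ++ (List.replicate (c + 1) false ++ [true])}

/-- The reversals of the words of a set. -/
def reversed (K : Set (List Bool)) : Set (List Bool) := {w | w.reverse ∈ K}

end ForbiddenSets

lemma _root_.WithOne.eq_one_or_eq_coe {S : Type*} (m : WithOne S) :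
    m = 1 ∨ ∃ a : S, m = (a : WithOne S) := by
  rcases eq_or_ne m 1 with h | h
  · exact Or.inl h
  · obtain ⟨a, ha⟩ := WithOne.ne_one_iff_exists.mp h
    exact Or.inr ⟨a, ha.symm⟩

/-! ### Eliminating the exceptional identities. -/

section Unsaturated

variable {M : Type*} [Monoid M]

/-- Some word of `K` equals on `I` a word outside of `K`. -/
def Unsaturated (I : Set M) (K : Set (List Bool)) : Prop :=
  ∃ u ∈ K, ∃ v ∉ K, ∀ x ∈ I, ∀ y ∈ I, wordEval x y u = wordEval x y v

lemma Unsaturated.op {I : Set M} {K : Set (List Bool)} (h : Unsaturated I (reversed K)) :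
    Unsaturated (opIdeal I) K := by
  obtain ⟨u, hu, v, hv, e⟩ := h
  refine ⟨u.reverse, hu, v.reverse, hv, fun x hx y hy => ?_⟩
  have e1 := wordEval_op x.unop y.unop u
  have e2 := wordEval_op x.unop y.unop v
  simp only [MulOpposite.op_unop] at e1 e2
  rw [e1, e2, e _ hx _ hy]

lemma reversed_reversed (K : Set (List Bool)) : reversed (reversed K) = K := by
  ext w; simp [reversed]

lemma replicate_append_eq {n i q : ℕ} {v : List Bool} (e : List.replicate n true ++ v
    = List.replicate (i + 1) true ++ List.replicate (q + 1) false ++ [true]) :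
    ∃ j, i + 1 = n + j ∧ v = List.replicate j true ++ (List.replicate (q + 1) false ++ [true]) := by
  induction n generalizing i with
  | zero => exact ⟨i + 1, by simp, by simpa using e⟩
  | succ n ih =>
    cases i with
    | zero =>
      cases n with
      | zero => exact ⟨0, rfl, by simpa using e⟩
      | succ n => simp [List.replicate_succ] at e
    | succ i =>
      obtain ⟨j, h1, h2⟩ := ih (i := i) (by simpa [List.replicate_succ] using e)
      exact ⟨j, by omega, h2⟩

namespace LocallyRegular

variable {I : Set M} {k r : ℕ}

/-- `k` is the least period. -/
def MinimalPeriod (I : Set M) (k : ℕ) : Prop :=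
  ∀ d, 0 < d → (∀ x ∈ I, x ^ (2 + d) = x ^ 2) → k ≤ d

lemma MinimalPeriod.op (h : MinimalPeriod I k) : MinimalPeriod (opIdeal I) k := by
  intro d hd hx
  refine h d hd fun x hxI => ?_
  have := congrArg MulOpposite.unop (hx (MulOpposite.op x) (by simpa [opIdeal]))
  simpa using this

variable (h : LocallyRegular I k r)
include h

/-- If `k` did not divide `d`, the remainder `d % k` would be a smaller positive period. -/
lemma period_dvd (hm : MinimalPeriod I k) {a d : ℕ}
    (hd : ∀ x ∈ I, x ^ (a + 2) = x ^ (a + 2 + d)) : k ∣ d := by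
  rw [Nat.dvd_iff_mod_eq_zero]
  by_contra hne
  have hlt := Nat.mod_lt d h.k_pos
  have := hm (d % k) (Nat.pos_of_ne_zero hne) fun x hx => ?_
  · omega
  -- Adding `a * k` to the exponent does not change the power and makes room for the exponent `a +
  -- 2` of the hypothesis.
  obtain ⟨n, hn⟩ : ∃ n, a * k = a + n := ⟨a * k - a, by have := Nat.le_mul_of_pos_right a h.k_pos; omega⟩
  calc x ^ (2 + d % k) = x ^ (d % k + 2 + a * k) := by
        rw [h.pow_add_period hx]; congr 1; ring
    _ = x ^ (d % k + n) * x ^ (a + 2) := by rw [← pow_add]; congr 1; omega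
    _ = x ^ (d % k + n) * x ^ (a + 2 + (d / k) * k) := by rw [h.pow_add_period hx]
    _ = x ^ n * x ^ (a + 2 + d) := by
        rw [← pow_add, ← pow_add]; congr 1
        have := Nat.mod_add_div d k
        rw [mul_comm k] at this; omega
    _ = x ^ n * x ^ (a + 2) := by rw [← hd x hx]
    _ = x ^ (0 + 2 + a * k) := by rw [← pow_add]; congr 1; omega
    _ = x ^ 2 := by rw [h.pow_add_period hx]

/-- Substituting `x` and `x ^ 2` for `y` shows that `k` divides `i + j + q` and `i + j + 2 * q`; the
difference is `q`. -/
lemma dvd_exponents (hm : MinimalPeriod I k) {i q j : ℕ}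
    (hw : CyclicIdentity I (List.replicate (i + 1) true ++ (List.replicate (q + 1) false ++
      List.replicate (j + 1) true))) : k ∣ i + j ∧ k ∣ q := by
  have h1 : k ∣ i + j + q := by
    refine h.period_dvd hm (a := 1) fun x hx => ?_
    have e := hw x hx x hx
    simp only [wordEval_append, wordEval_replicate_true, wordEval_replicate_false, ← pow_add] at e
    calc x ^ (1 + 2) = x * x * x := by simp [pow_succ]
      _ = _ := by rw [e]; congr 1; ring
  have h2 : k ∣ i + j + 2 * q := by
    refine h.period_dvd hm (a := 2) fun x hx => ?_
    have e := hw x hx (x ^ 2) (h.pow_mem hx 1)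
    simp only [wordEval_append, wordEval_replicate_true, wordEval_replicate_false, ← pow_add,
      ← pow_mul] at e
    calc x ^ (2 + 2) = x * x ^ 2 * x := by simp [pow_succ, mul_assoc]
      _ = _ := by rw [e]; congr 1; ring
  have hq : k ∣ q := by
    have := (Nat.dvd_add_right h1).mp (show k ∣ i + j + q + q by convert h2 using 1; ring)
    exact this
  exact ⟨(Nat.dvd_add_left hq).mp h1, hq⟩

/-- Positive multiples of `k` place both exponents beyond the index, where only residues modulo `k`
matter. -/
lemma pow_eq_of_dvd {x : M} (hx : x ∈ I) {a b : ℕ} (ha : 0 < a) (hb : 0 < b) (hka : k ∣ a)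
    (hkb : k ∣ b) : x ^ (a + 1) = x ^ (b + 1) := by
  obtain ⟨m, rfl⟩ := hka
  obtain ⟨n, rfl⟩ := hkb
  have hm : m ≠ 0 := by rintro rfl; simp at ha
  have hn : n ≠ 0 := by rintro rfl; simp at hb
  have hk := h.k_pos
  obtain ⟨m, rfl⟩ := Nat.exists_eq_succ_of_ne_zero hm
  obtain ⟨n, rfl⟩ := Nat.exists_eq_succ_of_ne_zero hn
  have e : ∀ t, x ^ (k * (t + 1) + 1) = x ^ (k + 1) := fun t => by
    have := h.pow_add_period hx (k - 1) t
    rw [show k - 1 + 2 = k + 1 by omega] at this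
    rw [← this]; congr 1; ring
  rw [Nat.succ_eq_add_one, Nat.succ_eq_add_one, e, e]

/-- The words `x^N v` in place of `xyx`. -/
lemma classify_power {n : ℕ} {v : List Bool} (hm : MinimalPeriod I k)
    (hw : CyclicIdentity I (List.replicate (n + 2) true ++ v)) : CyclicRegularOn I ∨
    ∃ j q, k ∣ q ∧ v = List.replicate j true ++ (List.replicate (q + 1) false ++ [true]) := by
  rcases h.classify hw with h1 | h1 | ⟨i, q, h1⟩ | ⟨i, q, h1⟩
  · exact Or.inl h1
  · simp [List.replicate_succ] at h1
  · obtain ⟨j, e1, e2⟩ := replicate_append_eq h1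
    refine Or.inr ⟨j, q, ?_, e2⟩
    rw [h1] at hw
    exact (h.dvd_exponents hm (i := i) (q := q) (j := 0) (by simpa using hw)).2
  · simp [List.replicate_succ] at h1

/-- For the pair `yx, x`, `hw` and then `hb` give `xyx = (yx) ^ (a + 1) x ^ (c + 1) yx`. This word
begins with `y` and ends in `x`, which excludes all exceptional forms of `classify`. -/
lemma regular_of_collapse {a c q : ℕ}
    (hb : ∀ x ∈ I, ∀ y ∈ I, x ^ (q + 1) * y * x = x * y * x)
    (hw : ∀ x ∈ I, ∀ y ∈ I, x ^ (a + 1) * y ^ (c + 1) * x = y ^ (q + 1) * x) :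
    CyclicRegularOn I := by
  have key : CyclicIdentity I ((List.replicate (a + 1) [false, true]).flatten ++
      List.replicate (c + 1) true ++ [false, true]) := by
    intro x hx y hy
    have e := hw (y * x) (h.mul_right _ hy _) x hx
    simp only [wordEval_append, wordEval_flatten_replicate, wordEval_false, wordEval_true,
      wordEval_nil, mul_one, wordEval_replicate_true]
    rw [e, ← mul_assoc, hb x hx y hy]
  rcases h.classify key with h1 | h1 | ⟨i, j, h1⟩ | ⟨i, j, h1⟩
  · exact h1
  · have := congrArg List.getLast? h1
    simp [List.getLast?_append] at this
  · simp [List.replicate_succ] at h1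
  · simp [List.replicate_succ] at h1

/-- The identity makes `x ^ (a + 1) y ^ (c + 1) x` equal to `xyx` whenever `k` divides `a` and `c`.
So a word of the language, and with it the word `v` outside that equals it, becomes `xyx` after
multiplication by a power of `x`. `classify_power` then leaves `v = x ^ j y ^ (q' + 1) x`, where `j
= 0` because `v` is outside. -/
lemma regular_of_bothPower (hm : MinimalPeriod I k) {i q : ℕ}
    (hw : CyclicIdentity I (List.replicate (i + 2) true ++ (List.replicate (q + 2) false ++
      [true]))) (hK : Unsaturated I (bothPowerWords k)) : CyclicRegularOn I := by
  obtain ⟨hki, hkq⟩ := h.dvd_exponents hm (i := i + 1) (q := q + 1) (j := 0) (by simpa using hw)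
  have hw' : ∀ x ∈ I, ∀ y ∈ I, x * y * x = x ^ (i + 2) * (y ^ (q + 2) * x) := fun x hx y hy => by
    have := hw x hx y hy
    simpa using this
  have hb : ∀ a c, k ∣ a → k ∣ c → ∀ x ∈ I, ∀ y ∈ I,
      x ^ (a + 1) * y ^ (c + 1) * x = x * y * x := by
    intro a c ha hc x hx y hy
    rw [pow_succ, mul_assoc (x ^ a), mul_assoc (x ^ a), hw' x hx _ (h.pow_mem hy c), hw' x hx y hy,
      ← mul_assoc, ← pow_add, ← pow_mul]
    congr 1
    · have := h.pow_eq_of_dvd hx (a := a + (i + 1)) (b := i + 1) (by omega) (by omega)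
        (dvd_add ha hki) hki
      simpa only [add_assoc] using this
    · congr 1
      have := h.pow_eq_of_dvd hy (a := c * (q + 1) + c + (q + 1)) (b := q + 1) (by omega) (by omega)
        (dvd_add (dvd_add (Dvd.dvd.mul_right hc _) hc) hkq) hkq
      convert this using 2
      ring
  obtain ⟨u, ⟨a, c, hc, rfl⟩, v, hv, e⟩ := hK
  -- The multiple `2 * k * (a + 1)` of `k` is large enough for the multiplier `x ^ (n + 2)` to have
  -- exponent at least two.
  have hN : ∃ n, k ∣ n + 2 + a := ⟨2 * k * (a + 1) - (a + 2), by
    have : a + 2 ≤ 2 * k * (a + 1) := by nlinarith [h.k_pos]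
    rw [show 2 * k * (a + 1) - (a + 2) + 2 + a = k * (2 * (a + 1)) by
      rw [Nat.sub_add_eq, add_assoc, ← Nat.sub_add_eq, add_comm 2 a, Nat.sub_add_cancel this]; ring]
    exact Dvd.intro _ rfl⟩
  obtain ⟨n, hn⟩ := hN
  have hwv : CyclicIdentity I (List.replicate (n + 2) true ++ v) := by
    intro x hx y hy
    rw [wordEval_append, ← e x hx y hy]
    simp only [wordEval_append, wordEval_replicate_true, wordEval_replicate_false, wordEval_true,
      wordEval_nil, mul_one]
    rw [← mul_assoc, ← pow_add, ← mul_assoc, ← add_assoc, hb _ _ hn hc x hx y hy]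
  rcases h.classify_power hm hwv with h1 | ⟨j, q', hq', rfl⟩
  · exact h1
  cases j with
  | succ j => exact absurd ⟨j, q', hq', rfl⟩ hv
  | zero =>
    refine h.regular_of_collapse (a := a) (c := c) (q := q') ?_ ?_
    · intro x hx y hy
      simpa using hb q' 0 hq' (dvd_zero k) x hx y hy
    · intro x hx y hy
      have := e x hx y hy
      simpa [mul_assoc] using this

/-- The argument of `regular_of_bothPower` with a single `y`. A right-hand side with several `y` may
result; it satisfies the hypothesis of `regular_of_bothPower`. -/
lemma regular_of_leftPower (hm : MinimalPeriod I k) {i : ℕ}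
    (hw : CyclicIdentity I (List.replicate (i + 2) true ++ [false, true]))
    (hK : Unsaturated I leftPowerWords) (hK' : Unsaturated I (bothPowerWords k)) :
    CyclicRegularOn I := by
  obtain ⟨hki, -⟩ := h.dvd_exponents hm (i := i + 1) (q := 0) (j := 0) (by simpa using hw)
  have hw' : ∀ x ∈ I, ∀ y ∈ I, x * y * x = x ^ (i + 2) * (y * x) := fun x hx y hy => by
    have := hw x hx y hy
    simpa using this
  have hb : ∀ a, k ∣ a → ∀ x ∈ I, ∀ y ∈ I, x ^ (a + 1) * y * x = x * y * x := by
    intro a ha x hx y hy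
    rw [pow_succ, mul_assoc (x ^ a), mul_assoc (x ^ a), hw' x hx y hy,
      ← mul_assoc, ← pow_add]
    congr 1
    have := h.pow_eq_of_dvd hx (a := a + (i + 1)) (b := i + 1) (by omega) (by omega)
      (dvd_add ha hki) hki
    simpa only [add_assoc] using this
  obtain ⟨u, ⟨a, rfl⟩, v, hv, e⟩ := hK
  have hN : ∃ n, k ∣ n + 2 + a := ⟨2 * k * (a + 1) - (a + 2), by
    have : a + 2 ≤ 2 * k * (a + 1) := by nlinarith [h.k_pos]
    rw [show 2 * k * (a + 1) - (a + 2) + 2 + a = k * (2 * (a + 1)) by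
      rw [Nat.sub_add_eq, add_assoc, ← Nat.sub_add_eq, add_comm 2 a, Nat.sub_add_cancel this]; ring]
    exact Dvd.intro _ rfl⟩
  obtain ⟨n, hn⟩ := hN
  have hwv : CyclicIdentity I (List.replicate (n + 2) true ++ v) := by
    intro x hx y hy
    rw [wordEval_append, ← e x hx y hy]
    simp only [wordEval_append, wordEval_replicate_true, wordEval_false, wordEval_true,
      wordEval_nil, mul_one]
    rw [← mul_assoc, ← pow_add, ← mul_assoc, ← add_assoc, hb _ hn x hx y hy]
  rcases h.classify_power hm hwv with h1 | ⟨j, q', hq', rfl⟩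
  · exact h1
  cases q' with
  | succ q' =>
    refine h.regular_of_bothPower hm (i := n + j) (q := q') ?_ hK'
    rw [← List.append_assoc, ← List.replicate_add] at hwv
    rwa [show n + 2 + j = n + j + 2 by ring] at hwv
  | zero =>
    cases j with
    | succ j => exact absurd ⟨j, by simp⟩ hv
    | zero =>
      refine h.regular_of_collapse (a := a) (c := 0) (q := 0) ?_ ?_
      · intro x hx y hy; simp
      · intro x hx y hy
        have := e x hx y hy
        simpa [mul_assoc] using this

/-- Substituting `y ^ (q + 2)` for `y` in the second identity lengthens its block of `y` and leaves
the powers of `x` alone. -/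
lemma CyclicIdentity.inner_power {q : ℕ} (hq : CyclicIdentity I
    (true :: (List.replicate (q + 2) false ++ [true]))) {i j q' : ℕ}
    (hw : CyclicIdentity I (List.replicate i true ++ (List.replicate (q' + 1) false ++
      List.replicate j true))) : ∃ q'', CyclicIdentity I (List.replicate i true ++
        (List.replicate (q'' + 2) false ++ List.replicate j true)) := by
  refine ⟨q' * (q + 2) + q, fun x hx y hy => ?_⟩
  have e1 := hq x hx y hy
  have e2 := hw x hx _ (h.pow_mem hy (q + 1))
  simp only [wordEval_append, wordEval_replicate_true, wordEval_replicate_false, wordEval_true,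
    wordEval_nil, mul_one, ← pow_mul] at e1 e2 ⊢
  rw [e1, ← mul_assoc, e2]
  congr 3
  ring

/-- All words of the language equal `xyx`, so the word outside is a right-hand side for `xyx`. If it
has a longer power of `x` on one side, `regular_of_bothPower` or its dual applies. -/
lemma regular_of_innerPower (hm : MinimalPeriod I k) {q : ℕ}
    (hw : CyclicIdentity I (true :: (List.replicate (q + 2) false ++ [true])))
    (hK : Unsaturated I (innerPowerWords k)) (hK' : Unsaturated I (bothPowerWords k))
    (hK'' : Unsaturated I (reversed (bothPowerWords k))) : CyclicRegularOn I := by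
  obtain ⟨-, hkq⟩ := h.dvd_exponents hm (i := 0) (q := q + 1) (j := 0) (by simpa using hw)
  obtain ⟨u, ⟨c, hc, rfl⟩, v, hv, e⟩ := hK
  have hwv : CyclicIdentity I v := by
    intro x hx y hy
    rw [← e x hx y hy]
    simp only [wordEval_append, wordEval_replicate_false, wordEval_true,
      wordEval_nil, mul_one]
    rcases Nat.eq_zero_or_pos c with rfl | hc0
    · simp [mul_assoc]
    · have e1 := hw x hx y hy
      simp only [wordEval_append, wordEval_replicate_false, wordEval_true,
        wordEval_nil, mul_one] at e1
      rw [e1, h.pow_eq_of_dvd hy hc0 (Nat.succ_pos q) hc hkq]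
  rcases h.classify hwv with h1 | rfl | ⟨i, q', rfl⟩ | ⟨i, q', rfl⟩
  · exact h1
  -- If `xyx = yxy`, the given identity with letters exchanged reads `xyx = y x ^ (q + 2) y`, where
  -- the block of `x` is long.
  · refine h.cyclicRegularOn_of_longBlocks (w := false :: (List.replicate (q + 2) true ++ [false]))
      ?_ (.cons (.block q (.cons .nil)))
    intro x hx y hy
    have e1 := hwv x hx y hy
    have e2 := hw y hy x hx
    simp only [wordEval_append, wordEval_replicate_false, wordEval_true, wordEval_false,
      wordEval_nil, mul_one, wordEval_replicate_true] at e1 e2 ⊢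
    rw [e1, ← e2, mul_assoc]
  · cases i with
    | zero =>
      refine absurd ⟨q', ?_, by simp⟩ hv
      exact (h.dvd_exponents hm (i := 0) (q := q') (j := 0) (by simpa using hwv)).2
    | succ i =>
      obtain ⟨q'', hq''⟩ := CyclicIdentity.inner_power h hw (i := i + 2) (j := 1) (q' := q')
        (by simpa using hwv)
      exact h.regular_of_bothPower hm (by simpa using hq'') hK'
  · cases i with
    | zero =>
      refine absurd ⟨q', ?_, by simp⟩ hv
      exact (h.dvd_exponents hm (i := 0) (q := q') (j := 0) (by simpa using hwv)).2
    | succ i =>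
      obtain ⟨q'', hq''⟩ := CyclicIdentity.inner_power h hw (i := 1) (j := i + 2) (q' := q')
        (by simpa using hwv)
      refine (h.op.regular_of_bothPower hm.op (i := i) (q := q'') ?_ hK''.op).of_op
      simpa using hq''.op

/-- `cyclicWords` provides a right-hand side other than `xyx` and `yxy`. Among the forms left by
`classify`, the exponents decide which of the remaining languages is needed. -/
lemma cyclicRegularOn_of_unsaturated (hm : MinimalPeriod I k)
    (h1 : Unsaturated I cyclicWords)
    (h2 : Unsaturated I leftPowerWords) (h2' : Unsaturated I (reversed leftPowerWords))
    (h3 : Unsaturated I (innerPowerWords k))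
    (h4 : Unsaturated I (bothPowerWords k)) (h4' : Unsaturated I (reversed (bothPowerWords k))) :
    CyclicRegularOn I := by
  obtain ⟨v, hv, hw⟩ : ∃ v, v ∉ cyclicWords ∧ CyclicIdentity I v := by
    obtain ⟨u, hu, v, hv, e⟩ := h1
    rcases hu with rfl | rfl
    · exact ⟨v, hv, fun x hx y hy => by rw [← e x hx y hy]; simp [mul_assoc]⟩
    · refine ⟨v.map not, fun hc => hv ?_, fun x hx y hy => ?_⟩
      · have hmm : (v.map not).map not = v := by simp [Function.comp_def]
        rcases hc with hc | hc
        · rw [← hmm, hc]; simp [cyclicWords]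
        · rw [Set.mem_singleton_iff] at hc
          rw [← hmm, hc]; simp [cyclicWords]
      · rw [wordEval_map_not, ← e y hy x hx]; simp [mul_assoc]
  rcases h.classify hw with h0 | rfl | ⟨i, q, rfl⟩ | ⟨i, q, rfl⟩
  · exact h0
  · exact absurd (by simp [cyclicWords]) hv
  · rcases i with _ | i <;> rcases q with _ | q
    · exact absurd (by simp [cyclicWords]) hv
    · exact h.regular_of_innerPower hm (by simpa using hw) h3 h4 h4'
    · exact h.regular_of_leftPower hm (by simpa using hw) h2 h4
    · exact h.regular_of_bothPower hm (by simpa using hw) h4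
  · rcases i with _ | i <;> rcases q with _ | q
    · exact absurd (by simp [cyclicWords]) hv
    · exact h.regular_of_innerPower hm (by simpa using hw) h3 h4 h4'
    · exact (h.op.regular_of_leftPower hm.op (i := i) (by simpa using hw.op) h2'.op h4'.op).of_op
    · exact (h.op.regular_of_bothPower hm.op (i := i) (q := q) (by simpa using hw.op) h4'.op).of_op

end LocallyRegular

/-- Substituting a power of `x` for `y` in `xx = v` gives `x ^ 2 = x ^ n`. The choice `y = x` yields
`n ≠ 2` unless `v` has length two; then `v` contains `y`, and `y = x ^ 2` works. -/
lemma exists_period_of_unsaturated {I : Set M} (hr : ∀ a ∈ I, ∀ m, a * m ∈ I) (h1 : (1 : M) ∉ I)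
    (h : Unsaturated I squareWords) : ∃ d, 0 < d ∧ ∀ x ∈ I, x ^ (2 + d) = x ^ 2 := by
  obtain ⟨u, rfl, v, hv, e⟩ := h
  have key : ∃ n, n ≠ 2 ∧ ∀ x ∈ I, x ^ 2 = x ^ n := by
    have ev : ∀ (x : M) (m : ℕ) (w : List Bool), wordEval x (x ^ m) w
        = x ^ (w.count true + m * w.count false) := by
      intro x m w
      induction w with
      | nil => simp
      | cons c w ih =>
        cases c
        · simp only [wordEval_false, ih, ← pow_add]; congr 1; simp; ring
        · simp only [wordEval_true, ih, ← pow_succ']; congr 1; simp; ring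
    by_cases hl : v.count true + 1 * v.count false = 2
    · refine ⟨v.count true + 2 * v.count false, ?_, fun x hx => ?_⟩
      · intro h2
        have hf : v.count false = 0 := by omega
        have ht : v.count true = 2 := by omega
        apply hv
        have hv' : v = List.replicate v.length true := by
          rw [List.eq_replicate_iff]
          refine ⟨rfl, fun b hb => ?_⟩
          cases b
          · exact absurd hb (List.count_eq_zero.mp hf)
          · rfl
        have hl2 : v.length = 2 := by
          rw [hv', List.count_replicate_self] at ht; exact ht
        rw [hv', hl2]; rfl
      · rw [← ev, ← e x hx (x ^ 2) (by rw [pow_two]; exact hr _ hx _)]; simp [pow_two]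
    · refine ⟨_, hl, fun x hx => ?_⟩
      rw [← ev, ← e x hx (x ^ 1) (by rwa [pow_one])]; simp [pow_two]
  obtain ⟨n, hn, hx⟩ := key
  -- `n = 0` would put `1` into `I`, and `n = 1` makes all elements of `I` idempotent.
  rcases n with _ | _ | _ | n
  · refine ⟨1, one_pos, fun x hxI => ?_⟩
    have := hx x hxI
    rw [pow_zero] at this
    exact absurd (this ▸ (by rw [pow_two]; exact hr _ hxI _)) h1
  · refine ⟨1, one_pos, fun x hxI => ?_⟩
    have := hx x hxI
    rw [zero_add, pow_one] at this
    rw [pow_add, this, pow_one, ← pow_two, this]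
  · simp at hn
  · exact ⟨n + 1, by omega, fun x hxI => by rw [hx x hxI]; congr 1; ring⟩

/-- At `f = x ^ (2 * k)` and `z = f y f`, a word takes, up to the factor `f`, the value `z ^ m` with
`m` its number of `y`. Thus `z = f z ^ m` for some `m ≠ 1`: `m = 0` means `z = f`, and `m ≥ 2` gives
`r = m - 1`. -/
lemma exists_completely_of_unsaturated {I : Set M} (hr : ∀ a ∈ I, ∀ m, a * m ∈ I)
    (hl : ∀ a ∈ I, ∀ m, m * a ∈ I)
    {k : ℕ} (hk : 0 < k) (hper : ∀ x ∈ I, x ^ (2 + k) = x ^ 2)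
    (h : Unsaturated I linearWords) : ∃ r, LocallyRegular I k r := by
  obtain ⟨u, hu, v, hv, e⟩ := h
  have hidem : ∀ x ∈ I, x ^ (2 * k) * x ^ (2 * k) = x ^ (2 * k) := by
    intro x hx
    have e1 : ∀ n, x ^ (n + 2) * x ^ k = x ^ (n + 2) := fun n => by
      rw [pow_add, mul_assoc, ← pow_add x 2 k, hper x hx]
    obtain ⟨n, hn⟩ : ∃ n, 2 * k = n + 2 := ⟨2 * k - 2, by omega⟩
    nth_rewrite 2 [two_mul]
    rw [pow_add, ← mul_assoc, hn, e1, e1]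
  have ev : ∀ (f z : M) (w : List Bool), f * f = f → f * z = z → z * f = z →
      f * wordEval f z w = f * z ^ w.count false := by
    intro f z w h1 h2 h3
    induction w with
    | nil => simp
    | cons c w ih =>
      cases c
      · simp only [wordEval_false, List.count_cons_self, pow_succ', ← mul_assoc, h2]
        nth_rewrite 1 [← h3]
        rw [mul_assoc, ih, ← mul_assoc, h3]
      · simp only [wordEval_true, ← mul_assoc, h1, ih]
        simp
  have key : ∀ x ∈ I, ∀ y ∈ I, x ^ (2 * k) * y * x ^ (2 * k)
      = x ^ (2 * k) * (x ^ (2 * k) * y * x ^ (2 * k)) ^ v.count false := by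
    intro x hx y hy
    have hf := hidem x hx
    obtain ⟨n, hn⟩ : ∃ n, 2 * k = n + 1 := ⟨2 * k - 1, by omega⟩
    have hfI : x ^ (2 * k) ∈ I := by rw [hn, pow_succ]; exact hl _ hx _
    set f := x ^ (2 * k)
    have h1 : f * (f * y * f) = f * y * f := by simp only [← mul_assoc, hf]
    have h2 : (f * y * f) * f = f * y * f := by simp only [mul_assoc, hf]
    rw [← ev f _ v hf h1 h2, ← e f hfI (f * y * f) (hr _ (hr _ hfI _) _), ev f _ u hf h1 h2,
      show u.count false = 1 from hu, pow_one, h1]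
  have hv' : v.count false ≠ 1 := hv
  rcases Nat.lt_or_ge (v.count false) 2 with hlt | hge
  · have h0 : v.count false = 0 := by omega
    refine ⟨1, hl, hr, hk, one_pos, hper, fun x hx y hy => ?_⟩
    have := key x hx y hy
    rw [h0, pow_zero, mul_one] at this
    rw [this, ← two_mul, mul_one, pow_two, hidem x hx]
  · refine ⟨v.count false - 1, hl, hr, hk, by omega, hper, fun x hx y hy => ?_⟩
    have := key x hx y hy
    obtain ⟨n, hn⟩ : ∃ n, v.count false = n + 1 := ⟨v.count false - 1, by omega⟩
    rw [show 1 + (v.count false - 1) = v.count false by omega]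
    rw [hn] at this ⊢
    rw [pow_succ', ← mul_assoc, mul_assoc (x ^ (2 * k)) y, ← mul_assoc (x ^ (2 * k)) (x ^ (2 * k)),
      hidem x hx, ← mul_assoc (x ^ (2 * k)) y] at this
    rw [pow_succ', ← this]

end Unsaturated

/-! ### Closed languages and syntactic semigroups. -/

section Closed

/-- The letters of the left-hand side. -/
def Identity.left (i : Identity) : List ℕ := i.lhs.head :: i.lhs.tail

/-- The letters of the right-hand side. -/
def Identity.right (i : Identity) : List ℕ := i.rhs.head :: i.rhs.tail

/-- Applying the identity `s = t` inside a word neither leaves nor enters the set `K`. -/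
def PairClosed (K : Set (List Bool)) (s t : List ℕ) : Prop :=
  ∀ φ : ℕ → List Bool, (∀ n, φ n ≠ []) → ∀ p r : List Bool,
    p ++ s.flatMap φ ++ r ∈ K ↔ p ++ t.flatMap φ ++ r ∈ K

/-- Applying identities of `B` neither leaves nor enters the set `K`. -/
def Closed (K : Set (List Bool)) (B : List Identity) : Prop :=
  ∀ i ∈ B, PairClosed K i.left i.right

/-- The letters of an element of a free semigroup. -/
def letters {α : Type*} (w : FreeSemigroup α) : List α := w.head :: w.tail

lemma letters_mul {α : Type*} (v w : FreeSemigroup α) : letters (v * w) = letters v ++ letters w :=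
  rfl

lemma letters_lift {α β : Type*} (f : α → FreeSemigroup β) (w : FreeSemigroup α) :
    letters (FreeSemigroup.lift f w) = (letters w).flatMap fun n => letters (f n) := by
  induction w using FreeSemigroup.recOnMul with
  | ih1 x => simp [letters]
  | ih2 x y hx hy =>
    rw [map_mul, letters_mul, letters_mul, List.flatMap_append, hy, ← hx]

lemma exists_letters {α : Type*} {l : List α} (hl : l ≠ []) :
    ∃ w : FreeSemigroup α, letters w = l := by
  cases l with
  | nil => simp at hl
  | cons a l => exact ⟨⟨a, l⟩, rfl⟩

/-- Two words are related if they are interchangeable in words of `K`. -/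
def syntacticCon (K : Set (List Bool)) : Con (FreeSemigroup Bool) where
  r a b := ∀ p r, p ++ letters a ++ r ∈ K ↔ p ++ letters b ++ r ∈ K
  iseqv := ⟨fun _ _ _ => Iff.rfl, fun h p r => (h p r).symm,
    fun h h' p r => (h p r).trans (h' p r)⟩
  mul' {a b c d} h h' p r := by
    rw [letters_mul, letters_mul]
    have e1 := h p (letters c ++ r)
    have e2 := h' (p ++ letters b) r
    simp only [List.append_assoc] at e1 e2 ⊢
    exact e1.trans e2

/-- The syntactic semigroup of `K` satisfies the identities, and the class of `aca` is cyclic.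
Regularity would identify `aca` with some `aca s aca`, but `K` contains only the first of them. -/
lemma not_allCyclicallyRegular_of_closed {K : Set (List Bool)} {B : List Identity}
    (hK : Closed K B) {a c : List Bool} (ha : a ≠ []) (hmem : a ++ c ++ a ∈ K)
    (hnot : ∀ s, a ++ c ++ a ++ s ++ (a ++ c ++ a) ∉ K) : ¬ AllCyclicallyRegular.{u} B := by
  intro hall
  let Q := (syntacticCon K).Quotient
  have hvar : InVariety B Q := by
    intro i hi φ
    choose ψ hψ using fun n => Quotient.exists_rep (φ n)
    have hφ : ∀ w : FreeSemigroup ℕ, FreeSemigroup.lift φ w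
        = ((FreeSemigroup.lift ψ w : FreeSemigroup Bool) : Q) := by
      intro w
      induction w using FreeSemigroup.recOnMul with
      | ih1 x => exact (hψ x).symm
      | ih2 x y hx hy => rw [map_mul, map_mul, Con.coe_mul, hx, hy]
    rw [hφ, hφ]
    refine (Con.eq _).mpr fun p r => ?_
    rw [letters_lift, letters_lift]
    exact hK i hi _ (fun n => by simp [letters]) p r
  -- The quotient lives in `Type`; `ULift` moves it to the universe of the statement.
  have hvar' : InVariety B (ULift.{u} Q) := by
    intro i hi φ
    have hφ : ∀ w : FreeSemigroup ℕ, (FreeSemigroup.lift φ w).down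
        = FreeSemigroup.lift (fun n => (φ n).down) w := by
      intro w
      induction w using FreeSemigroup.recOnMul with
      | ih1 x => rfl
      | ih2 x y hx hy => rw [map_mul, map_mul, ← hx, ← hy]; rfl
    apply ULift.down_injective
    rw [hφ, hφ]
    exact hvar i hi _
  obtain ⟨wa, hwa⟩ := exists_letters ha
  obtain ⟨wb, hwb⟩ := exists_letters (l := a ++ c ++ a) (by simp [ha])
  have hcyc : IsCyclicElement (ULift.up.{u} (wb : Q)) := by
    refine ⟨ULift.up (wa : Q), ?_⟩
    rcases eq_or_ne c [] with rfl | hc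
    · refine ⟨1, ?_⟩
      have : wb = wa * wa := by
        have : letters wb = letters (wa * wa) := by rw [letters_mul, hwa, hwb]; simp
        cases wb; cases h : wa * wa; simp_all [letters]
      rw [this, mul_one, ← WithOne.coe_mul]
      rfl
    · obtain ⟨wc, hwc⟩ := exists_letters hc
      refine ⟨(ULift.up.{u} (wc : Q) : ULift.{u} Q), ?_⟩
      have : wb = wa * wc * wa := by
        have : letters wb = letters (wa * wc * wa) := by
          rw [letters_mul, letters_mul, hwa, hwb, hwc]
        cases wb; cases h : wa * wc * wa; simp_all [letters]
      rw [this, ← WithOne.coe_mul, ← WithOne.coe_mul]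
      rfl
  obtain ⟨⟨x⟩, hx⟩ := hall _ hvar' _ hcyc
  obtain ⟨wx, rfl⟩ := Quotient.exists_rep x
  have hx' : (wb : Q) = ((wb * wx * wb : FreeSemigroup Bool) : Q) := congrArg ULift.down hx
  have h3 := ((Con.eq _).mp hx') [] []
  rw [letters_mul, letters_mul, hwb] at h3
  exact hnot (letters wx) (by simpa using h3.mp (by simpa using hmem))

lemma coe_lift_eq {S : Type*} [Semigroup S] (ψ : ℕ → S) (w : FreeSemigroup ℕ) :
    ((FreeSemigroup.lift ψ w : S) : WithOne S)
      = ((letters w).map fun n => (ψ n : WithOne S)).prod := by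
  induction w using FreeSemigroup.recOnMul with
  | ih1 x => simp [letters]
  | ih2 x y hx hy =>
    rw [map_mul, WithOne.coe_mul, hx, hy, letters_mul, List.map_append, List.prod_append]

/-- An instance of an identity that crosses the boundary of `K` is, in every semigroup of the
variety, an equality of a word inside and a word outside. The adjoined identity accommodates empty
contexts. -/
lemma unsaturated_of_not_closed {K : Set (List Bool)} {B : List Identity} (hK : ¬ Closed K B)
    {S : Type*} [Semigroup S] (hS : InVariety B S) :
    Unsaturated (Set.range ((↑) : S → WithOne S)) K := by
  have key : ∀ i ∈ B, ∀ φ : ℕ → List Bool, (∀ n, φ n ≠ []) → ∀ p r : List Bool, ∀ x y : S,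
      wordEval (x : WithOne S) y (p ++ i.left.flatMap φ ++ r)
        = wordEval (x : WithOne S) y (p ++ i.right.flatMap φ ++ r) := by
    intro i hi φ hφ p r x y
    have hval : ∀ l : List Bool, l ≠ [] → ∃ s : S, (s : WithOne S) = wordEval (x : WithOne S) y l := by
      intro l
      induction l with
      | nil => simp
      | cons c l ih =>
        intro _
        rcases eq_or_ne l [] with rfl | hl
        · cases c
          · exact ⟨y, by simp⟩
          · exact ⟨x, by simp⟩
        · obtain ⟨s, hs⟩ := ih hl
          cases c
          · exact ⟨y * s, by simp [hs]⟩
          · exact ⟨x * s, by simp [hs]⟩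
    choose ψ hψ using fun n => hval (φ n) (hφ n)
    have hw : ∀ l : List ℕ, wordEval (x : WithOne S) y (l.flatMap φ)
        = (l.map fun n => (ψ n : WithOne S)).prod := by
      intro l
      induction l with
      | nil => simp
      | cons n l ih => simp [ih, hψ]
    simp only [wordEval_append, hw]
    have := congrArg ((↑) : S → WithOne S) (hS i hi ψ)
    rw [coe_lift_eq, coe_lift_eq] at this
    simp only [Identity.left, Identity.right]
    simp only [letters] at this
    rw [this]
  simp only [Closed, PairClosed, not_forall] at hK
  obtain ⟨i, hi, φ, hφ, p, r, hne⟩ := hK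
  by_cases hL : p ++ i.left.flatMap φ ++ r ∈ K
  · refine ⟨_, hL, p ++ i.right.flatMap φ ++ r, fun hR => hne ⟨fun _ => hR, fun _ => hL⟩, ?_⟩
    rintro _ ⟨x, rfl⟩ _ ⟨y, rfl⟩
    exact key i hi φ hφ p r x y
  · have hR : p ++ i.right.flatMap φ ++ r ∈ K := by
      by_contra hR
      exact hne ⟨fun h => absurd h hL, fun h => absurd h hR⟩
    refine ⟨_, hR, _, hL, ?_⟩
    rintro _ ⟨x, rfl⟩ _ ⟨y, rfl⟩
    exact (key i hi φ hφ p r x y).symm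

/-- None of the obstructions to cyclic regularity is closed under the identities of `B`. -/
structure NoObstruction (B : List Identity) : Prop where
  square : ¬ Closed squareWords B
  linear : ¬ Closed linearWords B
  cyclic : ¬ Closed cyclicWords B
  leftPower : ¬ Closed leftPowerWords B
  leftPower_rev : ¬ Closed (reversed leftPowerWords) B
  innerPower : ∀ k, 0 < k → ¬ Closed (innerPowerWords k) B
  bothPower : ∀ k, 0 < k → ¬ Closed (bothPowerWords k) B
  bothPower_rev : ∀ k, 0 < k → ¬ Closed (reversed (bothPowerWords k)) B

/-- The parameter of the power languages is taken to be the least period of the semigroup at hand;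
this is why every `k` has to be excluded. -/
lemma NoObstruction.isCyclicallyRegular {B : List Identity} (h : NoObstruction B)
    {S : Type*} [Semigroup S] (hS : InVariety B S) : IsCyclicallyRegular S := by
  set I := Set.range ((↑) : S → WithOne S) with hI
  have hr : ∀ a ∈ I, ∀ m, a * m ∈ I := by
    rintro _ ⟨a, rfl⟩ m
    rcases WithOne.eq_one_or_eq_coe m with rfl | ⟨m, rfl⟩
    · exact ⟨a, by simp⟩
    · exact ⟨a * m, by simp⟩
  have hl : ∀ a ∈ I, ∀ m, m * a ∈ I := by
    rintro _ ⟨a, rfl⟩ m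
    rcases WithOne.eq_one_or_eq_coe m with rfl | ⟨m, rfl⟩
    · exact ⟨a, by simp⟩
    · exact ⟨m * a, by simp⟩
  have h1 : (1 : WithOne S) ∉ I := by rintro ⟨a, ha⟩; exact WithOne.coe_ne_one ha
  have hex := exists_period_of_unsaturated hr h1 (unsaturated_of_not_closed h.square hS)
  classical
  set k := Nat.find hex with hk
  obtain ⟨hk0, hper⟩ := Nat.find_spec hex
  have hm : LocallyRegular.MinimalPeriod I k := fun d hd hx => Nat.find_min' hex ⟨hd, hx⟩
  obtain ⟨r, hL⟩ := exists_completely_of_unsaturated hr hl hk0 hper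
    (unsaturated_of_not_closed h.linear hS)
  have hreg := hL.cyclicRegularOn_of_unsaturated hm (unsaturated_of_not_closed h.cyclic hS)
    (unsaturated_of_not_closed h.leftPower hS) (unsaturated_of_not_closed h.leftPower_rev hS)
    (unsaturated_of_not_closed (h.innerPower k hk0) hS)
    (unsaturated_of_not_closed (h.bothPower k hk0) hS)
    (unsaturated_of_not_closed (h.bothPower_rev k hk0) hS)
  -- A witness in `S¹` yields one in `S`: if it is `1`, then `b = b b = b b b`.
  have lower : ∀ b : S, (∃ z : WithOne S, (b : WithOne S) = b * z * b) → IsRegularElement b := by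
    rintro b ⟨z, hz⟩
    rcases WithOne.eq_one_or_eq_coe z with rfl | ⟨z, rfl⟩
    · rw [mul_one, ← WithOne.coe_mul, WithOne.coe_inj] at hz
      exact ⟨b, by rw [← hz, ← hz]⟩
    · rw [← WithOne.coe_mul, ← WithOne.coe_mul, WithOne.coe_inj] at hz
      exact ⟨z, hz⟩
  rintro b ⟨a, x, hb⟩
  apply lower
  rcases WithOne.eq_one_or_eq_coe x with rfl | ⟨x, rfl⟩
  -- Squares are regular by periodicity alone: `a ^ 2 = a ^ (2 + 2 * k)`.
  · rw [mul_one, ← pow_two] at hb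
    refine ⟨(a : WithOne S) ^ (2 * k - 2), ?_⟩
    rw [hb, ← pow_add, ← pow_add]
    have := hL.pow_add_period (x := (a : WithOne S)) ⟨a, rfl⟩ 0 2
    rw [zero_add] at this
    rw [← this]; congr 1
    have : 0 < k := hk0
    omega
  · obtain ⟨z, hz⟩ := hreg a ⟨a, rfl⟩ x ⟨x, rfl⟩
    exact ⟨z, by rw [hb]; exact hz⟩

/-- For necessity, every language contains `xyx` but no `xyx s xyx`, except that of squares, which
contains `xx` but no `xx s xx`; closedness of any of them would give a nonregular cyclic element. -/
theorem allCyclicallyRegular_iff (B : List Identity) :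
    AllCyclicallyRegular.{u} B ↔ NoObstruction B := by
  refine ⟨fun hall => ?_, fun h S _ hS => h.isCyclicallyRegular hS⟩
  have hcyc : ∀ K, [true, false, true] ∈ K →
      (∀ s, [true, false, true] ++ s ++ [true, false, true] ∉ K) → ¬ Closed K B := by
    intro K h1 h2 hK
    exact not_allCyclicallyRegular_of_closed.{u} hK (a := [true]) (c := [false]) (by simp) h1
      (fun s => by simpa using h2 s) hall
  have hboth : ∀ (a c : ℕ) (s : List Bool), [true, false, true] ++ s ++ [true, false, true]
      ≠ List.replicate (a + 1) true ++ (List.replicate (c + 1) false ++ [true]) := by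
    intro a c s he
    have h0 : a = 0 := by
      cases a with
      | zero => rfl
      | succ a => simp [List.replicate_succ] at he
    have h1 : c = 0 := by
      cases c with
      | zero => rfl
      | succ c => subst h0; simp [List.replicate_succ] at he
    subst h0; subst h1; simp at he
  have hK3 : ∀ k, 0 < k → ¬ Closed (bothPowerWords k) B := fun k hk =>
    hcyc _ ⟨0, 0, dvd_zero _, rfl⟩ (by rintro s ⟨a, c, -, e⟩; exact hboth a c s e)
  refine ⟨?_, ?_, ?_, ?_, ?_, ?_, hK3, ?_⟩
  · intro hK
    exact not_allCyclicallyRegular_of_closed.{u} hK (a := [true]) (c := []) (by simp)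
      (by simp [squareWords]) (fun s => by simp [squareWords]) hall
  · exact hcyc _ (by simp [linearWords]) (fun s => by simp [linearWords])
  · exact hcyc _ (by simp [cyclicWords]) (fun s => by simp [cyclicWords])
  · refine hcyc _ ⟨0, rfl⟩ ?_
    rintro s ⟨a, e⟩
    exact hboth a 0 s (by simpa using e)
  · refine hcyc _ ⟨0, rfl⟩ ?_
    rintro s ⟨a, e⟩
    exact hboth a 0 s.reverse (by simpa using e)
  · refine fun k hk => hcyc _ ⟨0, dvd_zero _, rfl⟩ ?_
    rintro s ⟨c, -, e⟩
    exact hboth 0 c s (by simpa using e)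
  · refine fun k hk => hcyc _ ⟨0, 0, dvd_zero _, rfl⟩ ?_
    rintro s ⟨a, c, -, e⟩
    exact hboth a c s.reverse (by simpa using e)

end Closed

/-! ### Structured programs and their translation into stack machines. -/

section Programs

variable {K : Type} [DecidableEq K] {Γ : K → Type} {σ : Type}

/-- Structured programs for machines with stacks of symbols `Γ k` and a register of type `σ`. -/
inductive Prog (Γ : K → Type) (σ : Type) : Type
  | act (f : σ → σ)
  | push (k : K) (f : σ → Γ k)
  | pop (k : K) (f : σ → Option (Γ k) → σ)
  | peek (k : K) (f : σ → Option (Γ k) → σ)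
  | seq (P Q : Prog Γ σ)
  | ite (c : σ → Bool) (P Q : Prog Γ σ)
  | loop (c : σ → Bool) (P : Prog Γ σ)

namespace Prog

/-- `Exec P s t n`: the program `P` transforms the state `s` into `t` in `n` steps. -/
inductive Exec : Prog Γ σ → σ × (∀ k, List (Γ k)) → σ × (∀ k, List (Γ k)) → ℕ → Prop
  | act (f : σ → σ) (v S) : Exec (.act f) (v, S) (f v, S) 1
  | push (k : K) (f : σ → Γ k) (v S) :
      Exec (.push k f) (v, S) (v, Function.update S k (f v :: S k)) 1
  | pop (k : K) (f : σ → Option (Γ k) → σ) (v S) :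
      Exec (.pop k f) (v, S) (f v (S k).head?, Function.update S k (S k).tail) 1
  | peek (k : K) (f : σ → Option (Γ k) → σ) (v S) :
      Exec (.peek k f) (v, S) (f v (S k).head?, S) 1
  | seq {P Q s t u m n} : Exec P s t m → Exec Q t u n → Exec (.seq P Q) s u (n + m)
  | ite_true {c P Q s t n} : c s.1 = true → Exec P s t n → Exec (.ite c P Q) s t (n + 1)
  | ite_false {c P Q s t n} : c s.1 = false → Exec Q s t n → Exec (.ite c P Q) s t (n + 1)
  | loop_done {c P s} : c s.1 = false → Exec (.loop c P) s s 1
  | loop_step {c P s t u m n} : c s.1 = true → Exec P s t m → Exec (.loop c P) t u n →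
      Exec (.loop c P) s u (n + (m + 1))

/-- The program transforms `s` into `t` in at most `n` steps. -/
def Runs (P : Prog Γ σ) (s t : σ × (∀ k, List (Γ k))) (n : ℕ) : Prop := ∃ m ≤ n, Exec P s t m

section Runs

variable {P Q : Prog Γ σ} {s t u : σ × (∀ k, List (Γ k))} {m n : ℕ} {c : σ → Bool}

lemma Exec.runs (h : Exec P s t n) : Runs P s t n := ⟨n, le_rfl, h⟩

lemma Runs.mono (h : Runs P s t m) (hmn : m ≤ n) : Runs P s t n := by
  obtain ⟨l, hl, h⟩ := h
  exact ⟨l, hl.trans hmn, h⟩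

lemma Runs.seq (h1 : Runs P s t m) (h2 : Runs Q t u n) : Runs (.seq P Q) s u (m + n) := by
  obtain ⟨m', hm, h1⟩ := h1
  obtain ⟨n', hn, h2⟩ := h2
  exact ⟨n' + m', by omega, h1.seq h2⟩

lemma Runs.ite_true (hc : c s.1 = true) (h : Runs P s t n) : Runs (.ite c P Q) s t (n + 1) := by
  obtain ⟨m, hm, h⟩ := h
  exact ⟨m + 1, by omega, .ite_true hc h⟩

lemma Runs.ite_false (hc : c s.1 = false) (h : Runs Q s t n) : Runs (.ite c P Q) s t (n + 1) := by
  obtain ⟨m, hm, h⟩ := h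
  exact ⟨m + 1, by omega, .ite_false hc h⟩

lemma Runs.loop_done (hc : c s.1 = false) : Runs (.loop c P) s s 1 := (Exec.loop_done hc).runs

lemma Runs.loop_step (hc : c s.1 = true) (h1 : Runs P s t m) (h2 : Runs (.loop c P) t u n) :
    Runs (.loop c P) s u (m + 1 + n) := by
  obtain ⟨m', hm, h1⟩ := h1
  obtain ⟨n', hn, h2⟩ := h2
  exact ⟨n' + (m' + 1), by omega, .loop_step hc h1 h2⟩

end Runs

/-- The labels of the machine code of a program. -/
def Label : Prog Γ σ → Type
  | .act _ => Unit
  | .push _ _ => Unit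
  | .pop _ _ => Unit
  | .peek _ _ => Unit
  | .seq P Q => P.Label ⊕ Q.Label
  | .ite _ P Q => Option (P.Label ⊕ Q.Label)
  | .loop _ P => Option P.Label

instance fintypeLabel : (P : Prog Γ σ) → Fintype P.Label
  | .act _ => inferInstanceAs (Fintype Unit)
  | .push _ _ => inferInstanceAs (Fintype Unit)
  | .pop _ _ => inferInstanceAs (Fintype Unit)
  | .peek _ _ => inferInstanceAs (Fintype Unit)
  | .seq P Q =>
    have := fintypeLabel P
    have := fintypeLabel Q
    inferInstanceAs (Fintype (P.Label ⊕ Q.Label))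
  | .ite _ P Q =>
    have := fintypeLabel P
    have := fintypeLabel Q
    inferInstanceAs (Fintype (Option (P.Label ⊕ Q.Label)))
  | .loop _ P =>
    have := fintypeLabel P
    inferInstanceAs (Fintype (Option P.Label))

/-- The label where the code of a program starts. -/
def entry : (P : Prog Γ σ) → P.Label
  | .act _ => ()
  | .push _ _ => ()
  | .pop _ _ => ()
  | .peek _ _ => ()
  | .seq P _ => Sum.inl P.entry
  | .ite _ _ _ => none
  | .loop _ _ => none

/-- The machine code of a program whose labels are placed by `e` and which leaves for `out`. -/
def code {Λ : Type} : (P : Prog Γ σ) → (P.Label → Λ) → Λ → P.Label → Turing.TM2.Stmt Γ Λ σ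
  | .act f, _, out, _ => .load f (.goto fun _ => out)
  | .push k f, _, out, _ => .push k f (.goto fun _ => out)
  | .pop k f, _, out, _ => .pop k f (.goto fun _ => out)
  | .peek k f, _, out, _ => .peek k f (.goto fun _ => out)
  | .seq P Q, e, out, l => match l with
    | Sum.inl l => P.code (e ∘ Sum.inl) (e (Sum.inr Q.entry)) l
    | Sum.inr l => Q.code (e ∘ Sum.inr) out l
  | .ite c P Q, e, out, l => match l with
    | none => .branch c (.goto fun _ => e (some (Sum.inl P.entry)))
        (.goto fun _ => e (some (Sum.inr Q.entry)))
    | some (Sum.inl l) => P.code (e ∘ some ∘ Sum.inl) out l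
    | some (Sum.inr l) => Q.code (e ∘ some ∘ Sum.inr) out l
  | .loop c P, e, out, l => match l with
    | none => .branch c (.goto fun _ => e (some P.entry)) (.goto fun _ => out)
    | some l => P.code (e ∘ some) (e none) l

/-- The parts of a program occupy disjoint labels and the exit of a part is the entry of its
successor, so the hypothesis on the code restricts to the parts. -/
lemma Exec.iterate {Λ : Type} (N : Λ → Turing.TM2.Stmt Γ Λ σ) {P : Prog Γ σ}
    {s t : σ × (∀ k, List (Γ k))} {n : ℕ} (h : Exec P s t n) : ∀ (e : P.Label → Λ) (out : Λ),
    (∀ l, N (e l) = P.code e out l) →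
    (flip bind (Turing.TM2.step N))^[n] (some (⟨some (e P.entry), s.1, s.2⟩ : Turing.TM2.Cfg Γ Λ σ))
      = some ⟨some out, t.1, t.2⟩ := by
  induction h with
  | act f v S => intro e out hN; simp [flip, Turing.TM2.step, hN, code, Turing.TM2.stepAux]
  | push k f v S => intro e out hN; simp [flip, Turing.TM2.step, hN, code, Turing.TM2.stepAux]
  | pop k f v S => intro e out hN; simp [flip, Turing.TM2.step, hN, code, Turing.TM2.stepAux]
  | peek k f v S => intro e out hN; simp [flip, Turing.TM2.step, hN, code, Turing.TM2.stepAux]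
  | @seq P Q s t u m n _ _ ih1 ih2 =>
    intro e out hN
    -- An iterate of `n + m` performs the `m` steps first; hence the order of the summands in the
    -- running times.
    rw [Function.iterate_add_apply]
    have h1 := ih1 (e ∘ Sum.inl) (e (Sum.inr Q.entry)) fun l => by
      exact hN (Sum.inl l)
    have h2 := ih2 (e ∘ Sum.inr) out fun l => by
      exact hN (Sum.inr l)
    simp only [Function.comp] at h1 h2
    rw [show (Prog.seq P Q).entry = Sum.inl P.entry from rfl, h1, h2]
  | @ite_true c P Q s t n hc _ ih =>
    intro e out hN
    have h1 := ih (e ∘ some ∘ Sum.inl) out fun l => by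
      exact hN (some (Sum.inl l))
    rw [Function.iterate_succ_apply, ← h1]
    congr 1
    have h0 := hN none
    simp only [flip, Option.bind_eq_bind, Option.bind_some, Turing.TM2.step,
      show (Prog.ite c P Q).entry = none from rfl, h0, code, Turing.TM2.stepAux, hc, cond_true]
    rfl
  | @ite_false c P Q s t n hc _ ih =>
    intro e out hN
    have h1 := ih (e ∘ some ∘ Sum.inr) out fun l => by
      exact hN (some (Sum.inr l))
    rw [Function.iterate_succ_apply, ← h1]
    congr 1
    have h0 := hN none
    simp only [flip, Option.bind_eq_bind, Option.bind_some, Turing.TM2.step,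
      show (Prog.ite c P Q).entry = none from rfl, h0, code, Turing.TM2.stepAux, hc, cond_false]
    rfl
  | @loop_done c P s hc =>
    intro e out hN
    have h0 := hN none
    simp only [Function.iterate_one, flip, Option.bind_eq_bind, Option.bind_some, Turing.TM2.step,
      show (Prog.loop c P).entry = none from rfl, h0, code, Turing.TM2.stepAux, hc, cond_false]
  | @loop_step c P s t u m n hc _ _ ih1 ih2 =>
    intro e out hN
    have h1 := ih1 (e ∘ some) (e none) fun l => by
      exact hN (some l)
    have h2 := ih2 e out hN
    rw [Function.iterate_add_apply, Function.iterate_succ_apply, ← h2]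
    congr 1
    rw [show (Prog.loop c P).entry = none from rfl, ← h1]
    congr 1
    have h0 := hN none
    simp only [flip, Option.bind_eq_bind, Option.bind_some, Turing.TM2.step,
      h0, code, Turing.TM2.stepAux, hc, cond_true]
    rfl

/-- The stacks with the list `l` in stack `k` and nothing in the other ones. -/
def singleStack (k : K) (l : List (Γ k)) : ∀ k, List (Γ k) := Function.update (fun _ => []) k l

lemma singleStack_apply (k₀ : K) (l : List (Γ k₀)) (k : K) : singleStack k₀ l k
    = if h : k = k₀ then (congrArg (fun k => List (Γ k)) h).mpr l else [] := by
  by_cases h : k = k₀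
  · subst h; simp [singleStack]
  · simp [singleStack, h]

variable [Fintype K] [Fintype σ]

/-- The machine that runs a program and halts. -/
def toMachine (P : Prog Γ σ) (k₀ k₁ : K) [Fintype (Γ k₀)] (v₀ : σ) : Turing.FinTM2 where
  K := K
  k₀ := k₀
  k₁ := k₁
  Γ := Γ
  Λ := Option P.Label
  main := some P.entry
  σ := σ
  initialState := v₀
  m
    | none => .halt
    | some l => P.code some none l

/-- The additional step executes the halt statement at the label `none`. -/
lemma Runs.outputs {P : Prog Γ σ} {k₀ k₁ : K} [Fintype (Γ k₀)] {v₀ : σ} {l : List (Γ k₀)}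
    {l' : List (Γ k₁)} {n : ℕ} (h : Runs P (v₀, singleStack k₀ l) (v₀, singleStack k₁ l') n) :
    Nonempty (Turing.TM2OutputsInTime (P.toMachine k₀ k₁ v₀) l (some l') (n + 1)) := by
  obtain ⟨m, hm, h⟩ := h
  refine ⟨⟨⟨1 + m, ?_⟩, show 1 + m ≤ n + 1 by omega⟩⟩
  have key := h.iterate (P.toMachine k₀ k₁ v₀).m some none fun l => rfl
  have e0 : Turing.initList (P.toMachine k₀ k₁ v₀) l
      = (⟨some (some P.entry), v₀, singleStack k₀ l⟩ : Turing.TM2.Cfg Γ (Option P.Label) σ) := by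
    refine congrArg (Turing.TM2.Cfg.mk _ _) (funext fun k => ?_)
    exact (singleStack_apply k₀ l k).symm
  have e1 : Turing.haltList (P.toMachine k₀ k₁ v₀) l'
      = (⟨none, v₀, singleStack k₁ l'⟩ : Turing.TM2.Cfg Γ (Option P.Label) σ) := by
    refine congrArg (Turing.TM2.Cfg.mk _ _) (funext fun k => ?_)
    exact (singleStack_apply k₁ l' k).symm
  refine (congrArg (fun c => (flip bind (Turing.TM2.step (P.toMachine k₀ k₁ v₀).m))^[1 + m]
    (some c)) e0).trans (Eq.trans ?_ (congrArg some e1.symm))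
  simp only [Function.iterate_add_apply]
  exact (congrArg _ key).trans rfl

end Prog

end Programs

/-! ### Bases as lists of tokens. -/

section Tokens

/-- The symbols of a written basis, with the letters taken as a whole. -/
inductive Token
  | letter (n : ℕ)
  | equals
  | identityEnd

/-- The binary digits in front of the delimiter. -/
def Token.bits : Token → List Symbol
  | .letter n => (Computability.encodeNat n).map Symbol.bit
  | _ => []

/-- The delimiter that closes a token. -/
def Token.delim : Token → Symbol
  | .letter _ => .letterEnd
  | .equals => .equals
  | .identityEnd => .identityEnd

/-- The string of a list of tokens. -/
def rawTokens (τ : List Token) : List Symbol := τ.flatMap fun t => t.bits ++ [t.delim]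

/-- Recognizes binary digits. -/
def isBit : Option Symbol → Bool
  | some (.bit _) => true
  | _ => false

@[simp] lemma isBit_none : isBit none = false := rfl

@[simp] lemma isBit_delim (t : Token) : isBit (some t.delim) = false := by cases t <;> rfl

lemma isBit_of_mem_bits {t : Token} {c : Symbol} (h : c ∈ t.bits) : isBit (some c) = true := by
  cases t with
  | letter n =>
    obtain ⟨b, -, rfl⟩ := List.mem_map.mp h
    rfl
  | _ => simp [Token.bits] at h

/-- The digits of the token in position `i`. -/
def bitsAt (τ : List Token) (i : ℕ) : List Symbol := (τ[i]?).elim [] Token.bits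

/-- The string up to the delimiter of the token in position `i`. -/
def preString (τ : List Token) (i : ℕ) : List Symbol := rawTokens (τ.take i) ++ bitsAt τ i

/-- The string from the delimiter of the token in position `i` on. -/
def postString (τ : List Token) (i : ℕ) : List Symbol :=
  match τ.drop i with
  | [] => []
  | t :: τ' => t.delim :: rawTokens τ'

/-- The string as seen from the delimiter of the token in position `i`. -/
def zipperAt (τ : List Token) (i : ℕ) : List Symbol × List Symbol :=
  ((preString τ i).reverse, postString τ i)

@[simp] lemma rawTokens_nil : rawTokens [] = [] := rfl

@[simp] lemma rawTokens_append (τ τ' : List Token) :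
    rawTokens (τ ++ τ') = rawTokens τ ++ rawTokens τ' := by simp [rawTokens]

@[simp] lemma rawTokens_cons (t : Token) (τ : List Token) :
    rawTokens (t :: τ) = t.bits ++ t.delim :: rawTokens τ := by simp [rawTokens]

lemma length_le_rawTokens (τ : List Token) : τ.length ≤ (rawTokens τ).length := by
  induction τ with
  | nil => simp
  | cons t τ ih => simp; omega

lemma preString_append_postString (τ : List Token) (i : ℕ) :
    preString τ i ++ postString τ i = rawTokens τ := by
  have e : rawTokens τ = rawTokens (τ.take i) ++ rawTokens (τ.drop i) := by
    rw [← rawTokens_append, List.take_append_drop]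
  rw [e, preString, postString, bitsAt, List.append_assoc]
  congr 1
  rcases lt_or_ge i τ.length with h | h
  · rw [List.drop_eq_getElem_cons h, List.getElem?_eq_getElem h, rawTokens_cons]
    rfl
  · rw [List.drop_eq_nil_of_le h, List.getElem?_eq_none h]
    simp

lemma postString_eq {τ : List Token} {i : ℕ} (h : i < τ.length) :
    postString τ i = τ[i].delim :: rawTokens (τ.drop (i + 1)) := by
  rw [postString, List.drop_eq_getElem_cons h]

lemma postString_eq_nil {τ : List Token} {i : ℕ} (h : τ.length ≤ i) : postString τ i = [] := by
  rw [postString, List.drop_eq_nil_of_le h]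

lemma isBit_head_postString (τ : List Token) (i : ℕ) : isBit (postString τ i).head? = false := by
  rcases lt_or_ge i τ.length with h | h
  · rw [postString_eq h]; simp
  · rw [postString_eq_nil h]; simp

lemma rawTokens_eq_bitsAt (τ : List Token) : rawTokens τ = bitsAt τ 0 ++ postString τ 0 := by
  rw [← preString_append_postString τ 0]; simp [preString]

lemma rawTokens_drop (τ : List Token) (i : ℕ) :
    rawTokens (τ.drop i) = bitsAt τ i ++ postString τ i := by
  rw [rawTokens_eq_bitsAt]
  simp [bitsAt, postString]

lemma preString_succ {τ : List Token} {i : ℕ} (h : i < τ.length) :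
    preString τ (i + 1) = preString τ i ++ τ[i].delim :: bitsAt τ (i + 1) := by
  rw [preString, preString, List.take_add_one, List.getElem?_eq_getElem h, rawTokens_append]
  simp only [bitsAt, List.getElem?_eq_getElem h, Option.toList_some, rawTokens_cons, rawTokens_nil,
    Option.elim_some, List.append_assoc, List.cons_append, List.nil_append]

/-- Positions are ordered like the lengths of the strings in front of them, so pointers can be
compared by the heights of their left stacks. -/
lemma length_preString_lt {τ : List Token} {i j : ℕ} (hij : i < j) (hj : j ≤ τ.length) :
    (preString τ i).length < (preString τ j).length := by
  induction j, hij using Nat.le_induction with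
  | base => rw [preString_succ (by omega)]; simp
  | succ j _ ih =>
    have := ih (by omega)
    rw [preString_succ (by omega)]; simp; omega

lemma preString_last (τ : List Token) : preString τ τ.length = rawTokens τ := by
  rw [← preString_append_postString τ τ.length, postString_eq_nil le_rfl, List.append_nil]

lemma isBit_of_mem_bitsAt {τ : List Token} {i : ℕ} {c : Symbol} (h : c ∈ bitsAt τ i) :
    isBit (some c) = true := by
  rw [bitsAt] at h
  cases ht : τ[i]? with
  | none => simp [ht] at h
  | some t => rw [ht] at h; exact isBit_of_mem_bits h

/-- In front of the digits of a token there is no digit. -/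
lemma isBit_getLast_take (τ : List Token) (i : ℕ) :
    isBit (rawTokens (τ.take i)).reverse.head? = false := by
  rcases List.eq_nil_or_concat' (τ.take i) with h | ⟨l, t, h⟩
  · rw [h]; simp
  · rw [h]; simp

end Tokens

/-! ### Pointers into the input, each held as a pair of stacks. -/

section Machine

variable {N : ℕ}

/-- The stacks: input, output, an auxiliary one, and two for each of the `N` pointers. -/
inductive Stack (N : ℕ)
  | inp
  | out
  | tmp
  | left (v : Fin N)
  | right (v : Fin N)
  deriving DecidableEq, Fintype

/-- The output stack holds truth values, the other ones symbols. -/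
abbrev Cell : Stack N → Type
  | .out => Bool
  | _ => Symbol

/-- The register: a truth value and two symbols. -/
structure Register where
  res : Bool
  a : Option Symbol
  b : Option Symbol
  deriving Fintype

/-- The contents of the stacks. -/
structure Memory (N : ℕ) where
  ptr : Fin N → List Symbol × List Symbol
  tmp : List Symbol
  inp : List Symbol
  out : List Bool

/-- The contents of the stacks as a function. -/
def Memory.stacks (m : Memory N) : ∀ k : Stack N, List (Cell k)
  | .inp => m.inp
  | .out => m.out
  | .tmp => m.tmp
  | .left v => (m.ptr v).1
  | .right v => (m.ptr v).2

/-- Programs with `N` pointers. -/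
abbrev PProg (N : ℕ) := Prog (Cell (N := N)) Register

/-- The program transforms one memory state into the other in at most `n` steps. -/
def Does (P : PProg N) (s : Register) (m : Memory N) (s' : Register) (m' : Memory N) (n : ℕ) :
    Prop := P.Runs (s, m.stacks) (s', m'.stacks) n

/-- Replaces the two stacks of a pointer. -/
def Memory.set (m : Memory N) (v : Fin N) (z : List Symbol × List Symbol) : Memory N :=
  { m with ptr := Function.update m.ptr v z }

@[simp] lemma Memory.set_ptr_self (m : Memory N) (v : Fin N) (z) : (m.set v z).ptr v = z := by
  simp [Memory.set]

lemma Memory.set_ptr_ne (m : Memory N) {v w : Fin N} (h : w ≠ v) (z) :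
    (m.set v z).ptr w = m.ptr w := by simp [Memory.set, h]

@[simp] lemma Memory.set_set (m : Memory N) (v : Fin N) (z z') : (m.set v z).set v z' = m.set v z' := by
  simp [Memory.set]

lemma Memory.set_self (m : Memory N) (v : Fin N) {z} (h : m.ptr v = z) : m.set v z = m := by
  subst h; simp [Memory.set]

lemma update_left (m : Memory N) (v : Fin N) (l : List Symbol) :
    Function.update m.stacks (.left v) l = (m.set v (l, (m.ptr v).2)).stacks := by
  funext k
  cases k with
  | left w =>
    by_cases h : w = v
    · subst h; simp [Memory.stacks]
    · rw [Function.update_of_ne (by simpa using h)]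
      simp [Memory.stacks, m.set_ptr_ne h]
  | right w =>
    rw [Function.update_of_ne (by simp)]
    by_cases h : w = v
    · subst h; simp [Memory.stacks]
    · simp [Memory.stacks, m.set_ptr_ne h]
  | _ => rw [Function.update_of_ne (by simp)]; rfl

lemma update_right (m : Memory N) (v : Fin N) (l : List Symbol) :
    Function.update m.stacks (.right v) l = (m.set v ((m.ptr v).1, l)).stacks := by
  funext k
  cases k with
  | right w =>
    by_cases h : w = v
    · subst h; simp [Memory.stacks]
    · rw [Function.update_of_ne (by simpa using h)]
      simp [Memory.stacks, m.set_ptr_ne h]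
  | left w =>
    rw [Function.update_of_ne (by simp)]
    by_cases h : w = v
    · subst h; simp [Memory.stacks]
    · simp [Memory.stacks, m.set_ptr_ne h]
  | _ => rw [Function.update_of_ne (by simp)]; rfl

lemma update_tmp (m : Memory N) (l : List Symbol) :
    Function.update m.stacks .tmp l = { m with tmp := l : Memory N }.stacks := by
  funext k
  cases k with
  | tmp => simp [Memory.stacks]
  | _ => rw [Function.update_of_ne (by simp)]; rfl

lemma update_inp (m : Memory N) (l : List Symbol) :
    Function.update m.stacks .inp l = { m with inp := l : Memory N }.stacks := by
  funext k
  cases k with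
  | inp => simp [Memory.stacks]
  | _ => rw [Function.update_of_ne (by simp)]; rfl

lemma update_out (m : Memory N) (l : List Bool) :
    Function.update m.stacks .out l = { m with out := l : Memory N }.stacks := by
  funext k
  cases k with
  | out => simp [Memory.stacks]
  | _ => rw [Function.update_of_ne (by simp)]; rfl

namespace Does

variable {P Q : PProg N} {s s' s'' : Register} {m m' m'' : Memory N} {n n' : ℕ}
  {c : Register → Bool}

lemma mono (h : Does P s m s' m' n) (hn : n ≤ n') : Does P s m s' m' n' := Prog.Runs.mono h hn

lemma seq (h : Does P s m s' m' n) (h' : Does Q s' m' s'' m'' n') :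
    Does (.seq P Q) s m s'' m'' (n + n') := Prog.Runs.seq h h'

lemma ite_true (hc : c s = true) (h : Does P s m s' m' n) : Does (.ite c P Q) s m s' m' (n + 1) :=
  Prog.Runs.ite_true hc h

lemma ite_false (hc : c s = false) (h : Does Q s m s' m' n) :
    Does (.ite c P Q) s m s' m' (n + 1) := Prog.Runs.ite_false hc h

lemma loop_done (hc : c s = false) : Does (.loop c P) s m s m 1 := Prog.Runs.loop_done hc

lemma loop_step (hc : c s = true) (h : Does P s m s' m' n)
    (h' : Does (.loop c P) s' m' s'' m'' n') : Does (.loop c P) s m s'' m'' (n + 1 + n') :=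
  Prog.Runs.loop_step hc h h'

lemma act (f : Register → Register) (s : Register) (m : Memory N) :
    Does (.act f) s m (f s) m 1 := (Prog.Exec.act f s _).runs

end Does

/-- Reads the top of a stack of symbols into the first symbol of the register. -/
def peekLeft (v : Fin N) : PProg N := .peek (.left v) fun s c => { s with a := c }

def peekRight (v : Fin N) : PProg N := .peek (.right v) fun s c => { s with a := c }

/-- Reads the top of a stack of symbols into the second symbol of the register. -/
def peekLeft' (v : Fin N) : PProg N := .peek (.left v) fun s c => { s with b := c }

lemma does_peekLeft (v : Fin N) (s : Register) (m : Memory N) :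
    Does (peekLeft v) s m { s with a := (m.ptr v).1.head? } m 1 := (Prog.Exec.peek ..).runs

lemma does_peekRight (v : Fin N) (s : Register) (m : Memory N) :
    Does (peekRight v) s m { s with a := (m.ptr v).2.head? } m 1 := (Prog.Exec.peek ..).runs

lemma does_peekLeft' (v : Fin N) (s : Register) (m : Memory N) :
    Does (peekLeft' v) s m { s with b := (m.ptr v).1.head? } m 1 := (Prog.Exec.peek ..).runs

/-- Moves a pointer one symbol to the right. -/
def moveRight (v : Fin N) : PProg N :=
  -- The default symbol is irrelevant: a pointer is moved only where there is a symbol to move over.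
  .seq (.pop (.right v) fun s c => { s with a := c }) (.push (.left v) fun s => s.a.getD .equals)

/-- Moves a pointer one symbol to the left. -/
def moveLeft (v : Fin N) : PProg N :=
  .seq (.pop (.left v) fun s c => { s with a := c }) (.push (.right v) fun s => s.a.getD .equals)

lemma does_moveRight {v : Fin N} {m : Memory N} {L R : List Symbol} {c : Symbol}
    (h : m.ptr v = (L, c :: R)) (s : Register) :
    Does (moveRight v) s m { s with a := some c } (m.set v (c :: L, R)) 2 := by
  have h1 := (Prog.Exec.pop (Γ := Cell) (Stack.right v) (fun s c => { s with a := c }) s m.stacks)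
  have e1 : m.stacks (Stack.right v) = c :: R := by simp [Memory.stacks, h]
  rw [e1] at h1
  simp only [List.head?_cons, List.tail_cons] at h1
  rw [update_right, h] at h1
  have h2 := (Prog.Exec.push (Γ := Cell) (Stack.left v) (fun s : Register => s.a.getD .equals)
    { s with a := some c } (m.set v (L, R)).stacks)
  have e2 : (m.set v (L, R)).stacks (Stack.left v) = L := by simp [Memory.stacks]
  rw [e2, update_left] at h2
  simp only [Memory.set_set, Memory.set_ptr_self, Option.getD_some] at h2
  exact (h1.seq h2).runs

lemma does_moveLeft {v : Fin N} {m : Memory N} {L R : List Symbol} {c : Symbol}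
    (h : m.ptr v = (c :: L, R)) (s : Register) :
    Does (moveLeft v) s m { s with a := some c } (m.set v (L, c :: R)) 2 := by
  have h1 := (Prog.Exec.pop (Γ := Cell) (Stack.left v) (fun s c => { s with a := c }) s m.stacks)
  have e1 : m.stacks (Stack.left v) = c :: L := by simp [Memory.stacks, h]
  rw [e1] at h1
  simp only [List.head?_cons, List.tail_cons] at h1
  rw [update_left, h] at h1
  have h2 := (Prog.Exec.push (Γ := Cell) (Stack.right v) (fun s : Register => s.a.getD .equals)
    { s with a := some c } (m.set v (L, R)).stacks)
  have e2 : (m.set v (L, R)).stacks (Stack.right v) = R := by simp [Memory.stacks]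
  rw [e2, update_right] at h2
  simp only [Memory.set_set, Memory.set_ptr_self, Option.getD_some] at h2
  exact (h1.seq h2).runs

/-- Moves a pointer over digits to the right. -/
def skipBits (v : Fin N) : PProg N :=
  .seq (peekRight v) (.loop (fun s => isBit s.a) (.seq (moveRight v) (peekRight v)))

lemma does_skipBits {v : Fin N} {bs L R : List Symbol} (hbs : ∀ c ∈ bs, isBit (some c) = true)
    (hR : isBit R.head? = false) {m : Memory N} (h : m.ptr v = (L, bs ++ R)) (s : Register) :
    ∃ s', s'.res = s.res ∧
      Does (skipBits v) s m s' (m.set v (bs.reverse ++ L, R)) (4 * bs.length + 2) := by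
  suffices hs : ∀ s : Register, s.a = (bs ++ R).head? → ∃ s', s'.res = s.res ∧
      Does (.loop (fun s => isBit s.a) (.seq (moveRight v) (peekRight v))) s m s'
        (m.set v (bs.reverse ++ L, R)) (4 * bs.length + 1) by
    obtain ⟨s', h1, h2⟩ := hs { s with a := (bs ++ R).head? } rfl
    have h3 := does_peekRight v s m
    rw [h] at h3
    exact ⟨s', h1, (h3.seq h2).mono (by omega)⟩
  clear s
  induction bs generalizing L m with
  | nil =>
    intro s hs
    simp only [List.nil_append] at hs h
    refine ⟨s, rfl, ?_⟩
    simp only [List.reverse_nil, List.nil_append, m.set_self v h]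
    exact (Does.loop_done (by rw [hs]; exact hR)).mono (by simp)
  | cons c bs ih =>
    intro s hs
    have h1 := does_moveRight (m := m) (L := L) (R := bs ++ R) (c := c) (by simpa using h) s
    have h2 := does_peekRight v { s with a := some c } (m.set v (c :: L, bs ++ R))
    obtain ⟨s', e, h3⟩ := ih (L := c :: L) (fun d hd => hbs d (by simp [hd]))
      (m := m.set v (c :: L, bs ++ R)) (by simp)
      { s with a := ((m.set v (c :: L, bs ++ R)).ptr v).2.head? } (by simp)
    refine ⟨s', e, (Does.loop_step ?_ (h1.seq h2) (by simpa using h3)).mono (by simp; omega)⟩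
    rw [hs]; exact hbs c (by simp)

/-- Moves a pointer to the first token. -/
def rewind (v : Fin N) : PProg N :=
  .seq (.seq (peekLeft v) (.loop (fun s => s.a.isSome) (.seq (moveLeft v) (peekLeft v))))
    (skipBits v)

/-- Moving left until the stack is empty leads in front of the digits of the first token; skipping
them leads to its delimiter, which is where pointers stand. -/
lemma does_rewind {τ : List Token} {v : Fin N} {m : Memory N} {i : ℕ} (h : m.ptr v = zipperAt τ i)
    (s : Register) : ∃ s', s'.res = s.res ∧
      Does (rewind v) s m s' (m.set v (zipperAt τ 0)) (8 * (rawTokens τ).length + 4) := by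
  have key : ∀ (L R : List Symbol) (m : Memory N) (s : Register), m.ptr v = (L, R) →
      s.a = L.head? → ∃ s', s'.res = s.res ∧
      Does (.loop (fun s => s.a.isSome) (.seq (moveLeft v) (peekLeft v))) s m s'
        (m.set v ([], L.reverse ++ R)) (4 * L.length + 1) := by
    intro L
    induction L with
    | nil =>
      intro R m s h hs
      refine ⟨s, rfl, ?_⟩
      simp only [List.reverse_nil, List.nil_append, m.set_self v h]
      exact (Does.loop_done (by simp [hs])).mono (by simp)
    | cons c L ih =>
      intro R m s h hs
      have h1 := does_moveLeft h s
      have h2 := does_peekLeft v { s with a := some c } (m.set v (L, c :: R))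
      obtain ⟨s', e, h3⟩ := ih (c :: R) (m.set v (L, c :: R))
        { s with a := ((m.set v (L, c :: R)).ptr v).1.head? } (by simp) (by simp)
      exact ⟨s', e, (Does.loop_step (by simp [hs]) (h1.seq h2) (by simpa using h3)).mono
        (by simp; omega)⟩
  have h0 := does_peekLeft v s m
  obtain ⟨s1, e1, h1⟩ := key _ _ m { s with a := (m.ptr v).1.head? } h (by rw [h]; rfl)
  have hr : (preString τ i).reverse.reverse ++ postString τ i = bitsAt τ 0 ++ postString τ 0 := by
    rw [List.reverse_reverse, preString_append_postString, rawTokens_eq_bitsAt]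
  rw [hr] at h1
  obtain ⟨s2, e2, h2⟩ := does_skipBits (v := v) (bs := bitsAt τ 0) (L := []) (R := postString τ 0)
    (fun c hc => isBit_of_mem_bitsAt hc) (isBit_head_postString τ 0)
    (m := m.set v ([], bitsAt τ 0 ++ postString τ 0)) (by simp) s1
  have e : ((bitsAt τ 0).reverse ++ [], postString τ 0) = zipperAt τ 0 := by
    simp [zipperAt, preString]
  rw [e, Memory.set_set] at h2
  refine ⟨s2, e2.trans e1, ((h0.seq h1).seq h2).mono ?_⟩
  have l1 : (preString τ i).length ≤ (rawTokens τ).length := by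
    rw [← preString_append_postString τ i]; simp
  have l2 : (bitsAt τ 0).length ≤ (rawTokens τ).length := by
    rw [rawTokens_eq_bitsAt τ]; simp
  simp only [List.length_reverse]
  omega

/-- Moves a pointer to the next token. -/
def advance (v : Fin N) : PProg N := .seq (moveRight v) (skipBits v)

lemma does_advance {τ : List Token} {v : Fin N} {m : Memory N} {i : ℕ} (hi : i < τ.length)
    (h : m.ptr v = zipperAt τ i) (s : Register) : ∃ s', s'.res = s.res ∧
      Does (advance v) s m s' (m.set v (zipperAt τ (i + 1))) (4 * (rawTokens τ).length + 4) := by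
  rw [zipperAt, postString_eq hi, rawTokens_drop] at h
  have h1 := does_moveRight h s
  obtain ⟨s', e, h2⟩ := does_skipBits (v := v) (bs := bitsAt τ (i + 1)) (R := postString τ (i + 1))
    (L := τ[i].delim :: (preString τ i).reverse)
    (fun c hc => isBit_of_mem_bitsAt hc) (isBit_head_postString τ _)
    (m := m.set v (τ[i].delim :: (preString τ i).reverse, bitsAt τ (i + 1) ++ postString τ (i + 1)))
    (by simp) { s with a := some τ[i].delim }
  have e' : ((bitsAt τ (i + 1)).reverse ++ τ[i].delim :: (preString τ i).reverse,
      postString τ (i + 1)) = zipperAt τ (i + 1) := by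
    simp [zipperAt, preString_succ hi]
  rw [e', Memory.set_set] at h2
  refine ⟨s', e, (h1.seq h2).mono ?_⟩
  have l2 : (bitsAt τ (i + 1)).length ≤ (rawTokens τ).length := by
    rw [← preString_append_postString τ (i + 1), preString]; simp; omega
  omega

end Machine

/-! ### Comparing two pointers by parallel motion. -/

section Lockstep

variable {N : ℕ}

/-- Replaces the stacks of two pointers and the auxiliary stack. -/
def Memory.set₂ (m : Memory N) (v w : Fin N) (z z' : List Symbol × List Symbol)
    (l : List Symbol) : Memory N :=
  { (m.set v z).set w z' with tmp := l }

section

variable {m : Memory N} {v w : Fin N} {z z' y : List Symbol × List Symbol} {l : List Symbol}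

lemma Memory.set₂_fst (h : v ≠ w) : (m.set₂ v w z z' l).ptr v = z := by
  simp [Memory.set₂, Memory.set, h]

@[simp] lemma Memory.set₂_snd : (m.set₂ v w z z' l).ptr w = z' := by
  simp [Memory.set₂, Memory.set]

lemma Memory.set₂_set_fst (h : v ≠ w) : (m.set₂ v w z z' l).set v y = m.set₂ v w y z' l := by
  simp [Memory.set₂, Memory.set, Function.update_comm h]

@[simp] lemma Memory.set₂_set_snd : (m.set₂ v w z z' l).set w y = m.set₂ v w z y l := by
  simp [Memory.set₂, Memory.set]

lemma Memory.set₂_self (hv : m.ptr v = z) (hw : m.ptr w = z') (hl : m.tmp = l) :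
    m.set₂ v w z z' l = m := by
  subst hv hw hl; simp [Memory.set₂, Memory.set]

end

variable {v w : Fin N}

lemma does_push_tmp (c : Symbol) (s : Register) (m : Memory N) :
    Does (.push .tmp fun _ => c) s m s { m with tmp := c :: m.tmp } 1 := by
  have h := Prog.Exec.push (Γ := Cell (N := N)) .tmp (fun _ : Register => c) s m.stacks
  rw [update_tmp] at h
  exact h.runs

lemma does_pop_tmp (s : Register) (m : Memory N) :
    Does (.pop .tmp fun s c => { s with a := c }) s m { s with a := m.tmp.head? }
      { m with tmp := m.tmp.tail } 1 := by
  have h := Prog.Exec.pop (Γ := Cell (N := N)) .tmp (fun s c => { s with a := c }) s m.stacks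
  rw [update_tmp] at h
  exact h.runs

/-- Reads the symbols to the left of two pointers. -/
def peekBoth (v w : Fin N) : PProg N := .seq (peekLeft v) (peekLeft' w)

lemma does_peekBoth (v w : Fin N) (s : Register) (m : Memory N) :
    Does (peekBoth v w) s m { s with a := (m.ptr v).1.head?, b := (m.ptr w).1.head? } m 2 :=
  (does_peekLeft v s m).seq (does_peekLeft' w _ m)

/-- Compares the positions of two pointers: the result is `f` applied to whether the first, the
second pointer reaches the start when both go left at the same pace. -/
def compare (v w : Fin N) (f : Bool → Bool → Bool) : PProg N :=
  .seq (.seq (peekBoth v w)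
    (.loop (fun s => s.a.isSome && s.b.isSome)
      (.seq (.seq (moveLeft v) (moveLeft w))
        -- The auxiliary stack counts the rounds, so that both pointers can be moved back.
        (.seq (.push .tmp fun _ => .equals) (peekBoth v w)))))
    (.seq (.act fun s => { s with res := f s.a.isNone s.b.isNone })
      (.seq (.pop .tmp fun s c => { s with a := c })
        (.loop (fun s => s.a.isSome) (.seq (.seq (moveRight v) (moveRight w))
          (.pop .tmp fun s c => { s with a := c })))))

/-- `A` and `A'` are the parts passed over; the loop ends as soon as one of the remainders `L`, `L'`
is empty. -/
lemma does_compare_down (hvw : v ≠ w) {L L' : List Symbol} (hL : L = [] ∨ L' = []) :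
    ∀ (A A' R R' l : List Symbol) (m : Memory N) (s : Register), A.length = A'.length →
      s.a = (A ++ L).head? → s.b = (A' ++ L').head? → ∃ s', s'.res = s.res ∧
      s'.a = L.head? ∧ s'.b = L'.head? ∧
      Does (.loop (fun s => s.a.isSome && s.b.isSome)
      (.seq (.seq (moveLeft v) (moveLeft w))
        (.seq (.push .tmp fun _ => .equals) (peekBoth v w)))) s
        (m.set₂ v w (A ++ L, R) (A' ++ L', R') l) s'
        (m.set₂ v w (L, A.reverse ++ R) (L', A'.reverse ++ R')
          (List.replicate A.length .equals ++ l)) (8 * A.length + 1)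
  | [], A', R, R', l, m, s, h, ha, hb => by
    obtain rfl : A' = [] := by simpa using h.symm
    refine ⟨s, rfl, by simpa using ha, by simpa using hb, ?_⟩
    exact (Does.loop_done (by rw [ha, hb]; rcases hL with rfl | rfl <;> simp)).mono (by simp)
  | c :: A, [], R, R', l, m, s, h, ha, hb => by simp at h
  | c :: A, c' :: A', R, R', l, m, s, h, ha, hb => by
    have h1 := does_moveLeft (v := v) (m := m.set₂ v w (c :: A ++ L, R) (c' :: A' ++ L', R') l)
      (c := c) (L := A ++ L) (R := R) (by rw [Memory.set₂_fst hvw]; rfl) s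
    rw [Memory.set₂_set_fst hvw] at h1
    have h2 := does_moveLeft (v := w) (m := m.set₂ v w (A ++ L, c :: R) (c' :: A' ++ L', R') l)
      (c := c') (L := A' ++ L') (R := R') (by simp) { s with a := some c }
    rw [Memory.set₂_set_snd] at h2
    have h3 := does_push_tmp .equals { s with a := some c' }
      (m.set₂ v w (A ++ L, c :: R) (A' ++ L', c' :: R') l)
    have h4 := does_peekBoth v w { s with a := some c' }
      (m.set₂ v w (A ++ L, c :: R) (A' ++ L', c' :: R') (.equals :: l))
    rw [Memory.set₂_fst hvw, Memory.set₂_snd] at h4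
    obtain ⟨s', e, ea, eb, h5⟩ := does_compare_down hvw hL A A' (c :: R) (c' :: R') (.equals :: l) m
      { s with a := (A ++ L).head?, b := (A' ++ L').head? } (by simpa using h) rfl rfl
    refine ⟨s', e, ea, eb, ?_⟩
    have e6 : List.replicate A.length Symbol.equals ++ .equals :: l
        = List.replicate (c :: A).length .equals ++ l := by
      rw [List.length_cons, List.replicate_succ', List.append_assoc]; rfl
    rw [e6] at h5
    have e7 : A.reverse ++ c :: R = (c :: A).reverse ++ R := by simp
    have e8 : A'.reverse ++ c' :: R' = (c' :: A').reverse ++ R' := by simp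
    rw [e7, e8] at h5
    exact (Does.loop_step (by rw [ha, hb]; rfl) ((h1.seq h2).seq (h3.seq h4)) h5).mono
      (by simp; omega)

lemma does_compare_up (hvw : v ≠ w) : ∀ (A A' L L' R R' : List Symbol) (m : Memory N)
    (s : Register), A.length = A'.length →
      ∃ s', s'.res = s.res ∧ Does (.seq (.pop .tmp fun s c => { s with a := c })
        (.loop (fun s => s.a.isSome) (.seq (.seq (moveRight v) (moveRight w))
          (.pop .tmp fun s c => { s with a := c })))) s
        (m.set₂ v w (L, A ++ R) (L', A' ++ R') (List.replicate A.length .equals)) s'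
        (m.set₂ v w (A.reverse ++ L, R) (A'.reverse ++ L', R') []) (6 * A.length + 2) := by
  suffices hs : ∀ (A A' L L' R R' : List Symbol) (m : Memory N) (s : Register),
      A.length = A'.length → s.a = (List.replicate A.length Symbol.equals).head? →
      ∃ s', s'.res = s.res ∧ Does (.loop (fun s => s.a.isSome)
        (.seq (.seq (moveRight v) (moveRight w)) (.pop .tmp fun s c => { s with a := c }))) s
        (m.set₂ v w (L, A ++ R) (L', A' ++ R') (List.replicate A.length .equals).tail) s'
        (m.set₂ v w (A.reverse ++ L, R) (A'.reverse ++ L', R') []) (6 * A.length + 1) by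
    intro A A' L L' R R' m s h
    obtain ⟨s', e, h2⟩ := hs A A' L L' R R' m
      { s with a := (List.replicate A.length Symbol.equals).head? } h rfl
    exact ⟨s', e, ((does_pop_tmp _ _).seq h2).mono (by omega)⟩
  intro A
  induction A with
  | nil =>
    intro A' L L' R R' m s h hs
    obtain rfl : A' = [] := by simpa using h.symm
    exact ⟨s, rfl, (Does.loop_done (by rw [hs]; rfl)).mono (by simp)⟩
  | cons c A ih =>
    intro A' L L' R R' m s h hs
    obtain - | ⟨c', A'⟩ := A'
    · simp at h
    have h1 := does_moveRight (v := v) (m := m.set₂ v w (L, c :: A ++ R) (L', c' :: A' ++ R')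
      (List.replicate A.length .equals)) (c := c) (L := L) (R := A ++ R)
      (by rw [Memory.set₂_fst hvw]; rfl) s
    rw [Memory.set₂_set_fst hvw] at h1
    have h2 := does_moveRight (v := w) (m := m.set₂ v w (c :: L, A ++ R) (L', c' :: A' ++ R')
      (List.replicate A.length .equals)) (c := c') (L := L') (R := A' ++ R')
      (by simp) { s with a := some c }
    rw [Memory.set₂_set_snd] at h2
    have h3 := does_pop_tmp { s with a := some c' } (m.set₂ v w (c :: L, A ++ R) (c' :: L', A' ++ R')
      (List.replicate A.length .equals))
    obtain ⟨s', e, h4⟩ := ih A' (c :: L) (c' :: L') R R' m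
      { s with a := (List.replicate A.length Symbol.equals).head? } (by simpa using h) rfl
    refine ⟨s', e, ?_⟩
    have e7 : A.reverse ++ c :: L = (c :: A).reverse ++ L := by simp
    have e8 : A'.reverse ++ c' :: L' = (c' :: A').reverse ++ L' := by simp
    rw [e7, e8] at h4
    exact (Does.loop_step (by rw [hs]; rfl) ((h1.seq h2).seq h3) h4).mono (by simp; omega)

/-- The number of rounds is the smaller height. After them a pointer is at the start iff its height
does not exceed the other one, and equally many rounds back restore the memory. -/
lemma does_compare (hvw : v ≠ w) (f : Bool → Bool → Bool) {L L' R R' : List Symbol} {m : Memory N}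
    (hv : m.ptr v = (L, R)) (hw : m.ptr w = (L', R')) (ht : m.tmp = []) (s : Register) :
    ∃ s', s'.res = f (decide (L.length ≤ L'.length)) (decide (L'.length ≤ L.length)) ∧
      Does (compare v w f) s m s' m (14 * L.length + 8) := by
  set k := min L.length L'.length with hk
  have hA : (L.take k).length = (L'.take k).length := by simp [hk]
  have hd : L.drop k = [] ∨ L'.drop k = [] := by simp; omega
  have h0 := does_peekBoth v w s m
  rw [hv, hw] at h0
  obtain ⟨s1, -, ea, eb, h1⟩ := does_compare_down hvw hd (L.take k) (L'.take k) R R' [] m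
    { s with a := L.head?, b := L'.head? } hA (by simp) (by simp)
  simp only [List.take_append_drop] at h1
  rw [Memory.set₂_self hv hw ht, List.append_nil] at h1
  have h2 := Does.act (fun s => { s with res := f s.a.isNone s.b.isNone }) s1
    (m.set₂ v w (L.drop k, (L.take k).reverse ++ R) (L'.drop k, (L'.take k).reverse ++ R')
          (List.replicate (L.take k).length .equals))
  obtain ⟨s3, e3, h3⟩ := does_compare_up hvw (L.take k).reverse (L'.take k).reverse (L.drop k)
    (L'.drop k) R R' m { s1 with res := f s1.a.isNone s1.b.isNone } (by simpa using hA)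
  simp only [List.reverse_reverse, List.take_append_drop, List.length_reverse] at h3
  rw [Memory.set₂_self hv hw ht] at h3
  refine ⟨s3, ?_, ((h0.seq h1).seq (h2.seq h3)).mono ?_⟩
  · rw [e3]
    have e1 : s1.a.isNone = decide (L.length ≤ L'.length) := by
      rw [ea]
      rw [Bool.eq_iff_iff]
      simp only [List.head?_drop, Option.isNone_iff_eq_none, decide_eq_true_eq,
        List.getElem?_eq_none_iff]
      omega
    have e2 : s1.b.isNone = decide (L'.length ≤ L.length) := by
      rw [eb]
      rw [Bool.eq_iff_iff]
      simp only [List.head?_drop, Option.isNone_iff_eq_none, decide_eq_true_eq,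
        List.getElem?_eq_none_iff]
      omega
    rw [e1, e2]
  · simp; omega

/-- Compares the digits of the tokens at two pointers. -/
def compareBits (v w : Fin N) : PProg N :=
  .seq (.seq (peekBoth v w)
    (.loop (fun s => isBit s.a && s.a == s.b)
      (.seq (.seq (moveLeft v) (moveLeft w)) (peekBoth v w))))
    -- The digits agree iff both run out at the same time. Going right to the next delimiter then
    -- undoes the motion.
    (.seq (.act fun s => { s with res := !isBit s.a && !isBit s.b })
      (.seq (skipBits v) (skipBits w)))

/-- `C` is the common part passed over, `D` and `D'` are the remaining digits; equality holds iff
both are empty. -/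
lemma does_compareBits_down (hvw : v ≠ w) {X X' : List Symbol} (hX : isBit X.head? = false)
    (hX' : isBit X'.head? = false) : ∀ (A A' R R' : List Symbol) (m : Memory N) (s : Register),
      (∀ c ∈ A, isBit (some c) = true) → (∀ c ∈ A', isBit (some c) = true) →
      s.a = (A ++ X).head? → s.b = (A' ++ X').head? → ∃ s' C D D', A = C ++ D ∧ A' = C ++ D' ∧
      (!isBit s'.a && !isBit s'.b) = decide (A = A') ∧
      Does (.loop (fun s => isBit s.a && s.a == s.b)
      (.seq (.seq (moveLeft v) (moveLeft w)) (peekBoth v w))) s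
        (m.set₂ v w (A ++ X, R) (A' ++ X', R') []) s'
        (m.set₂ v w (D ++ X, C.reverse ++ R) (D' ++ X', C.reverse ++ R') []) (8 * A.length + 1)
  | [], A', R, R', m, s, hA, hA', ha, hb => by
    refine ⟨s, [], [], A', rfl, rfl, ?_, (Does.loop_done ?_).mono (by simp)⟩
    · rw [ha, hb]
      cases A' with
      | nil => simp [hX, hX']
      | cons c A' => simp [hX, hA' c]
    · rw [ha]; simp [hX]
  | c :: A, [], R, R', m, s, hA, hA', ha, hb => by
    refine ⟨s, [], c :: A, [], rfl, rfl, ?_, (Does.loop_done ?_).mono (by simp)⟩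
    · rw [ha, hb]; simp [hA c]
    · have : s.a ≠ s.b := by
        intro h
        rw [ha, hb] at h
        have h1 := hA c (by simp)
        have h2 : X'.head? = some c := by simpa using h.symm
        rw [h2] at hX'
        simp [h1] at hX'
      simp [this]
  | c :: A, c' :: A', R, R', m, s, hA, hA', ha, hb => by
    by_cases hc : c = c'
    · subst hc
      have h1 := does_moveLeft (v := v) (m := m.set₂ v w (c :: A ++ X, R) (c :: A' ++ X', R') [])
        (c := c) (L := A ++ X) (R := R) (by rw [Memory.set₂_fst hvw]; rfl) s
      rw [Memory.set₂_set_fst hvw] at h1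
      have h2 := does_moveLeft (v := w) (m := m.set₂ v w (A ++ X, c :: R) (c :: A' ++ X', R') [])
        (c := c) (L := A' ++ X') (R := R') (by simp) { s with a := some c }
      rw [Memory.set₂_set_snd] at h2
      have h4 := does_peekBoth v w { s with a := some c }
        (m.set₂ v w (A ++ X, c :: R) (A' ++ X', c :: R') [])
      rw [Memory.set₂_fst hvw, Memory.set₂_snd] at h4
      obtain ⟨s', C, D, D', e, e', er, h5⟩ := does_compareBits_down hvw hX hX' A A' (c :: R)
        (c :: R') m { s with a := (A ++ X).head?, b := (A' ++ X').head? }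
        (fun d hd => hA d (by simp [hd])) (fun d hd => hA' d (by simp [hd])) rfl rfl
      refine ⟨s', c :: C, D, D', by simp [e], by simp [e'], by simpa using er, ?_⟩
      have e7 : ∀ R, C.reverse ++ c :: R = (c :: C).reverse ++ R := by simp
      rw [e7, e7] at h5
      exact (Does.loop_step (by rw [ha, hb]; simp [hA c]) ((h1.seq h2).seq h4) h5).mono
        (by simp; omega)
    · refine ⟨s, [], c :: A, c' :: A', rfl, rfl, ?_, (Does.loop_done ?_).mono (by simp)⟩
      · rw [ha, hb]; simp [hA c, hc]
      · rw [ha, hb]; simp [hc]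

lemma does_compareBits (hvw : v ≠ w) {A A' X X' R R' : List Symbol} (hX : isBit X.head? = false)
    (hX' : isBit X'.head? = false) (hR : isBit R.head? = false) (hR' : isBit R'.head? = false)
    (hA : ∀ c ∈ A, isBit (some c) = true) (hA' : ∀ c ∈ A', isBit (some c) = true)
    {m : Memory N} (hv : m.ptr v = (A ++ X, R)) (hw : m.ptr w = (A' ++ X', R')) (ht : m.tmp = [])
    (s : Register) : ∃ s', s'.res = decide (A = A') ∧
      Does (compareBits v w) s m s' m (16 * A.length + 8) := by
  have h0 := does_peekBoth v w s m
  rw [hv, hw] at h0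
  obtain ⟨s1, C, D, D', e, e', er, h1⟩ := does_compareBits_down hvw hX hX' A A' R R' m
    { s with a := (A ++ X).head?, b := (A' ++ X').head? } hA hA' rfl rfl
  rw [Memory.set₂_self hv hw ht] at h1
  have h2 := Does.act (fun s => { s with res := !isBit s.a && !isBit s.b }) s1
    (m.set₂ v w (D ++ X, C.reverse ++ R) (D' ++ X', C.reverse ++ R') [])
  obtain ⟨s3, e3, h3⟩ := does_skipBits (v := v) (bs := C.reverse) (L := D ++ X) (R := R)
    (fun c hc => hA c (by rw [e]; simp at hc; simp [hc])) hR
    (m := m.set₂ v w (D ++ X, C.reverse ++ R) (D' ++ X', C.reverse ++ R') [])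
    (by rw [Memory.set₂_fst hvw]) { s1 with res := !isBit s1.a && !isBit s1.b }
  obtain ⟨s4, e4, h4⟩ := does_skipBits (v := w) (bs := C.reverse) (L := D' ++ X') (R := R')
    (fun c hc => hA c (by rw [e]; simp at hc; simp [hc])) hR'
    (m := m.set₂ v w (A ++ X, R) (D' ++ X', C.reverse ++ R') []) (by simp) s3
  rw [Memory.set₂_set_snd, List.reverse_reverse, ← List.append_assoc, ← e',
    Memory.set₂_self hv hw ht] at h4
  rw [Memory.set₂_set_fst hvw, List.reverse_reverse, ← List.append_assoc, ← e] at h3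
  refine ⟨s4, by rw [e4, e3, ← er], ((h0.seq h1).seq (h2.seq (h3.seq h4))).mono ?_⟩
  have : C.length ≤ A.length := by rw [e]; simp
  simp
  omega

end Lockstep

/-! ### First-order formulas with modular counting over positions. -/

section Formulas

/-- First-order formulas with modular counting about the positions in a list of tokens; the
variables are numbered from the outermost quantifier on. -/
inductive Formula : ℕ → Type
  | kind {n : ℕ} (c : Symbol) (j : Fin n) : Formula n
  | same {n : ℕ} (i j : Fin n) : Formula n
  | lt {n : ℕ} (i j : Fin n) : Formula n
  | not {n : ℕ} (φ : Formula n) : Formula n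
  | and {n : ℕ} (φ ψ : Formula n) : Formula n
  | ex {n : ℕ} (φ : Formula (n + 1)) : Formula n
  | countMod {n : ℕ} (g r : Fin n) (φ : Formula (n + 1)) : Formula n

namespace Formula

open Classical in
/-- The meaning of a formula. -/
def eval (τ : List Token) : {n : ℕ} → Formula n → (Fin n → ℕ) → Prop
  | _, kind c j, e => (postString τ (e j)).head? = some c
  | _, same i j, e => bitsAt τ (e i) = bitsAt τ (e j)
  | _, lt i j, e => e i < e j
  | _, not φ, e => ¬ φ.eval τ e
  | _, and φ ψ, e => φ.eval τ e ∧ ψ.eval τ e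
  | _, ex φ, e => ∃ k < τ.length, φ.eval τ (Fin.snoc (α := fun _ => ℕ) e k)
  | _, countMod g r φ, e =>
    Nat.count (fun k => φ.eval τ (Fin.snoc (α := fun _ => ℕ) e k)) τ.length % e g = e r

/-- The depth of nested quantifiers. -/
def depth : {n : ℕ} → Formula n → ℕ
  | _, kind _ _ => 0
  | _, same _ _ => 0
  | _, lt _ _ => 0
  | _, not φ => φ.depth
  | _, and φ ψ => max φ.depth ψ.depth
  | _, ex φ => φ.depth + 1
  | _, countMod _ _ φ => φ.depth + 1

open Polynomial in
/-- A bound for the time needed to evaluate a formula. -/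
noncomputable def cost : {n : ℕ} → Formula n → ℕ[X]
  | _, kind _ _ => 2
  | _, same _ _ => 16 * X + 8
  | _, lt _ _ => 14 * X + 8
  | _, not φ => φ.cost + 1
  | _, and φ ψ => φ.cost + ψ.cost + 2
  | _, ex φ => 8 * X + 7 + X * (φ.cost + 4 * X + 8)
  | _, countMod _ _ φ => 30 * X + 18 + X * (φ.cost + 30 * X + 24)

/-- The pointer with the given number. -/
abbrev pointer {M : ℕ} (j : ℕ) : Fin (M + 1) := Fin.ofNat (M + 1) j

lemma pointer_ne {M i j : ℕ} (hi : i < M + 1) (hj : j < M + 1) (h : i ≠ j) :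
    (pointer i : Fin (M + 1)) ≠ pointer j := by
  intro e
  have := congrArg Fin.val e
  simp only [pointer, Fin.val_ofNat, Nat.mod_eq_of_lt hi, Nat.mod_eq_of_lt hj] at this
  exact h this

variable {M : ℕ}

/-- Evaluates a formula; the pointer of the `j`-th variable is the one with number `2j`. -/
def compile : {n : ℕ} → Formula n → PProg (M + 1)
  | _, kind c j => .seq (peekRight (pointer (2 * j))) (.act fun s => { s with res := s.a == some c })
  -- Parallel motion requires two different pointers, so equal variables are treated apart.
  | _, same i j => if i = j then .act fun s => { s with res := true } else
      compareBits (pointer (2 * i)) (pointer (2 * j))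
  | _, lt i j => if i = j then .act fun s => { s with res := false } else
      compare (pointer (2 * i)) (pointer (2 * j)) fun x y => x && !y
  | _, not φ => .seq φ.compile (.act fun s => { s with res := !s.res })
  | _, and φ ψ => .seq φ.compile (.ite (fun s => s.res) ψ.compile (.act id))
  | n, ex φ => .seq (.seq (rewind (pointer (2 * n))) (.act fun s => { s with res := false }))
      -- The search ends at the first success or at the end of the list.
      (.seq (peekRight (pointer (2 * n))) (.loop (fun s => s.a.isSome && !s.res)
        (.seq φ.compile (.seq (.ite (fun s => s.res) (.act id) (advance (pointer (2 * n))))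
          (peekRight (pointer (2 * n)))))))
  | n, countMod g r φ =>
      .seq (.seq (.seq (rewind (pointer (2 * n))) (rewind (pointer (2 * n + 1))))
        (.seq (peekRight (pointer (2 * n))) (.loop (fun s => s.a.isSome)
          -- The pointer `2 * n + 1` serves as a counter: on reaching the position of the modulus it
          -- returns to the start.
          (.seq (.seq φ.compile (.ite (fun s => s.res)
            (.seq (advance (pointer (2 * n + 1)))
              (.seq (compare (pointer (2 * n + 1)) (pointer (2 * g)) Bool.and)
                (.ite (fun s => s.res) (rewind (pointer (2 * n + 1))) (.act id))))
            (.act id)))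
            (.seq (advance (pointer (2 * n))) (peekRight (pointer (2 * n))))))))
        (compare (pointer (2 * n + 1)) (pointer (2 * r)) Bool.and)

end Formula

end Formulas

/-! ### Correctness and running time of formula evaluation. -/

section Evaluation

variable {N : ℕ} {τ : List Token}

/-- The memory with the pointers in the given positions. -/
def memoryAt (τ : List Token) (pos : Fin N → ℕ) : Memory N :=
  ⟨fun v => zipperAt τ (pos v), [], [], []⟩

lemma memoryAt_set (pos : Fin N → ℕ) (v : Fin N) (i : ℕ) :
    (memoryAt τ pos).set v (zipperAt τ i) = memoryAt τ (Function.update pos v i) := by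
  have : Function.update (fun v => zipperAt τ (pos v)) v (zipperAt τ i)
      = fun w => zipperAt τ (Function.update pos v i w) := by
    funext w
    by_cases h : w = v
    · subst h; simp
    · simp [h]
  simp [Memory.set, memoryAt, this]

/-- The program moves the pointers in at most `n` steps. -/
def Moves (τ : List Token) (P : PProg N) (s : Register) (pos : Fin N → ℕ) (s' : Register)
    (pos' : Fin N → ℕ) (n : ℕ) : Prop := Does P s (memoryAt τ pos) s' (memoryAt τ pos') n

lemma moves_rewind (v : Fin N) (s : Register) (pos : Fin N → ℕ) : ∃ s', s'.res = s.res ∧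
    Moves τ (rewind v) s pos s' (Function.update pos v 0) (8 * (rawTokens τ).length + 4) := by
  obtain ⟨s', e, h⟩ := does_rewind (τ := τ) (v := v) (m := memoryAt τ pos) (i := pos v) rfl s
  rw [memoryAt_set] at h
  exact ⟨s', e, h⟩

lemma moves_advance {v : Fin N} {pos : Fin N → ℕ} (hv : pos v < τ.length) (s : Register) :
    ∃ s', s'.res = s.res ∧ Moves τ (advance v) s pos s' (Function.update pos v (pos v + 1))
      (4 * (rawTokens τ).length + 4) := by
  obtain ⟨s', e, h⟩ := does_advance (τ := τ) (v := v) (m := memoryAt τ pos) hv rfl s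
  rw [memoryAt_set] at h
  exact ⟨s', e, h⟩

lemma moves_peekRight (v : Fin N) (s : Register) (pos : Fin N → ℕ) :
    Moves τ (peekRight v) s pos { s with a := (postString τ (pos v)).head? } pos 1 :=
  does_peekRight v s _

lemma length_preString_le_iff {i j : ℕ} (hi : i ≤ τ.length) (hj : j ≤ τ.length) :
    (preString τ i).length ≤ (preString τ j).length ↔ i ≤ j := by
  constructor
  · intro h
    by_contra hc
    have := length_preString_lt (not_le.mp hc) hi
    omega
  · intro h
    rcases h.eq_or_lt with rfl | h
    · exact le_rfl
    · exact (length_preString_lt h hj).le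

lemma length_preString_le (i : ℕ) : (preString τ i).length ≤ (rawTokens τ).length := by
  rw [← preString_append_postString τ i]; simp

lemma moves_compare {v w : Fin N} (hvw : v ≠ w) (f : Bool → Bool → Bool) {pos : Fin N → ℕ}
    (hv : pos v ≤ τ.length) (hw : pos w ≤ τ.length) (s : Register) :
    ∃ s', s'.res = f (decide (pos v ≤ pos w)) (decide (pos w ≤ pos v)) ∧
      Moves τ (compare v w f) s pos s' pos (14 * (rawTokens τ).length + 8) := by
  obtain ⟨s', e, h⟩ := does_compare hvw f (m := memoryAt τ pos) (L := (preString τ (pos v)).reverse)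
    (R := postString τ (pos v)) (L' := (preString τ (pos w)).reverse) (R' := postString τ (pos w))
    rfl rfl rfl s
  refine ⟨s', ?_, Does.mono h ?_⟩
  · simpa only [List.length_reverse, length_preString_le_iff hv hw,
      length_preString_le_iff hw hv] using e
  · have := length_preString_le (τ := τ) (pos v)
    rw [List.length_reverse]
    omega

lemma moves_compareBits {v w : Fin N} (hvw : v ≠ w) (pos : Fin N → ℕ) (s : Register) :
    ∃ s', s'.res = decide (bitsAt τ (pos v) = bitsAt τ (pos w)) ∧
      Moves τ (compareBits v w) s pos s' pos (16 * (rawTokens τ).length + 8) := by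
  obtain ⟨s', e, h⟩ := does_compareBits hvw (m := memoryAt τ pos) (A := (bitsAt τ (pos v)).reverse)
    (A' := (bitsAt τ (pos w)).reverse) (X := (rawTokens (τ.take (pos v))).reverse)
    (X' := (rawTokens (τ.take (pos w))).reverse) (R := postString τ (pos v))
    (R' := postString τ (pos w)) (isBit_getLast_take _ _) (isBit_getLast_take _ _)
    (isBit_head_postString _ _) (isBit_head_postString _ _)
    (fun c hc => isBit_of_mem_bitsAt (List.mem_reverse.mp hc))
    (fun c hc => isBit_of_mem_bitsAt (List.mem_reverse.mp hc))
    (by simp [memoryAt, zipperAt, preString]) (by simp [memoryAt, zipperAt, preString]) rfl s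
  refine ⟨s', by simpa using e, Does.mono h ?_⟩
  have h1 := length_preString_le (τ := τ) (pos v)
  rw [preString, List.length_append] at h1
  rw [List.length_reverse]
  omega

lemma isSome_head_postString {k : ℕ} : (postString τ k).head?.isSome = decide (k < τ.length) := by
  rcases lt_or_ge k τ.length with h | h
  · rw [postString_eq h]; simp [h]
  · rw [postString_eq_nil h]; simp [h]

namespace Formula

variable {M n : ℕ}

/-- The values of the variables, read off from the positions of the pointers. -/
def environment (n : ℕ) (pos : Fin (M + 1) → ℕ) (j : Fin n) : ℕ := pos (pointer (2 * j))

lemma environment_succ (pos : Fin (M + 1) → ℕ) : environment (n + 1) pos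
    = Fin.snoc (α := fun _ => ℕ) (environment n pos) (pos (pointer (2 * n))) := by
  funext j
  refine Fin.lastCases ?_ (fun j => ?_) j
  · simp [environment]
  · simp [environment]

lemma environment_congr {pos pos' : Fin (M + 1) → ℕ}
    (h : ∀ j < 2 * n, pos' (pointer j) = pos (pointer j)) :
    environment n pos' = environment n pos := by
  funext j
  exact h _ (by omega)

open Classical in
/-- The program evaluates the formula and does not disturb the pointers of its variables. -/
def Evaluates (τ : List Token) (P : PProg (M + 1)) (φ : Formula n) (c : ℕ) : Prop :=
  ∀ (pos : Fin (M + 1) → ℕ) (s : Register), (∀ v, pos v ≤ τ.length) → ∃ s' pos',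
    (∀ v, pos' v ≤ τ.length) ∧ (∀ j < 2 * n, pos' (pointer j) = pos (pointer j)) ∧
    s'.res = decide (φ.eval τ (environment n pos)) ∧ Moves τ P s pos s' pos' c

lemma update_pointer_of_lt {pos : Fin (M + 1) → ℕ} {i j k : ℕ} (h : j < i) (hi : i < M + 1) :
    Function.update pos (pointer i) k (pointer j) = pos (pointer j) :=
  Function.update_of_ne (pointer_ne (by omega) hi (by omega)) _ _

lemma update_le {pos : Fin (M + 1) → ℕ} (hpos : ∀ v, pos v ≤ τ.length) {v : Fin (M + 1)} {k : ℕ}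
    (hk : k ≤ τ.length) (w : Fin (M + 1)) : Function.update pos v k w ≤ τ.length := by
  by_cases h : w = v
  · subst h; simpa
  · simpa [h] using hpos w

/-- The loop entered at position `k` decides whether some position from `k` on satisfies `φ`; the
induction is on the number `d` of positions left. -/
lemma Evaluates.ex {P : PProg (M + 1)} {φ : Formula (n + 1)} {c : ℕ} (h : Evaluates τ P φ c)
    (hn : 2 * n + 1 < M + 1) : Evaluates τ
      (.seq (.seq (rewind (pointer (2 * n))) (.act fun s => { s with res := false }))
      (.seq (peekRight (pointer (2 * n))) (.loop (fun s => s.a.isSome && !s.res)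
        (.seq P (.seq (.ite (fun s => s.res) (.act id) (advance (pointer (2 * n))))
          (peekRight (pointer (2 * n))))))))
      (Formula.ex φ) (8 * (rawTokens τ).length + 7 + τ.length * (c + 4 * (rawTokens τ).length + 8)) := by
  classical
  intro pos s hpos
  have key : ∀ (d k : ℕ) (p : Fin (M + 1) → ℕ) (s : Register), k + d = τ.length →
      (∀ v, p v ≤ τ.length) → p (pointer (2 * n)) = k →
      (∀ j < 2 * n, p (pointer j) = pos (pointer j)) → s.a = (postString τ k).head? →
      s.res = false → ∃ s' p', (∀ v, p' v ≤ τ.length) ∧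
      (∀ j < 2 * n, p' (pointer j) = pos (pointer j)) ∧
      s'.res = decide (∃ i, k ≤ i ∧ i < τ.length ∧
        φ.eval τ (Fin.snoc (α := fun _ => ℕ) (environment n pos) i)) ∧
      Moves τ (.loop (fun s => s.a.isSome && !s.res)
        (.seq P (.seq (.ite (fun s => s.res) (.act id) (advance (pointer (2 * n))))
          (peekRight (pointer (2 * n)))))) s p s' p' (d * (c + 4 * (rawTokens τ).length + 8) + 1) := by
    intro d
    induction d with
    | zero =>
      intro k p s hk hp hpk hpj ha hr
      refine ⟨s, p, hp, hpj, ?_, ?_⟩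
      · rw [hr, eq_comm, decide_eq_false]
        rintro ⟨i, h1, h2, -⟩
        omega
      · exact (Does.loop_done (by simp [ha, isSome_head_postString]; omega)).mono (by omega)
    | succ d ih =>
      intro k p s hk hp hpk hpj ha hr
      have hkl : k < τ.length := by omega
      have hc : (s.a.isSome && !s.res) = true := by simp [ha, isSome_head_postString, hr, hkl]
      obtain ⟨s1, p1, b1, k1, r1, m1⟩ := h p s hp
      rw [environment_succ, environment_congr hpj, hpk] at r1
      have hp1k : p1 (pointer (2 * n)) = k := by rw [k1 _ (by omega), hpk]
      have hp1j : ∀ j < 2 * n, p1 (pointer j) = pos (pointer j) :=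
        fun j hj => by rw [k1 j (by omega), hpj j hj]
      by_cases hφ : φ.eval τ (Fin.snoc (α := fun _ => ℕ) (environment n pos) k)
      · have r1' : s1.res = true := by rw [r1]; simpa using hφ
        have m2 : Does (.ite (fun s => s.res) (.act id) (advance (pointer (2 * n)))) s1
            (memoryAt τ p1) s1 (memoryAt τ p1) 2 := Does.ite_true r1' (Does.act id s1 _)
        have m3 := moves_peekRight (τ := τ) (pointer (2 * n)) s1 p1
        refine ⟨_, p1, b1, hp1j, ?_, (Does.loop_step hc (Does.seq m1 (m2.seq m3))
          (Does.loop_done (by simp [r1']))).mono ?_⟩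
        · simp only [r1']
          rw [eq_comm, decide_eq_true_eq]
          exact ⟨k, le_rfl, hkl, hφ⟩
        · rw [add_mul]; omega
      · have r1' : s1.res = false := by rw [r1]; simpa using hφ
        obtain ⟨s2, r2, m2⟩ := moves_advance (τ := τ) (v := pointer (2 * n)) (pos := p1) (by rw [hp1k]; exact hkl) s1
        rw [hp1k] at m2
        have m3 := moves_peekRight (τ := τ) (pointer (2 * n)) s2
          (Function.update p1 (pointer (2 * n)) (k + 1))
        rw [Function.update_self] at m3
        obtain ⟨s4, p4, b4, k4, r4, m4⟩ := ih (k + 1) (Function.update p1 (pointer (2 * n)) (k + 1))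
          { s2 with a := (postString τ (k + 1)).head? } (by omega) (update_le b1 (by omega))
          (by simp) (fun j hj => by rw [update_pointer_of_lt hj (by omega), hp1j j hj]) rfl
          (by simp [r2, r1'])
        refine ⟨s4, p4, b4, k4, ?_, (Does.loop_step hc (Does.seq m1
          ((Does.ite_false r1' m2).seq m3)) m4).mono ?_⟩
        · rw [r4, decide_eq_decide]
          constructor
          · rintro ⟨i, h1, h2⟩
            exact ⟨i, by omega, h2⟩
          · rintro ⟨i, h1, h2, h3⟩
            refine ⟨i, ?_, h2, h3⟩
            rcases h1.eq_or_lt with rfl | h1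
            · exact absurd h3 hφ
            · exact h1
        · rw [add_mul]; omega
  obtain ⟨s1, r1, m1⟩ := moves_rewind (τ := τ) (pointer (2 * n)) s pos
  have m2 := Does.act (fun s => { s with res := false }) s1
    (memoryAt τ (Function.update pos (pointer (2 * n)) 0))
  have m3 := moves_peekRight (τ := τ) (pointer (2 * n)) { s1 with res := false }
    (Function.update pos (pointer (2 * n)) 0)
  rw [Function.update_self] at m3
  obtain ⟨s4, p4, b4, k4, r4, m4⟩ := key τ.length 0 (Function.update pos (pointer (2 * n)) 0)
    { s1 with res := false, a := (postString τ 0).head? } (by omega) (update_le hpos (by omega))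
    (by simp) (fun j hj => by rw [update_pointer_of_lt hj (by omega)]) rfl rfl
  refine ⟨s4, p4, b4, k4, ?_, ((Does.seq m1 m2).seq (Does.seq m3 m4)).mono (by omega)⟩
  rw [r4, decide_eq_decide]
  simp [eval]

/-- When the running pointer is at `k`, the counter stands at the number of successes before `k`,
reduced modulo `G`. This is at most `k`, so the counter always has room to advance. -/
lemma Evaluates.countMod {P : PProg (M + 1)} {φ : Formula (n + 1)} {c : ℕ} (h : Evaluates τ P φ c)
    (hn : 2 * n + 1 < M + 1) (g r : Fin n) : Evaluates τ
      (.seq (.seq (.seq (rewind (pointer (2 * n))) (rewind (pointer (2 * n + 1))))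
        (.seq (peekRight (pointer (2 * n))) (.loop (fun s => s.a.isSome)
          (.seq (.seq P (.ite (fun s => s.res)
            (.seq (advance (pointer (2 * n + 1)))
              (.seq (compare (pointer (2 * n + 1)) (pointer (2 * g)) Bool.and)
                (.ite (fun s => s.res) (rewind (pointer (2 * n + 1))) (.act id))))
            (.act id)))
            (.seq (advance (pointer (2 * n))) (peekRight (pointer (2 * n))))))))
        (compare (pointer (2 * n + 1)) (pointer (2 * r)) Bool.and))
      (Formula.countMod g r φ)
      (30 * (rawTokens τ).length + 18 + τ.length * (c + 30 * (rawTokens τ).length + 24)) := by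
  classical
  intro pos s hpos
  set q : ℕ → Prop := fun k => φ.eval τ (Fin.snoc (α := fun _ => ℕ) (environment n pos) k) with hq
  have hg : 2 * (g : ℕ) < 2 * n := by omega
  have hr : 2 * (r : ℕ) < 2 * n := by omega
  set G := pos (pointer (2 * g)) with hG
  have step : ∀ (k : ℕ) (p : Fin (M + 1) → ℕ) (s : Register), k < τ.length →
      (∀ v, p v ≤ τ.length) → p (pointer (2 * n)) = k →
      p (pointer (2 * n + 1)) = Nat.count q k % G →
      (∀ j < 2 * n, p (pointer j) = pos (pointer j)) → ∃ s' p', (∀ v, p' v ≤ τ.length) ∧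
      p' (pointer (2 * n)) = k ∧ p' (pointer (2 * n + 1)) = Nat.count q (k + 1) % G ∧
      (∀ j < 2 * n, p' (pointer j) = pos (pointer j)) ∧
      Moves τ (.seq P (.ite (fun s => s.res)
            (.seq (advance (pointer (2 * n + 1)))
              (.seq (compare (pointer (2 * n + 1)) (pointer (2 * g)) Bool.and)
                (.ite (fun s => s.res) (rewind (pointer (2 * n + 1))) (.act id))))
            (.act id))) s p s' p' (c + 26 * (rawTokens τ).length + 18) := by
    intro k p s hk hp hpk hpc hpj
    obtain ⟨s1, p1, b1, k1, r1, m1⟩ := h p s hp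
    rw [environment_succ, environment_congr hpj, hpk] at r1
    have hp1k : p1 (pointer (2 * n)) = k := by rw [k1 _ (by omega), hpk]
    have hp1c : p1 (pointer (2 * n + 1)) = Nat.count q k % G := by rw [k1 _ (by omega), hpc]
    have hp1j : ∀ j < 2 * n, p1 (pointer j) = pos (pointer j) :=
      fun j hj => by rw [k1 j (by omega), hpj j hj]
    have hcnt : Nat.count q k ≤ k := Nat.count_le _
    have hmod : Nat.count q k % G ≤ Nat.count q k := Nat.mod_le _ _
    by_cases hφ : q k
    · have r1' : s1.res = true := by rw [r1]; simpa using hφ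
      obtain ⟨s2, -, m2⟩ := moves_advance (τ := τ) (v := pointer (2 * n + 1)) (pos := p1)
        (by rw [hp1c]; omega) s1
      rw [hp1c] at m2
      set p2 := Function.update p1 (pointer (2 * n + 1)) (Nat.count q k % G + 1) with hp2
      have b2 : ∀ v, p2 v ≤ τ.length := update_le b1 (by omega)
      have hp2c : p2 (pointer (2 * n + 1)) = Nat.count q k % G + 1 := by simp [hp2]
      have hp2j : ∀ j < 2 * n + 1, p2 (pointer j) = p1 (pointer j) := fun j hj => by
        rw [hp2, update_pointer_of_lt (by omega) (by omega)]
      have hp2g : p2 (pointer (2 * g)) = G := by rw [hp2j _ (by omega), hp1j _ hg]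
      obtain ⟨s3, r3, m3⟩ := moves_compare (τ := τ) (pointer_ne (by omega) (by omega) (by omega) :
        (pointer (2 * n + 1) : Fin (M + 1)) ≠ pointer (2 * g)) Bool.and
        (b2 (pointer (2 * n + 1))) (b2 (pointer (2 * g))) s2
      rw [hp2c, hp2g] at r3
      by_cases he : Nat.count q k % G + 1 = G
      · have r3' : s3.res = true := by rw [r3]; simp [he]
        obtain ⟨s4, -, m4⟩ := moves_rewind (τ := τ) (pointer (2 * n + 1)) s3 p2
        refine ⟨s4, _, update_le b2 (by omega), ?_, ?_, ?_, (Does.seq m1 (Does.ite_true r1'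
          (Does.seq m2 (Does.seq m3 (Does.ite_true r3' m4))))).mono (by omega)⟩
        · rw [update_pointer_of_lt (by omega) (by omega), hp2j _ (by omega), hp1k]
        · rw [Function.update_self, Nat.count_succ, if_pos hφ, Nat.add_mod_eq_ite]
          · rcases Nat.lt_or_ge 1 G with h1 | h1
            · rw [Nat.mod_eq_of_lt h1, if_pos (by omega)]; omega
            · have : G = 1 := by omega
              simp [this, Nat.mod_one]
        · intro j hj
          rw [update_pointer_of_lt (by omega) (by omega), hp2j _ (by omega), hp1j j hj]
      · have r3' : s3.res = false := by
          rw [r3, Bool.and_eq_false_iff]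
          simp only [decide_eq_false_iff_not]
          omega
        refine ⟨_, p2, b2, ?_, ?_, ?_, (Does.seq m1 (Does.ite_true r1'
          (Does.seq m2 (Does.seq m3 (Does.ite_false r3' (Does.act id s3 _)))))).mono (by omega)⟩
        · rw [hp2j _ (by omega), hp1k]
        · rw [hp2c, Nat.count_succ, if_pos hφ]
          -- For `G = 0` the counter is never reset, in accordance with `n % 0 = n`.
          rcases Nat.eq_zero_or_pos G with h0 | h0
          · simp [h0]
          · have := Nat.mod_lt (Nat.count q k) h0
            rw [← Nat.mod_add_mod, Nat.mod_eq_of_lt (by omega : Nat.count q k % G + 1 < G)]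
        · intro j hj
          rw [hp2j _ (by omega), hp1j j hj]
    · have r1' : s1.res = false := by rw [r1]; simpa using hφ
      refine ⟨_, p1, b1, hp1k, ?_, hp1j, (Does.seq m1 (Does.ite_false r1'
        (Does.act id s1 _))).mono (by omega)⟩
      rw [hp1c, Nat.count_succ, if_neg hφ, add_zero]
  have key : ∀ (d k : ℕ) (p : Fin (M + 1) → ℕ) (s : Register), k + d = τ.length →
      (∀ v, p v ≤ τ.length) → p (pointer (2 * n)) = k →
      p (pointer (2 * n + 1)) = Nat.count q k % G →
      (∀ j < 2 * n, p (pointer j) = pos (pointer j)) → s.a = (postString τ k).head? →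
      ∃ s' p', (∀ v, p' v ≤ τ.length) ∧ p' (pointer (2 * n + 1)) = Nat.count q τ.length % G ∧
      (∀ j < 2 * n, p' (pointer j) = pos (pointer j)) ∧
      Moves τ (.loop (fun s => s.a.isSome)
          (.seq (.seq P (.ite (fun s => s.res)
            (.seq (advance (pointer (2 * n + 1)))
              (.seq (compare (pointer (2 * n + 1)) (pointer (2 * g)) Bool.and)
                (.ite (fun s => s.res) (rewind (pointer (2 * n + 1))) (.act id))))
            (.act id)))
            (.seq (advance (pointer (2 * n))) (peekRight (pointer (2 * n)))))) s p s' p'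
          (d * (c + 30 * (rawTokens τ).length + 24) + 1) := by
    intro d
    induction d with
    | zero =>
      intro k p s hk hp hpk hpc hpj ha
      refine ⟨s, p, hp, by rw [hpc]; congr 2, hpj, ?_⟩
      exact (Does.loop_done (by simp [ha, isSome_head_postString]; omega)).mono (by omega)
    | succ d ih =>
      intro k p s hk hp hpk hpc hpj ha
      have hkl : k < τ.length := by omega
      obtain ⟨s1, p1, b1, e1, c1, k1, m1⟩ := step k p s hkl hp hpk hpc hpj
      obtain ⟨s2, -, m2⟩ := moves_advance (τ := τ) (v := pointer (2 * n)) (pos := p1)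
        (by rw [e1]; exact hkl) s1
      rw [e1] at m2
      have m3 := moves_peekRight (τ := τ) (pointer (2 * n)) s2
        (Function.update p1 (pointer (2 * n)) (k + 1))
      rw [Function.update_self] at m3
      obtain ⟨s4, p4, b4, c4, k4, m4⟩ := ih (k + 1) (Function.update p1 (pointer (2 * n)) (k + 1))
        { s2 with a := (postString τ (k + 1)).head? } (by omega) (update_le b1 (by omega))
        (by simp)
        (by rw [Function.update_of_ne (pointer_ne (by omega) (by omega) (by omega)), c1])
        (fun j hj => by rw [update_pointer_of_lt hj (by omega), k1 j hj]) rfl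
      refine ⟨s4, p4, b4, c4, k4, (Does.loop_step (by simp [ha, isSome_head_postString, hkl])
        (Does.seq m1 (Does.seq m2 m3)) m4).mono ?_⟩
      rw [add_mul]; omega
  obtain ⟨s1, -, m1⟩ := moves_rewind (τ := τ) (pointer (2 * n)) s pos
  obtain ⟨s2, -, m2⟩ := moves_rewind (τ := τ) (pointer (2 * n + 1)) s1
    (Function.update pos (pointer (2 * n)) 0)
  set p2 := Function.update (Function.update pos (pointer (2 * n)) 0) (pointer (2 * n + 1)) 0 with hp2
  have hp2n : p2 (pointer (2 * n)) = 0 := by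
    rw [hp2, update_pointer_of_lt (by omega) (by omega), Function.update_self]
  have m3 := moves_peekRight (τ := τ) (pointer (2 * n)) s2 p2
  rw [hp2n] at m3
  obtain ⟨s4, p4, b4, c4, k4, m4⟩ := key τ.length 0 p2
    { s2 with a := (postString τ 0).head? } (by omega)
    (update_le (update_le hpos (by omega)) (by omega)) hp2n (by simp [hp2])
    (fun j hj => by
      rw [hp2, update_pointer_of_lt (by omega) (by omega), update_pointer_of_lt hj (by omega)]) rfl
  obtain ⟨s5, r5, m5⟩ := moves_compare (τ := τ) (pointer_ne (by omega) (by omega) (by omega) :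
    (pointer (2 * n + 1) : Fin (M + 1)) ≠ pointer (2 * r)) Bool.and
    (b4 (pointer (2 * n + 1))) (b4 (pointer (2 * r))) s4
  refine ⟨s5, p4, b4, k4, ?_,
    (((Does.seq m1 m2).seq (Does.seq m3 m4)).seq m5).mono (by omega)⟩
  rw [r5, c4, k4 _ hr, ← Bool.decide_and, decide_eq_decide]
  have hcnt : (fun k => φ.eval τ (Fin.snoc (α := fun _ => ℕ) (environment n pos) k)) = q := rfl
  simp only [eval, hcnt]
  rw [show environment n pos g = G from rfl, show environment n pos r = pos (pointer (2 * r)) from rfl]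
  omega

/-- A quantifier over variable `n` uses only the pointers `2 * n` and `2 * n + 1` and those of
deeper quantifiers, so the pointers of free variables survive; the bound on `M` provides enough
pointers for the whole depth. -/
theorem evaluates_compile : ∀ {n : ℕ} (φ : Formula n), 2 * (n + φ.depth) < M + 1 →
    Evaluates τ (φ.compile : PProg (M + 1)) φ (φ.cost.eval (rawTokens τ).length)
  | n, kind c j, hM => by
    classical
    intro pos s hpos
    refine ⟨_, pos, hpos, fun _ _ => rfl, ?_, (Does.seq (moves_peekRight (τ := τ) _ s pos)
      (Does.act _ _ _)).mono (by simp [cost])⟩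
    simp only [eval, environment, Bool.beq_eq_decide_eq]
    exact decide_eq_decide.mpr Iff.rfl
  | n, same i j, hM => by
    classical
    intro pos s hpos
    simp only [depth] at hM
    by_cases h : i = j
    · refine ⟨{ s with res := true }, pos, hpos, fun _ _ => rfl, by simp [eval, h], ?_⟩
      simp only [compile, h, if_true]
      exact (Does.act _ _ _).mono (by simp [cost])
    · obtain ⟨s', e, m⟩ := moves_compareBits (τ := τ) (pointer_ne (by omega) (by omega)
        (by have := Fin.val_ne_of_ne h; omega) :
        (pointer (2 * i) : Fin (M + 1)) ≠ pointer (2 * j)) pos s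
      refine ⟨s', pos, hpos, fun _ _ => rfl, ?_, ?_⟩
      · rw [e, decide_eq_decide]; rfl
      · simp only [compile, h, if_false]
        exact Does.mono m (by simp [cost])
  | n, lt i j, hM => by
    classical
    intro pos s hpos
    simp only [depth] at hM
    by_cases h : i = j
    · refine ⟨{ s with res := false }, pos, hpos, fun _ _ => rfl, by simp [eval, h], ?_⟩
      simp only [compile, h, if_true]
      exact (Does.act _ _ _).mono (by simp [cost])
    · obtain ⟨s', e, m⟩ := moves_compare (τ := τ) (pointer_ne (by omega) (by omega)
        (by have := Fin.val_ne_of_ne h; omega) :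
        (pointer (2 * i) : Fin (M + 1)) ≠ pointer (2 * j)) (fun x y => x && !y)
        (hpos _) (hpos _) s
      refine ⟨s', pos, hpos, fun _ _ => rfl, ?_, ?_⟩
      · rw [e, ← decide_not, ← Bool.decide_and, decide_eq_decide]
        simp only [eval, environment]
        omega
      · simp only [compile, h, if_false]
        exact Does.mono m (by simp [cost])
  | n, not φ, hM => by
    classical
    intro pos s hpos
    obtain ⟨s', p', b, k, e, m⟩ := evaluates_compile φ hM pos s hpos
    refine ⟨_, p', b, k, ?_, (Does.seq m (Does.act _ _ _)).mono (by simp [cost])⟩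
    simp only [e, eval]
    by_cases hφ : φ.eval τ (environment n pos) <;> simp [hφ]
  | n, and φ ψ, hM => by
    classical
    intro pos s hpos
    simp only [depth] at hM
    obtain ⟨s', p', b, k, e, m⟩ := evaluates_compile φ (by omega) pos s hpos
    by_cases hφ : φ.eval τ (environment n pos)
    · obtain ⟨s2, p2, b2, k2, e2, m2⟩ := evaluates_compile ψ (by omega) p' s' b
      refine ⟨s2, p2, b2, fun j hj => by rw [k2 j hj, k j hj], ?_, (Does.seq m
        (Does.ite_true (by rw [e]; simpa using hφ) m2)).mono (by simp [cost]; omega)⟩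
      rw [e2, environment_congr k]
      simp [eval, hφ]
    · refine ⟨s', p', b, k, by simp [e, eval, hφ], (Does.seq m (Does.ite_false
        (by rw [e]; simpa using hφ) (Does.act id _ _))).mono (by simp [cost])⟩
  | n, ex φ, hM => by
    simp only [depth] at hM
    have h := (evaluates_compile φ (by omega)).ex (by omega)
    intro pos s hpos
    obtain ⟨s', p', b, k, e, m⟩ := h pos s hpos
    refine ⟨s', p', b, k, e, Does.mono m ?_⟩
    -- Every token ends in a delimiter, so the number of rounds is at most the length of the string.
    have := Nat.mul_le_mul_right (φ.cost.eval (rawTokens τ).length + 4 * (rawTokens τ).length + 8)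
      (length_le_rawTokens τ)
    simpa [cost] using this
  | n, countMod g r φ, hM => by
    simp only [depth] at hM
    have h := (evaluates_compile φ (by omega)).countMod (by omega) g r
    intro pos s hpos
    obtain ⟨s', p', b, k, e, m⟩ := h pos s hpos
    refine ⟨s', p', b, k, e, Does.mono m ?_⟩
    have := Nat.mul_le_mul_right (φ.cost.eval (rawTokens τ).length + 30 * (rawTokens τ).length + 24)
      (length_le_rawTokens τ)
    simpa [cost] using this

end Formula

end Evaluation

/-! ### A polynomial-time machine for every closed formula. -/

section Computation

variable {N : ℕ}

/-- Pushes the symbol in the register on the left stacks of some pointers. -/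
def pushAll : List (Fin N) → PProg N
  | [] => .act id
  | v :: vs => .seq (.push (.left v) fun s => s.a.getD .equals) (pushAll vs)

lemma does_pushAll {c : Symbol} {s : Register} (hs : s.a = some c) :
    ∀ (vs : List (Fin N)) (_ : vs.Nodup) (m : Memory N), Does (pushAll vs) s m s
      { m with ptr := fun v => if v ∈ vs then (c :: (m.ptr v).1, (m.ptr v).2) else m.ptr v }
      (vs.length + 1)
  | [], _, m => by simpa [pushAll] using Does.act id s m
  | v :: vs, hv, m => by
    rw [List.nodup_cons] at hv
    have h1 := Prog.Exec.push (Γ := Cell (N := N)) (.left v) (fun s : Register => s.a.getD .equals) s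
      m.stacks
    rw [update_left] at h1
    have h2 := does_pushAll hs vs hv.2 (m.set v (c :: (m.ptr v).1, (m.ptr v).2))
    have e : (fun w => if w ∈ vs then (c :: ((m.set v (c :: (m.ptr v).1, (m.ptr v).2)).ptr w).1,
        ((m.set v (c :: (m.ptr v).1, (m.ptr v).2)).ptr w).2)
        else (m.set v (c :: (m.ptr v).1, (m.ptr v).2)).ptr w)
        = fun w => if w ∈ v :: vs then (c :: (m.ptr w).1, (m.ptr w).2) else m.ptr w := by
      funext w
      by_cases hw : w = v
      · subst hw; simp [hv.1]
      · simp [m.set_ptr_ne hw, hw]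
    rw [e] at h2
    simp only [hs, Option.getD_some] at h1
    exact (Does.seq h1.runs h2).mono (by simp; omega)

/-- Copies the input to the left stacks of all pointers. -/
def load : PProg N :=
  .seq (.pop .inp fun s c => { s with a := c })
    (.loop (fun s => s.a.isSome) (.seq (pushAll (List.finRange N))
      (.pop .inp fun s c => { s with a := c })))

lemma does_pop_inp (s : Register) (m : Memory N) :
    Does (.pop .inp fun s c => { s with a := c }) s m { s with a := m.inp.head? }
      { m with inp := m.inp.tail } 1 := by
  have h := Prog.Exec.pop (Γ := Cell (N := N)) .inp (fun s c => { s with a := c }) s m.stacks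
  rw [update_inp] at h
  exact h.runs

/-- Popping the input onto the left stacks reverses it there, which is the configuration of pointers
at the end of the list. -/
lemma does_load (l : List Symbol) (s : Register) : ∃ s', s'.res = s.res ∧
    Does load s (⟨fun _ => ([], []), [], l, []⟩ : Memory N) s'
      ⟨fun _ => (l.reverse, []), [], [], []⟩ ((N + 3) * l.length + 2) := by
  suffices h : ∀ (l A : List Symbol) (s : Register), s.a = l.head? → ∃ s', s'.res = s.res ∧
      Does (.loop (fun s => s.a.isSome) (.seq (pushAll (List.finRange N))
      (.pop .inp fun s c => { s with a := c }))) s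
      (⟨fun _ => (A, []), [], l.tail, []⟩ : Memory N) s'
      ⟨fun _ => (l.reverse ++ A, []), [], [], []⟩ ((N + 3) * l.length + 1) by
    obtain ⟨s', e, h'⟩ := h l [] { s with a := l.head? } rfl
    rw [List.append_nil] at h'
    exact ⟨s', e, ((does_pop_inp s _).seq h').mono (by omega)⟩
  intro l
  induction l with
  | nil =>
    intro A s hs
    exact ⟨s, rfl, (Does.loop_done (by simp [hs])).mono (by simp)⟩
  | cons c l ih =>
    intro A s hs
    have h1 := does_pushAll (N := N) (c := c) hs (List.finRange N) (List.nodup_finRange N)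
      ⟨fun _ => (A, []), [], l, []⟩
    simp only [List.mem_finRange, if_true, List.length_finRange] at h1
    have h2 := does_pop_inp s (⟨fun _ => (c :: A, []), [], l, []⟩ : Memory N)
    obtain ⟨s', e, h3⟩ := ih (c :: A) { s with a := l.head? } rfl
    have e3 : l.reverse ++ c :: A = (c :: l).reverse ++ A := by simp
    rw [e3] at h3
    refine ⟨s', e, (Does.loop_step (by simp [hs]) (h1.seq h2) h3).mono ?_⟩
    rw [List.length_cons, mul_add]
    omega

/-- Empties a stack of symbols. -/
def clearLeft (v : Fin N) : PProg N :=
  .seq (.pop (.left v) fun s c => { s with a := c })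
    (.loop (fun s => s.a.isSome) (.pop (.left v) fun s c => { s with a := c }))

/-- Empties a stack of symbols. -/
def clearRight (v : Fin N) : PProg N :=
  .seq (.pop (.right v) fun s c => { s with a := c })
    (.loop (fun s => s.a.isSome) (.pop (.right v) fun s c => { s with a := c }))

lemma does_clearLeft (v : Fin N) (s : Register) (m : Memory N) : ∃ s', s'.res = s.res ∧
    Does (clearLeft v) s m s' (m.set v ([], (m.ptr v).2)) (2 * (m.ptr v).1.length + 2) := by
  have hp : ∀ (s : Register) (L R : List Symbol), Does (.pop (.left v) fun s c => { s with a := c }) s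
      (m.set v (L, R)) { s with a := L.head? } (m.set v (L.tail, R)) 1 := fun s L R => by
    have h := Prog.Exec.pop (Γ := Cell (N := N)) (.left v) (fun s c => { s with a := c }) s
      (m.set v (L, R)).stacks
    rw [update_left, Memory.set_ptr_self, Memory.set_set] at h
    have e : (m.set v (L, R)).stacks (.left v) = L := by simp [Memory.stacks]
    rw [e] at h
    exact h.runs
  suffices h : ∀ (L R : List Symbol) (s : Register), s.a = L.head? → ∃ s', s'.res = s.res ∧
      Does (.loop (fun s => s.a.isSome) (.pop (.left v) fun s c => { s with a := c })) s
        (m.set v (L.tail, R)) s' (m.set v ([], R)) (2 * L.length + 1) by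
    obtain ⟨s', e, h'⟩ := h (m.ptr v).1 (m.ptr v).2 { s with a := (m.ptr v).1.head? } rfl
    have h0 := hp s (m.ptr v).1 (m.ptr v).2
    rw [m.set_self v (z := ((m.ptr v).1, (m.ptr v).2)) rfl] at h0
    exact ⟨s', e, (h0.seq h').mono (by omega)⟩
  intro L
  induction L with
  | nil => exact fun R s hs => ⟨s, rfl, (Does.loop_done (by simp [hs])).mono (by simp)⟩
  | cons c L ih =>
    intro R s hs
    obtain ⟨s', e, h⟩ := ih R { s with a := L.head? } rfl
    exact ⟨s', e, (Does.loop_step (by simp [hs]) (hp s L R) h).mono (by simp; omega)⟩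

lemma does_clearRight (v : Fin N) (s : Register) (m : Memory N) : ∃ s', s'.res = s.res ∧
    Does (clearRight v) s m s' (m.set v ((m.ptr v).1, [])) (2 * (m.ptr v).2.length + 2) := by
  have hp : ∀ (s : Register) (L R : List Symbol), Does (.pop (.right v) fun s c => { s with a := c })
      s (m.set v (L, R)) { s with a := R.head? } (m.set v (L, R.tail)) 1 := fun s L R => by
    have h := Prog.Exec.pop (Γ := Cell (N := N)) (.right v) (fun s c => { s with a := c }) s
      (m.set v (L, R)).stacks
    rw [update_right, Memory.set_ptr_self, Memory.set_set] at h
    have e : (m.set v (L, R)).stacks (.right v) = R := by simp [Memory.stacks]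
    rw [e] at h
    exact h.runs
  suffices h : ∀ (R L : List Symbol) (s : Register), s.a = R.head? → ∃ s', s'.res = s.res ∧
      Does (.loop (fun s => s.a.isSome) (.pop (.right v) fun s c => { s with a := c })) s
        (m.set v (L, R.tail)) s' (m.set v (L, [])) (2 * R.length + 1) by
    obtain ⟨s', e, h'⟩ := h (m.ptr v).2 (m.ptr v).1 { s with a := (m.ptr v).2.head? } rfl
    have h0 := hp s (m.ptr v).1 (m.ptr v).2
    rw [m.set_self v (z := ((m.ptr v).1, (m.ptr v).2)) rfl] at h0
    exact ⟨s', e, (h0.seq h').mono (by omega)⟩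
  intro R
  induction R with
  | nil => exact fun L s hs => ⟨s, rfl, (Does.loop_done (by simp [hs])).mono (by simp)⟩
  | cons c R ih =>
    intro L s hs
    obtain ⟨s', e, h⟩ := ih L { s with a := R.head? } rfl
    exact ⟨s', e, (Does.loop_step (by simp [hs]) (hp s L R) h).mono (by simp; omega)⟩

/-- Empties the stacks of some pointers. -/
def clearAll : List (Fin N) → PProg N
  | [] => .act id
  | v :: vs => .seq (.seq (clearLeft v) (clearRight v)) (clearAll vs)

lemma does_clearAll {c : ℕ} : ∀ (vs : List (Fin N)) (s : Register) (m : Memory N),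
    (∀ v, (m.ptr v).1.length + (m.ptr v).2.length ≤ c) → ∃ s', s'.res = s.res ∧
      Does (clearAll vs) s m s'
        { m with ptr := fun v => if v ∈ vs then ([], []) else m.ptr v }
        ((2 * c + 4) * vs.length + 1)
  | [], s, m, _ => ⟨s, rfl, by simpa [clearAll] using Does.act id s m⟩
  | v :: vs, s, m, hm => by
    obtain ⟨s1, e1, h1⟩ := does_clearLeft v s m
    obtain ⟨s2, e2, h2⟩ := does_clearRight v s1 (m.set v ([], (m.ptr v).2))
    rw [Memory.set_set, Memory.set_ptr_self] at h2
    obtain ⟨s3, e3, h3⟩ := does_clearAll (c := c) vs s2 (m.set v ([], [])) fun w => by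
      by_cases hw : w = v
      · subst hw; simp
      · rw [m.set_ptr_ne hw]; exact hm w
    have e : (fun w => if w ∈ vs then ([], []) else (m.set v ([], [])).ptr w)
        = fun w => if w ∈ v :: vs then ([], []) else m.ptr w := by
      funext w
      by_cases hw : w = v
      · subst hw; simp
      · simp [m.set_ptr_ne hw, hw]
    rw [e] at h3
    refine ⟨s3, by rw [e3, e2, e1], ((h1.seq h2).seq h3).mono ?_⟩
    have := hm v
    rw [List.length_cons, mul_add, mul_one]
    simp only
    omega

/-- The register at the start and at the end. -/
def Register.initial : Register := ⟨false, none, none⟩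

variable {M : ℕ}

/-- Reads the input, evaluates a closed formula, and leaves nothing but its truth value. -/
def decideProgram (M : ℕ) (φ : Formula 0) : PProg (M + 1) :=
  .seq (.seq load φ.compile) (.seq (clearAll (List.finRange (M + 1)))
    (.seq (.push .out fun s => s.res) (.act fun _ => Register.initial)))

lemma stacks_inp (l : List Symbol) : (⟨fun _ => ([], []), [], l, []⟩ : Memory N).stacks
    = Prog.singleStack (Γ := Cell (N := N)) .inp l := by
  have h : (fun _ => [] : ∀ k : Stack N, List (Cell k))
      = (⟨fun _ => ([], []), [], [], []⟩ : Memory N).stacks := by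
    funext k; cases k <;> rfl
  exact ((congrArg (fun S => Function.update S Stack.inp l) h).trans (update_inp _ l)).symm

lemma stacks_out (l : List Bool) : (⟨fun _ => ([], []), [], [], l⟩ : Memory N).stacks
    = Prog.singleStack (Γ := Cell (N := N)) .out l := by
  have h : (fun _ => [] : ∀ k : Stack N, List (Cell k))
      = (⟨fun _ => ([], []), [], [], []⟩ : Memory N).stacks := by
    funext k; cases k <;> rfl
  exact ((congrArg (fun S => Function.update S Stack.out l) h).trans (update_out _ l)).symm

-- The computation must end with nothing but the answer: hence the clearing of all pointer stacks
-- and the reset of the register.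
open Classical in
lemma does_decideProgram (φ : Formula 0) (hM : 2 * φ.depth < M + 1) (τ : List Token) :
    Does (decideProgram M φ) Register.initial ⟨fun _ => ([], []), [], rawTokens τ, []⟩
      Register.initial ⟨fun _ => ([], []), [], [], [decide (φ.eval τ Fin.elim0)]⟩
      ((M + 1 + 3) * (rawTokens τ).length + 2 + φ.cost.eval (rawTokens τ).length
        + ((2 * (rawTokens τ).length + 4) * (M + 1) + 3)) := by
  obtain ⟨s1, e1, h1⟩ := does_load (N := M + 1) (rawTokens τ) Register.initial
  obtain ⟨s2, p2, -, -, e2, h2⟩ := Formula.evaluates_compile (τ := τ) (M := M) φ (by simpa using hM)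
    (fun _ => τ.length) s1 (fun _ => le_rfl)
  have h0 : memoryAt τ (fun _ : Fin (M + 1) => τ.length)
      = ⟨fun _ => ((rawTokens τ).reverse, []), [], [], []⟩ := by
    simp [memoryAt, zipperAt, preString_last, postString_eq_nil]
  rw [Moves, h0] at h2
  obtain ⟨s3, e3, h3⟩ := does_clearAll (c := (rawTokens τ).length) (List.finRange (M + 1)) s2
    (memoryAt τ p2) fun v => by
      rw [← preString_append_postString τ (p2 v)]; simp [memoryAt, zipperAt]
  have h4 := Prog.Exec.push (Γ := Cell (N := M + 1)) .out (fun s : Register => s.res) s3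
    (⟨fun _ => ([], []), [], [], []⟩ : Memory (M + 1)).stacks
  rw [update_out] at h4
  have h5 := Does.act (fun _ => Register.initial) s3
    (⟨fun _ => ([], []), [], [], [s3.res]⟩ : Memory (M + 1))
  simp only [List.mem_finRange, if_true, List.length_finRange] at h3
  have e : s3.res = decide (φ.eval τ Fin.elim0) := by
    rw [e3, e2, decide_eq_decide, Subsingleton.elim (Formula.environment 0 _) Fin.elim0]
  rw [e] at h4 h5
  exact ((h1.seq h2).seq (h3.seq (Does.seq h4.runs h5))).mono (by omega)

/-- The tokens of a written identity. -/
def identityTokens (i : Identity) : List Token :=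
  i.left.map .letter ++ .equals :: (i.right.map .letter ++ [.identityEnd])

/-- The tokens of a written basis. -/
def basisTokens (B : List Identity) : List Token := B.flatMap identityTokens

lemma rawTokens_letters (l : List ℕ) : rawTokens (l.map .letter) = l.flatMap encodeLetter := by
  induction l with
  | nil => rfl
  | cons n l ih => simp [ih, encodeLetter, Token.bits, Token.delim]

lemma rawTokens_basisTokens (B : List Identity) : rawTokens (basisTokens B) = encodeBasis B := by
  induction B with
  | nil => rfl
  | cons i B ih =>
    rw [basisTokens, List.flatMap_cons, rawTokens_append, ← basisTokens, ih, encodeBasis,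
      encodeBasis, List.flatMap_cons]
    congr 1
    simp [identityTokens, rawTokens_letters, encodeIdentity, encodeWord, encodeLetter, Identity.left,
      Identity.right, Token.bits, Token.delim]

open Classical Polynomial in
/-- The truth of a closed formula is decided in polynomial time. -/
theorem Formula.computableInPolyTime (φ : Formula 0) : Nonempty (Turing.TM2ComputableInPolyTime
    encodeBasis Computability.encodeBool fun B => decide (φ.eval (basisTokens B) Fin.elim0)) := by
  set M := 2 * φ.depth with hM
  -- The final summand `1` is the halting step.
  set p : ℕ[X] := ((M : ℕ[X]) + 1 + 3) * X + 2 + φ.cost + ((2 * X + 4) * ((M : ℕ[X]) + 1) + 3) + 1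
    with hp
  have h : ∀ (B : List Identity) (l : List Symbol) (n : ℕ), l = encodeBasis B →
      n = p.eval (encodeBasis B).length → Nonempty (Turing.TM2OutputsInTime
      ((decideProgram M φ).toMachine .inp .out Register.initial) l
      (some [decide (φ.eval (basisTokens B) Fin.elim0)]) n) := by
    intro B l n hl hn
    have h1 := does_decideProgram φ (M := M) (by omega) (basisTokens B)
    rw [rawTokens_basisTokens, Does, stacks_inp, stacks_out, ← hl] at h1
    have e : n = (M + 1 + 3) * l.length + 2 + φ.cost.eval l.length
        + ((2 * l.length + 4) * (M + 1) + 3) + 1 := by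
      rw [hn, hp, hl]; simp
    subst e
    exact Prog.Runs.outputs h1
  exact ⟨⟨⟨(decideProgram M φ).toMachine .inp .out Register.initial, Equiv.refl _, Equiv.refl _⟩,
    p, fun B => (h B _ _ (List.map_id _) rfl).some⟩⟩

end Computation

/-! ### Definability over families of token lists with distinguished positions. -/

section Definability

namespace Formula

/-- Extends a renaming of variables to a new innermost variable. -/
def liftRename {n m : ℕ} (ρ : Fin n → Fin m) : Fin (n + 1) → Fin (m + 1) :=
  Fin.snoc (α := fun _ => Fin (m + 1)) (fun j => (ρ j).castSucc) (Fin.last m)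

/-- Renames the variables of a formula. -/
def rename : {n m : ℕ} → (Fin n → Fin m) → Formula n → Formula m
  | _, _, ρ, kind c j => kind c (ρ j)
  | _, _, ρ, same i j => same (ρ i) (ρ j)
  | _, _, ρ, lt i j => lt (ρ i) (ρ j)
  | _, _, ρ, not φ => not (φ.rename ρ)
  | _, _, ρ, and φ ψ => and (φ.rename ρ) (ψ.rename ρ)
  | _, _, ρ, ex φ => ex (φ.rename (liftRename ρ))
  | _, _, ρ, countMod g r φ => countMod (ρ g) (ρ r) (φ.rename (liftRename ρ))

lemma snoc_comp_liftRename {n m : ℕ} (ρ : Fin n → Fin m) (e : Fin m → ℕ) (k : ℕ) :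
    Fin.snoc (α := fun _ => ℕ) e k ∘ liftRename ρ = Fin.snoc (α := fun _ => ℕ) (e ∘ ρ) k := by
  funext j
  refine Fin.lastCases ?_ (fun j => ?_) j <;> simp [liftRename]

open Classical in
lemma eval_rename (τ : List Token) : ∀ {n m : ℕ} (ρ : Fin n → Fin m) (φ : Formula n)
    (e : Fin m → ℕ), (φ.rename ρ).eval τ e ↔ φ.eval τ (e ∘ ρ)
  | _, _, ρ, kind c j, e => Iff.rfl
  | _, _, ρ, same i j, e => Iff.rfl
  | _, _, ρ, lt i j, e => Iff.rfl
  | _, _, ρ, not φ, e => not_congr (eval_rename τ ρ φ e)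
  | _, _, ρ, and φ ψ, e => and_congr (eval_rename τ ρ φ e) (eval_rename τ ρ ψ e)
  | _, _, ρ, ex φ, e => by
    simp only [rename, eval, eval_rename τ (liftRename ρ) φ, snoc_comp_liftRename]
  | _, _, ρ, countMod g r φ, e => by
    have h : (fun k => (φ.rename (liftRename ρ)).eval τ (Fin.snoc (α := fun _ => ℕ) e k))
        = fun k => φ.eval τ (Fin.snoc (α := fun _ => ℕ) (e ∘ ρ) k) := by
      funext k
      rw [eval_rename τ (liftRename ρ) φ, snoc_comp_liftRename]
    have key : ∀ p q : ℕ → Prop, p = q → Nat.count p τ.length = Nat.count q τ.length := by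
      rintro p _ rfl; rfl
    simp only [rename, eval]
    rw [key _ _ h]
    rfl

end Formula

/-- A family of lists of tokens with `n` distinguished positions. -/
structure Context (α : Type) where
  n : ℕ
  toks : α → List Token
  env : α → Fin n → ℕ

namespace Context

variable {α β γ : Type} {C : Context α} {C' : Context β} {C'' : Context γ}

/-- The property is expressed by a formula. -/
def Definable (C : Context α) (P : α → Prop) : Prop :=
  ∃ φ : Formula C.n, ∀ a, φ.eval (C.toks a) (C.env a) ↔ P a

/-- `C'` arises from `C` by distinguishing further positions. -/
def Extends (C' : Context β) (C : Context α) (f : β → α) : Prop :=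
  ∃ ρ : Fin C.n → Fin C'.n, ∀ b, C'.toks b = C.toks (f b) ∧ ∀ j, C'.env b (ρ j) = C.env (f b) j

lemma Extends.trans {f : β → α} {g : γ → β} (h' : C''.Extends C' g) (h : C'.Extends C f) :
    C''.Extends C (f ∘ g) := by
  obtain ⟨ρ, hρ⟩ := h
  obtain ⟨ρ', hρ'⟩ := h'
  refine ⟨ρ' ∘ ρ, fun c => ⟨(hρ' c).1.trans (hρ _).1, fun j => ?_⟩⟩
  rw [Function.comp_apply, (hρ' c).2, (hρ _).2]; rfl

namespace Definable

variable {P Q : α → Prop}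

lemma congr (h : C.Definable P) (e : ∀ a, P a ↔ Q a) : C.Definable Q := by
  obtain ⟨φ, hφ⟩ := h
  exact ⟨φ, fun a => (hφ a).trans (e a)⟩

lemma comp {f : β → α} (h : C.Definable P) (hf : C'.Extends C f) :
    C'.Definable fun b => P (f b) := by
  obtain ⟨φ, hφ⟩ := h
  obtain ⟨ρ, hρ⟩ := hf
  refine ⟨φ.rename ρ, fun b => ?_⟩
  beta_reduce
  rw [Formula.eval_rename, ← hφ, (hρ b).1]
  have : C'.env b ∘ ρ = C.env (f b) := funext (hρ b).2
  rw [this]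

lemma not (h : C.Definable P) : C.Definable fun a => ¬ P a := by
  obtain ⟨φ, hφ⟩ := h
  exact ⟨φ.not, fun a => not_congr (hφ a)⟩

lemma and (h : C.Definable P) (h' : C.Definable Q) : C.Definable fun a => P a ∧ Q a := by
  obtain ⟨φ, hφ⟩ := h
  obtain ⟨ψ, hψ⟩ := h'
  exact ⟨φ.and ψ, fun a => and_congr (hφ a) (hψ a)⟩

lemma or (h : C.Definable P) (h' : C.Definable Q) : C.Definable fun a => P a ∨ Q a :=
  (h.not.and h'.not).not.congr fun a => by tauto

lemma imp (h : C.Definable P) (h' : C.Definable Q) : C.Definable fun a => P a → Q a :=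
  (h.and h'.not).not.congr fun a => by tauto

end Definable

/-- The context with one more, arbitrary position. -/
def push (C : Context α) : Context {p : α × ℕ // p.2 < (C.toks p.1).length} where
  n := C.n + 1
  toks p := C.toks p.1.1
  env p := Fin.snoc (α := fun _ => ℕ) (C.env p.1.1) p.1.2

lemma push_extends (C : Context α) : C.push.Extends C fun p => p.1.1 :=
  ⟨Fin.castSucc, fun p => ⟨rfl, fun j => by simp [push]⟩⟩

lemma Extends.push {f : β → α} (h : C'.Extends C f) : C'.push.Extends C.push
    fun p => ⟨(f p.1.1, p.1.2), by
      obtain ⟨ρ, hρ⟩ := h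
      rw [← (hρ _).1]; exact p.2⟩ := by
  obtain ⟨ρ, hρ⟩ := h
  refine ⟨Formula.liftRename ρ, fun p => ⟨(hρ _).1, fun j => ?_⟩⟩
  refine Fin.lastCases ?_ (fun j => ?_) j
  · simp [Formula.liftRename, Context.push]
  · simp [Formula.liftRename, Context.push, (hρ _).2]

/-- A distinguished position. -/
def IsNum (C : Context α) (x : α → ℕ) : Prop := ∃ j, ∀ a, C.env a j = x a

lemma IsNum.comp {x : α → ℕ} {f : β → α} (h : C.IsNum x) (hf : C'.Extends C f) :
    C'.IsNum fun b => x (f b) := by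
  obtain ⟨j, hj⟩ := h
  obtain ⟨ρ, hρ⟩ := hf
  exact ⟨ρ j, fun b => by rw [(hρ b).2, hj]⟩

lemma isNum_push (C : Context α) : C.push.IsNum fun p => p.1.2 :=
  ⟨Fin.last _, fun p => by simp [push]⟩

lemma IsNum.lt {x y : α → ℕ} (hx : C.IsNum x) (hy : C.IsNum y) : C.Definable fun a => x a < y a := by
  obtain ⟨i, hi⟩ := hx
  obtain ⟨j, hj⟩ := hy
  exact ⟨.lt i j, fun a => by beta_reduce; rw [← hi, ← hj]; exact Iff.rfl⟩

lemma Definable.exists_pos {P : α → ℕ → Prop}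
    (h : C.push.Definable fun p => P p.1.1 p.1.2) :
    C.Definable fun a => ∃ k < (C.toks a).length, P a k := by
  obtain ⟨φ, hφ⟩ := h
  refine ⟨φ.ex, fun a => ?_⟩
  constructor
  · rintro ⟨k, hk, h⟩
    exact ⟨k, hk, (hφ ⟨(a, k), hk⟩).mp h⟩
  · rintro ⟨k, hk, h⟩
    exact ⟨k, hk, (hφ ⟨(a, k), hk⟩).mpr h⟩

lemma IsNum.kind {x : α → ℕ} (hx : C.IsNum x) (c : Symbol) :
    C.Definable fun a => (postString (C.toks a) (x a)).head? = some c := by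
  obtain ⟨i, hi⟩ := hx
  exact ⟨.kind c i, fun a => by beta_reduce; rw [← hi]; exact Iff.rfl⟩

/-- A distinguished position holds the letter. -/
def IsLetter (C : Context α) (z : α → ℕ) : Prop :=
  ∃ j, ∀ a, (C.toks a)[C.env a j]? = some (.letter (z a))

lemma IsLetter.comp {z : α → ℕ} {f : β → α} (h : C.IsLetter z) (hf : C'.Extends C f) :
    C'.IsLetter fun b => z (f b) := by
  obtain ⟨j, hj⟩ := h
  obtain ⟨ρ, hρ⟩ := hf
  exact ⟨ρ j, fun b => by rw [(hρ b).2, (hρ b).1, hj]⟩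

lemma bits_letter_inj {m n : ℕ} : (Token.letter m).bits = (Token.letter n).bits ↔ m = n := by
  constructor
  · intro h
    have h1 : Computability.encodeNat m = Computability.encodeNat n :=
      List.map_injective_iff.mpr (fun a b h => by injection h) h
    rw [← Computability.decode_encodeNat m, h1, Computability.decode_encodeNat]
  · rintro rfl; rfl

/-- Letters are compared by their digits. An index may be exponentially large in the length of the
string, but equality is all that is ever asked about it. -/
lemma IsLetter.eq {z y : α → ℕ} (hz : C.IsLetter z) (hy : C.IsLetter y) :
    C.Definable fun a => z a = y a := by
  obtain ⟨i, hi⟩ := hz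
  obtain ⟨j, hj⟩ := hy
  refine ⟨.same i j, fun a => ?_⟩
  simp only [Formula.eval, bitsAt, hi, hj, Option.elim_some]
  exact bits_letter_inj

/-- The word is read off, forwards or backwards, from the positions of a definable set. -/
def IsWord (C : Context α) (s : α → List ℕ) : Prop :=
  ∃ (pos : α → ℕ → ℕ) (rev : Bool),
    (∀ a, (s a).length < (C.toks a).length) ∧
    (∀ a i (h : i < (s a).length), (C.toks a)[pos a i]? = some (.letter (s a)[i])) ∧
    (∀ a i j, i < j → j < (s a).length →
      if rev then pos a j < pos a i else pos a i < pos a j) ∧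
    C.push.Definable fun p => ∃ i < (s p.1.1).length, pos p.1.1 i = p.1.2

lemma IsWord.comp {s : α → List ℕ} {f : β → α} (h : C.IsWord s) (hf : C'.Extends C f) :
    C'.IsWord fun b => s (f b) := by
  obtain ⟨pos, rev, h1, h2, h3, h4⟩ := h
  have h4' := h4.comp hf.push
  obtain ⟨ρ, hρ⟩ := hf
  refine ⟨fun b => pos (f b), rev, fun b => ?_, fun b i hi => ?_, fun b => h3 (f b), h4'⟩
  · rw [(hρ b).1]; exact h1 _
  · rw [(hρ b).1]; exact h2 _ i hi

/-- The set of positions stays the same and only the direction of reading changes; mirrored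
conditions thus need no formulas of their own. -/
lemma IsWord.reverse {s : α → List ℕ} (h : C.IsWord s) : C.IsWord fun a => (s a).reverse := by
  obtain ⟨pos, rev, h1, h2, h3, h4⟩ := h
  refine ⟨fun a i => pos a ((s a).length - 1 - i), !rev, by simpa using h1, fun a i hi => ?_,
    fun a i j hij hj => ?_, h4.congr fun p => ?_⟩
  · rw [List.length_reverse] at hi
    rw [h2 a _ (by omega), List.getElem_reverse]
  · rw [List.length_reverse] at hj
    have := h3 a ((s a).length - 1 - j) ((s a).length - 1 - i) (by omega) (by omega)
    cases rev <;> simpa using this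
  · simp only [List.length_reverse]
    constructor
    · rintro ⟨i, hi, e⟩
      refine ⟨(s p.1.1).length - 1 - i, by omega, ?_⟩
      rw [← e]; congr 1; omega
    · rintro ⟨i, hi, e⟩
      exact ⟨_, by omega, e⟩

lemma IsWord.inj {s : α → List ℕ} {pos : α → ℕ → ℕ} {rev : Bool}
    (h3 : ∀ a i j, i < j → j < (s a).length →
      if rev then pos a j < pos a i else pos a i < pos a j) {a : α} {i j : ℕ}
    (hi : i < (s a).length) (hj : j < (s a).length) (e : pos a i = pos a j) : i = j := by
  rcases lt_trichotomy i j with h | h | h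
  · have := h3 a i j h hj
    cases rev <;> simp [e] at this
  · exact h
  · have := h3 a j i h hi
    cases rev <;> simp [e] at this

/-- Quantification over the ways to split a word at a letter. -/
lemma IsWord.exists_split {s : α → List ℕ} (hs : C.IsWord s) {P : α → List ℕ → ℕ → List ℕ → Prop}
    (hP : ∀ (β : Type) (C' : Context β) (f : β → α) (s₁ : β → List ℕ) (z : β → ℕ)
      (s₂ : β → List ℕ), C'.Extends C f → C'.IsWord s₁ → C'.IsLetter z → C'.IsWord s₂ →
      C'.IsWord (fun b => z b :: s₂ b) → C'.Definable fun b => P (f b) (s₁ b) (z b) (s₂ b)) :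
    C.Definable fun a => ∃ s₁ z s₂, s a = s₁ ++ z :: s₂ ∧ P a s₁ z s₂ := by
  obtain ⟨pos, rev, h1, h2, h3, h4⟩ := hs
  -- The new family consists of the splittings themselves, with the position of the splitting letter
  -- distinguished.
  set β := {p : α × ℕ // p.2 < (s p.1).length}
  let C' : Context β := ⟨C.n + 1, fun b => C.toks b.1.1,
    fun b => Fin.snoc (α := fun _ => ℕ) (C.env b.1.1) (pos b.1.1 b.1.2)⟩
  let f : β → α := fun b => b.1.1
  have hf : C'.Extends C f := ⟨Fin.castSucc, fun b => ⟨rfl, fun j => by simp [C', f]⟩⟩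
  have hx : C'.IsNum fun b => pos b.1.1 b.1.2 := ⟨Fin.last _, fun b => by simp [C']⟩
  have hx' := hx.comp C'.push_extends
  have hp := C'.isNum_push
  have h4' := h4.comp hf.push
  let z : β → ℕ := fun b => (s b.1.1)[b.1.2]'b.2
  have hz : C'.IsLetter z := ⟨Fin.last _, fun b => by simp [C', z, h2 _ _ b.2]⟩
  have key : ∀ (b : β) (i : ℕ), i < (s b.1.1).length →
      (pos b.1.1 i < pos b.1.1 b.1.2 ↔ if rev then b.1.2 < i else i < b.1.2) := by
    intro b i hi
    rcases lt_trichotomy i b.1.2 with h | h | h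
    · have := h3 b.1.1 i b.1.2 h b.2
      cases rev <;> simp at this ⊢ <;> omega
    · subst h; cases rev <;> simp
    · have := h3 b.1.1 b.1.2 i h hi
      cases rev <;> simp at this ⊢ <;> omega
  have key' : ∀ (b : β) (i : ℕ), i < (s b.1.1).length →
      (pos b.1.1 b.1.2 < pos b.1.1 i ↔ if rev then i < b.1.2 else b.1.2 < i) := by
    intro b i hi
    rcases lt_trichotomy i b.1.2 with h | h | h
    · have := h3 b.1.1 i b.1.2 h b.2
      cases rev <;> simp at this ⊢ <;> omega
    · subst h; cases rev <;> simp
    · have := h3 b.1.1 b.1.2 i h hi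
      cases rev <;> simp at this ⊢ <;> omega
  -- Earlier letters lie to the left or to the right of the splitting letter, depending on the
  -- direction of reading.
  have before : C'.push.Definable fun p => ∃ i < (s p.1.1.1.1).length, pos p.1.1.1.1 i = p.1.2 ∧
      i < p.1.1.1.2 := by
    cases rev
    · refine (h4'.and (hp.lt hx')).congr fun p => ?_
      constructor
      · rintro ⟨⟨i, hi, e⟩, h⟩
        exact ⟨i, hi, e, by simpa using (key p.1.1 i hi).mp (by rw [← e] at h; exact h)⟩
      · rintro ⟨i, hi, e, h⟩
        exact ⟨⟨i, hi, e⟩, by rw [← e]; exact (key p.1.1 i hi).mpr (by simpa using h)⟩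
    · refine (h4'.and (hx'.lt hp)).congr fun p => ?_
      constructor
      · rintro ⟨⟨i, hi, e⟩, h⟩
        exact ⟨i, hi, e, by simpa using (key' p.1.1 i hi).mp (by rw [← e] at h; exact h)⟩
      · rintro ⟨i, hi, e, h⟩
        exact ⟨⟨i, hi, e⟩, by rw [← e]; exact (key' p.1.1 i hi).mpr (by simpa using h)⟩
  have after : C'.push.Definable fun p => ∃ i < (s p.1.1.1.1).length, pos p.1.1.1.1 i = p.1.2 ∧
      p.1.1.1.2 < i := by
    cases rev
    · refine (h4'.and (hx'.lt hp)).congr fun p => ?_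
      constructor
      · rintro ⟨⟨i, hi, e⟩, h⟩
        exact ⟨i, hi, e, by simpa using (key' p.1.1 i hi).mp (by rw [← e] at h; exact h)⟩
      · rintro ⟨i, hi, e, h⟩
        exact ⟨⟨i, hi, e⟩, by rw [← e]; exact (key' p.1.1 i hi).mpr (by simpa using h)⟩
    · refine (h4'.and (hp.lt hx')).congr fun p => ?_
      constructor
      · rintro ⟨⟨i, hi, e⟩, h⟩
        exact ⟨i, hi, e, by simpa using (key p.1.1 i hi).mp (by rw [← e] at h; exact h)⟩
      · rintro ⟨i, hi, e, h⟩
        exact ⟨⟨i, hi, e⟩, by rw [← e]; exact (key p.1.1 i hi).mpr (by simpa using h)⟩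
  have w1 : C'.IsWord fun b => (s b.1.1).take b.1.2 := by
    refine ⟨fun b => pos b.1.1, rev, fun b => ?_, fun b i hi => ?_, fun b i j hij hj => ?_,
      before.congr fun p => ?_⟩
    · have := h1 b.1.1
      simp only [List.length_take, C']; omega
    · rw [List.length_take] at hi
      rw [List.getElem_take]; exact h2 _ _ (by omega)
    · rw [List.length_take] at hj
      exact h3 _ i j hij (by omega)
    · have := p.1.1.2
      simp only [List.length_take]
      constructor
      · rintro ⟨i, hi, e, h⟩
        exact ⟨i, by omega, e⟩
      · rintro ⟨i, hi, e⟩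
        exact ⟨i, by omega, e, by omega⟩
  have w2 : C'.IsWord fun b => (s b.1.1).drop (b.1.2 + 1) := by
    refine ⟨fun b i => pos b.1.1 (b.1.2 + 1 + i), rev, fun b => ?_, fun b i hi => ?_,
      fun b i j hij hj => ?_, after.congr fun p => ?_⟩
    · have := h1 b.1.1
      simp only [List.length_drop, C']; omega
    · rw [List.length_drop] at hi
      rw [List.getElem_drop]; exact h2 _ _ (by omega)
    · rw [List.length_drop] at hj
      exact h3 _ _ _ (by omega) (by omega)
    · simp only [List.length_drop]
      constructor
      · rintro ⟨i, hi, e, h⟩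
        exact ⟨i - (p.1.1.1.2 + 1), by omega, by rw [← e]; congr 1; omega⟩
      · rintro ⟨i, hi, e⟩
        exact ⟨_, by omega, e, by omega⟩
  -- The suffix including the splitting letter consists of the positions not before it; it makes
  -- cuts between letters expressible.
  have w3 : C'.IsWord fun b => z b :: (s b.1.1).drop (b.1.2 + 1) := by
    have e : ∀ b : β, z b :: (s b.1.1).drop (b.1.2 + 1) = (s b.1.1).drop b.1.2 :=
      fun b => (List.drop_eq_getElem_cons b.2).symm
    simp only [e]
    refine ⟨fun b i => pos b.1.1 (b.1.2 + i), rev, fun b => ?_, fun b i hi => ?_,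
      fun b i j hij hj => ?_, (h4'.and before.not).congr fun p => ?_⟩
    · have := h1 b.1.1
      simp only [List.length_drop, C']; omega
    · rw [List.length_drop] at hi
      rw [List.getElem_drop]; exact h2 _ _ (by omega)
    · rw [List.length_drop] at hj
      exact h3 _ _ _ (by omega) (by omega)
    · simp only [List.length_drop]
      constructor
      · rintro ⟨⟨i, hi, e⟩, h⟩
        refine ⟨i - p.1.1.1.2, ?_⟩
        have : ¬ i < p.1.1.1.2 := fun hlt => h ⟨i, hi, e, hlt⟩
        have hi' : i < (s p.1.1.1.1).length := hi
        exact ⟨by omega, by rw [← e]; congr 1; omega⟩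
      · rintro ⟨i, hi, e⟩
        refine ⟨⟨_, show _ < (s p.1.1.1.1).length by omega, e⟩, ?_⟩
        rintro ⟨j, hj, e', h⟩
        have := IsWord.inj h3 hj (by omega) (e'.trans e.symm)
        omega
  obtain ⟨φ, hφ⟩ := hP β C' f _ z _ hf w1 hz w2 w3
  obtain ⟨ψ, hψ⟩ := h4
  refine ⟨(ψ.and φ).ex, fun a => ?_⟩
  constructor
  · rintro ⟨k, hk, h5, h6⟩
    obtain ⟨i, hi, e⟩ := (hψ ⟨(a, k), hk⟩).mp h5
    simp only at hi e
    subst e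
    have := (hφ ⟨(a, i), hi⟩).mp h6
    refine ⟨_, _, _, ?_, this⟩
    simp [z]
  · rintro ⟨s₁, y, s₂, e, h⟩
    have hi : s₁.length < (s a).length := by rw [e]; simp
    have hlt : pos a s₁.length < (C.toks a).length := by
      by_contra hc
      have := h2 a _ hi
      rw [List.getElem?_eq_none (by omega)] at this
      simp at this
    refine ⟨pos a s₁.length, hlt, (hψ ⟨(a, _), hlt⟩).mpr ⟨s₁.length, hi, rfl⟩,
      (hφ ⟨(a, s₁.length), hi⟩).mpr ?_⟩
    simp only [f, z]
    have e1 : (s a).take s₁.length = s₁ := by rw [e]; simp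
    have e2 : (s a)[s₁.length] = y := by simp [e]
    have e3 : (s a).drop (s₁.length + 1) = s₂ := by rw [e]; simp
    rw [e1, e2, e3]
    exact h

end Context

end Definability

/-! ### Definable relations between words and letters. -/

section Definability

namespace Context

variable {α β : Type} {C : Context α} {C' : Context β}

lemma IsWord.forall_split {s : α → List ℕ} (hs : C.IsWord s) {P : α → List ℕ → ℕ → List ℕ → Prop}
    (hP : ∀ (β : Type) (C' : Context β) (f : β → α) (s₁ : β → List ℕ) (z : β → ℕ)
      (s₂ : β → List ℕ), C'.Extends C f → C'.IsWord s₁ → C'.IsLetter z → C'.IsWord s₂ →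
      C'.IsWord (fun b => z b :: s₂ b) → C'.Definable fun b => P (f b) (s₁ b) (z b) (s₂ b)) :
    C.Definable fun a => ∀ s₁ z s₂, s a = s₁ ++ z :: s₂ → P a s₁ z s₂ := by
  refine (hs.exists_split (P := fun a s₁ z s₂ => ¬ P a s₁ z s₂) fun β C' f s₁ z s₂ h1 h2 h3 h4 h5 =>
    (hP β C' f s₁ z s₂ h1 h2 h3 h4 h5).not).not.congr fun a => ?_
  push Not
  rfl

lemma IsLetter.mem {z : α → ℕ} {s : α → List ℕ} (hz : C.IsLetter z) (hs : C.IsWord s) :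
    C.Definable fun a => z a ∈ s a := by
  refine (hs.exists_split (P := fun a _ y _ => z a = y) fun β C' f s₁ y s₂ hf _ hy _ _ =>
    (hz.comp hf).eq hy).congr fun a => ?_
  constructor
  · rintro ⟨s₁, y, s₂, e, h⟩
    rw [e, h]; simp
  · intro h
    obtain ⟨s₁, s₂, e⟩ := List.append_of_mem h
    exact ⟨s₁, _, s₂, e, rfl⟩

lemma IsWord.eq_nil {s : α → List ℕ} (hs : C.IsWord s) : C.Definable fun a => s a = [] := by
  refine (hs.forall_split (P := fun _ _ _ _ => False) fun β C' f s₁ y s₂ hf _ hy _ _ =>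
    (((hy.eq hy).not).congr fun b => by simp)).congr fun a => ?_
  constructor
  · intro h
    cases e : s a with
    | nil => rfl
    | cons y l => exact (h [] y l (by simpa using e)).elim
  · intro h s₁ z s₂ e
    simp [h] at e

lemma IsWord.forall_mem {s : α → List ℕ} (hs : C.IsWord s) {P : α → ℕ → Prop}
    (hP : ∀ (β : Type) (C' : Context β) (f : β → α) (z : β → ℕ), C'.Extends C f → C'.IsLetter z →
      C'.Definable fun b => P (f b) (z b)) :
    C.Definable fun a => ∀ z ∈ s a, P a z := by
  refine (hs.forall_split (P := fun a _ z _ => P a z) fun β C' f _ z _ hf _ hz _ _ =>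
    hP β C' f z hf hz).congr fun a => ?_
  constructor
  · intro h z hz
    obtain ⟨s₁, s₂, e⟩ := List.append_of_mem hz
    exact h s₁ z s₂ e
  · intro h s₁ z s₂ e
    exact h z (by rw [e]; simp)

lemma IsWord.subset {s t : α → List ℕ} (hs : C.IsWord s) (ht : C.IsWord t) :
    C.Definable fun a => ∀ z ∈ s a, z ∈ t a :=
  hs.forall_mem fun _ _ _ _ hf hz => hz.mem (ht.comp hf)

lemma _root_.List.count_eq_card_filter_range (l : List ℕ) (z : ℕ) :
    l.count z = ((Finset.range l.length).filter fun i => l[i]? = some z).card := by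
  induction l using List.reverseRecOn with
  | nil => simp
  | append_singleton l y ih =>
    rw [List.count_append, List.length_append, List.length_singleton, Finset.range_add_one,
      Finset.filter_insert]
    have e : (Finset.range l.length).filter (fun i => (l ++ [y])[i]? = some z)
        = (Finset.range l.length).filter fun i => l[i]? = some z := by
      refine Finset.filter_congr fun i hi => ?_
      rw [List.getElem?_append_left (by simpa using hi)]
    rw [e, ih]
    by_cases hy : y = z
    · simp [hy]
    · simp [hy]

open Classical in
/-- The number of occurrences of a letter can be compared modulo a number. -/
lemma IsWord.count_mod {s : α → List ℕ} {z g r : α → ℕ} (hs : C.IsWord s) (hz : C.IsLetter z)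
    (hg : C.IsNum g) (hr : C.IsNum r) : C.Definable fun a => (s a).count (z a) % g a = r a := by
  obtain ⟨pos, rev, h1, h2, h3, ψ, hψ⟩ := hs
  obtain ⟨j, hj⟩ := hz
  obtain ⟨g', hg⟩ := hg
  obtain ⟨r', hr⟩ := hr
  -- The occurrences of the letter are the positions of the word that carry the same digits as the
  -- distinguished one.
  let χ : Formula (C.n + 1) := Formula.and ψ (.same (Fin.last _) j.castSucc)
  have hχ : ∀ a k, k < (C.toks a).length →
      (χ.eval (C.toks a) (Fin.snoc (α := fun _ => ℕ) (C.env a) k) ↔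
        (∃ i < (s a).length, pos a i = k) ∧
          bitsAt (C.toks a) k = bitsAt (C.toks a) (C.env a j)) := by
    intro a k hk
    refine and_congr (hψ ⟨(a, k), hk⟩) ?_
    simp [Formula.eval]
  refine ⟨.countMod g' r' χ, fun a => ?_⟩
  change Nat.count (fun k => χ.eval (C.toks a) (Fin.snoc (α := fun _ => ℕ) (C.env a) k))
    (C.toks a).length % C.env a g' = C.env a r' ↔ _
  rw [hg, hr]
  suffices h : Nat.count (fun k => χ.eval (C.toks a) (Fin.snoc (α := fun _ => ℕ) (C.env a) k))
      (C.toks a).length = (s a).count (z a) by rw [h]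
  have hlt : ∀ i < (s a).length, pos a i < (C.toks a).length := by
    intro i hi
    by_contra hc
    have := h2 a _ hi
    rw [List.getElem?_eq_none (by omega)] at this
    simp at this
  rw [Nat.count_eq_card_filter_range, List.count_eq_card_filter_range]
  symm
  refine Finset.card_bij (fun i _ => pos a i) ?_ ?_ ?_
  · intro i hi
    simp only [Finset.mem_filter, Finset.mem_range] at hi ⊢
    refine ⟨hlt i hi.1, (hχ a _ (hlt i hi.1)).mpr ⟨⟨i, hi.1, rfl⟩, ?_⟩⟩
    rw [bitsAt, h2 a i hi.1, bitsAt, hj]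
    have := hi.2
    rw [List.getElem?_eq_getElem hi.1, Option.some_inj] at this
    rw [this]
  · intro i hi i' hi' e
    simp only [Finset.mem_filter, Finset.mem_range] at hi hi'
    exact IsWord.inj h3 hi.1 hi'.1 e
  · intro k hk
    simp only [Finset.mem_filter, Finset.mem_range] at hk
    obtain ⟨⟨i, hi, e⟩, h4⟩ := (hχ a k hk.1).mp hk.2
    refine ⟨i, ?_, e⟩
    simp only [Finset.mem_filter, Finset.mem_range]
    refine ⟨hi, ?_⟩
    rw [bitsAt, bitsAt, ← e, h2 a i hi, hj] at h4
    rw [List.getElem?_eq_getElem hi, Option.some_inj]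
    exact bits_letter_inj.mp h4

/-- The common residue is quantified over positions. It is at most the length of the word, and words
are required to be shorter than the list of tokens. -/
lemma IsWord.count_modEq {s t : α → List ℕ} {z g : α → ℕ} (hs : C.IsWord s) (ht : C.IsWord t)
    (hz : C.IsLetter z) (hg : C.IsNum g) :
    C.Definable fun a => (s a).count (z a) ≡ (t a).count (z a) [MOD g a] := by
  have hlt : ∀ a, (s a).length < (C.toks a).length := by
    obtain ⟨pos, rev, h1, -⟩ := hs
    exact h1
  have hf := C.push_extends
  refine (Definable.exists_pos (P := fun a k => (s a).count (z a) % g a = k ∧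
    (t a).count (z a) % g a = k) (((hs.comp hf).count_mod (hz.comp hf) (hg.comp hf) C.isNum_push).and
      ((ht.comp hf).count_mod (hz.comp hf) (hg.comp hf) C.isNum_push))).congr fun a => ?_
  constructor
  · rintro ⟨k, -, h1, h2⟩
    exact h1.trans h2.symm
  · intro h
    refine ⟨(s a).count (z a) % g a, ?_, rfl, h.symm⟩
    have h1 := Nat.mod_le ((s a).count (z a)) (g a)
    have h2 := List.count_le_length (l := s a) (a := z a)
    have := hlt a
    omega

lemma IsNum.eq_zero {x : α → ℕ} (hx : C.IsNum x) (hlt : ∀ a, x a < (C.toks a).length) :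
    C.Definable fun a => x a = 0 := by
  refine (Definable.exists_pos (P := fun a k => k < x a)
    (C.isNum_push.lt (hx.comp C.push_extends))).not.congr fun a => ?_
  have := hlt a
  push Not
  constructor
  · intro h
    by_contra hc
    have := h 0 (by omega)
    omega
  · intro h k _
    omega

lemma IsWord.dvd_count {s : α → List ℕ} {z g : α → ℕ} (hs : C.IsWord s)
    (hz : C.IsLetter z) (hg : C.IsNum g) : C.Definable fun a => g a ∣ (s a).count (z a) := by
  have hlt : ∀ a, (s a).length < (C.toks a).length := by
    obtain ⟨pos, rev, h1, -⟩ := hs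
    exact h1
  have hf := C.push_extends
  refine (Definable.exists_pos (P := fun a k => (s a).count (z a) % g a = k ∧ k = 0)
    (((hs.comp hf).count_mod (hz.comp hf) (hg.comp hf) C.isNum_push).and
      (C.isNum_push.eq_zero fun p => p.2))).congr fun a => ?_
  rw [Nat.dvd_iff_mod_eq_zero]
  constructor
  · rintro ⟨k, -, h, rfl⟩
    exact h
  · intro h
    have := hlt a
    exact ⟨0, by omega, h, rfl⟩

lemma IsNum.two_le {x : α → ℕ} (hx : C.IsNum x) (hlt : ∀ a, x a < (C.toks a).length) :
    C.Definable fun a => 2 ≤ x a := by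
  have hf := C.push_extends
  refine (Definable.exists_pos (P := fun a k => k ≠ 0 ∧ k < x a)
    ((C.isNum_push.eq_zero fun p => p.2).not.and (C.isNum_push.lt (hx.comp hf)))).congr fun a => ?_
  have := hlt a
  constructor
  · rintro ⟨k, -, h1, h2⟩
    omega
  · intro h
    exact ⟨1, by omega, by omega, by omega⟩

end Context

/-! ### Recovering identities from the tokens of a basis. -/

section Identities

/-- The tokens of a basis around the equality sign of an identity. -/
lemma basisTokens_eq {B₁ B₂ : List Identity} (i : Identity) : basisTokens (B₁ ++ i :: B₂) =
    basisTokens B₁ ++ (i.left.map .letter ++ .equals :: (i.right.map .letter ++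
      .identityEnd :: basisTokens B₂)) := by
  simp [basisTokens, identityTokens]

lemma basisTokens_getLast (B : List Identity) :
    basisTokens B = [] ∨ ∃ τ, basisTokens B = τ ++ [.identityEnd] := by
  rcases List.eq_nil_or_concat' B with rfl | ⟨B', i, rfl⟩
  · exact Or.inl rfl
  · right
    refine ⟨basisTokens B' ++ (i.left.map .letter ++ .equals :: i.right.map .letter), ?_⟩
    rw [basisTokens_eq]
    simp [basisTokens]

/-- The position of the equality sign of an identity in a basis. -/
def equalsPosition (B₁ : List Identity) (i : Identity) : ℕ :=
  (basisTokens B₁).length + i.left.length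

/-- Each identity is written with exactly one equality sign, so quantifying over identities means
quantifying over these signs. -/
lemma exists_of_equals {B : List Identity} {k : ℕ} (h : (basisTokens B)[k]? = some .equals) :
    ∃ B₁ i B₂, B = B₁ ++ i :: B₂ ∧ k = equalsPosition B₁ i := by
  induction B generalizing k with
  | nil => simp [basisTokens] at h
  | cons i B ih =>
    have e : basisTokens (i :: B) = i.left.map .letter ++ .equals :: (i.right.map .letter ++
      .identityEnd :: basisTokens B) := basisTokens_eq (B₁ := []) i
    rw [e] at h
    rcases lt_trichotomy k i.left.length with h1 | h1 | h1
    · rw [List.getElem?_append_left (by simpa using h1)] at h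
      simp at h
    · exact ⟨[], i, B, rfl, by simp [equalsPosition, basisTokens, h1]⟩
    · rw [List.getElem?_append_right (by simp; omega), List.length_map] at h
      obtain ⟨d, rfl⟩ : ∃ d, k = i.left.length + (d + 1) := ⟨k - i.left.length - 1, by omega⟩
      rw [Nat.add_sub_cancel_left, List.getElem?_cons_succ] at h
      rcases lt_trichotomy d i.right.length with h2 | h2 | h2
      · rw [List.getElem?_append_left (by simpa using h2)] at h
        simp at h
      · rw [List.getElem?_append_right (by simp; omega)] at h
        simp [h2] at h
      · rw [List.getElem?_append_right (by simp; omega), List.length_map] at h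
        obtain ⟨c, rfl⟩ : ∃ c, d = i.right.length + (c + 1) := ⟨d - i.right.length - 1, by omega⟩
        rw [Nat.add_sub_cancel_left, List.getElem?_cons_succ] at h
        obtain ⟨B₁, i', B₂, hB, hk⟩ := ih h
        refine ⟨i :: B₁, i', B₂, by simp [hB], ?_⟩
        have : (basisTokens (i :: B₁)).length
            = (identityTokens i).length + (basisTokens B₁).length := by simp [basisTokens]
        rw [equalsPosition, this]
        rw [equalsPosition] at hk
        simp [identityTokens]
        omega

lemma head_postString (τ : List Token) (k : ℕ) :
    (postString τ k).head? = (τ[k]?).map Token.delim := by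
  rcases lt_or_ge k τ.length with h | h
  · rw [postString_eq h]; simp [h]
  · rw [postString_eq_nil h]; simp [h]

lemma delim_eq_equals {t : Token} : t.delim = .equals ↔ t = .equals := by
  cases t <;> simp [Token.delim]

/-- The letters directly in front of a position. -/
lemma mem_letters_before {τ₁ τ₂ : List Token} {l : List ℕ}
    (h₁ : τ₁ = [] ∨ ∃ τ, τ₁ = τ ++ [.identityEnd]) {τ : List Token}
    (hτ : τ = τ₁ ++ (l.map .letter ++ τ₂)) (k : ℕ) :
    (k < τ₁.length + l.length ∧ (postString τ k).head? = some .letterEnd ∧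
      ¬ ∃ q < τ.length, k < q ∧ q < τ₁.length + l.length ∧
        (postString τ q).head? ≠ some .letterEnd) ↔ ∃ j < l.length, τ₁.length + j = k := by
  have hl : ∀ j < l.length, (postString τ (τ₁.length + j)).head? = some .letterEnd := by
    intro j hj
    rw [head_postString, hτ, List.getElem?_append_right (by omega),
      List.getElem?_append_left (by simp; omega)]
    simp [hj, Token.delim]
  constructor
  · rintro ⟨h2, h3, h4⟩
    refine ⟨k - τ₁.length, ?_⟩
    suffices h : τ₁.length ≤ k by omega
    by_contra hc
    rcases h₁ with rfl | ⟨τ', rfl⟩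
    · simp at hc
    · have hend : (postString τ τ'.length).head? = some .identityEnd := by
        rw [head_postString, hτ]; simp [Token.delim]
      rw [List.length_append, List.length_singleton] at hc h2
      rcases lt_or_ge k τ'.length with h5 | h5
      · refine h4 ⟨τ'.length, ?_, h5, ?_, by rw [hend]; simp⟩
        · rw [hτ]; simp
        · simp; omega
      · have : k = τ'.length := by omega
        rw [this, hend] at h3
        simp at h3
  · rintro ⟨j, hj, rfl⟩
    refine ⟨by omega, hl j hj, ?_⟩
    rintro ⟨q, -, h5, h6, h7⟩
    obtain ⟨d, rfl⟩ : ∃ d, q = τ₁.length + d := ⟨q - τ₁.length, by omega⟩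
    exact h7 (hl d (by omega))

/-- The letters directly after a position. -/
lemma mem_letters_after {τ₁ τ₂ : List Token} {l : List ℕ} {τ : List Token}
    (hτ : τ = τ₁ ++ .equals :: (l.map .letter ++ .identityEnd :: τ₂)) (k : ℕ) :
    (τ₁.length < k ∧ (postString τ k).head? = some .letterEnd ∧
      ¬ ∃ q < τ.length, τ₁.length < q ∧ q < k ∧
        (postString τ q).head? ≠ some .letterEnd) ↔ ∃ j < l.length, τ₁.length + 1 + j = k := by
  have hl : ∀ j < l.length, (postString τ (τ₁.length + 1 + j)).head? = some .letterEnd := by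
    intro j hj
    rw [head_postString, hτ, List.getElem?_append_right (by omega),
      show τ₁.length + 1 + j - τ₁.length = j + 1 by omega, List.getElem?_cons_succ,
      List.getElem?_append_left (by simp; omega)]
    simp [hj, Token.delim]
  have hend : (postString τ (τ₁.length + 1 + l.length)).head? = some .identityEnd := by
    rw [head_postString, hτ, List.getElem?_append_right (by omega),
      show τ₁.length + 1 + l.length - τ₁.length = l.length + 1 by omega, List.getElem?_cons_succ,
      List.getElem?_append_right (by simp)]
    simp [Token.delim]
  constructor
  · rintro ⟨h2, h3, h4⟩
    refine ⟨k - (τ₁.length + 1), ?_⟩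
    suffices h : k < τ₁.length + 1 + l.length by omega
    by_contra hc
    rcases (not_lt.mp hc).eq_or_lt with h5 | h5
    · rw [← h5, hend] at h3
      simp at h3
    · refine h4 ⟨_, ?_, ?_, h5, by rw [hend]; simp⟩
      · rw [hτ]; simp; omega
      · omega
  · rintro ⟨j, hj, rfl⟩
    refine ⟨by omega, hl j hj, ?_⟩
    rintro ⟨q, -, h5, h6, h7⟩
    obtain ⟨d, rfl⟩ : ∃ d, q = τ₁.length + 1 + d := ⟨q - (τ₁.length + 1), by omega⟩
    exact h7 (hl d (by omega))

namespace Context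

variable {α β : Type} {C : Context α} {C' : Context β}

/-- Quantification over the identities of a basis. -/
lemma exists_identity {B : α → List Identity} (hB : ∀ a, C.toks a = basisTokens (B a))
    {P : α → List ℕ → List ℕ → Prop}
    (hP : ∀ (β : Type) (C' : Context β) (f : β → α) (s t : β → List ℕ), C'.Extends C f →
      C'.IsWord s → C'.IsWord t → C'.Definable fun b => P (f b) (s b) (t b)) :
    C.Definable fun a => ∃ i ∈ B a, P a i.left i.right := by
  set β := {p : α × List Identity × Identity × List Identity // B p.1 = p.2.1 ++ p.2.2.1 :: p.2.2.2}
  let e : β → ℕ := fun b => equalsPosition b.1.2.1 b.1.2.2.1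
  let C' : Context β := ⟨C.n + 1, fun b => C.toks b.1.1,
    fun b => Fin.snoc (α := fun _ => ℕ) (C.env b.1.1) (e b)⟩
  let f : β → α := fun b => b.1.1
  have hf : C'.Extends C f := ⟨Fin.castSucc, fun b => ⟨rfl, fun j => by simp [C', f]⟩⟩
  have hx : C'.IsNum e := ⟨Fin.last _, fun b => by simp [C']⟩
  have hτ : ∀ b : β, C'.toks b = basisTokens b.1.2.1 ++ (b.1.2.2.1.left.map .letter ++
      .equals :: (b.1.2.2.1.right.map .letter ++ .identityEnd :: basisTokens b.1.2.2.2)) := by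
    intro b
    simp only [C']
    rw [hB, b.2, basisTokens_eq]
  have hp := C'.isNum_push
  have hx' := hx.comp C'.push_extends
  have hp2 := C'.push.isNum_push
  have hp' := hp.comp C'.push.push_extends
  have hx'' := hx'.comp C'.push.push_extends
  -- The left side is the maximal run of letters before the equality sign, the right side the one
  -- after it.
  have wl : C'.IsWord fun b => b.1.2.2.1.left := by
    refine ⟨fun b j => (basisTokens b.1.2.1).length + j, false, fun b => ?_, fun b i hi => ?_,
      fun b i j hij hj => by simpa using hij, ?_⟩
    · rw [hτ]; simp; omega
    · beta_reduce at hi ⊢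
      rw [hτ, List.getElem?_append_right (by omega), List.getElem?_append_left (by simp; omega)]
      simp [hi]
    · refine ((hp.lt hx').and ((hp.kind .letterEnd).and (Definable.exists_pos
        (P := fun p q => p.1.2 < q ∧ q < e p.1.1 ∧
          (postString (C'.toks p.1.1) q).head? ≠ some .letterEnd)
        ((hp'.lt hp2).and ((hp2.lt hx'').and (hp2.kind .letterEnd).not))).not)).congr fun p => ?_
      exact mem_letters_before (basisTokens_getLast _) (hτ p.1.1) p.1.2
  have wr : C'.IsWord fun b => b.1.2.2.1.right := by
    refine ⟨fun b j => e b + 1 + j, false, fun b => ?_, fun b i hi => ?_,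
      fun b i j hij hj => by simpa using hij, ?_⟩
    · rw [hτ]; simp; omega
    · beta_reduce at hi ⊢
      rw [hτ, ← List.append_assoc, List.getElem?_append_right (by simp [e, equalsPosition]; omega)]
      have : e b + 1 + i - (basisTokens b.1.2.1 ++
          b.1.2.2.1.left.map Token.letter).length = i + 1 := by
        simp [e, equalsPosition]; omega
      rw [this, List.getElem?_cons_succ, List.getElem?_append_left (by simp; omega)]
      simp [hi]
    · refine ((hx'.lt hp).and ((hp.kind .letterEnd).and (Definable.exists_pos
        (P := fun p q => e p.1.1 < q ∧ q < p.1.2 ∧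
          (postString (C'.toks p.1.1) q).head? ≠ some .letterEnd)
        ((hx''.lt hp2).and ((hp2.lt hp').and (hp2.kind .letterEnd).not))).not)).congr fun p => ?_
      have h := mem_letters_after (τ₁ := basisTokens p.1.1.1.2.1 ++
        p.1.1.1.2.2.1.left.map .letter) (l := p.1.1.1.2.2.1.right)
        (τ₂ := basisTokens p.1.1.1.2.2.2) (τ := C'.toks p.1.1)
        (by rw [hτ, List.append_assoc]) p.1.2
      rw [List.length_append, List.length_map] at h
      exact h
  obtain ⟨φ, hφ⟩ := hP β C' f _ _ hf wl wr
  refine ⟨((Formula.kind .equals (Fin.last _)).and φ).ex, fun a => ?_⟩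
  constructor
  · rintro ⟨k, hk, h1, h2⟩
    simp only [Formula.eval, Fin.snoc_last, head_postString, Option.map_eq_some_iff,
      delim_eq_equals] at h1
    obtain ⟨t, h1, rfl⟩ := h1
    rw [hB] at h1
    obtain ⟨B₁, i, B₂, h3, rfl⟩ := exists_of_equals h1
    exact ⟨i, by rw [h3]; simp, (hφ ⟨(a, B₁, i, B₂), h3⟩).mp h2⟩
  · rintro ⟨i, hi, h⟩
    obtain ⟨B₁, B₂, h3⟩ := List.append_of_mem hi
    have hk : (C.toks a)[equalsPosition B₁ i]? = some .equals := by
      rw [hB, h3, basisTokens_eq, equalsPosition, ← List.append_assoc,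
        List.getElem?_append_right (by simp)]
      simp
    refine ⟨equalsPosition B₁ i, ?_, ?_, (hφ ⟨(a, B₁, i, B₂), h3⟩).mpr h⟩
    · by_contra hc
      rw [List.getElem?_eq_none (by omega)] at hk
      simp at hk
    · simp only [Formula.eval, Fin.snoc_last, head_postString, hk]
      rfl

end Context

end Identities

end Definability

/-! ### Closedness of a language under a single pair of words. -/

section Transfer

/-- Substitution instances of `s` in `K` remain in `K` when `s` is replaced by `t`. -/
def Transfers (K : Set (List Bool)) (s t : List ℕ) : Prop :=
  ∀ φ : ℕ → List Bool, (∀ n, φ n ≠ []) → ∀ p r, p ++ s.flatMap φ ++ r ∈ K →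
    p ++ t.flatMap φ ++ r ∈ K

lemma pairClosed_iff {K : Set (List Bool)} {s t : List ℕ} :
    PairClosed K s t ↔ Transfers K s t ∧ Transfers K t s :=
  ⟨fun h => ⟨fun φ hφ p r => (h φ hφ p r).mp, fun φ hφ p r => (h φ hφ p r).mpr⟩,
    fun h φ hφ p r => ⟨h.1 φ hφ p r, h.2 φ hφ p r⟩⟩

lemma reverse_flatMap_reverse (φ : ℕ → List Bool) (s : List ℕ) :
    (s.flatMap φ).reverse = s.reverse.flatMap fun n => (φ n).reverse := by
  rw [List.reverse_flatMap]; rfl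

lemma Transfers.of_reversed {K : Set (List Bool)} {s t : List ℕ} (h : Transfers (reversed K) s t) :
    Transfers K s.reverse t.reverse := by
  intro φ hφ p r hs
  have key : ∀ l : List ℕ, (p ++ l.reverse.flatMap φ ++ r).reverse
      = r.reverse ++ (l.flatMap fun n => (φ n).reverse) ++ p.reverse := by
    intro l
    rw [List.reverse_append, List.reverse_append, reverse_flatMap_reverse, List.reverse_reverse,
      List.append_assoc]
  have := h (fun n => (φ n).reverse) (fun n => by simpa using hφ n) r.reverse p.reverse
  rw [← key, ← key] at this
  simp only [reversed, Set.mem_ofPred_eq, List.reverse_reverse] at this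
  exact this hs

lemma transfers_reversed {K : Set (List Bool)} {s t : List ℕ} :
    Transfers (reversed K) s t ↔ Transfers K s.reverse t.reverse := by
  refine ⟨Transfers.of_reversed, fun h => ?_⟩
  have : Transfers (reversed (reversed K)) s.reverse t.reverse := by rwa [reversed_reversed]
  simpa using this.of_reversed

lemma exists_first {α : Type*} {l : List α} {P : α → Prop} (h : ∃ z ∈ l, P z) :
    ∃ l₁ z l₂, l = l₁ ++ z :: l₂ ∧ P z ∧ ∀ y ∈ l₁, ¬ P y := by
  induction l with
  | nil => simp at h
  | cons x l ih =>
    by_cases hx : P x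
    · exact ⟨[], x, l, rfl, hx, by simp⟩
    · obtain ⟨z, hz, hP⟩ := h
      have hz' : z ∈ l := by
        rcases List.mem_cons.mp hz with rfl | hz
        · exact absurd hP hx
        · exact hz
      obtain ⟨l₁, y, l₂, rfl, h1, h2⟩ := ih ⟨z, hz', hP⟩
      exact ⟨x :: l₁, y, l₂, rfl, h1, by simpa [hx] using h2⟩

lemma mem_of_not_mem {w : List Bool} (hw : w ≠ []) {b : Bool} (h : b ∉ w) : (!b) ∈ w := by
  obtain ⟨c, hc⟩ := List.exists_mem_of_ne_nil _ hw
  by_cases e : c = b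
  · subst e; exact absurd hc h
  · rwa [Bool.eq_not.mpr e] at hc

lemma length_le_flatMap {φ : ℕ → List Bool} (hφ : ∀ n, φ n ≠ []) (s : List ℕ) :
    s.length ≤ (s.flatMap φ).length := by
  induction s with
  | nil => simp
  | cons z s ih =>
    have := List.length_pos_of_ne_nil (hφ z)
    simp only [List.flatMap_cons, List.length_cons, List.length_append]
    omega

lemma flatMap_ne_nil {φ : ℕ → List Bool} (hφ : ∀ n, φ n ≠ []) {s : List ℕ} (hs : s ≠ []) :
    s.flatMap φ ≠ [] := by
  have h1 := List.length_pos_of_ne_nil hs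
  have h2 := length_le_flatMap hφ s
  exact List.ne_nil_of_length_pos (by omega)

lemma mem_flatMap_of {φ : ℕ → List Bool} {s : List ℕ} {z : ℕ} {b : Bool} (hz : z ∈ s)
    (hb : b ∈ φ z) : b ∈ s.flatMap φ := List.mem_flatMap.mpr ⟨z, hz, hb⟩

lemma count_flatMap_eq_zero {φ : ℕ → List Bool} {s : List ℕ} {b : Bool} :
    (s.flatMap φ).count b = 0 ↔ ∀ z ∈ s, b ∉ φ z := by
  rw [List.count_eq_zero]; simp [List.mem_flatMap]

lemma flatMap_single {φ : ℕ → List Bool} {s : List ℕ} (f : ℕ → Bool) (h : ∀ z ∈ s, φ z = [f z]) :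
    s.flatMap φ = s.map f := by
  induction s with
  | nil => rfl
  | cons z s ih =>
    simp [h z (by simp), ih fun y hy => h y (by simp [hy])]

/-- Test substitutions give unwanted letters images of length `k`; in a shorter word they cannot
occur. -/
lemma mem_of_length_flatMap_lt {A : ℕ → Prop} [DecidablePred A] {f : ℕ → Bool} {t : List ℕ} {k : ℕ}
    (h : (t.flatMap fun n => if A n then [f n] else List.replicate k true).length < k) :
    ∀ z ∈ t, A z := by
  intro z hz
  by_contra hc
  obtain ⟨t₁, t₂, rfl⟩ := List.append_of_mem hz
  simp only [List.flatMap_append, List.flatMap_cons, if_neg hc, List.length_append,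
    List.length_replicate] at h
  omega

end Transfer

/-! ### Pairs preserving `xx`. -/

section Square

/-- The condition under which instances of `s` that are squares of a letter stay such. -/
def SquareTransfer (s t : List ℕ) : Prop := s.length = 2 → t.length = 2 ∧ ∀ z ∈ t, z ∈ s

/-- As `s` has at least two letters, an instance equal to `xx` has no context and maps both letters
to `x`. The test substitution maps the letters of `s` to `x` and all others to `xxx`. -/
lemma transfers_squareWords {s t : List ℕ} (hs : 2 ≤ s.length) :
    Transfers squareWords s t ↔ SquareTransfer s t := by
  constructor
  · intro h h2
    have h1 := h (fun n => if n ∈ s then [true] else List.replicate 3 true)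
      (fun n => by by_cases hn : n ∈ s <;> simp [hn]) [] [] (by
        match s, h2 with
        | [a, b], _ => simp [squareWords])
    simp only [squareWords, List.nil_append, List.append_nil, Set.mem_singleton_iff] at h1
    have hl := congrArg List.length h1
    simp only [List.length_cons, List.length_nil] at hl
    have hmem := mem_of_length_flatMap_lt (t := t) (A := fun n => n ∈ s) (f := fun _ => true)
      (k := 3) (by omega)
    rw [flatMap_single (s := t) (fun _ => true) fun z hz => by simp only [if_pos (hmem z hz)]] at hl
    exact ⟨by simpa using hl, hmem⟩
  · intro h φ hφ p r hw
    simp only [squareWords, Set.mem_singleton_iff] at hw ⊢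
    have hl := congrArg List.length hw
    have h1 := length_le_flatMap hφ s
    simp only [List.length_append, List.length_cons, List.length_nil] at hl
    obtain rfl : p = [] := List.length_eq_zero_iff.mp (by omega)
    obtain rfl : r = [] := List.length_eq_zero_iff.mp (by omega)
    obtain ⟨ht, hts⟩ := h (by omega)
    simp only [List.nil_append, List.append_nil] at hw ⊢
    match s, (by omega : s.length = 2) with
    | [a, b], _ =>
      simp only [List.flatMap_cons, List.flatMap_nil, List.append_nil] at hw
      have ha := List.length_pos_of_ne_nil (hφ a)
      have hb := List.length_pos_of_ne_nil (hφ b)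
      have hab := congrArg List.length hw
      simp only [List.length_append, List.length_cons, List.length_nil] at hab
      obtain ⟨ea, eb⟩ := List.append_inj (s₁ := φ a) (t₁ := φ b) (s₂ := [true]) (t₂ := [true]) hw
        (by simp; omega)
      match t, ht with
      | [c, d], _ =>
        have hc := hts c (by simp)
        have hd := hts d (by simp)
        simp only [List.mem_cons, List.not_mem_nil, or_false] at hc hd
        rcases hc with rfl | rfl <;> rcases hd with rfl | rfl <;> simp [ea, eb]

end Square

/-! ### Pairs preserving the number one of letters `y`. -/

section Linear

/-- The condition under which instances of `s` with exactly one `y` stay such. -/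
def LinearTransfer (s t : List ℕ) : Prop :=
  (∀ z ∈ t, z ∈ s) ∧ ∀ s₁ z s₂, s = s₁ ++ z :: s₂ → z ∉ s₁ → z ∉ s₂ →
    ∃ t₁ y t₂, t = t₁ ++ y :: t₂ ∧ y = z ∧ z ∉ t₁ ∧ z ∉ t₂

/-- The only `y` comes from the context or from a letter occurring once in `s`. Mapping one letter
to `y` and all others to `x` tests both cases. -/
lemma transfers_linearWords {s t : List ℕ} : Transfers linearWords s t ↔ LinearTransfer s t := by
  constructor
  · intro h
    have hts : ∀ z ∈ t, z ∈ s := by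
      intro z hz
      by_contra hc
      have h1 := h (fun n => if n = z then [false] else [true])
        (fun n => by by_cases hn : n = z <;> simp [hn]) [false] [] (by
          simp only [linearWords, Set.mem_ofPred_eq, List.count_append, List.append_nil]
          rw [count_flatMap_eq_zero.mpr]
          · simp
          · intro y hy
            simp [show y ≠ z from fun e => hc (e ▸ hy)])
      simp only [linearWords, Set.mem_ofPred_eq, List.count_append, List.append_nil] at h1
      have : 0 < (t.flatMap fun n => if n = z then [false] else [true]).count false :=
        List.count_pos_iff.mpr (mem_flatMap_of hz (by simp))
      simp at h1
      omega
    refine ⟨hts, ?_⟩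
    rintro s₁ z s₂ rfl h1 h2
    have key : ∀ l : List ℕ, z ∉ l →
        (l.flatMap fun n => if n = z then [false] else [true]).count false = 0 := by
      intro l hl
      rw [count_flatMap_eq_zero]
      intro y hy
      simp [show y ≠ z from fun e => hl (e ▸ hy)]
    have h3 := h (fun n => if n = z then [false] else [true])
      (fun n => by by_cases hn : n = z <;> simp [hn]) [] [] (by
        simp [linearWords, key s₁ h1, key s₂ h2])
    simp only [linearWords, Set.mem_ofPred_eq, List.nil_append, List.append_nil] at h3
    have hz : z ∈ t := by
      by_contra hc
      rw [key t hc] at h3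
      omega
    obtain ⟨t₁, t₂, rfl⟩ := List.append_of_mem hz
    simp only [List.flatMap_append, List.flatMap_cons, List.count_append, if_true,
      List.count_singleton_self] at h3
    refine ⟨t₁, z, t₂, rfl, rfl, fun hc => ?_, fun hc => ?_⟩
    · have : 0 < (t₁.flatMap fun n => if n = z then [false] else [true]).count false :=
        List.count_pos_iff.mpr (mem_flatMap_of hc (by simp))
      omega
    · have : 0 < (t₂.flatMap fun n => if n = z then [false] else [true]).count false :=
        List.count_pos_iff.mpr (mem_flatMap_of hc (by simp))
      omega
  · rintro ⟨hts, hlin⟩ φ hφ p r hw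
    simp only [linearWords, Set.mem_ofPred_eq, List.count_append] at hw ⊢
    by_cases h0 : ∀ z ∈ s, false ∉ φ z
    · rw [count_flatMap_eq_zero.mpr h0] at hw
      rw [count_flatMap_eq_zero.mpr fun z hz => h0 z (hts z hz)]
      exact hw
    · push Not at h0
      obtain ⟨s₁, z, s₂, rfl, hz, h1⟩ := exists_first h0
      have hz' := List.count_pos_iff.mpr hz
      simp only [List.flatMap_append, List.flatMap_cons, List.count_append] at hw
      have h2 : ∀ y ∈ s₂, false ∉ φ y := count_flatMap_eq_zero.mp (by omega)
      obtain ⟨t₁, y, t₂, rfl, rfl, h3, h4⟩ := hlin s₁ z s₂ rfl (fun hc => h1 z hc hz)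
        fun hc => h2 z hc hz
      have key : ∀ x ∈ s₁ ++ y :: s₂, x ≠ y → false ∉ φ x := by
        intro x hx hxy
        simp only [List.mem_append, List.mem_cons, hxy, false_or] at hx
        rcases hx with hx | hx
        · exact h1 x hx
        · exact h2 x hx
      have e1 : (t₁.flatMap φ).count false = 0 := count_flatMap_eq_zero.mpr fun x hx =>
        key x (hts x (by simp [hx])) fun e => h3 (e ▸ hx)
      have e2 : (t₂.flatMap φ).count false = 0 := count_flatMap_eq_zero.mpr fun x hx =>
        key x (hts x (by simp [hx])) fun e => h4 (e ▸ hx)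
      simp only [List.flatMap_append, List.flatMap_cons, List.count_append]
      omega

end Linear

/-! ### Pairs preserving `{xyx, yxy}`. -/

section Cyclic

/-- The condition under which instances `xyx` and `yxy` of `s` stay such. -/
def CyclicTransfer (s t : List ℕ) : Prop :=
  (∀ z₁ z₂, s = [z₁, z₂] → z₁ ≠ z₂ → ∃ y₁ y₂, t = [y₁, y₂] ∧ y₁ = z₁ ∧ y₂ = z₂) ∧
  ∀ z₁ z₂ z₃, s = [z₁, z₂, z₃] → z₁ ≠ z₂ → z₂ ≠ z₃ → ∃ y₁ y₂ y₃, t = [y₁, y₂, y₃] ∧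
    ((y₁ = z₁ ∨ y₁ = z₃) ∧ y₂ = z₂ ∧ (y₃ = z₁ ∨ y₃ = z₃) ∨
      y₁ = z₂ ∧ (y₂ = z₁ ∨ y₂ = z₃) ∧ y₃ = z₂)

lemma length_of_mem_cyclicWords {w : List Bool} (h : w ∈ cyclicWords) : w.length = 3 := by
  rcases h with rfl | rfl <;> rfl

/-- The words have length three, so only sides `s` of length two or three matter. Two equal letters
never fit; two different ones force `t = s`; three letters must have single letters as images. -/
lemma transfers_cyclicWords {s t : List ℕ} (hs : 2 ≤ s.length) :
    Transfers cyclicWords s t ↔ CyclicTransfer s t := by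
  constructor
  · intro h
    constructor
    · rintro z₁ z₂ rfl h12
      set f : ℕ → Bool := fun n => decide (n = z₂)
      have h1 := h (fun n => if n = z₁ ∨ n = z₂ then [f n] else List.replicate 3 true)
        (fun n => by by_cases hn : n = z₁ ∨ n = z₂ <;> simp [hn]) [true] [] (by
          simp [f, cyclicWords, h12])
      have hl := length_of_mem_cyclicWords h1
      simp only [List.length_append, List.length_cons, List.length_nil] at hl
      have hmem := mem_of_length_flatMap_lt (t := t) (A := fun n => n = z₁ ∨ n = z₂) (f := f)
        (k := 3) (by omega)
      rw [flatMap_single (s := t) f fun z hz => by simp only [if_pos (hmem z hz)]] at h1 hl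
      rw [List.length_map] at hl
      match t, (by omega : t.length = 2) with
      | [y₁, y₂], _ =>
        refine ⟨y₁, y₂, rfl, ?_⟩
        have m1 := hmem y₁ (by simp)
        have m2 := hmem y₂ (by simp)
        rcases m1 with rfl | rfl <;> rcases m2 with rfl | rfl <;>
          simp_all [cyclicWords, f]
    · rintro z₁ z₂ z₃ rfl h12 h23
      set f : ℕ → Bool := fun n => decide (n ≠ z₂)
      have h1 := h (fun n => if n = z₁ ∨ n = z₂ ∨ n = z₃ then [f n] else List.replicate 4 true)
        (fun n => by by_cases hn : n = z₁ ∨ n = z₂ ∨ n = z₃ <;> simp [hn]) [] [] (by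
          simp [f, cyclicWords, h12, h23.symm])
      have hl := length_of_mem_cyclicWords h1
      simp only [List.nil_append, List.append_nil] at hl h1
      have hmem := mem_of_length_flatMap_lt (t := t) (A := fun n => n = z₁ ∨ n = z₂ ∨ n = z₃)
        (f := f) (k := 4) (by omega)
      rw [flatMap_single (s := t) f fun z hz => by simp only [if_pos (hmem z hz)]] at h1 hl
      rw [List.length_map] at hl
      match t, hl with
      | [y₁, y₂, y₃], _ =>
        refine ⟨y₁, y₂, y₃, rfl, ?_⟩
        have m1 := hmem y₁ (by simp)
        have m2 := hmem y₂ (by simp)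
        have m3 := hmem y₃ (by simp)
        simp only [cyclicWords, Set.mem_insert_iff, Set.mem_singleton_iff, List.map_cons,
          List.map_nil, List.cons.injEq, and_true, f, decide_eq_true_eq, decide_eq_false_iff_not,
          not_not] at h1
        rcases h1 with ⟨n1, n2, n3⟩ | ⟨n1, n2, n3⟩
        · left; exact ⟨by tauto, n2, by tauto⟩
        · right; exact ⟨n1, by tauto, n3⟩
  · rintro ⟨h2, h3⟩ φ hφ p r hw
    have hl := length_of_mem_cyclicWords hw
    have h1 := length_le_flatMap hφ s
    simp only [List.length_append] at hl
    rcases (by omega : s.length = 2 ∨ s.length = 3) with hs2 | hs3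
    · match s, hs2 with
      | [a, b], _ =>
        by_cases hab : a = b
        · exfalso
          subst hab
          have ha := List.length_pos_of_ne_nil (hφ a)
          simp only [List.flatMap_cons, List.flatMap_nil, List.append_nil,
            List.length_append] at hl hw
          obtain ⟨c, hc⟩ := List.length_eq_one_iff.mp (by omega : (φ a).length = 1)
          rw [hc] at hw hl
          simp only [List.length_cons, List.length_nil] at hl
          rcases p with - | ⟨d, p⟩
          · obtain ⟨d, rfl⟩ := List.length_eq_one_iff.mp (by simp at hl; omega : r.length = 1)
            cases c <;> cases d <;> simp [cyclicWords] at hw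
          · rw [List.length_cons] at hl
            obtain rfl : p = [] := List.length_eq_zero_iff.mp (by omega)
            obtain rfl : r = [] := List.length_eq_zero_iff.mp (by omega)
            cases c <;> cases d <;> simp [cyclicWords] at hw
        · obtain ⟨y₁, y₂, rfl, rfl, rfl⟩ := h2 a b rfl hab
          exact hw
    · obtain rfl : p = [] := List.length_eq_zero_iff.mp (by omega)
      obtain rfl : r = [] := List.length_eq_zero_iff.mp (by omega)
      match s, hs3 with
      | [a, b, c], _ =>
        simp only [List.nil_append, List.append_nil, List.flatMap_cons, List.flatMap_nil,
          List.length_append] at hw hl ⊢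
        have ha := List.length_pos_of_ne_nil (hφ a)
        have hb := List.length_pos_of_ne_nil (hφ b)
        have hc := List.length_pos_of_ne_nil (hφ c)
        simp only [List.length_nil] at hl
        obtain ⟨a', ea⟩ := List.length_eq_one_iff.mp (by omega : (φ a).length = 1)
        obtain ⟨b', eb⟩ := List.length_eq_one_iff.mp (by omega : (φ b).length = 1)
        obtain ⟨c', ec⟩ := List.length_eq_one_iff.mp (by omega : (φ c).length = 1)
        rw [ea, eb, ec] at hw
        have hab : a ≠ b := by
          rintro rfl
          rw [ea] at eb
          cases a' <;> cases b' <;> simp_all [cyclicWords]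
        have hbc : b ≠ c := by
          rintro rfl
          rw [eb] at ec
          cases b' <;> cases c' <;> simp_all [cyclicWords]
        obtain ⟨y₁, y₂, y₃, rfl, h⟩ := h3 a b c rfl hab hbc
        simp only [List.flatMap_cons, List.flatMap_nil, List.append_nil]
        have hac : c' = a' := by
          cases a' <;> cases b' <;> cases c' <;> simp_all [cyclicWords]
        subst hac
        rcases h with ⟨rfl | rfl, rfl, rfl | rfl⟩ | ⟨rfl, rfl | rfl, rfl⟩ <;>
          simp only [ea, eb, ec] <;>
          cases c' <;> cases b' <;> simp_all [cyclicWords]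

end Cyclic

/-! ### Sorted words and the power languages. -/

section Sorted

/-- In the word no `x` comes after a `y`. -/
def IsSorted (w : List Bool) : Prop := w.Pairwise fun c d => c = false → d = false

lemma isSorted_append {v w : List Bool} :
    IsSorted (v ++ w) ↔ IsSorted v ∧ IsSorted w ∧ (false ∈ v → true ∉ w) := by
  rw [IsSorted, List.pairwise_append]
  refine and_congr Iff.rfl (and_congr Iff.rfl ⟨fun h hv hw => ?_, fun h c hc d hd e => ?_⟩)
  · simpa using h false hv true hw rfl
  · subst e
    cases d
    · rfl
    · exact absurd hd (h hc)

lemma isSorted_of_false_notMem {w : List Bool} (h : false ∉ w) : IsSorted w := by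
  refine List.pairwise_iff_forall_sublist.mpr fun {c d} hs e => ?_
  subst e
  exact absurd (hs.subset (by simp)) h

lemma isSorted_of_true_notMem {w : List Bool} (h : true ∉ w) : IsSorted w := by
  refine List.pairwise_iff_forall_sublist.mpr fun {c d} hs _ => ?_
  cases d
  · rfl
  · exact absurd (hs.subset (by simp)) h

lemma eq_replicate_of_notMem {w : List Bool} {b : Bool} (h : (!b) ∉ w) :
    w = List.replicate w.length b := by
  rw [List.eq_replicate_iff]
  refine ⟨rfl, fun c hc => ?_⟩
  by_contra hne
  exact h (Bool.eq_not.mpr hne ▸ hc)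

lemma isSorted_iff {w : List Bool} :
    IsSorted w ↔ w = List.replicate (w.count true) true ++ List.replicate (w.count false) false := by
  constructor
  · intro h
    induction w with
    | nil => rfl
    | cons c w ih =>
      have hw := ih (List.pairwise_cons.mp h).2
      cases c
      · have h1 : true ∉ w := fun hc => by simpa using (List.pairwise_cons.mp h).1 true hc
        have h2 := eq_replicate_of_notMem (b := false) h1
        rw [h2]
        simp [List.replicate_succ, List.count_replicate]
      · rw [List.count_cons_self, List.count_cons_of_ne (by simp), List.replicate_succ,
          List.cons_append, ← hw]
  · intro h
    rw [h, isSorted_append]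
    exact ⟨isSorted_of_false_notMem (by simp), isSorted_of_true_notMem (by simp), by simp⟩

lemma isSorted_flatMap_of_false_notMem {φ : ℕ → List Bool} {s : List ℕ} (h : ∀ z ∈ s, false ∉ φ z) :
    IsSorted (s.flatMap φ) :=
  isSorted_of_false_notMem fun hc => by
    obtain ⟨z, hz, hc⟩ := List.mem_flatMap.mp hc
    exact h z hz hc

lemma notMem_flatMap {φ : ℕ → List Bool} {s : List ℕ} {b : Bool} :
    b ∉ s.flatMap φ ↔ ∀ z ∈ s, b ∉ φ z := by simp [List.mem_flatMap]

/-- Once the final `x` is removed, membership is sortedness plus a count, and both can be followed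
through concatenations. -/
lemma mem_leftPowerWords {w : List Bool} : w ∈ leftPowerWords ↔
    ∃ w', w = w' ++ [true] ∧ IsSorted w' ∧ true ∈ w' ∧ w'.count false = 1 := by
  constructor
  · rintro ⟨a, rfl⟩
    refine ⟨List.replicate (a + 1) true ++ [false], by simp, ?_, by simp,
      by simp [List.count_replicate]⟩
    rw [isSorted_append]
    exact ⟨isSorted_of_false_notMem (by simp), isSorted_of_true_notMem (by simp), by simp⟩
  · rintro ⟨w', rfl, h1, h2, h3⟩
    rw [isSorted_iff, h3] at h1
    have := List.count_pos_iff.mpr h2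
    refine ⟨w'.count true - 1, ?_⟩
    rw [Nat.sub_add_cancel (by omega)]
    conv_lhs => rw [h1]
    simp

lemma mem_bothPowerWords {k : ℕ} {w : List Bool} : w ∈ bothPowerWords k ↔
    ∃ w', w = w' ++ [true] ∧ IsSorted w' ∧ true ∈ w' ∧ false ∈ w' ∧
      w'.count false ≡ 1 [MOD k] := by
  constructor
  · rintro ⟨a, c, hk, rfl⟩
    refine ⟨List.replicate (a + 1) true ++ List.replicate (c + 1) false, by simp, ?_, by simp,
      by simp, ?_⟩
    · rw [isSorted_append]
      exact ⟨isSorted_of_false_notMem (by simp), isSorted_of_true_notMem (by simp), by simp⟩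
    · have : (List.replicate (a + 1) true ++ List.replicate (c + 1) false).count false = c + 1 := by
        simp [List.count_replicate]
      rw [this]
      simpa using (Nat.modEq_zero_iff_dvd.mpr hk).add_right 1
  · rintro ⟨w', rfl, h1, h2, h3, h4⟩
    rw [isSorted_iff] at h1
    have h2' := List.count_pos_iff.mpr h2
    have h3' := List.count_pos_iff.mpr h3
    refine ⟨w'.count true - 1, w'.count false - 1, (Nat.modEq_iff_dvd' h3').mp h4.symm, ?_⟩
    rw [Nat.sub_add_cancel (by omega), Nat.sub_add_cancel (by omega)]
    conv_lhs => rw [h1]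
    simp

lemma mem_innerPowerWords {k : ℕ} {w : List Bool} : w ∈ innerPowerWords k ↔
    ∃ w', w = true :: (w' ++ [true]) ∧ true ∉ w' ∧ w' ≠ [] ∧ w.count false ≡ 1 [MOD k] := by
  have key : ∀ c, (true :: (List.replicate (c + 1) false ++ [true])).count false = c + 1 := by
    simp
  constructor
  · rintro ⟨c, hk, rfl⟩
    refine ⟨List.replicate (c + 1) false, rfl, by simp, by simp, ?_⟩
    rw [key]
    simpa using (Nat.modEq_zero_iff_dvd.mpr hk).add_right 1
  · rintro ⟨w', rfl, h1, h2, h4⟩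
    have h3 := List.length_pos_of_ne_nil h2
    have h5 := eq_replicate_of_notMem (b := false) h1
    have h6 : w' = List.replicate (w'.length - 1 + 1) false := by
      rwa [Nat.sub_add_cancel (by omega)]
    refine ⟨w'.length - 1, ?_, by rw [← h6]⟩
    rw [h6, key] at h4
    exact (Nat.modEq_zero_iff_dvd.mp (Nat.ModEq.add_right_cancel' 1 (by simpa using h4)))

/-- A word that contains `y` in front of its last letter, which is `x`, is not sorted. -/
lemma not_isSorted_of_append_true {w : List Bool} (h : IsSorted (w ++ [true])) : false ∉ w :=
  fun hc => (isSorted_append.mp h).2.2 hc (by simp)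

lemma concat_inj {α : Type*} {v w : List α} {a b : α} (h : v ++ [a] = w ++ [b]) : v = w ∧ a = b := by
  simpa using List.append_inj' h rfl

end Sorted

/-! ### Pairs preserving the words `x ⋯ xyx`. -/

section LeftPower

/-- The condition under which instances `x ⋯ xyx` of `s` stay such. -/
def LeftPowerTransfer (s t : List ℕ) : Prop :=
  (∀ z ∈ t, z ∈ s) ∧
  (∀ s' z, s = s' ++ [z] → z ∉ s' → ∃ t' y, t = t' ++ [y] ∧ y = z ∧ z ∉ t') ∧
  ∀ s' z z', s = s' ++ [z] ++ [z'] → z ∉ s' → z ≠ z' → ∃ t' y y', t = t' ++ [y] ++ [y'] ∧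
    y = z ∧ y' = z' ∧ z ∉ t' ∧ (s' ≠ [] → t' ≠ [])

/-- In a sorted word with one `y` this is the last letter: it lies behind the instance or ends it. A
`y` in `p` would force a further one in the nonempty instance. -/
lemma sorted_count_one {φ : ℕ → List Bool} (hφ : ∀ n, φ n ≠ []) {p r : List Bool} {l : List ℕ}
    (hl : l ≠ []) (h : IsSorted (p ++ l.flatMap φ ++ r))
    (hc : (p ++ l.flatMap φ ++ r).count false = 1) : false ∉ p ∧
    ((∀ z ∈ l, false ∉ φ z) ∧ false ∈ r ∨
      r = [] ∧ ∃ l' z, l = l' ++ [z] ∧ (∀ y ∈ l', false ∉ φ y) ∧ false ∈ φ z) := by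
  obtain ⟨h1, h2, h3⟩ := isSorted_append.mp h
  obtain ⟨h4, h5, h6⟩ := isSorted_append.mp h1
  simp only [List.count_append] at hc
  have hp : false ∉ p := by
    intro hp
    have := List.count_pos_iff.mpr (mem_of_not_mem (flatMap_ne_nil hφ hl) (h6 hp))
    have := List.count_pos_iff.mpr hp
    simp only [Bool.not_true] at *
    omega
  refine ⟨hp, ?_⟩
  by_cases h0 : ∀ z ∈ l, false ∉ φ z
  · refine Or.inl ⟨h0, ?_⟩
    rw [count_flatMap_eq_zero.mpr h0, List.count_eq_zero.mpr hp] at hc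
    exact List.count_pos_iff.mp (by omega)
  · right
    push Not at h0
    obtain ⟨l₁, z, l₂, rfl, hz, hl₁⟩ := exists_first h0
    have hz' := List.count_pos_iff.mpr hz
    simp only [List.flatMap_append, List.flatMap_cons, List.count_append] at hc
    constructor
    · by_contra hr
      have := List.count_pos_iff.mpr (mem_of_not_mem hr (h3 (by simp [hz])))
      simp only [Bool.not_true] at this
      omega
    · have : l₂ = [] := by
        by_contra hl₂
        rw [List.flatMap_append, List.flatMap_cons] at h5
        have h7 := (isSorted_append.mp (isSorted_append.mp h5).2.1).2.2 hz
        have := List.count_pos_iff.mpr (mem_of_not_mem (flatMap_ne_nil hφ hl₂) h7)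
        simp only [Bool.not_true] at this
        omega
      subst this
      exact ⟨l₁, z, rfl, hl₁, hz⟩

/-- The final `x` belongs to the context or to the last letter of `s`. In either case
`sorted_count_one` locates the `y`, and the clauses on the last two letters carry it over to `t`. -/
lemma LeftPowerTransfer.transfers {s t : List ℕ} (h : LeftPowerTransfer s t) (hs : 2 ≤ s.length)
    (ht : 2 ≤ t.length) : Transfers leftPowerWords s t := by
  obtain ⟨hts, hlast, hpen⟩ := h
  intro φ hφ p r hw
  rw [mem_leftPowerWords] at hw ⊢
  obtain ⟨w, e, h1, h2, h3⟩ := hw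
  have hs0 : s ≠ [] := by rintro rfl; simp at hs
  have ht0 : t ≠ [] := by rintro rfl; simp at ht
  have htrue : ∀ {l : List ℕ}, l ≠ [] → (∀ z ∈ l, false ∉ φ z) → true ∈ l.flatMap φ := by
    intro l hl h
    exact mem_of_not_mem (flatMap_ne_nil hφ hl) (notMem_flatMap.mpr h)
  rcases List.eq_nil_or_concat' r with rfl | ⟨r', c, rfl⟩
  -- The final `x` comes from the last letter `z'` of `s`; `ζ` is the rest of its image.
  · obtain ⟨s₀, z', rfl⟩ := (List.eq_nil_or_concat' s).resolve_left hs0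
    obtain ⟨ζ, c, hζ⟩ := (List.eq_nil_or_concat' (φ z')).resolve_left (hφ z')
    have e' : p ++ s₀.flatMap φ ++ ζ = w ∧ c = true := by
      refine concat_inj ?_
      rw [← e]
      simp [hζ]
    obtain ⟨rfl, rfl⟩ := e'
    have hs₀ : s₀ ≠ [] := by rintro rfl; simp at hs
    obtain ⟨hp, h | ⟨rfl, s', z, rfl, hs', hz⟩⟩ := sorted_count_one hφ hs₀ h1 h3
    · have hz' : z' ∉ s₀ := fun hc => h.1 z' hc (by rw [hζ]; simp [h.2])
      obtain ⟨t', y, rfl, rfl, ht'⟩ := hlast s₀ z' rfl hz'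
      have ht₀ : t' ≠ [] := by rintro rfl; simp at ht
      have htt : ∀ x ∈ t', false ∉ φ x := by
        intro x hx
        have := hts x (by simp [hx])
        simp only [List.mem_append, List.mem_singleton] at this
        rcases this with h' | rfl
        · exact h.1 x h'
        · exact absurd hx ht'
      refine ⟨p ++ t'.flatMap φ ++ ζ, by simp [hζ], ?_, ?_, ?_⟩
      · have h5 := (isSorted_append.mp h1).2.1
        rw [isSorted_append, isSorted_append]
        refine ⟨⟨isSorted_of_false_notMem hp, isSorted_flatMap_of_false_notMem htt,
          fun h => absurd h hp⟩, h5, fun h => ?_⟩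
        rw [List.mem_append] at h
        rcases h with h | h
        · exact absurd h hp
        · exact absurd h (notMem_flatMap.mpr htt)
      · simp [htrue ht₀ htt]
      · simp only [List.count_append, count_flatMap_eq_zero.mpr h.1] at h3
        simp only [List.count_append, count_flatMap_eq_zero.mpr htt]
        exact h3
    · simp only [List.nil_append] at hζ
      have hzz : z ≠ z' := by rintro rfl; simp [hζ] at hz
      obtain ⟨t', y, y', rfl, rfl, rfl, hzt, hne⟩ := hpen s' z z' rfl (fun hc => hs' z hc hz) hzz
      have htt : ∀ x ∈ t', false ∉ φ x := by
        intro x hx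
        have := hts x (by simp [hx])
        simp only [List.mem_append, List.mem_singleton] at this
        rcases this with (h' | rfl) | rfl
        · exact hs' x h'
        · exact absurd hx hzt
        · simp [hζ]
      refine ⟨p ++ t'.flatMap φ ++ φ y, by simp [hζ], ?_, ?_, ?_⟩
      · simp only [List.append_nil, List.flatMap_append, List.flatMap_cons, List.flatMap_nil,
          ← List.append_assoc] at h1
        have h5 := (isSorted_append.mp h1).2.1
        rw [isSorted_append, isSorted_append]
        refine ⟨⟨isSorted_of_false_notMem hp, isSorted_flatMap_of_false_notMem htt,
          fun h => absurd h hp⟩, h5, fun h => ?_⟩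
        rw [List.mem_append] at h
        rcases h with h | h
        · exact absurd h hp
        · exact absurd h (notMem_flatMap.mpr htt)
      · simp only [List.append_nil, List.flatMap_append, List.flatMap_cons, List.flatMap_nil,
          List.mem_append] at h2 ⊢
        rcases h2 with h2 | h2 | h2
        · exact Or.inl (Or.inl h2)
        · refine Or.inl (Or.inr (htrue (hne ?_) htt))
          rintro rfl
          simp at h2
        · exact Or.inr h2
      · simp only [List.append_nil, List.flatMap_append, List.flatMap_cons, List.flatMap_nil,
          List.count_append, count_flatMap_eq_zero.mpr hs'] at h3
        simp only [List.count_append, count_flatMap_eq_zero.mpr htt]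
        omega
  · rw [← List.append_assoc] at e
    obtain ⟨rfl, rfl⟩ := concat_inj e
    refine ⟨p ++ t.flatMap φ ++ r', by simp, ?_⟩
    obtain ⟨hp, h | ⟨rfl, s', z, rfl, hs', hz⟩⟩ := sorted_count_one hφ hs0 h1 h3
    · have htt : ∀ x ∈ t, false ∉ φ x := fun x hx => h.1 x (hts x hx)
      refine ⟨?_, ?_, ?_⟩
      · have h5 := (isSorted_append.mp h1).2.1
        rw [isSorted_append, isSorted_append]
        refine ⟨⟨isSorted_of_false_notMem hp, isSorted_flatMap_of_false_notMem htt,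
          fun h => absurd h hp⟩, h5, fun h => ?_⟩
        rw [List.mem_append] at h
        rcases h with h | h
        · exact absurd h hp
        · exact absurd h (notMem_flatMap.mpr htt)
      · simp [htrue ht0 htt]
      · simp only [List.count_append, count_flatMap_eq_zero.mpr h.1] at h3
        simp only [List.count_append, count_flatMap_eq_zero.mpr htt]
        exact h3
    · obtain ⟨t', y, rfl, rfl, ht'⟩ := hlast s' z rfl fun hc => hs' z hc hz
      have ht₀ : t' ≠ [] := by rintro rfl; simp at ht
      have htt : ∀ x ∈ t', false ∉ φ x := by
        intro x hx
        have := hts x (by simp [hx])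
        simp only [List.mem_append, List.mem_singleton] at this
        rcases this with h' | rfl
        · exact hs' x h'
        · exact absurd hx ht'
      simp only [List.append_nil, List.flatMap_append, List.flatMap_cons, List.flatMap_nil,
        ← List.append_assoc] at h1 h3 ⊢
      refine ⟨?_, ?_, ?_⟩
      · have h5 := (isSorted_append.mp h1).2.1
        rw [isSorted_append, isSorted_append]
        refine ⟨⟨isSorted_of_false_notMem hp, isSorted_flatMap_of_false_notMem htt,
          fun h => absurd h hp⟩, h5, fun h => ?_⟩
        rw [List.mem_append] at h
        rcases h with h | h
        · exact absurd h hp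
        · exact absurd h (notMem_flatMap.mpr htt)
      · simp [htrue ht₀ htt]
      · simp only [List.count_append, count_flatMap_eq_zero.mpr hs'] at h3
        simp only [List.count_append, count_flatMap_eq_zero.mpr htt]
        omega

/-- The first two clauses are tested with images `x` and `y` only. For the third, `z ↦ y`, `z' ↦ x`,
and all other letters are mapped to `xx`, which keeps them from standing at the end of `t`. -/
lemma leftPowerTransfer_of_transfers {s t : List ℕ} (hs : 2 ≤ s.length) (ht : t ≠ [])
    (h : Transfers leftPowerWords s t) : LeftPowerTransfer s t := by
  refine ⟨?_, ?_, ?_⟩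
  · intro z hz
    by_contra hc
    have h1 := h (fun n => if n ∈ s then [true] else [false])
      (fun n => by by_cases hn : n ∈ s <;> simp [hn]) [true] [false, true] ?_
    · rw [mem_leftPowerWords] at h1
      obtain ⟨w, e, -, -, h3⟩ := h1
      have e' := congrArg (List.count false) e
      have : 0 < (t.flatMap fun n => if n ∈ s then [true] else [false]).count false :=
        List.count_pos_iff.mpr (mem_flatMap_of hz (by simp [hc]))
      simp [h3] at e'
      omega
    · have hf : ∀ z ∈ s, false ∉ (if z ∈ s then [true] else [false]) := by
        intro y hy
        simp [hy]
      rw [mem_leftPowerWords]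
      refine ⟨[true] ++ (s.flatMap fun n => if n ∈ s then [true] else [false]) ++ [false],
        by simp, ?_, by simp, ?_⟩
      · rw [isSorted_append, isSorted_append]
        refine ⟨⟨isSorted_of_false_notMem (by simp), isSorted_flatMap_of_false_notMem hf, by simp⟩,
          isSorted_of_true_notMem (by simp), by simp⟩
      · simp [count_flatMap_eq_zero.mpr hf]
  · rintro s' z rfl hz
    set φ : ℕ → List Bool := fun n => if n = z then [false] else [true] with hφ
    have hf : ∀ y ∈ s', false ∉ φ y := by
      intro y hy
      simp [hφ, show y ≠ z from fun e => hz (e ▸ hy)]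
    have hφn : ∀ n, φ n ≠ [] := fun n => by by_cases hn : n = z <;> simp [hφ, hn]
    have h1 := h φ hφn [true] [true] ?_
    · rw [mem_leftPowerWords] at h1
      obtain ⟨w, e, h1, h2, h3⟩ := h1
      obtain ⟨rfl, -⟩ := concat_inj e
      rw [← List.append_nil ([true] ++ t.flatMap φ)] at h1 h3
      obtain ⟨-, h | ⟨-, t', y, rfl, ht', hy⟩⟩ := sorted_count_one hφn ht h1 h3
      · simp at h
      · have hyz : y = z := by
          by_contra hc
          simp [hφ, hc] at hy
        exact ⟨t', y, rfl, hyz, fun hc => ht' z hc (by simp [hφ])⟩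
    · rw [mem_leftPowerWords]
      refine ⟨[true] ++ (s' ++ [z]).flatMap φ, by simp, ?_, by simp, ?_⟩
      · simp only [List.flatMap_append, List.flatMap_cons, List.flatMap_nil, List.append_nil]
        rw [isSorted_append, isSorted_append]
        refine ⟨isSorted_of_false_notMem (by simp), ⟨isSorted_flatMap_of_false_notMem hf,
          isSorted_of_true_notMem (by simp [hφ]), fun hc => absurd hc (notMem_flatMap.mpr hf)⟩,
          by simp⟩
      · have : φ z = [false] := by simp [hφ]
        simp [count_flatMap_eq_zero.mpr hf, this]
  · rintro s' z z' rfl hz hzz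
    set φ : ℕ → List Bool := fun n => if n = z then [false] else
      if n = z' then [true] else [true, true] with hφ
    have hfz : ∀ y, y ≠ z → false ∉ φ y := by
      intro y hy
      by_cases hy' : y = z' <;> simp [hφ, hy, hy', hzz.symm]
    have hf : ∀ y ∈ s', false ∉ φ y := fun y hy => hfz y fun e => hz (e ▸ hy)
    have hφn : ∀ n, φ n ≠ [] := fun n => by
      by_cases hn : n = z <;> by_cases hn' : n = z' <;> simp [hφ, hn, hn', hzz.symm]
    have hφz : φ z = [false] := by simp [hφ]
    have hφz' : φ z' = [true] := by simp [hφ, hzz.symm]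
    -- The leading `x` is supplied by the context only if `s'` is empty; otherwise `t'` has to
    -- provide one and is nonempty.
    set p : List Bool := if s' = [] then [true] else [] with hp
    have hpf : false ∉ p := by by_cases h0 : s' = [] <;> simp [hp, h0]
    have h1 := h φ hφn p [] ?_
    · rw [mem_leftPowerWords] at h1
      obtain ⟨w, e, h1, h2, h3⟩ := h1
      obtain ⟨t₀, y', rfl⟩ := (List.eq_nil_or_concat' t).resolve_left ht
      simp only [List.append_nil, List.flatMap_append, List.flatMap_cons, List.flatMap_nil,
        ← List.append_assoc] at e
      have hyz' : y' = z' ∧ w = p ++ t₀.flatMap φ := by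
        by_cases hy : y' = z
        · rw [hy, hφz] at e
          simpa using (concat_inj e).2
        · by_cases hy' : y' = z'
          · rw [hy', hφz'] at e
            exact ⟨hy', (concat_inj e).1.symm⟩
          · exfalso
            have hφy : φ y' = [true] ++ [true] := by simp [hφ, hy, hy']
            rw [hφy, ← List.append_assoc] at e
            obtain ⟨rfl, -⟩ := concat_inj e
            have h4 := not_isSorted_of_append_true h1
            rw [List.count_append, List.count_eq_zero.mpr h4] at h3
            simp at h3
      obtain ⟨rfl, rfl⟩ := hyz'
      have ht₀ : t₀ ≠ [] := by
        rintro rfl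
        simp [List.count_eq_zero.mpr hpf] at h3
      rw [← List.append_nil (p ++ t₀.flatMap φ)] at h1 h3
      obtain ⟨-, h | ⟨-, t', y, rfl, ht', hy⟩⟩ := sorted_count_one hφn ht₀ h1 h3
      · simp at h
      · have hyz : y = z := by
          by_contra hc
          exact hfz y hc hy
        subst hyz
        refine ⟨t', y, y', rfl, rfl, rfl, fun hc => ht' y hc (by simp [hφz]), fun hne => ?_⟩
        rintro rfl
        simp [hp, hne, hφz] at h2
    · rw [mem_leftPowerWords]
      refine ⟨p ++ (s' ++ [z]).flatMap φ, by simp [hφz'], ?_, ?_, ?_⟩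
      · simp only [List.flatMap_append, List.flatMap_cons, List.flatMap_nil, List.append_nil]
        rw [isSorted_append, isSorted_append]
        refine ⟨isSorted_of_false_notMem hpf, ⟨isSorted_flatMap_of_false_notMem hf,
          isSorted_of_true_notMem (by simp [hφz]), fun hc => absurd hc (notMem_flatMap.mpr hf)⟩,
          fun hc => absurd hc hpf⟩
      · by_cases h0 : s' = []
        · simp [hp, h0]
        · have := mem_of_not_mem (flatMap_ne_nil hφn h0) (notMem_flatMap.mpr hf)
          simp only [Bool.not_false] at this
          simp [this]
      · simp [count_flatMap_eq_zero.mpr hf, hφz, List.count_eq_zero.mpr hpf]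

end LeftPower

/-! ### Occurrence numbers modulo a period. -/

section Period

/-- All letters occur in both words equally often modulo `k`. -/
def SamePeriod (k : ℕ) (s t : List ℕ) : Prop := ∀ z, s.count z ≡ t.count z [MOD k]

lemma SamePeriod.symm {k : ℕ} {s t : List ℕ} (h : SamePeriod k s t) : SamePeriod k t s :=
  fun z => (h z).symm

lemma sum_map_eq_sum_count {s : List ℕ} {F : Finset ℕ} (hF : s.toFinset ⊆ F) (w : ℕ → ℕ) :
    (s.map w).sum = ∑ z ∈ F, s.count z * w z := by
  rw [Finset.sum_list_map_count]
  refine Finset.sum_subset hF fun z _ hz => ?_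
  rw [List.count_eq_zero.mpr (by simpa using hz), zero_smul]

lemma SamePeriod.sum_map {k : ℕ} {s t : List ℕ} (h : SamePeriod k s t) (w : ℕ → ℕ) :
    (s.map w).sum ≡ (t.map w).sum [MOD k] := by
  rw [sum_map_eq_sum_count (F := s.toFinset ∪ t.toFinset) Finset.subset_union_left,
    sum_map_eq_sum_count (F := s.toFinset ∪ t.toFinset) Finset.subset_union_right,
    ← ZMod.natCast_eq_natCast_iff]
  push_cast
  refine Finset.sum_congr rfl fun z _ => ?_
  rw [(ZMod.natCast_eq_natCast_iff _ _ _).mpr (h z)]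

lemma SamePeriod.count_flatMap {k : ℕ} {s t : List ℕ} (h : SamePeriod k s t)
    (φ : ℕ → List Bool) (b : Bool) :
    (s.flatMap φ).count b ≡ (t.flatMap φ).count b [MOD k] := by
  rw [List.count_flatMap, List.count_flatMap]
  exact h.sum_map _

lemma SamePeriod.count_context {k : ℕ} {s t : List ℕ} (h : SamePeriod k s t)
    (φ : ℕ → List Bool) (p r : List Bool) (b : Bool) :
    (p ++ s.flatMap φ ++ r).count b ≡ (p ++ t.flatMap φ ++ r).count b [MOD k] := by
  simp only [List.count_append]
  exact ((h.count_flatMap φ b).add_left _).add_right _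

/-- No `g ≥ 2` that divides `k` divides all numbers of occurrences of letters. -/
def Solvable (k : ℕ) (s : List ℕ) : Prop := ∀ g, 2 ≤ g → g ∣ k → ∃ z ∈ s, ¬ g ∣ s.count z

lemma sum_map_indicator (s : List ℕ) (z : ℕ) :
    (s.map fun n => if n = z then (1 : ℤ) else 0).sum = s.count z := by
  induction s with
  | nil => simp
  | cons y s ih =>
    by_cases h : y = z
    · simp [h, ih]; ring
    · simp [h, ih]

lemma sum_map_int_modEq {k : ℕ} (s : List ℕ) {f g : ℕ → ℤ} (h : ∀ n, f n ≡ g n [ZMOD k]) :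
    (s.map f).sum ≡ (s.map g).sum [ZMOD k] := by
  induction s with
  | nil => rfl
  | cons y s ih => simpa using (h y).add ih

/-- Integer-weighted sums over `s`, taken modulo `k`, form an ideal of `ℤ` that contains `k` and all
occurrence numbers. `Solvable` says that these have no common divisor `g ≥ 2`, so the ideal contains
`1`. Reducing the weights modulo `k` and adding `k` makes them positive. -/
lemma solvable_iff {k : ℕ} (hk : 0 < k) {s : List ℕ} : Solvable k s ↔
    ∃ e : ℕ → ℕ, (∀ n, 0 < e n) ∧ (s.map e).sum ≡ 1 [MOD k] := by
  constructor
  · intro h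
    let I : Ideal ℤ :=
      { carrier := {n | ∃ c : ℕ → ℤ, n ≡ (s.map c).sum [ZMOD k]}
        zero_mem' := ⟨fun _ => 0, by simp⟩
        add_mem' := by
          rintro m n ⟨c, hc⟩ ⟨d, hd⟩
          refine ⟨fun i => c i + d i, ?_⟩
          rw [List.sum_map_add]
          exact hc.add hd
        smul_mem' := by
          rintro m n ⟨c, hc⟩
          refine ⟨fun i => m * c i, ?_⟩
          rw [List.sum_map_mul_left]
          exact hc.mul_left m }
    have hI : ∀ n : ℤ, n ∈ I ↔ Submodule.IsPrincipal.generator I ∣ n :=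
      fun n => Submodule.IsPrincipal.mem_iff_generator_dvd I
    set g := (Submodule.IsPrincipal.generator I).natAbs with hg
    have hI' : ∀ n : ℕ, (n : ℤ) ∈ I ↔ g ∣ n := fun n => by
      rw [hI, hg, ← Int.natAbs_dvd, Int.natCast_dvd_natCast]
    have hgk : g ∣ k := (hI' k).mp ⟨fun _ => 0, by simp [Int.ModEq]⟩
    have hgc : ∀ z, g ∣ s.count z := fun z => (hI' _).mp
      ⟨fun n => if n = z then 1 else 0, by rw [sum_map_indicator]⟩
    have h1 : g ∣ 1 := by
      by_cases h2 : 2 ≤ g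
      · obtain ⟨z, -, hz⟩ := h g h2 hgk
        exact absurd (hgc z) hz
      · have h0 : g ≠ 0 := fun h0 => by rw [h0, zero_dvd_iff] at hgk; exact hk.ne' hgk
        interval_cases g
        · exact absurd rfl h0
        · exact dvd_rfl
    obtain ⟨c, hc⟩ := (hI' 1).mpr h1
    have hk' : (0 : ℤ) < k := by exact_mod_cast hk
    refine ⟨fun n => (c n % k).toNat + k, fun n => Nat.add_pos_right _ hk, ?_⟩
    rw [← Int.natCast_modEq_iff]
    have e : (((s.map fun n => (c n % k).toNat + k).sum : ℕ) : ℤ)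
        = (s.map fun n => c n % k + k).sum := by
      rw [Nat.cast_list_sum, List.map_map]
      congr 1
      refine List.map_congr_left fun n _ => ?_
      simp [Int.toNat_of_nonneg (Int.emod_nonneg (c n) hk'.ne')]
    rw [e]
    refine Int.ModEq.trans ?_ hc.symm
    exact sum_map_int_modEq s fun n => by simpa using Int.mod_modEq (c n) k
  · rintro ⟨e, -, he⟩ g hg hgk
    by_contra hc
    push Not at hc
    have h1 : g ∣ (s.map e).sum := by
      rw [sum_map_eq_sum_count (F := s.toFinset) le_rfl]
      exact Finset.dvd_sum fun z hz => (hc z (by simpa using hz)).mul_right _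
    have h2 : (s.map e).sum ≡ 1 [MOD g] := he.of_dvd hgk
    have h3 : g ∣ 1 := (Nat.modEq_zero_iff_dvd.mp (h2.symm.trans (Nat.modEq_zero_iff_dvd.mpr h1)))
    have := Nat.le_of_dvd one_pos h3
    omega

/-- A number that completes another one to `1` modulo `k`. -/
lemma complement_modEq {k : ℕ} (hk : 0 < k) (m : ℕ) : 1 + (k - 1) * m + m ≡ 1 [MOD k] := by
  obtain ⟨k, rfl⟩ := Nat.exists_eq_succ_of_ne_zero hk.ne'
  have : 1 + (k.succ - 1) * m + m = 1 + (k + 1) * m := by simp; ring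
  rw [this]
  simp

/-- Comparing the constant weight one with the weight that is two at `z` isolates the occurrences of
`z`. -/
lemma samePeriod_of_forall_sum {k : ℕ} {s t : List ℕ}
    (h : ∀ e : ℕ → ℕ, (∀ n, 0 < e n) → (s.map e).sum ≡ (t.map e).sum [MOD k]) :
    SamePeriod k s t := by
  have key : ∀ (l : List ℕ) (z : ℕ), (l.map fun n => 1 + if n = z then 1 else 0).sum
      = l.length + l.count z := by
    intro l z
    induction l with
    | nil => rfl
    | cons y l ih =>
      by_cases hy : y = z
      · simp [hy] at ih ⊢; omega
      · simp [hy] at ih ⊢; omega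
  intro z
  have h1 := h (fun _ => 1) (by simp)
  have h2 := h (fun n => 1 + if n = z then 1 else 0) (by intro n; omega)
  rw [key, key] at h2
  simp only [List.map_const', List.sum_replicate, smul_eq_mul, mul_one] at h1
  exact Nat.ModEq.add_left_cancel h1 h2

lemma length_flatMap_replicate (e : ℕ → ℕ) (s : List ℕ) (b : Bool) :
    (s.flatMap fun n => List.replicate (e n) b).length = (s.map e).sum := by
  rw [List.length_flatMap]; simp

lemma flatMap_replicate (e : ℕ → ℕ) (s : List ℕ) (b : Bool) :
    (s.flatMap fun n => List.replicate (e n) b) = List.replicate (s.map e).sum b := by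
  rw [List.eq_replicate_iff]
  refine ⟨length_flatMap_replicate e s b, fun c hc => ?_⟩
  obtain ⟨z, -, hz⟩ := List.mem_flatMap.mp hc
  exact (List.mem_replicate.mp hz).2

end Period

/-! ### Pairs preserving the words `xy^qx`. -/

section InnerPower

/-- The condition under which instances `xy^qx` of `s` stay such, up to the period. -/
def InnerPowerTransfer (Sol : List ℕ → Prop) (s t : List ℕ) : Prop :=
  (∀ z ∈ s, z ∈ t) ∧ (∀ z ∈ t, z ∈ s) ∧
  (∀ z s', s = z :: s' → z ∉ s' → ∃ y t', t = y :: t' ∧ y = z ∧ z ∉ t') ∧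
  (∀ s' z, s = s' ++ [z] → z ∉ s' → ∃ t' y, t = t' ++ [y] ∧ y = z ∧ z ∉ t') ∧
  ∀ z s₂ z', s = z :: (s₂ ++ [z']) → z = z' → z ∉ s₂ → s₂ ≠ [] → Sol s₂ →
    ∃ y t₂ y', t = y :: (t₂ ++ [y']) ∧ y = z ∧ y' = z ∧ z ∉ t₂

variable {k : ℕ} {s t : List ℕ}

/-- The number of `y`s in the images of letters without `x`. -/
lemma count_flatMap_of_true_notMem {φ : ℕ → List Bool} {l : List ℕ} (h : ∀ z ∈ l, true ∉ φ z) :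
    (l.flatMap φ).count false = (l.map fun n => (φ n).length).sum := by
  rw [List.count_flatMap]
  congr 1
  refine List.map_congr_left fun z hz => ?_
  have e := eq_replicate_of_notMem (b := false) (h z hz)
  rw [Function.comp_apply, e]
  simp

/-- `SamePeriod` preserves the congruence for `q`, so only the origin of the two outer `x` matters:
the context, or the first and the last letter of `s`. `Solvable` enters if both come from the same
letter, for then the inner letters alone supply the `y`. -/
lemma InnerPowerTransfer.transfers (hk : 0 < k) (h : InnerPowerTransfer (Solvable k) s t)
    (hper : SamePeriod k s t) (hs : 2 ≤ s.length) (ht : 2 ≤ t.length) :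
    Transfers (innerPowerWords k) s t := by
  obtain ⟨hst, hts, hfirst, hlast, hloop⟩ := h
  intro φ hφ p r hw
  rw [mem_innerPowerWords] at hw ⊢
  obtain ⟨w, e, h1, h2, h3⟩ := hw
  replace h3 := (hper.count_context φ p r false).symm.trans h3
  suffices h : ∃ w', p ++ t.flatMap φ ++ r = true :: (w' ++ [true]) ∧ true ∉ w' ∧ w' ≠ [] by
    obtain ⟨w', e1, e2, e3⟩ := h
    exact ⟨w', e1, e2, e3, h3⟩
  have hs0 : s ≠ [] := by rintro rfl; simp at hs
  have ht0 : t ≠ [] := by rintro rfl; simp at ht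
  rcases p with - | ⟨c, p⟩
  · obtain ⟨z, s', rfl⟩ := List.exists_cons_of_ne_nil hs0
    obtain ⟨c, ζ, hζ⟩ := List.exists_cons_of_ne_nil (hφ z)
    rw [List.nil_append, List.flatMap_cons, hζ] at e
    simp only [List.cons_append, List.cons.injEq] at e
    obtain ⟨rfl, e⟩ := e
    have hs' : s' ≠ [] := by rintro rfl; simp at hs
    rcases List.eq_nil_or_concat' r with rfl | ⟨r, c, rfl⟩
    · obtain ⟨s₂, z', rfl⟩ := (List.eq_nil_or_concat' s').resolve_left hs'
      obtain ⟨ζ', c, hζ'⟩ := (List.eq_nil_or_concat' (φ z')).resolve_left (hφ z')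
      have e' : ζ ++ s₂.flatMap φ ++ ζ' = w ∧ c = true := by
        refine concat_inj ?_
        rw [← e]
        simp [hζ']
      obtain ⟨rfl, rfl⟩ := e'
      simp only [List.mem_append, not_or, notMem_flatMap] at h1
      obtain ⟨⟨hζt, hs₂⟩, hζt'⟩ := h1
      have hzs : z ∉ s₂ := fun hc => hs₂ z hc (by simp [hζ])
      have hzs' : z' ∉ s₂ := fun hc => hs₂ z' hc (by simp [hζ'])
      by_cases hzz : z = z'
      · subst hzz
        -- If `z` both begins and ends the instance, a longer image would place its final `x` in the
        -- interior.
        have hζ0 : ζ = [] := by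
          rcases List.eq_nil_or_concat' ζ with h | ⟨ξ, c, rfl⟩
          · exact h
          · exfalso
            rw [hζ, ← List.cons_append] at hζ'
            obtain ⟨-, rfl⟩ := concat_inj hζ'
            simp at hζt
        subst hζ0
        have hζ0' : ζ' = [] := by simpa using congrArg List.length (hζ'.symm.trans hζ)
        subst hζ0'
        have hs₂0 : s₂ ≠ [] := by rintro rfl; simp at h2
        have hsol : Solvable k s₂ := by
          refine (solvable_iff hk).mpr ⟨fun n => (φ n).length,
            fun n => List.length_pos_of_ne_nil (hφ n), ?_⟩
          rw [← count_flatMap_of_true_notMem hs₂]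
          have h4 := (hper.count_context φ [] [] false).trans h3
          simpa [hζ] using h4
        obtain ⟨y, t₂, y', rfl, rfl, rfl, hyt⟩ := hloop z s₂ z rfl rfl hzs hs₂0 hsol
        have hmem : ∀ x ∈ t₂, x ∈ s₂ := by
          intro x hx
          have := hts x (by simp [hx])
          have hxy : x ≠ y' := fun e => hyt (e ▸ hx)
          simpa [hxy] using this
        refine ⟨t₂.flatMap φ, by simp [hζ], notMem_flatMap.mpr fun x hx => hs₂ x (hmem x hx), ?_⟩
        refine flatMap_ne_nil hφ ?_
        obtain ⟨x, hx⟩ := List.exists_mem_of_ne_nil _ hs₂0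
        have hxy : x ≠ y' := fun e => hzs (e ▸ hx)
        have := hst x (by simp [hx])
        rintro rfl
        simp [hxy] at this
      · obtain ⟨y, t', rfl, rfl, hyt⟩ := hfirst z _ rfl (by simp [hzs, hzz])
        obtain ⟨t'', y', e'', rfl, hyt''⟩ := hlast (y :: s₂) z' rfl (by simp [hzs', Ne.symm hzz])
        rcases t'' with - | ⟨x, t₂⟩
        · simp at e''; exact absurd e''.1 hzz
        simp only [List.cons_append, List.cons.injEq] at e''
        obtain ⟨rfl, rfl⟩ := e''
        simp only [List.mem_append, List.mem_cons, not_or] at hyt hyt''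
        have hmem : ∀ x ∈ t₂, x ∈ s₂ := by
          intro x hx
          have := hts x (by simp [hx])
          have hxy : x ≠ y := fun e => hyt.1 (e ▸ hx)
          have hxy' : x ≠ y' := fun e => hyt''.2 (e ▸ hx)
          simpa [hxy, hxy'] using this
        refine ⟨ζ ++ t₂.flatMap φ ++ ζ', by simp [hζ, hζ'], ?_, ?_⟩
        · simp only [List.mem_append, not_or]
          exact ⟨⟨hζt, notMem_flatMap.mpr fun x hx => hs₂ x (hmem x hx)⟩, hζt'⟩
        · intro h0
          simp only [List.append_eq_nil_iff] at h0
          obtain ⟨⟨rfl, h0⟩, rfl⟩ := h0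
          have hs₂0 : s₂ ≠ [] := by rintro rfl; simp at h2
          obtain ⟨x, hx⟩ := List.exists_mem_of_ne_nil _ hs₂0
          have hxy : x ≠ y := fun e => hzs (e ▸ hx)
          have hxy' : x ≠ y' := fun e => hzs' (e ▸ hx)
          have h4 := hst x (by simp [hx])
          have h5 : x ∈ t₂ := by simpa [hxy, hxy'] using h4
          exact flatMap_ne_nil hφ (List.ne_nil_of_mem h5) h0
    · rw [← List.append_assoc] at e
      obtain ⟨rfl, rfl⟩ := concat_inj e
      simp only [List.mem_append, not_or, notMem_flatMap] at h1
      obtain ⟨⟨hζt, hs₂⟩, hr⟩ := h1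
      obtain ⟨y, t', rfl, rfl, hyt⟩ := hfirst z _ rfl fun hc => hs₂ z hc (by simp [hζ])
      have hmem : ∀ x ∈ t', x ∈ s' := by
        intro x hx
        have := hts x (by simp [hx])
        have hxy : x ≠ y := fun e => hyt (e ▸ hx)
        simpa [hxy] using this
      have ht' : t' ≠ [] := by rintro rfl; simp at ht
      refine ⟨ζ ++ t'.flatMap φ ++ r, by simp [hζ], ?_, ?_⟩
      · simp only [List.mem_append, not_or]
        exact ⟨⟨hζt, notMem_flatMap.mpr fun x hx => hs₂ x (hmem x hx)⟩, hr⟩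
      · simp only [ne_eq, List.append_eq_nil_iff, not_and]
        intro h0
        exact absurd h0.2 (flatMap_ne_nil hφ ht')
  · simp only [List.cons_append, List.cons.injEq] at e
    obtain ⟨rfl, e⟩ := e
    rcases List.eq_nil_or_concat' r with rfl | ⟨r, c, rfl⟩
    · obtain ⟨s', z, rfl⟩ := (List.eq_nil_or_concat' s).resolve_left hs0
      obtain ⟨ζ, c, hζ⟩ := (List.eq_nil_or_concat' (φ z)).resolve_left (hφ z)
      have e' : p ++ s'.flatMap φ ++ ζ = w ∧ c = true := by
        refine concat_inj ?_
        rw [← e]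
        simp [hζ]
      obtain ⟨rfl, rfl⟩ := e'
      simp only [List.mem_append, not_or, notMem_flatMap] at h1
      obtain ⟨⟨hp, hs₂⟩, hζt⟩ := h1
      obtain ⟨t', y, rfl, rfl, hyt⟩ := hlast s' z rfl fun hc => hs₂ z hc (by simp [hζ])
      have hmem : ∀ x ∈ t', x ∈ s' := by
        intro x hx
        have := hts x (by simp [hx])
        have hxy : x ≠ y := fun e => hyt (e ▸ hx)
        simpa [hxy] using this
      have ht' : t' ≠ [] := by rintro rfl; simp at ht
      refine ⟨p ++ t'.flatMap φ ++ ζ, by simp [hζ], ?_, ?_⟩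
      · simp only [List.mem_append, not_or]
        exact ⟨⟨hp, notMem_flatMap.mpr fun x hx => hs₂ x (hmem x hx)⟩, hζt⟩
      · simp only [ne_eq, List.append_eq_nil_iff, not_and]
        intro h0
        exact absurd h0.2 (flatMap_ne_nil hφ ht')
    · rw [← List.append_assoc] at e
      obtain ⟨rfl, rfl⟩ := concat_inj e
      simp only [List.mem_append, not_or, notMem_flatMap] at h1
      refine ⟨p ++ t.flatMap φ ++ r, by simp, ?_, ?_⟩
      · simp only [List.mem_append, not_or]
        exact ⟨⟨h1.1.1, notMem_flatMap.mpr fun x hx => h1.1.2 x (hts x hx)⟩, h1.2⟩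
      · simp only [ne_eq, List.append_eq_nil_iff, not_and]
        intro h0
        exact absurd h0.2 (flatMap_ne_nil hφ ht0)

/-- Most test substitutions let the context add `1 + (k - 1) * m` letters `y` to the `m` of the
instance, for a total congruent to one. In the last clause there is no context, and `solvable_iff`
supplies suitable lengths. -/
lemma innerPowerTransfer_of_transfers (hk : 0 < k) (hs : 2 ≤ s.length) (ht : 2 ≤ t.length)
    (h : Transfers (innerPowerWords k) s t) (h' : Transfers (innerPowerWords k) t s) :
    SamePeriod k s t ∧ InnerPowerTransfer (Solvable k) s t := by
  have ht0 : t ≠ [] := by rintro rfl; simp at ht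
  have hsub : ∀ {s t : List ℕ}, Transfers (innerPowerWords k) s t → ∀ z ∈ t, z ∈ s := by
    intro s t h z hz
    by_contra hc
    have hf : ∀ y ∈ s, true ∉ (if y ∈ s then [false] else [true]) := by
      intro y hy
      simp [hy]
    have h1 := h (fun n => if n ∈ s then [false] else [true])
      (fun n => by by_cases hn : n ∈ s <;> simp [hn])
      (true :: List.replicate (1 + (k - 1) * s.length) false) [true] (by
        rw [mem_innerPowerWords]
        refine ⟨List.replicate (1 + (k - 1) * s.length) false ++
          s.flatMap fun n => if n ∈ s then [false] else [true], by simp, ?_, by simp, ?_⟩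
        · simp only [List.mem_append, not_or, notMem_flatMap]
          exact ⟨by simp, hf⟩
        · have : (s.flatMap fun n => if n ∈ s then [false] else [true]).count false = s.length := by
            rw [count_flatMap_of_true_notMem hf]
            have : (fun n => (if n ∈ s then [false] else [true]).length) = fun _ => 1 := by
              funext n; by_cases hn : n ∈ s <;> simp [hn]
            rw [this]; simp
          simp only [List.cons_append, List.count_append, List.count_cons, this,
            List.count_replicate, List.count_nil]
          simpa using complement_modEq hk s.length)
    rw [mem_innerPowerWords] at h1
    obtain ⟨w, e, h1, -⟩ := h1
    simp only [List.cons_append, List.cons.injEq, true_and] at e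
    obtain ⟨rfl, -⟩ := concat_inj e
    simp only [List.mem_append, not_or, notMem_flatMap] at h1
    have := h1.2 z hz
    simp [hc] at this
  have hone : ∀ {z : ℕ} {l : List ℕ} {e : ℕ → ℕ}, z ∉ l →
      (l.flatMap fun n => if n = z then [true] else List.replicate (e n) false)
        = List.replicate (l.map e).sum false := by
    intro z l e hz
    rw [← flatMap_replicate]
    refine List.flatMap_congr fun n hn => ?_
    simp [show n ≠ z from fun h => hz (h ▸ hn)]
  have hne : ∀ (z : ℕ) (e : ℕ → ℕ), (∀ n, 0 < e n) →
      ∀ n, (if n = z then [true] else List.replicate (e n) false) ≠ [] := by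
    intro z e he n
    have := he n
    by_cases hn : n = z <;> simp [hn]
    omega
  refine ⟨samePeriod_of_forall_sum fun e he => ?_, hsub h', hsub h, ?_, ?_, ?_⟩
  · have key : ∀ l : List ℕ, true :: List.replicate (1 + (k - 1) * (s.map e).sum) false ++
        (l.flatMap fun n => List.replicate (e n) false) ++ [true] ∈ innerPowerWords k ↔
        1 + (k - 1) * (s.map e).sum + (l.map e).sum ≡ 1 [MOD k] := by
      intro l
      rw [flatMap_replicate, mem_innerPowerWords]
      have hc : (true :: List.replicate (1 + (k - 1) * (s.map e).sum) false ++
        List.replicate (l.map e).sum false ++ [true]).count false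
          = 1 + (k - 1) * (s.map e).sum + (l.map e).sum := by simp
      rw [hc]
      constructor
      · rintro ⟨w, -, -, -, h⟩
        exact h
      · intro h
        exact ⟨List.replicate (1 + (k - 1) * (s.map e).sum) false ++
          List.replicate (l.map e).sum false, by simp, by simp, by simp, h⟩
    have h1 := h (fun n => List.replicate (e n) false) (fun n => by simpa using (he n).ne') _ _
      ((key s).mpr (complement_modEq hk _))
    exact Nat.ModEq.add_left_cancel' _ ((complement_modEq hk _).trans ((key t).mp h1).symm)
  · rintro z s' rfl hz
    have h1 := h _ (hne z (fun _ => 1) (by simp)) []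
      (List.replicate (1 + (k - 1) * (s'.map fun _ => 1).sum) false ++ [true]) (by
        rw [List.flatMap_cons, hone hz, mem_innerPowerWords]
        refine ⟨List.replicate (s'.map fun _ => 1).sum false ++
          List.replicate (1 + (k - 1) * (s'.map fun _ => 1).sum) false,
          by simp [-List.replicate_append_replicate], by simp, by simp, ?_⟩
        have := complement_modEq hk (s'.map fun _ => 1).sum
        rw [add_comm] at this
        simpa using this)
    rw [mem_innerPowerWords] at h1
    obtain ⟨w, e, h1, -⟩ := h1
    obtain ⟨y, t', rfl⟩ := List.exists_cons_of_ne_nil ht0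
    refine ⟨y, t', rfl, ?_⟩
    by_cases hy : y = z
    · refine ⟨hy, fun hc => h1 ?_⟩
      subst hy
      simp only [List.flatMap_cons, if_true, List.nil_append, List.cons_append,
        List.cons.injEq, true_and, ← List.append_assoc] at e
      obtain ⟨rfl, -⟩ := concat_inj e
      simp only [List.mem_append]
      exact Or.inl (mem_flatMap_of hc (by simp))
    · simp [hy] at e
  · rintro s' z rfl hz
    have h1 := h _ (hne z (fun _ => 1) (by simp))
      (true :: List.replicate (1 + (k - 1) * (s'.map fun _ => 1).sum) false) [] (by
        rw [List.flatMap_append, hone hz, mem_innerPowerWords]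
        refine ⟨List.replicate (1 + (k - 1) * (s'.map fun _ => 1).sum) false ++
          List.replicate (s'.map fun _ => 1).sum false,
          by simp [-List.replicate_append_replicate], by simp, by simp, ?_⟩
        simpa using complement_modEq hk (s'.map fun _ => 1).sum)
    rw [mem_innerPowerWords] at h1
    obtain ⟨w, e, h1, -⟩ := h1
    obtain ⟨t', y, rfl⟩ := (List.eq_nil_or_concat' t).resolve_left ht0
    refine ⟨t', y, rfl, ?_⟩
    simp only [List.flatMap_append, List.flatMap_cons, List.flatMap_nil, List.append_nil,
      List.cons_append, List.cons.injEq, true_and, ← List.append_assoc] at e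
    by_cases hy : y = z
    · refine ⟨hy, fun hc => h1 ?_⟩
      rw [if_pos hy] at e
      obtain ⟨rfl, -⟩ := concat_inj e
      simp only [List.mem_append]
      exact Or.inr (mem_flatMap_of hc (by simp))
    · rw [if_neg hy, List.replicate_one] at e
      simpa using (concat_inj e).2
  · rintro z s₂ z' rfl rfl hz hs₂ hsol
    obtain ⟨e, he, hsum⟩ := (solvable_iff hk).mp hsol
    have h1 := h _ (hne z e he) [] [] (by
      rw [List.flatMap_cons, List.flatMap_append, hone hz, mem_innerPowerWords]
      refine ⟨List.replicate (s₂.map e).sum false, by simp, by simp, ?_, by simpa using hsum⟩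
      rw [← flatMap_replicate]
      exact flatMap_ne_nil (fun n => by simpa using (he n).ne') hs₂)
    rw [mem_innerPowerWords] at h1
    obtain ⟨w, e', h1, -⟩ := h1
    obtain ⟨y, t', rfl⟩ := List.exists_cons_of_ne_nil ht0
    have ht' : t' ≠ [] := by rintro rfl; simp at ht
    obtain ⟨t₂, y', rfl⟩ := (List.eq_nil_or_concat' t').resolve_left ht'
    have hf : ∀ x, x ≠ z → ∃ c, (if x = z then [true] else List.replicate (e x) false)
        = List.replicate c false ++ [false] ∧ (if x = z then [true] else List.replicate (e x) false)
        = false :: List.replicate c false := by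
      intro x hx
      obtain ⟨c, hc⟩ := Nat.exists_eq_succ_of_ne_zero (he x).ne'
      refine ⟨c, ?_, ?_⟩
      · rw [if_neg hx, hc, Nat.succ_eq_add_one, List.replicate_succ']
      · rw [if_neg hx, hc, Nat.succ_eq_add_one, List.replicate_succ]
    have hy : y = z := by
      by_contra hc
      obtain ⟨c, -, h2⟩ := hf y hc
      rw [List.flatMap_cons, h2] at e'
      simp at e'
    subst hy
    simp only [List.flatMap_cons, List.flatMap_append, if_true, List.nil_append, List.append_nil,
      List.cons_append, List.cons.injEq, true_and, List.flatMap_nil] at e'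
    have hy' : y' = y := by
      by_contra hc
      obtain ⟨c, h2, -⟩ := hf y' hc
      rw [h2, ← List.append_assoc] at e'
      simpa using (concat_inj e').2
    subst hy'
    rw [if_pos rfl] at e'
    obtain ⟨rfl, -⟩ := concat_inj e'
    exact ⟨y', t₂, y', rfl, rfl, rfl, fun hc => h1 (mem_flatMap_of hc (by simp))⟩

end InnerPower

/-! ### Pairs preserving the words `x ⋯ xy^qx`: sufficient conditions. -/

section BothPower

/-- The condition under which sorted instances of `s` stay sorted. -/
def SortedTransfer (s t : List ℕ) : Prop :=
  (∀ z ∈ s, z ∈ t) ∧ (∀ z ∈ t, z ∈ s) ∧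
  (∀ s₁ s₂, s = s₁ ++ s₂ → s₂ ≠ [] → s₁ ≠ [] → (∀ x ∈ s₁, x ∉ s₂) →
    ∃ t₁ t₂, t = t₁ ++ t₂ ∧ t₂ ≠ [] ∧ (∀ x ∈ t₁, x ∈ s₁) ∧ ∀ x ∈ t₂, x ∈ s₂) ∧
  ∀ s₁ z s₂, s = s₁ ++ z :: s₂ → z ∉ s₁ → z ∉ s₂ → (∀ x ∈ s₁, x ∉ s₂) →
    ∃ t₁ y t₂, t = t₁ ++ y :: t₂ ∧ y = z ∧ (∀ x ∈ t₁, x ∈ s₁) ∧ ∀ x ∈ t₂, x ∈ s₂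

/-- The condition under which instances `x ⋯ xy^qx` of `s` stay such, up to the period. -/
def BothPowerTransfer (Sol : List ℕ → Prop) (s t : List ℕ) : Prop :=
  SortedTransfer s t ∧
  (∀ s' z, s = s' ++ [z] → z ∉ s' → ∃ t' y, t = t' ++ [y] ∧ y = z ∧ z ∉ t') ∧
  (∀ s₁ s₂ z', s = s₁ ++ (s₂ ++ [z']) → z' ∈ s₁ → s₂ ≠ [] → (∀ x ∈ s₁, x ∉ s₂) → Sol s₂ →
    ∃ t₁ t₂ y, t = t₁ ++ (t₂ ++ [y]) ∧ y = z' ∧ t₁ ≠ [] ∧ (∀ x ∈ t₁, x ∈ s₁) ∧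
      ∀ x ∈ t₂, x ∈ s₂) ∧
  ∀ s₁ z s₂ z', s = s₁ ++ z :: (s₂ ++ [z']) → z' ∈ s₁ → z ∉ s₁ → z ∉ s₂ → (∀ x ∈ s₁, x ∉ s₂) →
    ∃ t₁ y t₂ y', t = t₁ ++ y :: (t₂ ++ [y']) ∧ y = z ∧ y' = z' ∧ (∀ x ∈ t₁, x ∈ s₁) ∧
      ∀ x ∈ t₂, x ∈ s₂

variable {k : ℕ} {s t : List ℕ} {φ : ℕ → List Bool} {p r : List Bool} {l : List ℕ}

/-- `z` is the first letter whose image contains a `y`; behind its image no `x` is possible. -/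
lemma isSorted_cases (h : IsSorted (p ++ l.flatMap φ ++ r)) :
    (∀ y ∈ l, false ∉ φ y) ∨ ∃ l₁ z l₂, l = l₁ ++ z :: l₂ ∧ (∀ y ∈ l₁, false ∉ φ y) ∧
      false ∈ φ z ∧ IsSorted (φ z) ∧ (∀ y ∈ l₂, true ∉ φ y) ∧ true ∉ r := by
  by_cases h0 : ∀ y ∈ l, false ∉ φ y
  · exact Or.inl h0
  · right
    push Not at h0
    obtain ⟨l₁, z, l₂, rfl, hz, hl₁⟩ := exists_first h0
    obtain ⟨h1, -, h3⟩ := isSorted_append.mp h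
    obtain ⟨-, h5, -⟩ := isSorted_append.mp h1
    rw [List.flatMap_append, List.flatMap_cons] at h5
    obtain ⟨h6, -, h7⟩ := isSorted_append.mp (isSorted_append.mp h5).2.1
    exact ⟨l₁, z, l₂, rfl, hl₁, hz, h6, notMem_flatMap.mp (h7 hz), h3 (by simp [hz])⟩

lemma isSorted_glue {l₁ l₂ : List ℕ} {w : List Bool} (hp : false ∉ p)
    (h₁ : ∀ y ∈ l₁, false ∉ φ y) (hw : IsSorted w) (h₂ : ∀ y ∈ l₂, true ∉ φ y) (hr : true ∉ r) :
    IsSorted (p ++ (l₁.flatMap φ ++ (w ++ l₂.flatMap φ)) ++ r) := by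
  have h₁' := notMem_flatMap.mpr h₁
  have h₂' := notMem_flatMap.mpr h₂
  simp only [isSorted_append]
  refine ⟨⟨isSorted_of_false_notMem hp, ⟨isSorted_of_false_notMem h₁', ⟨hw,
    isSorted_of_true_notMem h₂', fun _ => h₂'⟩, fun h => absurd h h₁'⟩, fun h => absurd h hp⟩,
    isSorted_of_true_notMem hr, fun _ => hr⟩

/-- The border between `x` and `y` lies in the context, between two letters, or inside the image of
a letter `z`, which then occurs once. Letters on different sides of the border are different, and
the clauses cut `t` at the corresponding place. -/
lemma SortedTransfer.isSorted (h : SortedTransfer s t) (hs : s ≠ []) (ht : t ≠ [])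
    (hφ : ∀ n, φ n ≠ []) (h1 : IsSorted (p ++ s.flatMap φ ++ r))
    (h2 : true ∈ p ++ s.flatMap φ ++ r) (h3 : false ∈ p ++ s.flatMap φ ++ r) :
    IsSorted (p ++ t.flatMap φ ++ r) ∧ true ∈ p ++ t.flatMap φ ++ r ∧
      false ∈ p ++ t.flatMap φ ++ r := by
  obtain ⟨hst, hts, hS, hM⟩ := h
  have hp : true ∈ s.flatMap φ → false ∉ p := fun h hc =>
    (isSorted_append.mp (isSorted_append.mp h1).1).2.2 hc h
  have hpf : ∀ {y}, false ∉ φ y → true ∈ φ y := fun h => mem_of_not_mem (hφ _) h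
  have hpt : ∀ {y}, true ∉ φ y → false ∈ φ y := fun h => mem_of_not_mem (hφ _) h
  rcases isSorted_cases h1 with h0 | ⟨s₁, z, s₂, rfl, hs₁, hz, hzs, hs₂, hr⟩
  · obtain ⟨y, hy⟩ := List.exists_mem_of_ne_nil _ hs
    have hp' := hp (mem_flatMap_of hy (hpf (h0 y hy)))
    have ht' : ∀ y ∈ t, false ∉ φ y := fun y hy => h0 y (hts y hy)
    have hsr := (isSorted_append.mp h1).2.1
    have hfr : false ∈ r := by
      simp only [List.mem_append] at h3
      rcases h3 with (h3 | h3) | h3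
      · exact absurd h3 hp'
      · exact absurd h3 (notMem_flatMap.mpr h0)
      · exact h3
    refine ⟨?_, ?_, by simp [hfr]⟩
    · rw [isSorted_append, isSorted_append]
      refine ⟨⟨isSorted_of_false_notMem hp', isSorted_flatMap_of_false_notMem ht',
        fun h => absurd h hp'⟩, hsr, fun h => ?_⟩
      rw [List.mem_append] at h
      rcases h with h | h
      · exact absurd h hp'
      · exact absurd h (notMem_flatMap.mpr ht')
    · obtain ⟨y, hy⟩ := List.exists_mem_of_ne_nil _ ht
      simp only [List.mem_append]
      exact Or.inl (Or.inr (mem_flatMap_of hy (hpf (ht' y hy))))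
  · have hdisj : ∀ x ∈ s₁, x ∉ s₂ := fun x hx hx' => hs₂ x hx' (hpf (hs₁ x hx))
    have hzs₁ : z ∉ s₁ := fun hc => hs₁ z hc hz
    by_cases hzt : true ∈ φ z
    · obtain ⟨t₁, y, t₂, rfl, rfl, ht₁, ht₂⟩ := hM s₁ z s₂ rfl hzs₁ (fun hc => hs₂ z hc hzt) hdisj
      refine ⟨?_, by simp [hzt], by simp [hz]⟩
      rw [List.flatMap_append, List.flatMap_cons]
      exact isSorted_glue (hp (mem_flatMap_of (z := y) (by simp) hzt))
        (fun x hx => hs₁ x (ht₁ x hx)) hzs (fun x hx => hs₂ x (ht₂ x hx)) hr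
    · have hall : ∀ x ∈ z :: s₂, true ∉ φ x := by simpa using ⟨hzt, hs₂⟩
      by_cases hs₁0 : s₁ = []
      · subst hs₁0
        have ht' : ∀ y ∈ t, true ∉ φ y := fun y hy => hall y (by simpa using hts y hy)
        have hpt' : true ∈ p := by
          simp only [List.nil_append, List.mem_append] at h2
          rcases h2 with (h2 | h2) | h2
          · exact h2
          · exact absurd h2 (notMem_flatMap.mpr hall)
          · exact absurd h2 hr
        refine ⟨?_, by simp [hpt'], ?_⟩
        · rw [isSorted_append, isSorted_append]
          exact ⟨⟨(isSorted_append.mp (isSorted_append.mp h1).1).1,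
            isSorted_of_true_notMem (notMem_flatMap.mpr ht'), fun _ => notMem_flatMap.mpr ht'⟩,
            isSorted_of_true_notMem hr, fun _ => hr⟩
        · obtain ⟨y, hy⟩ := List.exists_mem_of_ne_nil _ ht
          simp only [List.mem_append]
          exact Or.inl (Or.inr (mem_flatMap_of hy (hpt (ht' y hy))))
      · have hdisj' : ∀ x ∈ s₁, x ∉ z :: s₂ := by
          intro x hx
          simp only [List.mem_cons, not_or]
          exact ⟨fun e => hzs₁ (e ▸ hx), hdisj x hx⟩
        obtain ⟨t₁, t₂, rfl, ht₂0, ht₁, ht₂⟩ := hS s₁ (z :: s₂) rfl (by simp) hs₁0 hdisj'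
        obtain ⟨x, hx⟩ := List.exists_mem_of_ne_nil _ hs₁0
        obtain ⟨y, hy⟩ := List.exists_mem_of_ne_nil _ ht₂0
        have hxt : x ∈ t₁ := by
          have := hst x (by simp [hx])
          rw [List.mem_append] at this
          exact this.resolve_right fun hc => hdisj' x hx (ht₂ x hc)
        have hxtrue := hpf (hs₁ x hx)
        refine ⟨?_, ?_, ?_⟩
        · have := isSorted_glue (φ := φ) (w := [])
            (hp (mem_flatMap_of (z := x) (by simp [hx]) hxtrue))
            (fun x hx => hs₁ x (ht₁ x hx)) List.Pairwise.nil (fun x hx => hall x (ht₂ x hx)) hr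
          simpa using this
        · simp only [List.mem_append]
          exact Or.inl (Or.inr (mem_flatMap_of (z := x) (by simp [hxt]) hxtrue))
        · simp only [List.mem_append]
          exact Or.inl (Or.inr (mem_flatMap_of (z := y) (by simp [hy])
            (hpt (hall y (ht₂ y hy)))))

/-- A last letter that occurs nowhere else can be removed on both sides, since every cut extends to
the longer word. This detaches the final `x` from the sorted part. -/
lemma SortedTransfer.of_concat {z : ℕ} (h : SortedTransfer (s ++ [z]) (t ++ [z])) (hs : z ∉ s)
    (ht : z ∉ t) : SortedTransfer s t := by
  obtain ⟨hst, hts, hS, hM⟩ := h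
  have hst' : ∀ x ∈ s, x ∈ t := by
    intro x hx
    have := hst x (by simp [hx])
    simpa [show x ≠ z from fun e => hs (e ▸ hx)] using this
  have hts' : ∀ x ∈ t, x ∈ s := by
    intro x hx
    have := hts x (by simp [hx])
    simpa [show x ≠ z from fun e => ht (e ▸ hx)] using this
  have hsub : ∀ {l l' : List ℕ}, z ∉ l → (∀ x ∈ l, x ∈ l' ++ [z]) → ∀ x ∈ l, x ∈ l' := by
    intro l l' hl h x hx
    simpa [show x ≠ z from fun e => hl (e ▸ hx)] using h x hx
  refine ⟨hst', hts', ?_, ?_⟩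
  · rintro s₁ s₂ rfl h2 h1 hd
    have hz₁ : z ∉ s₁ := fun hc => hs (by simp [hc])
    obtain ⟨t₁, t₂, e, ht₂0, ht₁, ht₂⟩ := hS s₁ (s₂ ++ [z]) (by simp) (by simp) h1 (by
      intro x hx
      simp only [List.mem_append, List.mem_singleton, not_or]
      exact ⟨hd x hx, fun e => hz₁ (e ▸ hx)⟩)
    obtain ⟨t₂, y, rfl⟩ := (List.eq_nil_or_concat' t₂).resolve_left ht₂0
    rw [← List.append_assoc] at e
    obtain ⟨rfl, rfl⟩ := concat_inj e
    have ht₂' := hsub (l := t₂) (l' := s₂) (fun hc => ht (by simp [hc]))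
      fun x hx => ht₂ x (by simp [hx])
    refine ⟨t₁, t₂, rfl, ?_, ht₁, ht₂'⟩
    rintro rfl
    obtain ⟨x, hx⟩ := List.exists_mem_of_ne_nil _ h2
    have h3 := hst' x (by simp [hx])
    rw [List.append_nil] at h3
    exact hd x (ht₁ x h3) hx
  · rintro s₁ y s₂ rfl hy₁ hy₂ hd
    have hz₁ : z ∉ s₁ := fun hc => hs (by simp [hc])
    have hzy : y ≠ z := fun e => hs (by simp [e])
    obtain ⟨t₁, y', t₂, e, rfl, ht₁, ht₂⟩ := hM s₁ y (s₂ ++ [z]) (by simp) hy₁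
      (by simp [hy₂, hzy]) (by
      intro x hx
      simp only [List.mem_append, List.mem_singleton, not_or]
      exact ⟨hd x hx, fun e => hz₁ (e ▸ hx)⟩)
    rcases List.eq_nil_or_concat' t₂ with rfl | ⟨t₂, x, rfl⟩
    · exact absurd (concat_inj e).2.symm hzy
    · rw [← List.cons_append, ← List.append_assoc] at e
      obtain ⟨rfl, rfl⟩ := concat_inj e
      exact ⟨t₁, y', t₂, rfl, rfl, ht₁, hsub (fun hc => ht (by simp [hc]))
        fun x hx => ht₂ x (by simp [hx])⟩

/-- The final `x` comes from the context, from a last letter occurring once, or from one that occurs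
earlier as well. In the last case its image is `x` alone; `Solvable` is needed if the border lies
between two letters, where only whole images contribute `y`. -/
lemma BothPowerTransfer.transfers (hk : 0 < k) (h : BothPowerTransfer (Solvable k) s t)
    (hper : SamePeriod k s t) (hs : 2 ≤ s.length) (ht : 2 ≤ t.length) :
    Transfers (bothPowerWords k) s t := by
  obtain ⟨hsort, hlast, hTS, hTM⟩ := h
  intro φ hφ p r hw
  rw [mem_bothPowerWords] at hw ⊢
  obtain ⟨w, e, h1, h2, h3, h4⟩ := hw
  have h4' : (p ++ t.flatMap φ ++ r).count false ≡ 1 [MOD k] := by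
    refine (hper.count_context φ p r false).symm.trans ?_
    rw [e]
    simpa using h4
  suffices h : ∃ w', p ++ t.flatMap φ ++ r = w' ++ [true] ∧ IsSorted w' ∧ true ∈ w' ∧ false ∈ w' by
    obtain ⟨w', e1, e2, e3, e4⟩ := h
    refine ⟨w', e1, e2, e3, e4, ?_⟩
    rw [e1] at h4'
    simpa using h4'
  have hs0 : s ≠ [] := by rintro rfl; simp at hs
  have ht0 : t ≠ [] := by rintro rfl; simp at ht
  rcases List.eq_nil_or_concat' r with rfl | ⟨r, c, rfl⟩
  · obtain ⟨s₀, z', rfl⟩ := (List.eq_nil_or_concat' s).resolve_left hs0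
    obtain ⟨ζ, c, hζ⟩ := (List.eq_nil_or_concat' (φ z')).resolve_left (hφ z')
    have e' : p ++ s₀.flatMap φ ++ ζ = w ∧ c = true := by
      refine concat_inj ?_
      rw [← e]
      simp [hζ]
    obtain ⟨rfl, rfl⟩ := e'
    have hs₀ : s₀ ≠ [] := by rintro rfl; simp at hs
    by_cases hz' : z' ∈ s₀
    · have hp : true ∈ s₀.flatMap φ → false ∉ p := fun h hc =>
        (isSorted_append.mp (isSorted_append.mp h1).1).2.2 hc h
      have hp' := hp (mem_flatMap_of hz' (by simp [hζ]))
      rcases isSorted_cases h1 with h0 | ⟨s₁, z, s₂, rfl, hs₁, hz, hzs, hs₂, hr⟩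
      · exfalso
        have h5 := h0 z' hz'
        rw [hζ] at h5
        simp only [List.mem_append] at h3
        rcases h3 with (h3 | h3) | h3
        · exact hp' h3
        · exact notMem_flatMap.mpr h0 h3
        · simp [h3] at h5
      · have hz's : z' ∈ s₁ := by
          simp only [List.mem_append, List.mem_cons] at hz'
          rcases hz' with h | rfl | h
          · exact h
          · exfalso
            rw [hζ] at hz hzs
            exact not_isSorted_of_append_true hzs (by simpa using hz)
          · exact absurd (by simp [hζ]) (hs₂ z' h)
        -- The earlier occurrence of `z'` forbids `y` in its image, the occurrence at the end
        -- forbids `x` before the final one.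
        have hζ0 : ζ = [] := by
          by_contra hne
          have h5 := hs₁ z' hz's
          rw [hζ] at h5
          exact h5 (by simp [show false ∈ ζ from mem_of_not_mem hne hr])
        subst hζ0
        rw [List.nil_append] at hζ
        have hdisj : ∀ x ∈ s₁, x ∉ s₂ := fun x hx hx' =>
          hs₂ x hx' (mem_of_not_mem (hφ x) (hs₁ x hx))
        have hzs₁ : z ∉ s₁ := fun hc => hs₁ z hc hz
        by_cases hzt : true ∈ φ z
        · obtain ⟨t₁, y, t₂, y', rfl, rfl, rfl, ht₁, ht₂⟩ := hTM s₁ z s₂ z' (by simp) hz's hzs₁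
            (fun hc => hs₂ z hc hzt) hdisj
          refine ⟨p ++ (t₁.flatMap φ ++ (φ y ++ t₂.flatMap φ)) ++ [], by simp [hζ], ?_, ?_, ?_⟩
          · exact isSorted_glue hp' (fun x hx => hs₁ x (ht₁ x hx)) hzs
              (fun x hx => hs₂ x (ht₂ x hx)) (by simp)
          · simp [hzt]
          · simp [hz]
        · have hall : ∀ x ∈ z :: s₂, true ∉ φ x := by simpa using ⟨hzt, hs₂⟩
          have hdisj' : ∀ x ∈ s₁, x ∉ z :: s₂ := by
            intro x hx
            simp only [List.mem_cons, not_or]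
            exact ⟨fun e => hzs₁ (e ▸ hx), hdisj x hx⟩
          have hsol : Solvable k (z :: s₂) := by
            refine (solvable_iff hk).mpr ⟨fun n => (φ n).length,
              fun n => List.length_pos_of_ne_nil (hφ n), ?_⟩
            rw [← count_flatMap_of_true_notMem hall]
            simpa only [List.append_nil, List.flatMap_append, List.count_append,
              List.count_eq_zero.mpr hp', count_flatMap_eq_zero.mpr hs₁, zero_add] using h4
          obtain ⟨t₁, t₂, y, rfl, rfl, ht₁0, ht₁, ht₂⟩ := hTS s₁ (z :: s₂) z' (by simp) hz's
            (by simp) hdisj' hsol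
          obtain ⟨x, hx⟩ := List.exists_mem_of_ne_nil _ ht₁0
          have hzt₂ : z ∈ t₂ := by
            have h5 := hsort.1 z (by simp)
            simp only [List.mem_append, List.mem_singleton] at h5
            rcases h5 with h5 | h5 | rfl
            · exact absurd (ht₁ z h5) hzs₁
            · exact h5
            · exact absurd hz's hzs₁
          refine ⟨p ++ (t₁.flatMap φ ++ ([] ++ t₂.flatMap φ)) ++ [], by simp [hζ], ?_, ?_, ?_⟩
          · exact isSorted_glue hp' (fun x hx => hs₁ x (ht₁ x hx)) List.Pairwise.nil
              (fun x hx => hall x (ht₂ x hx)) (by simp)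
          · simp only [List.mem_append]
            exact Or.inl (Or.inr (Or.inl (mem_flatMap_of hx
              (mem_of_not_mem (hφ x) (hs₁ x (ht₁ x hx))))))
          · simp only [List.mem_append]
            exact Or.inl (Or.inr (Or.inr (Or.inr (mem_flatMap_of hzt₂ hz))))
    · obtain ⟨t', y, rfl, rfl, ht'⟩ := hlast s₀ z' rfl hz'
      have ht₀ : t' ≠ [] := by rintro rfl; simp at ht
      exact ⟨p ++ t'.flatMap φ ++ ζ, by simp [hζ],
        (hsort.of_concat hz' ht').isSorted hs₀ ht₀ hφ h1 h2 h3⟩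
  · rw [← List.append_assoc] at e
    obtain ⟨rfl, rfl⟩ := concat_inj e
    exact ⟨p ++ t.flatMap φ ++ r, by simp, hsort.isSorted hs0 ht0 hφ h1 h2 h3⟩

/-- The cut is made before the first letter outside `A`: its image contains `y`, so no letter with
an `x` can follow. -/
lemma exists_append_of_isSorted {A : ℕ → Prop} (hA : ∀ y ∈ l, A y → true ∈ φ y)
    (hA' : ∀ y ∈ l, ¬ A y → false ∈ φ y) (h : IsSorted (l.flatMap φ)) :
    ∃ l₁ l₂, l = l₁ ++ l₂ ∧ (∀ y ∈ l₁, A y) ∧ ∀ y ∈ l₂, ¬ A y := by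
  by_cases h0 : ∀ y ∈ l, A y
  · exact ⟨l, [], by simp, h0, by simp⟩
  · push Not at h0
    obtain ⟨l₁, z, l₂, rfl, hz, hl₁⟩ := exists_first h0
    refine ⟨l₁, z :: l₂, rfl, by simpa using hl₁, fun y hy hAy => ?_⟩
    rcases List.mem_cons.mp hy with rfl | hy
    · exact hz hAy
    · rw [List.flatMap_append, List.flatMap_cons] at h
      exact (isSorted_append.mp (isSorted_append.mp h).2.1).2.2 (hA' z (by simp) hz)
        (mem_flatMap_of hy (hA y (by simp [hy]) hAy))

lemma notMem_of_isSorted_around {l₁ l₂ : List ℕ} {z : ℕ} (ht : true ∈ φ z) (hf : false ∈ φ z)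
    (h : IsSorted ((l₁ ++ z :: l₂).flatMap φ)) :
    (∀ y ∈ l₁, false ∉ φ y) ∧ ∀ y ∈ l₂, true ∉ φ y := by
  rw [List.flatMap_append, List.flatMap_cons] at h
  obtain ⟨-, h2, h3⟩ := isSorted_append.mp h
  refine ⟨fun y hy hc => h3 (mem_flatMap_of hy hc) (by simp [ht]), fun y hy hc => ?_⟩
  exact (isSorted_append.mp h2).2.2 hf (mem_flatMap_of hy hc)

end BothPower

/-! ### Pairs preserving the words `x ⋯ xy^qx`: necessity. -/

section BothPowerConverse

variable {k : ℕ} {s t : List ℕ} {φ : ℕ → List Bool}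

lemma flatMap_eq_replicate {l : List ℕ} {e : ℕ → ℕ} {b : Bool}
    (h : ∀ y ∈ l, φ y = List.replicate (e y) b) : l.flatMap φ = List.replicate (l.map e).sum b := by
  rw [← flatMap_replicate]
  exact List.flatMap_congr h

lemma flatMap_eq_replicate_length {l : List ℕ} {b : Bool} (h : ∀ y ∈ l, φ y = [b]) :
    l.flatMap φ = List.replicate l.length b := by
  rw [flatMap_eq_replicate (e := fun _ => 1) h]
  simp

lemma isSorted_blocks {w : List Bool} {a b : ℕ} (hw : IsSorted w) :
    IsSorted (List.replicate a true ++ w ++ List.replicate b false) := by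
  rw [isSorted_append, isSorted_append]
  exact ⟨⟨isSorted_of_false_notMem (by simp), hw, by simp⟩, isSorted_of_true_notMem (by simp),
    by simp⟩

/-- A letter outside `s` is mapped to `yx`, which is not a factor of a sorted word; the extra `yx`
of the context keeps it away from the final `x`. -/
lemma mem_of_transfers_bothPowerWords (h : Transfers (bothPowerWords k) s t) :
    ∀ z ∈ t, z ∈ s := by
  intro z hz
  by_contra hc
  have h1 := h (fun n => if n ∈ s then [true] else [false, true])
    (fun n => by by_cases hn : n ∈ s <;> simp [hn]) [true] [false, true] (by
      rw [flatMap_eq_replicate_length (b := true) fun y hy => by simp [hy], mem_bothPowerWords]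
      refine ⟨[true] ++ List.replicate s.length true ++ List.replicate 1 false, by simp,
        isSorted_blocks (a := 1) (isSorted_of_false_notMem (by simp)), by simp, by simp, ?_⟩
      simp [List.count_replicate]
      rfl)
  rw [mem_bothPowerWords] at h1
  obtain ⟨w, e, h1, -⟩ := h1
  obtain ⟨t₁, t₂, rfl⟩ := List.append_of_mem hz
  rw [show [false, true] = [false] ++ [true] from rfl, ← List.append_assoc] at e
  obtain ⟨rfl, -⟩ := concat_inj e
  rw [List.flatMap_append, List.flatMap_cons, if_neg hc] at h1
  have h2 := (isSorted_append.mp (isSorted_append.mp (isSorted_append.mp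
    (isSorted_append.mp h1).1).2.1).2.1).1
  exact not_isSorted_of_append_true (w := [false]) h2 (by simp)

/-- If all letters are mapped to blocks of `y` and the context supplies the `x`, only the congruence
is tested. -/
lemma samePeriod_of_transfers_bothPowerWords (hk : 0 < k) (h : Transfers (bothPowerWords k) s t) :
    SamePeriod k s t := by
  refine samePeriod_of_forall_sum fun e he => ?_
  have h1 := h (fun n => List.replicate (e n) false) (fun n => by simpa using (he n).ne')
    (true :: List.replicate (1 + (k - 1) * (s.map e).sum) false) [true] (by
      rw [flatMap_replicate, mem_bothPowerWords]
      refine ⟨List.replicate 1 true ++ [] ++ List.replicate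
        (1 + (k - 1) * (s.map e).sum + (s.map e).sum) false,
        by simp [List.replicate_append_replicate], isSorted_blocks List.Pairwise.nil, by simp,
        ?_, by simpa using complement_modEq hk (s.map e).sum⟩
      simp)
  rw [flatMap_replicate, mem_bothPowerWords] at h1
  obtain ⟨w, e', -, -, -, h1⟩ := h1
  obtain ⟨rfl, -⟩ := concat_inj e'
  have h2 : 1 + (k - 1) * (s.map e).sum + (t.map e).sum ≡ 1 [MOD k] := by simpa using h1
  exact Nat.ModEq.add_left_cancel' _ ((complement_modEq hk _).trans h2.symm)

/-- Letters of `A` other than `z` are doubled: at the end they would leave an `x` behind the `y` of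
`w`. Letters outside `A` end in `y`. So only `z` can supply the final `x`. -/
lemma last_of_isSorted {l : List ℕ} {y z : ℕ} {w : List Bool} {A : ℕ → Prop}
    (hz : φ z = [true]) (hA : ∀ x, A x → x ≠ z → φ x = [true, true])
    (hA' : ∀ x, ¬ A x → ∃ v, φ x = v ++ [false]) (hw : IsSorted w) (hf : false ∈ w)
    (e : (l ++ [y]).flatMap φ = w ++ [true]) : y = z ∧ w = l.flatMap φ := by
  simp only [List.flatMap_append, List.flatMap_cons, List.flatMap_nil, List.append_nil] at e
  by_cases hy : A y
  · by_cases hyz : y = z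
    · subst hyz
      rw [hz] at e
      exact ⟨rfl, (concat_inj e).1.symm⟩
    · rw [hA y hy hyz, show [true, true] = [true] ++ [true] from rfl, ← List.append_assoc] at e
      obtain ⟨rfl, -⟩ := concat_inj e
      exfalso
      have := not_isSorted_of_append_true hw
      simp [this] at hf
  · obtain ⟨v, hv⟩ := hA' y hy
    rw [hv, ← List.append_assoc] at e
    simpa using (concat_inj e).2

/-- A cut between letters is tested with `x` before it and `y` behind it, a cut at `z` with `z ↦
xy`; the context adjusts the number of `y`. -/
lemma sortedTransfer_of_transfers (hk : 0 < k) (h : Transfers (bothPowerWords k) s t)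
    (h' : Transfers (bothPowerWords k) t s) : SortedTransfer s t := by
  have hst := mem_of_transfers_bothPowerWords h'
  have hts := mem_of_transfers_bothPowerWords h
  refine ⟨hst, hts, ?_, ?_⟩
  · rintro s₁ s₂ rfl hs₂ hs₁ hd
    have e₁ : s₁.flatMap (fun n => if n ∈ s₁ then [true] else [false])
        = List.replicate s₁.length true := flatMap_eq_replicate_length fun y hy => by simp [hy]
    have e₂ : s₂.flatMap (fun n => if n ∈ s₁ then [true] else [false])
        = List.replicate s₂.length false := flatMap_eq_replicate_length fun y hy => by
      simp [show y ∉ s₁ from fun hc => hd y hc hy]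
    have h1 := h (fun n => if n ∈ s₁ then [true] else [false])
      (fun n => by by_cases hn : n ∈ s₁ <;> simp [hn]) []
      (List.replicate (1 + (k - 1) * s₂.length) false ++ [true]) (by
        rw [List.flatMap_append, e₁, e₂, mem_bothPowerWords]
        refine ⟨List.replicate s₁.length true ++ [] ++ List.replicate
          (s₂.length + (1 + (k - 1) * s₂.length)) false,
          by simp [← List.replicate_append_replicate], isSorted_blocks List.Pairwise.nil, by simp [hs₁],
          by simp, ?_⟩
        rw [add_comm]
        simpa [List.count_replicate] using complement_modEq hk s₂.length)
    rw [mem_bothPowerWords] at h1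
    obtain ⟨w, e, h1, -⟩ := h1
    rw [← List.append_assoc] at e
    obtain ⟨rfl, -⟩ := concat_inj e
    obtain ⟨t₁, t₂, rfl, ht₁, ht₂⟩ := exists_append_of_isSorted (A := fun n => n ∈ s₁)
      (fun y _ hy => by simp [hy]) (fun y _ hy => by simp [hy]) (isSorted_append.mp h1).1
    refine ⟨t₁, t₂, rfl, ?_, ht₁, fun x hx => ?_⟩
    · rintro rfl
      obtain ⟨x, hx⟩ := List.exists_mem_of_ne_nil _ hs₂
      exact hd x (ht₁ x (by simpa using hst x (by simp [hx]))) hx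
    · have := hts x (by simp [hx])
      simpa [ht₂ x hx] using this
  · rintro s₁ z s₂ rfl hz₁ hz₂ hd
    set φ : ℕ → List Bool := fun n => if n ∈ s₁ then [true] else
      if n = z then [true, false] else [false] with hφ
    have hφz : φ z = [true, false] := by simp [hφ, hz₁]
    have e₁ : s₁.flatMap φ = List.replicate s₁.length true :=
      flatMap_eq_replicate_length fun y hy => by simp [hφ, hy]
    have e₂ : s₂.flatMap φ = List.replicate s₂.length false :=
      flatMap_eq_replicate_length fun y hy => by
        simp [hφ, show y ∉ s₁ from fun hc => hd y hc hy, show y ≠ z from fun e => hz₂ (e ▸ hy)]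
    have h1 := h φ (fun n => by by_cases hn : n ∈ s₁ <;> by_cases hn' : n = z <;>
        simp [hφ, hn, hn', hz₁]) [] (List.replicate ((k - 1) * s₂.length) false ++ [true]) (by
        rw [List.flatMap_append, List.flatMap_cons, e₁, e₂, hφz, mem_bothPowerWords]
        refine ⟨List.replicate s₁.length true ++ [true, false] ++ List.replicate
          (s₂.length + (k - 1) * s₂.length) false,
          by simp [← List.replicate_append_replicate], isSorted_blocks (by simp [IsSorted]), by simp,
          by simp, ?_⟩
        have := complement_modEq hk s₂.length
        rw [show 1 + (k - 1) * s₂.length + s₂.length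
          = s₂.length + (k - 1) * s₂.length + 1 by ring] at this
        simpa [List.count_replicate, add_comm, add_left_comm] using this)
    rw [mem_bothPowerWords] at h1
    obtain ⟨w, e, h1, -⟩ := h1
    rw [← List.append_assoc] at e
    obtain ⟨rfl, -⟩ := concat_inj e
    obtain ⟨t₁, t₂, rfl⟩ := List.append_of_mem (hst z (by simp))
    obtain ⟨ht₁, ht₂⟩ := notMem_of_isSorted_around (by simp [hφz]) (by simp [hφz])
      (isSorted_append.mp h1).1
    refine ⟨t₁, z, t₂, rfl, rfl, fun x hx => ?_, fun x hx => ?_⟩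
    · by_contra hc
      have := ht₁ x hx
      by_cases hxz : x = z <;> simp [hφ, hc, hxz, hz₁] at this
    · have h2 := ht₂ x hx
      have h3 : x ∉ s₁ := fun hc => by simp [hφ, hc] at h2
      have h4 : x ≠ z := by
        rintro rfl
        simp [hφz] at h2
      simpa [h3, h4] using hts x (by simp [hx])

/-- In the three clauses about the last letter, the number of `y` is adjusted by the context, by the
lengths from `solvable_iff`, and by the image of `z`, respectively. -/
lemma bothPowerTransfer_of_transfers (hk : 0 < k) (ht : t ≠ [])
    (h : Transfers (bothPowerWords k) s t) (h' : Transfers (bothPowerWords k) t s) :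
    SamePeriod k s t ∧ BothPowerTransfer (Solvable k) s t := by
  have hst := mem_of_transfers_bothPowerWords h'
  have hts := mem_of_transfers_bothPowerWords h
  refine ⟨samePeriod_of_transfers_bothPowerWords hk h, sortedTransfer_of_transfers hk h h',
    ?_, ?_, ?_⟩
  · rintro s' z rfl hz
    have e₁ : s'.flatMap (fun n => if n = z then [true] else [false])
        = List.replicate s'.length false := flatMap_eq_replicate_length fun y hy => by
      simp [show y ≠ z from fun e => hz (e ▸ hy)]
    have h1 := h (fun n => if n = z then [true] else [false])
      (fun n => by by_cases hn : n = z <;> simp [hn])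
      (true :: List.replicate (1 + (k - 1) * s'.length) false) [] (by
        rw [List.flatMap_append, e₁, mem_bothPowerWords]
        refine ⟨List.replicate 1 true ++ [] ++ List.replicate
          (1 + (k - 1) * s'.length + s'.length) false,
          by simp [← List.replicate_append_replicate], isSorted_blocks List.Pairwise.nil, by simp,
          by simp, ?_⟩
        simpa [List.count_replicate] using complement_modEq hk s'.length)
    rw [mem_bothPowerWords] at h1
    obtain ⟨w, e, h1, -⟩ := h1
    obtain ⟨t', y, rfl⟩ := (List.eq_nil_or_concat' t).resolve_left ht
    simp only [List.flatMap_append, List.flatMap_cons, List.flatMap_nil, List.append_nil,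
      ← List.append_assoc] at e
    by_cases hy : y = z
    · subst hy
      rw [if_pos rfl] at e
      obtain ⟨rfl, -⟩ := concat_inj e
      exact ⟨t', y, rfl, rfl, fun hc => (isSorted_append.mp h1).2.2 (by simp)
        (mem_flatMap_of hc (by simp))⟩
    · rw [if_neg hy] at e
      simpa using (concat_inj e).2
  · rintro s₁ s₂ z rfl hz hs₂ hd hsol
    obtain ⟨e, he, hsum⟩ := (solvable_iff hk).mp hsol
    set φ : ℕ → List Bool := fun n => if n = z then [true] else
      if n ∈ s₁ then [true, true] else List.replicate (e n) false with hφ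
    have hφz : φ z = [true] := by simp [hφ]
    have hφ₁ : ∀ x ∈ s₁, x ≠ z → φ x = [true, true] := fun x hx hxz => by simp [hφ, hx, hxz]
    have hφ₂ : ∀ x ∉ s₁, φ x = List.replicate (e x) false := fun x hx => by
      simp [hφ, hx, show x ≠ z from fun e => hx (e ▸ hz)]
    have hφn : ∀ n, φ n ≠ [] := by
      intro n
      by_cases hn : n ∈ s₁
      · by_cases hn' : n = z <;> simp [hφ, hn, hn']
      · rw [hφ₂ n hn]
        simpa using (he n).ne'
    have hf₁ : ∀ x ∈ s₁, false ∉ φ x := fun x hx => by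
      by_cases hxz : x = z
      · simp [hxz, hφz]
      · simp [hφ₁ x hx hxz]
    have e₂ : s₂.flatMap φ = List.replicate (s₂.map e).sum false :=
      flatMap_eq_replicate fun y hy => hφ₂ y fun hc => hd y hc hy
    have hpos : (s₂.map e).sum ≠ 0 := by
      have := flatMap_ne_nil hφn hs₂
      rw [e₂] at this
      simpa using this
    have h1 := h φ hφn [] [] (by
      rw [List.flatMap_append, List.flatMap_append, e₂, mem_bothPowerWords]
      refine ⟨s₁.flatMap φ ++ List.replicate (s₂.map e).sum false, by simp [hφz], ?_, ?_, ?_, ?_⟩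
      · rw [isSorted_append]
        exact ⟨isSorted_of_false_notMem (notMem_flatMap.mpr hf₁),
          isSorted_of_true_notMem (by simp), by simp⟩
      · rw [List.mem_append]
        exact Or.inl (mem_flatMap_of hz (by simp [hφz]))
      · rw [List.mem_append]
        exact Or.inr (by simpa using hpos)
      · simpa [count_flatMap_eq_zero.mpr hf₁] using hsum)
    rw [mem_bothPowerWords] at h1
    obtain ⟨w, e', h1, h2, h3, -⟩ := h1
    obtain ⟨t₀, y, rfl⟩ := (List.eq_nil_or_concat' t).resolve_left ht
    rw [List.nil_append, List.append_nil] at e'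
    obtain ⟨rfl, rfl⟩ := last_of_isSorted (A := fun n => n ∈ s₁) hφz hφ₁ (fun x hx => by
      obtain ⟨c, hc⟩ := Nat.exists_eq_succ_of_ne_zero (he x).ne'
      exact ⟨List.replicate c false, by rw [hφ₂ x hx, hc, Nat.succ_eq_add_one,
        List.replicate_succ']⟩) h1 h3 e'
    have hA' : ∀ x ∉ s₁, φ x = List.replicate (e x) false ∧ false ∈ φ x ∧ true ∉ φ x := by
      intro x hx
      have := (he x).ne'
      simp [hφ₂ x hx, this]
    obtain ⟨t₁, t₂, rfl, ht₁, ht₂⟩ := exists_append_of_isSorted (A := fun n => n ∈ s₁)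
      (fun x _ hx => mem_of_not_mem (hφn x) (hf₁ x hx)) (fun x _ hx => (hA' x hx).2.1) h1
    refine ⟨t₁, t₂, y, by simp, rfl, ?_, ht₁, fun x hx => ?_⟩
    · rintro rfl
      exact notMem_flatMap.mpr (fun x hx => (hA' x (ht₂ x (by simpa using hx))).2.2) h2
    · have h4 := hts x (by simp [hx])
      have h5 := ht₂ x hx
      simpa [h5, show x ≠ y from fun e => h5 (e ▸ hz)] using h4
  · rintro s₁ z s₂ z' rfl hz' hz₁ hz₂ hd
    have hzz : z ≠ z' := fun e => hz₁ (e ▸ hz')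
    set φ : ℕ → List Bool := fun n => if n = z' then [true] else
      if n ∈ s₁ then [true, true] else
      if n = z then true :: List.replicate (1 + (k - 1) * s₂.length) false else [false] with hφ
    have hφz' : φ z' = [true] := by simp [hφ]
    have hφz : φ z = true :: List.replicate (1 + (k - 1) * s₂.length) false := by
      simp [hφ, hz₁, hzz]
    have hφ₁ : ∀ x ∈ s₁, x ≠ z' → φ x = [true, true] := fun x hx hxz => by simp [hφ, hx, hxz]
    have hφ₂ : ∀ x ∉ s₁, x ≠ z → φ x = [false] := fun x hx hxz => by
      simp [hφ, hx, hxz, show x ≠ z' from fun e => hx (e ▸ hz')]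
    have hφn : ∀ n, φ n ≠ [] := by
      intro n
      by_cases hn : n ∈ s₁
      · by_cases hn' : n = z' <;> simp [hφ, hn, hn']
      · by_cases hn' : n = z
        · simp [hn', hφz]
        · simp [hφ₂ n hn hn']
    have hf₁ : ∀ x ∈ s₁, false ∉ φ x := fun x hx => by
      by_cases hxz : x = z'
      · simp [hxz, hφz']
      · simp [hφ₁ x hx hxz]
    have hf₂ : ∀ x ∉ s₁, false ∈ φ x := fun x hx => by
      by_cases hxz : x = z
      · simp [hxz, hφz]
      · simp [hφ₂ x hx hxz]
    have e₂ : s₂.flatMap φ = List.replicate s₂.length false :=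
      flatMap_eq_replicate_length fun y hy => hφ₂ y (fun hc => hd y hc hy) fun e => hz₂ (e ▸ hy)
    have h1 := h φ hφn [] [] (by
      rw [List.flatMap_append, List.flatMap_cons, List.flatMap_append, e₂, hφz, mem_bothPowerWords]
      refine ⟨s₁.flatMap φ ++ (List.replicate 1 true ++ [] ++
        List.replicate (1 + (k - 1) * s₂.length + s₂.length) false),
        by simp [hφz', ← List.replicate_append_replicate], ?_, ?_, ?_, ?_⟩
      · rw [isSorted_append]
        exact ⟨isSorted_of_false_notMem (notMem_flatMap.mpr hf₁),
          isSorted_blocks List.Pairwise.nil, fun hc => absurd hc (notMem_flatMap.mpr hf₁)⟩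
      · simp
      · simp
      · simpa [count_flatMap_eq_zero.mpr hf₁] using complement_modEq hk s₂.length)
    rw [mem_bothPowerWords] at h1
    obtain ⟨w, e', h1, h2, h3, -⟩ := h1
    obtain ⟨t₀, y, rfl⟩ := (List.eq_nil_or_concat' t).resolve_left ht
    rw [List.nil_append, List.append_nil] at e'
    obtain ⟨rfl, rfl⟩ := last_of_isSorted (A := fun n => n ∈ s₁) hφz' hφ₁ (fun x hx => by
      by_cases hxz : x = z
      · exact ⟨true :: List.replicate ((k - 1) * s₂.length) false, by
          rw [hxz, hφz, add_comm, List.replicate_succ', List.cons_append]⟩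
      · exact ⟨[], hφ₂ x hx hxz⟩) h1 h3 e'
    have hzt : z ∈ t₀ := by simpa [hzz] using hst z (by simp)
    obtain ⟨t₁, t₂, rfl⟩ := List.append_of_mem hzt
    obtain ⟨ht₁, ht₂⟩ := notMem_of_isSorted_around (by simp [hφz]) (by simp [hφz]) h1
    refine ⟨t₁, z, t₂, y, by simp, rfl, rfl, fun x hx => ?_, fun x hx => ?_⟩
    · by_contra hc
      exact ht₁ x hx (hf₂ x hc)
    · have h5 : x ∉ s₁ := fun hc => ht₂ x hx (mem_of_not_mem (hφn x) (hf₁ x hc))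
      have h6 : x ≠ z := by
        rintro rfl
        exact ht₂ x hx (by simp [hφz])
      simpa [h5, h6, show x ≠ y from fun e => h5 (e ▸ hz')] using hts x (by simp [hx])

end BothPowerConverse

/-! ### Definability of the transfer conditions. -/

namespace Context

variable {α β : Type} {C : Context α} {C' : Context β} {s t : α → List ℕ}

lemma Extends.refl (C : Context α) : C.Extends C id := ⟨id, fun _ => ⟨rfl, fun _ => rfl⟩⟩

lemma IsWord.nil (hs : C.IsWord s) : C.IsWord fun _ => [] := by
  obtain ⟨pos, rev, h1, -, -, h4⟩ := hs
  exact ⟨pos, rev, fun a => (Nat.zero_le _).trans_lt (h1 a), by simp, by simp,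
    (h4.and h4.not).congr fun p => by simp⟩

lemma IsWord.exists_cons (hs : C.IsWord s) {P : α → ℕ → List ℕ → Prop}
    (hP : ∀ (β : Type) (C' : Context β) (f : β → α) (z : β → ℕ) (s' : β → List ℕ),
      C'.Extends C f → C'.IsLetter z → C'.IsWord s' → C'.Definable fun b => P (f b) (z b) (s' b)) :
    C.Definable fun a => ∃ z s', s a = z :: s' ∧ P a z s' := by
  refine (hs.exists_split (P := fun a s₁ z s' => s₁ = [] ∧ P a z s')
    fun β C' f s₁ z s' hf h1 hz h2 _ => h1.eq_nil.and (hP β C' f z s' hf hz h2)).congr fun a => ?_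
  constructor
  · rintro ⟨_, z, s', e, rfl, h⟩
    exact ⟨z, s', e, h⟩
  · rintro ⟨z, s', e, h⟩
    exact ⟨[], z, s', e, rfl, h⟩

lemma IsWord.exists_concat (hs : C.IsWord s) {P : α → List ℕ → ℕ → Prop}
    (hP : ∀ (β : Type) (C' : Context β) (f : β → α) (s' : β → List ℕ) (z : β → ℕ),
      C'.Extends C f → C'.IsWord s' → C'.IsLetter z → C'.Definable fun b => P (f b) (s' b) (z b)) :
    C.Definable fun a => ∃ s' z, s a = s' ++ [z] ∧ P a s' z := by
  refine (hs.exists_split (P := fun a s' z s₂ => s₂ = [] ∧ P a s' z)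
    fun β C' f s' z s₂ hf h1 hz h2 _ => h2.eq_nil.and (hP β C' f s' z hf h1 hz)).congr fun a => ?_
  constructor
  · rintro ⟨s', z, _, e, rfl, h⟩
    exact ⟨s', z, e, h⟩
  · rintro ⟨s', z, e, h⟩
    exact ⟨s', z, [], e, rfl, h⟩

/-- A cut lies either before a letter or at the end of the word. -/
lemma IsWord.exists_append (hs : C.IsWord s) {P : α → List ℕ → List ℕ → Prop}
    (hP : ∀ (β : Type) (C' : Context β) (f : β → α) (s₁ s₂ : β → List ℕ),
      C'.Extends C f → C'.IsWord s₁ → C'.IsWord s₂ → C'.Definable fun b => P (f b) (s₁ b) (s₂ b)) :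
    C.Definable fun a => ∃ s₁ s₂, s a = s₁ ++ s₂ ∧ P a s₁ s₂ := by
  refine ((hs.exists_split (P := fun a s₁ z s₂ => P a s₁ (z :: s₂))
    fun β C' f s₁ z s₂ hf h1 _ _ h2 => hP β C' f s₁ _ hf h1 h2).or
    (hP α C id s _ (Extends.refl C) hs hs.nil)).congr fun a => ?_
  constructor
  · rintro (⟨s₁, z, s₂, e, h⟩ | h)
    · exact ⟨s₁, z :: s₂, e, h⟩
    · exact ⟨s a, [], by simp, h⟩
  · rintro ⟨s₁, s₂, e, h⟩
    rcases s₂ with - | ⟨z, s₂⟩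
    · right
      rw [List.append_nil] at e
      rw [id, e]
      exact h
    · exact Or.inl ⟨s₁, z, s₂, e, h⟩

lemma IsWord.forall_cons (hs : C.IsWord s) {P : α → ℕ → List ℕ → Prop}
    (hP : ∀ (β : Type) (C' : Context β) (f : β → α) (z : β → ℕ) (s' : β → List ℕ),
      C'.Extends C f → C'.IsLetter z → C'.IsWord s' → C'.Definable fun b => P (f b) (z b) (s' b)) :
    C.Definable fun a => ∀ z s', s a = z :: s' → P a z s' :=
  (hs.exists_cons (P := fun a z s' => ¬ P a z s') fun β C' f z s' hf hz h =>
    (hP β C' f z s' hf hz h).not).not.congr fun a => by push Not; rfl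

lemma IsWord.forall_concat (hs : C.IsWord s) {P : α → List ℕ → ℕ → Prop}
    (hP : ∀ (β : Type) (C' : Context β) (f : β → α) (s' : β → List ℕ) (z : β → ℕ),
      C'.Extends C f → C'.IsWord s' → C'.IsLetter z → C'.Definable fun b => P (f b) (s' b) (z b)) :
    C.Definable fun a => ∀ s' z, s a = s' ++ [z] → P a s' z :=
  (hs.exists_concat (P := fun a s' z => ¬ P a s' z) fun β C' f s' z hf h hz =>
    (hP β C' f s' z hf h hz).not).not.congr fun a => by push Not; rfl

lemma IsWord.forall_append (hs : C.IsWord s) {P : α → List ℕ → List ℕ → Prop}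
    (hP : ∀ (β : Type) (C' : Context β) (f : β → α) (s₁ s₂ : β → List ℕ),
      C'.Extends C f → C'.IsWord s₁ → C'.IsWord s₂ → C'.Definable fun b => P (f b) (s₁ b) (s₂ b)) :
    C.Definable fun a => ∀ s₁ s₂, s a = s₁ ++ s₂ → P a s₁ s₂ :=
  (hs.exists_append (P := fun a s₁ s₂ => ¬ P a s₁ s₂) fun β C' f s₁ s₂ hf h1 h2 =>
    (hP β C' f s₁ s₂ hf h1 h2).not).not.congr fun a => by push Not; rfl

lemma IsWord.length_eq (n : ℕ) : ∀ {α : Type} {C : Context α} {s : α → List ℕ}, C.IsWord s →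
    C.Definable fun a => (s a).length = n := by
  induction n with
  | zero =>
    intro α C s hs
    exact hs.eq_nil.congr fun a => List.length_eq_zero_iff.symm
  | succ n ih =>
    intro α C s hs
    refine (hs.exists_cons (P := fun _ _ s' => s'.length = n)
      fun β C' f z s' _ _ h => ih h).congr fun a => ?_
    constructor
    · rintro ⟨z, s', e, h⟩
      simp [e, h]
    · intro h
      obtain ⟨z, s', e⟩ := List.exists_cons_of_length_eq_add_one h
      exact ⟨z, s', e, by simpa [e] using h⟩

lemma IsWord.two_le_length (hs : C.IsWord s) : C.Definable fun a => 2 ≤ (s a).length :=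
  ((hs.length_eq 0).not.and (hs.length_eq 1).not).congr fun a => by omega

lemma IsWord.disjoint (hs : C.IsWord s) (ht : C.IsWord t) :
    C.Definable fun a => ∀ z ∈ s a, z ∉ t a :=
  hs.forall_mem fun _ _ _ _ hf hz => (hz.mem (ht.comp hf)).not

section Transfers

variable (hs : C.IsWord s) (ht : C.IsWord t)
include hs ht

lemma IsWord.squareTransfer : C.Definable fun a => SquareTransfer (s a) (t a) :=
  (hs.length_eq 2).imp ((ht.length_eq 2).and (ht.subset hs))

/-- The last letter of `s`, if it is linear, is the last one of `t` and linear there. -/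
lemma IsWord.linear_last : C.Definable fun a => ∀ s' z, s a = s' ++ [z] → z ∉ s' →
    ∃ t' y, t a = t' ++ [y] ∧ y = z ∧ z ∉ t' := by
  refine hs.forall_concat (P := fun a s' z => z ∉ s' → ∃ t' y, t a = t' ++ [y] ∧ y = z ∧ z ∉ t')
    fun β C' f s' z hf h1 hz => (hz.mem h1).not.imp ?_
  refine (ht.comp hf).exists_concat (P := fun b t' y => y = z b ∧ z b ∉ t')
    fun β' C'' f' t' y hf' h2 hy => ?_
  exact (hy.eq (hz.comp hf')).and ((hz.comp hf').mem h2).not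

lemma IsWord.linearTransfer : C.Definable fun a => LinearTransfer (s a) (t a) := by
  refine (ht.subset hs).and (hs.forall_split (P := fun a s₁ z s₂ => z ∉ s₁ → z ∉ s₂ →
    ∃ t₁ y t₂, t a = t₁ ++ y :: t₂ ∧ y = z ∧ z ∉ t₁ ∧ z ∉ t₂)
    fun β C' f s₁ z s₂ hf h1 hz h2 _ => (hz.mem h1).not.imp ((hz.mem h2).not.imp ?_))
  refine (ht.comp hf).exists_split (P := fun b t₁ y t₂ => y = z b ∧ z b ∉ t₁ ∧ z b ∉ t₂)
    fun β' C'' f' t₁ y t₂ hf' h3 hy h4 _ => ?_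
  have hz' := hz.comp hf'
  exact (hy.eq hz').and ((hz'.mem h3).not.and (hz'.mem h4).not)

/-- Words of two and three explicit letters are unfolded into successive heads, each of which
becomes a distinguished position. -/
lemma IsWord.cyclicTransfer : C.Definable fun a => CyclicTransfer (s a) (t a) := by
  refine Definable.and ?_ ?_
  · refine (hs.forall_cons (P := fun a z₁ s₁ => ∀ z₂ s₂, s₁ = z₂ :: s₂ → s₂ = [] → z₁ ≠ z₂ →
      ∃ y₁ t₁, t a = y₁ :: t₁ ∧ ∃ y₂ t₂, t₁ = y₂ :: t₂ ∧ t₂ = [] ∧ y₁ = z₁ ∧ y₂ = z₂)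
      fun β C₁ f₁ z₁ s₁ hf₁ hz₁ hs₁ => ?_).congr fun a => ?_
    · refine hs₁.forall_cons (P := fun b z₂ s₂ => s₂ = [] → z₁ b ≠ z₂ →
        ∃ y₁ t₁, t (f₁ b) = y₁ :: t₁ ∧ ∃ y₂ t₂, t₁ = y₂ :: t₂ ∧ t₂ = [] ∧ y₁ = z₁ b ∧ y₂ = z₂)
        fun β C₂ f₂ z₂ s₂ hf₂ hz₂ hs₂ => ?_
      have hz₁' := hz₁.comp hf₂
      refine hs₂.eq_nil.imp ((hz₁'.eq hz₂).not.imp ?_)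
      refine ((ht.comp hf₁).comp hf₂).exists_cons (P := fun b y₁ t₁ =>
        ∃ y₂ t₂, t₁ = y₂ :: t₂ ∧ t₂ = [] ∧ y₁ = z₁ (f₂ b) ∧ y₂ = z₂ b)
        fun β C₃ f₃ y₁ t₁ hf₃ hy₁ ht₁ => ?_
      refine ht₁.exists_cons (P := fun b y₂ t₂ =>
        t₂ = [] ∧ y₁ b = z₁ (f₂ (f₃ b)) ∧ y₂ = z₂ (f₃ b))
        fun β C₄ f₄ y₂ t₂ hf₄ hy₂ ht₂ => ?_
      exact ht₂.eq_nil.and (((hy₁.comp hf₄).eq ((hz₁'.comp hf₃).comp hf₄)).and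
        (hy₂.eq ((hz₂.comp hf₃).comp hf₄)))
    · constructor
      · intro h z₁ z₂ e hne
        obtain ⟨y₁, _, e', y₂, _, rfl, rfl, h⟩ := h z₁ _ e z₂ _ rfl rfl hne
        exact ⟨y₁, y₂, e', h⟩
      · rintro h z₁ _ e z₂ _ rfl rfl hne
        obtain ⟨y₁, y₂, e', h⟩ := h z₁ z₂ e hne
        exact ⟨y₁, _, e', y₂, _, rfl, rfl, h⟩
  · let R : ℕ → ℕ → ℕ → ℕ → ℕ → ℕ → Prop := fun z₁ z₂ z₃ y₁ y₂ y₃ =>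
      (y₁ = z₁ ∨ y₁ = z₃) ∧ y₂ = z₂ ∧ (y₃ = z₁ ∨ y₃ = z₃) ∨
        y₁ = z₂ ∧ (y₂ = z₁ ∨ y₂ = z₃) ∧ y₃ = z₂
    refine (hs.forall_cons (P := fun a z₁ s₁ => ∀ z₂ s₂, s₁ = z₂ :: s₂ → ∀ z₃ s₃, s₂ = z₃ :: s₃ →
      s₃ = [] → z₁ ≠ z₂ → z₂ ≠ z₃ → ∃ y₁ t₁, t a = y₁ :: t₁ ∧ ∃ y₂ t₂, t₁ = y₂ :: t₂ ∧
        ∃ y₃ t₃, t₂ = y₃ :: t₃ ∧ t₃ = [] ∧ R z₁ z₂ z₃ y₁ y₂ y₃)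
      fun β C₁ f₁ z₁ s₁ hf₁ hz₁ hs₁ => ?_).congr fun a => ?_
    · refine hs₁.forall_cons (P := fun b z₂ s₂ => ∀ z₃ s₃, s₂ = z₃ :: s₃ →
        s₃ = [] → z₁ b ≠ z₂ → z₂ ≠ z₃ → ∃ y₁ t₁, t (f₁ b) = y₁ :: t₁ ∧ ∃ y₂ t₂, t₁ = y₂ :: t₂ ∧
        ∃ y₃ t₃, t₂ = y₃ :: t₃ ∧ t₃ = [] ∧ R (z₁ b) z₂ z₃ y₁ y₂ y₃)
        fun β C₂ f₂ z₂ s₂ hf₂ hz₂ hs₂ => ?_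
      refine hs₂.forall_cons (P := fun b z₃ s₃ =>
        s₃ = [] → z₁ (f₂ b) ≠ z₂ b → z₂ b ≠ z₃ → ∃ y₁ t₁, t (f₁ (f₂ b)) = y₁ :: t₁ ∧
        ∃ y₂ t₂, t₁ = y₂ :: t₂ ∧
        ∃ y₃ t₃, t₂ = y₃ :: t₃ ∧ t₃ = [] ∧ R (z₁ (f₂ b)) (z₂ b) z₃ y₁ y₂ y₃)
        fun β C₃ f₃ z₃ s₃ hf₃ hz₃ hs₃ => ?_
      have hz₁' := (hz₁.comp hf₂).comp hf₃
      have hz₂' := hz₂.comp hf₃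
      refine hs₃.eq_nil.imp ((hz₁'.eq hz₂').not.imp ((hz₂'.eq hz₃).not.imp ?_))
      refine (((ht.comp hf₁).comp hf₂).comp hf₃).exists_cons (P := fun b y₁ t₁ =>
        ∃ y₂ t₂, t₁ = y₂ :: t₂ ∧ ∃ y₃ t₃, t₂ = y₃ :: t₃ ∧ t₃ = [] ∧
          R (z₁ (f₂ (f₃ b))) (z₂ (f₃ b)) (z₃ b) y₁ y₂ y₃)
        fun β C₄ f₄ y₁ t₁ hf₄ hy₁ ht₁ => ?_
      refine ht₁.exists_cons (P := fun b y₂ t₂ => ∃ y₃ t₃, t₂ = y₃ :: t₃ ∧ t₃ = [] ∧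
          R (z₁ (f₂ (f₃ (f₄ b)))) (z₂ (f₃ (f₄ b))) (z₃ (f₄ b)) (y₁ b) y₂ y₃)
        fun β C₅ f₅ y₂ t₂ hf₅ hy₂ ht₂ => ?_
      refine ht₂.exists_cons (P := fun b y₃ t₃ => t₃ = [] ∧
          R (z₁ (f₂ (f₃ (f₄ (f₅ b))))) (z₂ (f₃ (f₄ (f₅ b)))) (z₃ (f₄ (f₅ b))) (y₁ (f₅ b)) (y₂ b) y₃)
        fun β C₆ f₆ y₃ t₃ hf₆ hy₃ ht₃ => ?_
      have k₁ := ((hz₁'.comp hf₄).comp hf₅).comp hf₆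
      have k₂ := ((hz₂'.comp hf₄).comp hf₅).comp hf₆
      have k₃ := ((hz₃.comp hf₄).comp hf₅).comp hf₆
      have l₁ := (hy₁.comp hf₅).comp hf₆
      have l₂ := hy₂.comp hf₆
      exact ht₃.eq_nil.and ((((l₁.eq k₁).or (l₁.eq k₃)).and ((l₂.eq k₂).and
        ((hy₃.eq k₁).or (hy₃.eq k₃)))).or ((l₁.eq k₂).and (((l₂.eq k₁).or (l₂.eq k₃)).and
        (hy₃.eq k₂))))
    · constructor
      · intro h z₁ z₂ z₃ e h12 h23
        obtain ⟨y₁, _, e', y₂, _, rfl, y₃, _, rfl, rfl, h⟩ :=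
          h z₁ _ e z₂ _ rfl z₃ _ rfl rfl h12 h23
        exact ⟨y₁, y₂, y₃, e', h⟩
      · rintro h z₁ _ e z₂ _ rfl z₃ _ rfl rfl h12 h23
        obtain ⟨y₁, y₂, y₃, e', h⟩ := h z₁ z₂ z₃ e h12 h23
        exact ⟨y₁, _, e', y₂, _, rfl, y₃, _, rfl, rfl, h⟩

lemma IsWord.leftPowerTransfer : C.Definable fun a => LeftPowerTransfer (s a) (t a) := by
  refine (ht.subset hs).and ((hs.linear_last ht).and ?_)
  refine (hs.forall_concat (P := fun a s₁ z' => ∀ s' z, s₁ = s' ++ [z] → z ∉ s' → z ≠ z' →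
    ∃ t₁ y', t a = t₁ ++ [y'] ∧ ∃ t' y, t₁ = t' ++ [y] ∧
      y = z ∧ y' = z' ∧ z ∉ t' ∧ (s' ≠ [] → t' ≠ []))
    fun β C₁ f₁ s₁ z' hf₁ hs₁ hz' => ?_).congr fun a => ?_
  · refine hs₁.forall_concat (P := fun b s' z => z ∉ s' → z ≠ z' b →
      ∃ t₁ y', t (f₁ b) = t₁ ++ [y'] ∧ ∃ t' y, t₁ = t' ++ [y] ∧
      y = z ∧ y' = z' b ∧ z ∉ t' ∧ (s' ≠ [] → t' ≠ []))
      fun β C₂ f₂ s' z hf₂ hs' hz => ?_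
    refine (hz.mem hs').not.imp ((hz.eq (hz'.comp hf₂)).not.imp ?_)
    refine ((ht.comp hf₁).comp hf₂).exists_concat (P := fun b t₁ y' => ∃ t' y, t₁ = t' ++ [y] ∧
      y = z b ∧ y' = z' (f₂ b) ∧ z b ∉ t' ∧ (s' b ≠ [] → t' ≠ []))
      fun β C₃ f₃ t₁ y' hf₃ ht₁ hy' => ?_
    refine ht₁.exists_concat (P := fun b t' y =>
      y = z (f₃ b) ∧ y' b = z' (f₂ (f₃ b)) ∧ z (f₃ b) ∉ t' ∧ (s' (f₃ b) ≠ [] → t' ≠ []))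
      fun β C₄ f₄ t' y hf₄ ht' hy => ?_
    have kz := (hz.comp hf₃).comp hf₄
    exact (hy.eq kz).and (((hy'.comp hf₄).eq (((hz'.comp hf₂).comp hf₃).comp hf₄)).and
      ((kz.mem ht').not.and (((hs'.comp hf₃).comp hf₄).eq_nil.not.imp ht'.eq_nil.not)))
  · constructor
    · intro h s' z z' e h1 h2
      obtain ⟨_, y', e', t', y, rfl, h3, h4⟩ := h _ z' e s' z rfl h1 h2
      exact ⟨t', y, y', e', h3, h4⟩
    · rintro h _ z' e s' z rfl h1 h2
      obtain ⟨t', y, y', e', h3, h4⟩ := h s' z z' e h1 h2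
      exact ⟨_, y', e', t', y, rfl, h3, h4⟩

variable {Sol : α → List ℕ → Prop}
  (hSol : ∀ (β : Type) (C' : Context β) (f : β → α) (l : β → List ℕ), C'.Extends C f →
    C'.IsWord l → C'.Definable fun b => Sol (f b) (l b))
include hSol

/-- `Sol` is kept abstract, because solvability refers to the whole basis and is shown definable
only with a guard against the empty word. -/
lemma IsWord.innerPowerTransfer :
    C.Definable fun a => InnerPowerTransfer (Sol a) (s a) (t a) := by
  refine (hs.subset ht).and ((ht.subset hs).and (Definable.and ?_ ((hs.linear_last ht).and ?_)))
  · refine hs.forall_cons (P := fun a z s' => z ∉ s' → ∃ y t', t a = y :: t' ∧ y = z ∧ z ∉ t')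
      fun β C₁ f₁ z s' hf₁ hz hs' => (hz.mem hs').not.imp ?_
    refine (ht.comp hf₁).exists_cons (P := fun b y t' => y = z b ∧ z b ∉ t')
      fun β C₂ f₂ y t' hf₂ hy ht' => ?_
    exact (hy.eq (hz.comp hf₂)).and ((hz.comp hf₂).mem ht').not
  · refine (hs.forall_cons (P := fun a z s' => ∀ s₂ z', s' = s₂ ++ [z'] → z = z' → z ∉ s₂ →
      s₂ ≠ [] → Sol a s₂ → ∃ y t', t a = y :: t' ∧ ∃ t₂ y', t' = t₂ ++ [y'] ∧
        y = z ∧ y' = z ∧ z ∉ t₂)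
      fun β C₁ f₁ z s' hf₁ hz hs' => ?_).congr fun a => ?_
    · refine hs'.forall_concat (P := fun b s₂ z' => z b = z' → z b ∉ s₂ →
        s₂ ≠ [] → Sol (f₁ b) s₂ → ∃ y t', t (f₁ b) = y :: t' ∧ ∃ t₂ y', t' = t₂ ++ [y'] ∧
        y = z b ∧ y' = z b ∧ z b ∉ t₂)
        fun β C₂ f₂ s₂ z' hf₂ hs₂ hz' => ?_
      have kz := hz.comp hf₂
      refine (kz.eq hz').imp ((kz.mem hs₂).not.imp (hs₂.eq_nil.not.imp
        ((hSol β C₂ _ s₂ (hf₂.trans hf₁) hs₂).imp ?_)))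
      refine ((ht.comp hf₁).comp hf₂).exists_cons (P := fun b y t' => ∃ t₂ y', t' = t₂ ++ [y'] ∧
        y = z (f₂ b) ∧ y' = z (f₂ b) ∧ z (f₂ b) ∉ t₂) fun β C₃ f₃ y t' hf₃ hy ht' => ?_
      refine ht'.exists_concat (P := fun b t₂ y' =>
        y b = z (f₂ (f₃ b)) ∧ y' = z (f₂ (f₃ b)) ∧ z (f₂ (f₃ b)) ∉ t₂)
        fun β C₄ f₄ t₂ y' hf₄ ht₂ hy' => ?_
      have lz := (kz.comp hf₃).comp hf₄
      exact ((hy.comp hf₄).eq lz).and ((hy'.eq lz).and (lz.mem ht₂).not)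
    · constructor
      · intro h z s₂ z' e h1 h2 h3 h4
        obtain ⟨y, _, e', t₂, y', rfl, h⟩ := h z _ e s₂ z' rfl h1 h2 h3 h4
        exact ⟨y, t₂, y', e', h⟩
      · rintro h z _ e s₂ z' rfl h1 h2 h3 h4
        obtain ⟨y, t₂, y', e', h⟩ := h z s₂ z' e h1 h2 h3 h4
        exact ⟨y, _, e', t₂, y', rfl, h⟩

omit hSol in
lemma IsWord.sortedTransfer : C.Definable fun a => SortedTransfer (s a) (t a) := by
  refine (hs.subset ht).and ((ht.subset hs).and (Definable.and ?_ ?_))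
  · refine hs.forall_append (P := fun a s₁ s₂ => s₂ ≠ [] → s₁ ≠ [] → (∀ x ∈ s₁, x ∉ s₂) →
      ∃ t₁ t₂, t a = t₁ ++ t₂ ∧ t₂ ≠ [] ∧ (∀ x ∈ t₁, x ∈ s₁) ∧ ∀ x ∈ t₂, x ∈ s₂)
      fun β C₁ f₁ s₁ s₂ hf₁ h1 h2 => h2.eq_nil.not.imp (h1.eq_nil.not.imp ((h1.disjoint h2).imp ?_))
    refine (ht.comp hf₁).exists_append (P := fun b t₁ t₂ =>
      t₂ ≠ [] ∧ (∀ x ∈ t₁, x ∈ s₁ b) ∧ ∀ x ∈ t₂, x ∈ s₂ b) fun β C₂ f₂ t₁ t₂ hf₂ h3 h4 => ?_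
    exact h4.eq_nil.not.and ((h3.subset (h1.comp hf₂)).and (h4.subset (h2.comp hf₂)))
  · refine hs.forall_split (P := fun a s₁ z s₂ => z ∉ s₁ → z ∉ s₂ → (∀ x ∈ s₁, x ∉ s₂) →
      ∃ t₁ y t₂, t a = t₁ ++ y :: t₂ ∧ y = z ∧ (∀ x ∈ t₁, x ∈ s₁) ∧ ∀ x ∈ t₂, x ∈ s₂)
      fun β C₁ f₁ s₁ z s₂ hf₁ h1 hz h2 _ => (hz.mem h1).not.imp ((hz.mem h2).not.imp
        ((h1.disjoint h2).imp ?_))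
    refine (ht.comp hf₁).exists_split (P := fun b t₁ y t₂ =>
      y = z b ∧ (∀ x ∈ t₁, x ∈ s₁ b) ∧ ∀ x ∈ t₂, x ∈ s₂ b) fun β C₂ f₂ t₁ y t₂ hf₂ h3 hy h4 _ => ?_
    exact (hy.eq (hz.comp hf₂)).and ((h3.subset (h1.comp hf₂)).and (h4.subset (h2.comp hf₂)))

lemma IsWord.bothPowerTransfer :
    C.Definable fun a => BothPowerTransfer (Sol a) (s a) (t a) := by
  refine (hs.sortedTransfer ht).and ((hs.linear_last ht).and (Definable.and ?_ ?_))
  · refine (hs.forall_concat (P := fun a s₀ z' => ∀ s₁ s₂, s₀ = s₁ ++ s₂ → z' ∈ s₁ → s₂ ≠ [] →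
      (∀ x ∈ s₁, x ∉ s₂) → Sol a s₂ → ∃ t₀ y, t a = t₀ ++ [y] ∧ ∃ t₁ t₂, t₀ = t₁ ++ t₂ ∧
        y = z' ∧ t₁ ≠ [] ∧ (∀ x ∈ t₁, x ∈ s₁) ∧ ∀ x ∈ t₂, x ∈ s₂)
      fun β C₁ f₁ s₀ z' hf₁ hs₀ hz' => ?_).congr fun a => ?_
    · refine hs₀.forall_append (P := fun b s₁ s₂ => z' b ∈ s₁ → s₂ ≠ [] →
        (∀ x ∈ s₁, x ∉ s₂) → Sol (f₁ b) s₂ → ∃ t₀ y, t (f₁ b) = t₀ ++ [y] ∧ ∃ t₁ t₂, t₀ = t₁ ++ t₂ ∧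
        y = z' b ∧ t₁ ≠ [] ∧ (∀ x ∈ t₁, x ∈ s₁) ∧ ∀ x ∈ t₂, x ∈ s₂)
        fun β C₂ f₂ s₁ s₂ hf₂ h1 h2 => ?_
      have kz := hz'.comp hf₂
      refine (kz.mem h1).imp (h2.eq_nil.not.imp ((h1.disjoint h2).imp
        ((hSol β C₂ _ s₂ (hf₂.trans hf₁) h2).imp ?_)))
      refine ((ht.comp hf₁).comp hf₂).exists_concat (P := fun b t₀ y => ∃ t₁ t₂, t₀ = t₁ ++ t₂ ∧
        y = z' (f₂ b) ∧ t₁ ≠ [] ∧ (∀ x ∈ t₁, x ∈ s₁ b) ∧ ∀ x ∈ t₂, x ∈ s₂ b)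
        fun β C₃ f₃ t₀ y hf₃ ht₀ hy => ?_
      refine ht₀.exists_append (P := fun b t₁ t₂ => y b = z' (f₂ (f₃ b)) ∧ t₁ ≠ [] ∧
        (∀ x ∈ t₁, x ∈ s₁ (f₃ b)) ∧ ∀ x ∈ t₂, x ∈ s₂ (f₃ b)) fun β C₄ f₄ t₁ t₂ hf₄ h3 h4 => ?_
      exact ((hy.comp hf₄).eq ((kz.comp hf₃).comp hf₄)).and (h3.eq_nil.not.and
        ((h3.subset ((h1.comp hf₃).comp hf₄)).and (h4.subset ((h2.comp hf₃).comp hf₄))))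
    · constructor
      · intro h s₁ s₂ z' e h1 h2 h3 h4
        obtain ⟨_, y, e', t₁, t₂, rfl, h⟩ :=
          h _ z' (by rw [e, List.append_assoc]) s₁ s₂ rfl h1 h2 h3 h4
        exact ⟨t₁, t₂, y, by rw [e', List.append_assoc], h⟩
      · rintro h _ z' e s₁ s₂ rfl h1 h2 h3 h4
        obtain ⟨t₁, t₂, y, e', h⟩ := h s₁ s₂ z' (by rw [e, List.append_assoc]) h1 h2 h3 h4
        exact ⟨_, y, by rw [e', List.append_assoc], t₁, t₂, rfl, h⟩
  · refine (hs.forall_concat (P := fun a s₀ z' => ∀ s₁ z s₂, s₀ = s₁ ++ z :: s₂ → z' ∈ s₁ →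
      z ∉ s₁ → z ∉ s₂ → (∀ x ∈ s₁, x ∉ s₂) → ∃ t₀ y', t a = t₀ ++ [y'] ∧
        ∃ t₁ y t₂, t₀ = t₁ ++ y :: t₂ ∧ y = z ∧ y' = z' ∧ (∀ x ∈ t₁, x ∈ s₁) ∧ ∀ x ∈ t₂, x ∈ s₂)
      fun β C₁ f₁ s₀ z' hf₁ hs₀ hz' => ?_).congr fun a => ?_
    · refine hs₀.forall_split (P := fun b s₁ z s₂ => z' b ∈ s₁ →
        z ∉ s₁ → z ∉ s₂ → (∀ x ∈ s₁, x ∉ s₂) → ∃ t₀ y', t (f₁ b) = t₀ ++ [y'] ∧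
        ∃ t₁ y t₂, t₀ = t₁ ++ y :: t₂ ∧ y = z ∧ y' = z' b ∧ (∀ x ∈ t₁, x ∈ s₁) ∧ ∀ x ∈ t₂, x ∈ s₂)
        fun β C₂ f₂ s₁ z s₂ hf₂ h1 hz h2 _ => ?_
      have kz := hz'.comp hf₂
      refine (kz.mem h1).imp ((hz.mem h1).not.imp ((hz.mem h2).not.imp ((h1.disjoint h2).imp ?_)))
      refine ((ht.comp hf₁).comp hf₂).exists_concat (P := fun b t₀ y' => ∃ t₁ y t₂,
        t₀ = t₁ ++ y :: t₂ ∧ y = z b ∧ y' = z' (f₂ b) ∧ (∀ x ∈ t₁, x ∈ s₁ b) ∧ ∀ x ∈ t₂, x ∈ s₂ b)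
        fun β C₃ f₃ t₀ y' hf₃ ht₀ hy' => ?_
      refine ht₀.exists_split (P := fun b t₁ y t₂ => y = z (f₃ b) ∧ y' b = z' (f₂ (f₃ b)) ∧
        (∀ x ∈ t₁, x ∈ s₁ (f₃ b)) ∧ ∀ x ∈ t₂, x ∈ s₂ (f₃ b))
        fun β C₄ f₄ t₁ y t₂ hf₄ h3 hy h4 _ => ?_
      exact (hy.eq ((hz.comp hf₃).comp hf₄)).and (((hy'.comp hf₄).eq ((kz.comp hf₃).comp hf₄)).and
        ((h3.subset ((h1.comp hf₃).comp hf₄)).and (h4.subset ((h2.comp hf₃).comp hf₄))))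
    · constructor
      · intro h s₁ z s₂ z' e h1 h2 h3 h4
        obtain ⟨_, y', e', t₁, y, t₂, rfl, h5, h6, h7⟩ :=
          h _ z' (by rw [e, List.append_assoc, List.cons_append]) s₁ z s₂ rfl h1 h2 h3 h4
        exact ⟨t₁, y, t₂, y', by rw [e', List.append_assoc, List.cons_append], h5, h6, h7⟩
      · rintro h _ z' e s₁ z s₂ rfl h1 h2 h3 h4
        obtain ⟨t₁, y, t₂, y', e', h⟩ :=
          h s₁ z s₂ z' (by rw [e, List.append_assoc, List.cons_append]) h1 h2 h3 h4
        exact ⟨_, y', by rw [e', List.append_assoc, List.cons_append], t₁, y, t₂, rfl, h⟩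

end Transfers

end Context

/-! ### A combinatorial criterion without the parameter `k`. -/

section Criterion

/-- The identity `s = t` is nontrivial and one of its sides is a letter. -/
def IsShort (s t : List ℕ) : Prop :=
  ¬ (2 ≤ s.length ∧ 2 ≤ t.length) ∧ ¬ (¬ 2 ≤ s.length ∧ ¬ 2 ≤ t.length ∧ ∀ z ∈ s, z ∈ t)

/-- The sides of `s = t` are not letters and do not transfer to each other. -/
def Violates (X : List ℕ → List ℕ → Prop) (s t : List ℕ) : Prop :=
  (2 ≤ s.length ∧ 2 ≤ t.length) ∧ ¬ (X s t ∧ X t s)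

/-- In every identity of `B`, letters occur on both sides equally often modulo `g`. -/
def IsPeriod (B : List Identity) (g : ℕ) : Prop := ∀ i ∈ B, SamePeriod g i.left i.right

/-- Solvability with respect to all periods of `B`. -/
def PeriodSolvable (B : List Identity) (s : List ℕ) : Prop :=
  ∀ g, 2 ≤ g → IsPeriod B g → ∃ z ∈ s, ¬ g ∣ s.count z

variable {B : List Identity}

/-- Applying the equation once more gives `b = b ^ (2 * m + 3)`, where the middle factor `b ^ (2 * m
+ 1)` lies in `S` even for `m = 0`. -/
lemma isRegularElement_of_eq_prod {S : Type*} [Semigroup S] {b : S} {m : ℕ}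
    (h : (b : WithOne S) = (b : WithOne S) ^ (m + 2)) : IsRegularElement b := by
  have hcoe : ∀ n, ∃ x : S, (x : WithOne S) = (b : WithOne S) ^ (n + 1) := by
    intro n
    induction n with
    | zero => exact ⟨b, by simp⟩
    | succ n ih =>
      obtain ⟨x, hx⟩ := ih
      exact ⟨x * b, by rw [WithOne.coe_mul, hx, ← pow_succ]⟩
  have h' : (b : WithOne S) = (b : WithOne S) ^ (2 * m + 3) := by
    calc (b : WithOne S) = (b : WithOne S) ^ (m + 1) * b := by rw [← pow_succ]; exact h
      _ = (b : WithOne S) ^ (m + 1) * (b : WithOne S) ^ (m + 2) := by rw [← h]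
      _ = _ := by rw [← pow_add]; congr 1; omega
  obtain ⟨x, hx⟩ := hcoe (2 * m)
  refine ⟨x, WithOne.coe_inj.mp ?_⟩
  rw [WithOne.coe_mul, WithOne.coe_mul, hx, ← pow_succ', ← pow_succ]
  exact h'

lemma Identity.HoldsIn.prod_eq {i : Identity} {S : Type*} [Semigroup S] (h : i.HoldsIn S)
    (ψ : ℕ → S) : (i.left.map fun n => (ψ n : WithOne S)).prod
      = (i.right.map fun n => (ψ n : WithOne S)).prod := by
  have := congrArg ((↑) : S → WithOne S) (h ψ)
  rwa [coe_lift_eq, coe_lift_eq] at this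

/-- If `t` is another letter, mapping it to `b * b` gives `b = b ^ 2`; otherwise mapping all letters
to `b` gives `b` as a power with exponent the length of `t`. -/
lemma isRegularElement_of_singleton {S : Type*} [Semigroup S] {z : ℕ} {t : List ℕ}
    (h : ∀ ψ : ℕ → S, ([z].map fun n => (ψ n : WithOne S)).prod
      = (t.map fun n => (ψ n : WithOne S)).prod) (ht : t ≠ []) (hne : t ≠ [z]) (b : S) :
    IsRegularElement b := by
  match t, ht with
  | [y], _ =>
    have hy : y ≠ z := fun e => hne (by rw [e])
    have := h fun n => if n = z then b else b * b
    simp only [List.map_cons, List.map_nil, if_true, List.prod_singleton, if_neg hy] at this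
    exact isRegularElement_of_eq_prod (m := 0) (by rw [pow_two, ← WithOne.coe_mul]; exact this)
  | y :: y' :: t, _ =>
    have := h fun _ => b
    simp only [List.map_const', List.prod_replicate, List.length_cons, List.length_nil] at this
    exact isRegularElement_of_eq_prod (m := t.length) (by simpa using this)

lemma allCyclicallyRegular_of_isShort {i : Identity} (hi : i ∈ B)
    (h : IsShort i.left i.right) : AllCyclicallyRegular.{u} B := by
  intro S _ hS b _
  have hl : i.left ≠ [] := by simp [Identity.left]
  have hr : i.right ≠ [] := by simp [Identity.right]
  have hprod := (hS i hi).prod_eq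
  have hsing : ∀ {l : List ℕ}, l ≠ [] → ¬ 2 ≤ l.length → ∃ z, l = [z] := fun h h2 =>
    List.length_eq_one_iff.mp (by have := List.length_pos_of_ne_nil h; omega)
  obtain ⟨h1, h2⟩ := h
  by_cases hs : 2 ≤ i.left.length
  · have ht : ¬ 2 ≤ i.right.length := fun ht => h1 ⟨hs, ht⟩
    obtain ⟨z, hz⟩ := hsing hr ht
    rw [hz] at hprod
    exact isRegularElement_of_singleton (fun ψ => (hprod ψ).symm) hl
      (fun e => by simp [e] at hs) b
  · obtain ⟨z, hz⟩ := hsing hl hs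
    rw [hz] at hprod
    refine isRegularElement_of_singleton hprod hr (fun e => h2 ⟨hs, ?_, ?_⟩) b
    · simp [e]
    · simp [hz, e]

lemma eq_of_not_isShort {i : Identity} (h : ¬ IsShort i.left i.right)
    (h' : ¬ (2 ≤ i.left.length ∧ 2 ≤ i.right.length)) : i.left = i.right := by
  obtain ⟨h1, h2, h3⟩ := not_not.mp fun hc => h ⟨h', hc⟩
  simp only [Identity.left, Identity.right, List.length_cons, not_le] at h1 h2 h3 ⊢
  have e1 : i.lhs.tail = [] := List.length_eq_zero_iff.mp (by omega)
  have e2 : i.rhs.tail = [] := List.length_eq_zero_iff.mp (by omega)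
  simpa [e1, e2] using h3

section Long

variable (hB : ¬ ∃ i ∈ B, IsShort i.left i.right)
include hB

/-- Short identities, being trivial, can be ignored. -/
lemma forall_identity_iff {P Q : List ℕ → List ℕ → Prop} (hP : ∀ s, P s s)
    (h : ∀ s t, 2 ≤ s.length → 2 ≤ t.length → (P s t ↔ Q s t)) :
    (∀ i ∈ B, P i.left i.right) ↔
      ∀ i ∈ B, 2 ≤ i.left.length ∧ 2 ≤ i.right.length → Q i.left i.right := by
  refine forall₂_congr fun i hi => ?_
  constructor
  · rintro h1 ⟨h2, h3⟩
    exact (h _ _ h2 h3).mp h1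
  · intro h1
    by_cases h2 : 2 ≤ i.left.length ∧ 2 ≤ i.right.length
    · exact (h _ _ h2.1 h2.2).mpr (h1 h2)
    · rw [eq_of_not_isShort (fun hc => hB ⟨i, hi, hc⟩) h2]
      exact hP _

lemma not_closed_iff {K : Set (List Bool)} {X : List ℕ → List ℕ → Prop}
    (h : ∀ s t, 2 ≤ s.length → 2 ≤ t.length → (Transfers K s t ↔ X s t)) :
    ¬ Closed K B ↔ ∃ i ∈ B, Violates X i.left i.right := by
  rw [Closed, forall_identity_iff hB (Q := fun s t => X s t ∧ X t s) (fun s φ _ p r => Iff.rfl)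
    fun s t hs ht => by rw [pairClosed_iff, h s t hs ht, h t s ht hs]]
  simp only [Violates]
  push Not
  rfl

/-- Closedness for `k` makes `k` a period, hence a divisor of `D`. Then solvability for `D` implies
solvability for `k`, and the transfer condition, being antitone in it, passes from `k` to `D`. So
closedness for any `k` implies closedness for `D`, and a single test suffices. -/
lemma not_closed_power_iff {K : ℕ → Set (List Bool)} {X : (List ℕ → Prop) → List ℕ → List ℕ → Prop}
    (hX : ∀ k, 0 < k → ∀ s t, 2 ≤ s.length → 2 ≤ t.length → SamePeriod k s t →
      X (Solvable k) s t → Transfers (K k) s t)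
    (hX' : ∀ k, 0 < k → ∀ s t, 2 ≤ s.length → 2 ≤ t.length → Transfers (K k) s t →
      Transfers (K k) t s → SamePeriod k s t ∧ X (Solvable k) s t)
    (hanti : ∀ (S S' : List ℕ → Prop) s t, (∀ l, l ≠ [] → S l → S' l) → X S' s t → X S s t)
    {D : ℕ} (hD0 : 0 < D) (hD : ∀ g, IsPeriod B g ↔ g ∣ D) :
    (∀ k, 0 < k → ¬ Closed (K k) B) ↔ ∃ i ∈ B, Violates (X (PeriodSolvable B)) i.left i.right := by
  have hk : ∀ k, 0 < k → (Closed (K k) B ↔ IsPeriod B k ∧ ∀ i ∈ B,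
      2 ≤ i.left.length ∧ 2 ≤ i.right.length →
        X (Solvable k) i.left i.right ∧ X (Solvable k) i.right i.left) := by
    intro k hk
    have hper : IsPeriod B k ↔ ∀ i ∈ B, 2 ≤ i.left.length ∧ 2 ≤ i.right.length →
        SamePeriod k i.left i.right :=
      forall_identity_iff hB (fun s z => Nat.ModEq.refl _) fun s t _ _ => Iff.rfl
    rw [hper, ← forall₂_and, Closed, forall_identity_iff hB (Q := fun s t => SamePeriod k s t ∧
      X (Solvable k) s t ∧ X (Solvable k) t s) (fun s φ _ p r => Iff.rfl)]
    · exact forall₂_congr fun i _ => forall_and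
    · intro s t hs ht
      rw [pairClosed_iff]
      constructor
      · rintro ⟨h1, h2⟩
        obtain ⟨h3, h4⟩ := hX' k hk s t hs ht h1 h2
        exact ⟨h3, h4, (hX' k hk t s ht hs h2 h1).2⟩
      · rintro ⟨h1, h2, h3⟩
        exact ⟨hX k hk s t hs ht h1 h2, hX k hk t s ht hs h1.symm h3⟩
  have hsol : ∀ l, Solvable D l ↔ PeriodSolvable B l := by
    intro l
    simp only [Solvable, PeriodSolvable, hD]
  have hsol' : Solvable D = PeriodSolvable B := funext fun l => propext (hsol l)
  constructor
  · intro h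
    by_contra hc
    refine h D hD0 ((hk D hD0).mpr ⟨(hD D).mpr dvd_rfl, fun i hi h2 => ?_⟩)
    rw [hsol']
    by_contra h3
    exact hc ⟨i, hi, h2, h3⟩
  · rintro ⟨i, hi, h2, h3⟩ k hk0 hc
    obtain ⟨h4, h5⟩ := (hk k hk0).mp hc
    have hmono : ∀ l, l ≠ [] → PeriodSolvable B l → Solvable k l := fun l _ hl g hg hgk =>
      hl g hg ((hD g).mpr (hgk.trans ((hD k).mp h4)))
    exact h3 ⟨hanti _ _ _ _ hmono (h5 i hi h2).1, hanti _ _ _ _ hmono (h5 i hi h2).2⟩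

end Long

/-- `D` generates the ideal of all differences of occurrence numbers. -/
lemma exists_isPeriod_iff_dvd (B : List Identity) : ∃ D, ∀ g, IsPeriod B g ↔ g ∣ D := by
  let I : Ideal ℤ :=
    Ideal.span {d | ∃ i ∈ B, ∃ z, d = (i.right.count z : ℤ) - i.left.count z}
  refine ⟨(Submodule.IsPrincipal.generator I).natAbs, fun g => ?_⟩
  rw [← Int.natCast_dvd, ← Ideal.span_singleton_le_span_singleton, Ideal.span_singleton_generator,
    Ideal.span_le]
  constructor
  · rintro h _ ⟨i, hi, z, rfl⟩
    exact Ideal.mem_span_singleton.mpr (Nat.modEq_iff_dvd.mp (h i hi z))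
  · intro h i hi z
    exact Nat.modEq_iff_dvd.mpr (Ideal.mem_span_singleton.mp (h ⟨i, hi, z, rfl⟩))

lemma squareTransfer_of_perm {s t : List ℕ} (h : s.Perm t) : SquareTransfer s t :=
  fun h2 => ⟨h.length_eq ▸ h2, fun _ hz => h.mem_iff.mpr hz⟩

/-- `D = 0` would make the sides of every identity permutations of each other, and such identities
preserve squares of letters. -/
lemma exists_period_pos (h : ∃ i ∈ B, Violates SquareTransfer i.left i.right) :
    ∃ D, 0 < D ∧ ∀ g, IsPeriod B g ↔ g ∣ D := by
  obtain ⟨D, hD⟩ := exists_isPeriod_iff_dvd B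
  refine ⟨D, Nat.pos_of_ne_zero ?_, hD⟩
  rintro rfl
  obtain ⟨i, hi, -, h⟩ := h
  have hp : i.left.Perm i.right := List.perm_iff_count.mpr fun z => by
    have := (hD 0).mpr dvd_rfl i hi z
    rwa [Nat.modEq_zero_iff] at this
  exact h ⟨squareTransfer_of_perm hp, squareTransfer_of_perm hp.symm⟩

lemma innerPowerTransfer_antitone {S S' : List ℕ → Prop} {s t : List ℕ}
    (h : ∀ l, l ≠ [] → S l → S' l) (hX : InnerPowerTransfer S' s t) : InnerPowerTransfer S s t := by
  obtain ⟨h1, h2, h3, h4, h5⟩ := hX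
  exact ⟨h1, h2, h3, h4, fun z s₂ z' e h6 h7 h8 h9 => h5 z s₂ z' e h6 h7 h8 (h _ h8 h9)⟩

lemma bothPowerTransfer_antitone {S S' : List ℕ → Prop} {s t : List ℕ}
    (h : ∀ l, l ≠ [] → S l → S' l) (hX : BothPowerTransfer S' s t) : BothPowerTransfer S s t := by
  obtain ⟨h1, h2, h3, h4⟩ := hX
  exact ⟨h1, h2, fun s₁ s₂ z' e h6 h7 h8 h9 => h3 s₁ s₂ z' e h6 h7 h8 (h _ h7 h9), h4⟩

lemma samePeriod_reverse {k : ℕ} {s t : List ℕ} :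
    SamePeriod k s.reverse t.reverse ↔ SamePeriod k s t := by simp [SamePeriod]

/-- A combinatorial description of the bases whose varieties are cyclically regular. -/
def Criterion (B : List Identity) : Prop :=
  (∃ i ∈ B, IsShort i.left i.right) ∨
    (∃ i ∈ B, Violates SquareTransfer i.left i.right) ∧
    (∃ i ∈ B, Violates LinearTransfer i.left i.right) ∧
    (∃ i ∈ B, Violates CyclicTransfer i.left i.right) ∧
    (∃ i ∈ B, Violates LeftPowerTransfer i.left i.right) ∧
    (∃ i ∈ B, Violates LeftPowerTransfer i.left.reverse i.right.reverse) ∧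
    (∃ i ∈ B, Violates (InnerPowerTransfer (PeriodSolvable B)) i.left i.right) ∧
    (∃ i ∈ B, Violates (BothPowerTransfer (PeriodSolvable B)) i.left i.right) ∧
    ∃ i ∈ B, Violates (BothPowerTransfer (PeriodSolvable B)) i.left.reverse i.right.reverse

lemma transfers_leftPowerWords {s t : List ℕ} (hs : 2 ≤ s.length) (ht : 2 ≤ t.length) :
    Transfers leftPowerWords s t ↔ LeftPowerTransfer s t :=
  ⟨leftPowerTransfer_of_transfers hs (List.ne_nil_of_length_pos (by omega)),
    fun h => h.transfers hs ht⟩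

/-- The power languages are compared only once the squares are known not to be closed, as this
provides a positive `D`. -/
lemma noObstruction_iff (hB : ¬ ∃ i ∈ B, IsShort i.left i.right) :
    NoObstruction B ↔ Criterion B := by
  have hsq : ¬ Closed squareWords B ↔ ∃ i ∈ B, Violates SquareTransfer i.left i.right :=
    not_closed_iff hB fun s t hs _ => transfers_squareWords hs
  have hlin : ¬ Closed linearWords B ↔ ∃ i ∈ B, Violates LinearTransfer i.left i.right :=
    not_closed_iff hB fun s t _ _ => transfers_linearWords
  have hcyc : ¬ Closed cyclicWords B ↔ ∃ i ∈ B, Violates CyclicTransfer i.left i.right :=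
    not_closed_iff hB fun s t hs _ => transfers_cyclicWords hs
  have hleft : ¬ Closed leftPowerWords B ↔ ∃ i ∈ B, Violates LeftPowerTransfer i.left i.right :=
    not_closed_iff hB fun s t hs ht => transfers_leftPowerWords hs ht
  have hleft' : ¬ Closed (reversed leftPowerWords) B ↔
      ∃ i ∈ B, Violates LeftPowerTransfer i.left.reverse i.right.reverse := by
    rw [not_closed_iff hB (X := fun s t => LeftPowerTransfer s.reverse t.reverse)
      fun s t hs ht => by rw [transfers_reversed, transfers_leftPowerWords] <;> simpa]
    simp [Violates]
  have hpow : (∃ i ∈ B, Violates SquareTransfer i.left i.right) →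
      ((∀ k, 0 < k → ¬ Closed (innerPowerWords k) B) ↔
        ∃ i ∈ B, Violates (InnerPowerTransfer (PeriodSolvable B)) i.left i.right) ∧
      ((∀ k, 0 < k → ¬ Closed (bothPowerWords k) B) ↔
        ∃ i ∈ B, Violates (BothPowerTransfer (PeriodSolvable B)) i.left i.right) ∧
      ((∀ k, 0 < k → ¬ Closed (reversed (bothPowerWords k)) B) ↔ ∃ i ∈ B,
        Violates (BothPowerTransfer (PeriodSolvable B)) i.left.reverse i.right.reverse) := by
    intro h
    obtain ⟨D, hD0, hD⟩ := exists_period_pos h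
    have hne : ∀ {t : List ℕ}, 2 ≤ t.length → t ≠ [] := fun h =>
      List.ne_nil_of_length_pos (by omega)
    refine ⟨not_closed_power_iff hB
      (fun k hk s t hs ht hper hX => hX.transfers hk hper hs ht)
      (fun k hk s t hs ht h h' => innerPowerTransfer_of_transfers hk hs ht h h')
      (fun S S' s t => innerPowerTransfer_antitone) hD0 hD,
      not_closed_power_iff hB
      (fun k hk s t hs ht hper hX => hX.transfers hk hper hs ht)
      (fun k hk s t hs ht h h' => bothPowerTransfer_of_transfers hk (hne ht) h h')
      (fun S S' s t => bothPowerTransfer_antitone) hD0 hD, ?_⟩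
    rw [not_closed_power_iff hB (K := fun k => reversed (bothPowerWords k))
      (X := fun Sol s t => BothPowerTransfer Sol s.reverse t.reverse)
      (fun k hk s t hs ht hper hX => transfers_reversed.mpr
        (hX.transfers hk (samePeriod_reverse.mpr hper) (by simpa) (by simpa)))
      (fun k hk s t hs ht h h' => by
        have := bothPowerTransfer_of_transfers hk (by simpa using hne ht)
          (transfers_reversed.mp h) (transfers_reversed.mp h')
        rwa [samePeriod_reverse] at this)
      (fun S S' s t => bothPowerTransfer_antitone) hD0 hD]
    simp [Violates]
  rw [Criterion, or_iff_right hB]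
  constructor
  · rintro ⟨h1, h2, h3, h4, h5, h6, h7, h8⟩
    obtain ⟨p1, p2, p3⟩ := hpow (hsq.mp h1)
    exact ⟨hsq.mp h1, hlin.mp h2, hcyc.mp h3, hleft.mp h4, hleft'.mp h5, p1.mp h6, p2.mp h7,
      p3.mp h8⟩
  · rintro ⟨h1, h2, h3, h4, h5, h6, h7, h8⟩
    obtain ⟨p1, p2, p3⟩ := hpow h1
    exact ⟨hsq.mpr h1, hlin.mpr h2, hcyc.mpr h3, hleft.mpr h4, hleft'.mpr h5, p1.mpr h6, p2.mpr h7,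
      p3.mpr h8⟩

theorem allCyclicallyRegular_iff_criterion (B : List Identity) :
    AllCyclicallyRegular.{u} B ↔ Criterion B := by
  by_cases hB : ∃ i ∈ B, IsShort i.left i.right
  · obtain ⟨i, hi, h⟩ := hB
    exact iff_of_true (allCyclicallyRegular_of_isShort hi h) (Or.inl ⟨i, hi, h⟩)
  · rw [allCyclicallyRegular_iff, noObstruction_iff hB]

end Criterion

/-! ### Definability of the criterion. -/

namespace Context

variable {α β : Type} {C : Context α} {C' : Context β} {s t : α → List ℕ} {B : α → List Identity}

lemma IsWord.isShort (hs : C.IsWord s) (ht : C.IsWord t) :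
    C.Definable fun a => IsShort (s a) (t a) :=
  (hs.two_le_length.and ht.two_le_length).not.and
    (hs.two_le_length.not.and (ht.two_le_length.not.and (hs.subset ht))).not

lemma IsWord.violates (hs : C.IsWord s) (ht : C.IsWord t) {X : α → List ℕ → List ℕ → Prop}
    (h : C.Definable fun a => X a (s a) (t a)) (h' : C.Definable fun a => X a (t a) (s a)) :
    C.Definable fun a => Violates (X a) (s a) (t a) :=
  (hs.two_le_length.and ht.two_le_length).and (h.and h').not

lemma forall_identity (hB : ∀ a, C.toks a = basisTokens (B a)) {P : α → List ℕ → List ℕ → Prop}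
    (hP : ∀ (β : Type) (C' : Context β) (f : β → α) (s t : β → List ℕ), C'.Extends C f →
      C'.IsWord s → C'.IsWord t → C'.Definable fun b => P (f b) (s b) (t b)) :
    C.Definable fun a => ∀ i ∈ B a, P a i.left i.right :=
  (exists_identity hB (P := fun a s t => ¬ P a s t) fun β C' f s t hf hs ht =>
    (hP β C' f s t hf hs ht).not).not.congr fun a => by push Not; rfl

/-- Letters that occur on neither side are irrelevant, so quantifying over positions suffices. -/
lemma samePeriod_iff {g : ℕ} {s t : List ℕ} : SamePeriod g s t ↔
    (∀ z ∈ s, s.count z ≡ t.count z [MOD g]) ∧ ∀ z ∈ t, s.count z ≡ t.count z [MOD g] := by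
  refine ⟨fun h => ⟨fun z _ => h z, fun z _ => h z⟩, fun h z => ?_⟩
  by_cases hs : z ∈ s
  · exact h.1 z hs
  · by_cases ht : z ∈ t
    · exact h.2 z ht
    · rw [List.count_eq_zero.mpr hs, List.count_eq_zero.mpr ht]

lemma isPeriod (hB : ∀ a, C.toks a = basisTokens (B a)) {g : α → ℕ} (hg : C.IsNum g) :
    C.Definable fun a => IsPeriod (B a) (g a) := by
  refine forall_identity hB (P := fun a s t => SamePeriod (g a) s t)
    fun β C' f s t hf hs ht => ?_
  have key : ∀ {l : β → List ℕ}, C'.IsWord l → C'.Definable fun b => ∀ z ∈ l b,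
      (s b).count z ≡ (t b).count z [MOD g (f b)] := fun hl =>
    hl.forall_mem fun β C'' f' z hf' hz =>
      (hs.comp hf').count_modEq (ht.comp hf') hz ((hg.comp hf).comp hf')
  exact ((key hs).and (key ht)).congr fun b => samePeriod_iff.symm

/-- A common divisor of the occurrence numbers of a nonempty word is at most its length, hence the
quantifier over `g` becomes one over positions. For the empty word there is no such bound. -/
lemma IsWord.periodSolvable (hB : ∀ a, C.toks a = basisTokens (B a)) (hs : C.IsWord s) :
    C.Definable fun a => s a ≠ [] → PeriodSolvable (B a) (s a) := by
  have hlt : ∀ a, (s a).length < (C.toks a).length := by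
    obtain ⟨pos, rev, h1, -⟩ := hs
    exact h1
  have hf := C.push_extends
  refine (hs.eq_nil.not.imp (Definable.exists_pos (P := fun a g => 2 ≤ g ∧ IsPeriod (B a) g ∧
    ∀ z ∈ s a, g ∣ (s a).count z) ?_).not).congr fun a => ?_
  · refine (C.isNum_push.two_le fun p => p.2).and
      ((isPeriod (B := fun p => B p.1.1) (fun p => hB p.1.1) C.isNum_push).and ?_)
    exact (hs.comp hf).forall_mem fun β C' f z hf' hz =>
      ((hs.comp hf).comp hf').dvd_count hz (C.isNum_push.comp hf')
  · refine imp_congr_right fun hne => ?_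
    constructor
    · intro h g hg hper
      by_contra hc
      push Not at hc
      obtain ⟨z, hz⟩ := List.exists_mem_of_ne_nil _ hne
      have h1 := Nat.le_of_dvd (List.count_pos_iff.mpr hz) (hc z hz)
      have h2 := List.count_le_length (l := s a) (a := z)
      have := hlt a
      exact h ⟨g, by omega, hg, hper, hc⟩
    · rintro h ⟨g, -, hg, hper, hc⟩
      obtain ⟨z, hz, hzg⟩ := h g hg hper
      exact hzg (hc z hz)

lemma criterion (hB : ∀ a, C.toks a = basisTokens (B a)) :
    C.Definable fun a => Criterion (B a) := by
  have hB' : ∀ {β : Type} {C' : Context β} {f : β → α}, C'.Extends C f →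
      ∀ b, C'.toks b = basisTokens (B (f b)) := by
    rintro β C' f ⟨ρ, hρ⟩ b
    rw [(hρ b).1, hB]
  have inner : ∀ {β : Type} {C' : Context β} {f : β → α} {s t : β → List ℕ}, C'.Extends C f →
      C'.IsWord s → C'.IsWord t →
      C'.Definable fun b => InnerPowerTransfer (PeriodSolvable (B (f b))) (s b) (t b) :=
    fun {_ _ f _ _} hf hs ht => (hs.innerPowerTransfer ht
      (Sol := fun b l => l ≠ [] → PeriodSolvable (B (f b)) l)
      fun β' C'' f' l hf' hl => hl.periodSolvable (hB' (hf'.trans hf))).congr fun b =>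
        -- Solvability is only asked of nonempty words, so the guard makes no difference.
        ⟨innerPowerTransfer_antitone fun _ _ h _ => h, innerPowerTransfer_antitone fun _ h h' => h' h⟩
  have both : ∀ {β : Type} {C' : Context β} {f : β → α} {s t : β → List ℕ}, C'.Extends C f →
      C'.IsWord s → C'.IsWord t →
      C'.Definable fun b => BothPowerTransfer (PeriodSolvable (B (f b))) (s b) (t b) :=
    fun {_ _ f _ _} hf hs ht => (hs.bothPowerTransfer ht
      (Sol := fun b l => l ≠ [] → PeriodSolvable (B (f b)) l)
      fun β' C'' f' l hf' hl => hl.periodSolvable (hB' (hf'.trans hf))).congr fun b =>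
        ⟨bothPowerTransfer_antitone fun _ _ h _ => h, bothPowerTransfer_antitone fun _ h h' => h' h⟩
  have h0 := exists_identity hB (P := fun _ => IsShort) fun β C' f s t _ hs ht => hs.isShort ht
  have h1 := exists_identity hB (P := fun _ => Violates SquareTransfer) fun β C' f s t _ hs ht =>
    hs.violates ht (X := fun _ => SquareTransfer) (hs.squareTransfer ht) (ht.squareTransfer hs)
  have h2 := exists_identity hB (P := fun _ => Violates LinearTransfer) fun β C' f s t _ hs ht =>
    hs.violates ht (X := fun _ => LinearTransfer) (hs.linearTransfer ht) (ht.linearTransfer hs)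
  have h3 := exists_identity hB (P := fun _ => Violates CyclicTransfer) fun β C' f s t _ hs ht =>
    hs.violates ht (X := fun _ => CyclicTransfer) (hs.cyclicTransfer ht) (ht.cyclicTransfer hs)
  have h4 := exists_identity hB (P := fun _ => Violates LeftPowerTransfer)
    fun β C' f s t _ hs ht => hs.violates ht (X := fun _ => LeftPowerTransfer)
      (hs.leftPowerTransfer ht) (ht.leftPowerTransfer hs)
  have h5 := exists_identity hB (P := fun _ s t => Violates LeftPowerTransfer s.reverse t.reverse)
    fun β C' f s t _ hs ht => hs.reverse.violates ht.reverse (X := fun _ => LeftPowerTransfer)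
      (hs.reverse.leftPowerTransfer ht.reverse) (ht.reverse.leftPowerTransfer hs.reverse)
  have h6 := exists_identity hB
    (P := fun a => Violates (InnerPowerTransfer (PeriodSolvable (B a))))
    fun β C' f s t hf hs ht => hs.violates ht
      (X := fun b => InnerPowerTransfer (PeriodSolvable (B (f b)))) (inner hf hs ht) (inner hf ht hs)
  have h7 := exists_identity hB
    (P := fun a => Violates (BothPowerTransfer (PeriodSolvable (B a))))
    fun β C' f s t hf hs ht => hs.violates ht
      (X := fun b => BothPowerTransfer (PeriodSolvable (B (f b)))) (both hf hs ht) (both hf ht hs)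
  have h8 := exists_identity hB
    (P := fun a s t => Violates (BothPowerTransfer (PeriodSolvable (B a))) s.reverse t.reverse)
    fun β C' f s t hf hs ht => hs.reverse.violates ht.reverse
      (X := fun b => BothPowerTransfer (PeriodSolvable (B (f b))))
      (both hf hs.reverse ht.reverse) (both hf ht.reverse hs.reverse)
  exact h0.or (h1.and (h2.and (h3.and (h4.and (h5.and (h6.and (h7.and h8)))))))

end Context

/-- Cyclic regularity is expressed by a formula over the tokens of a basis. -/
lemma exists_formula : ∃ φ : Formula 0, ∀ B : List Identity,
    φ.eval (basisTokens B) Fin.elim0 ↔ AllCyclicallyRegular.{u} B := by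
  let C : Context (List Identity) := ⟨0, basisTokens, fun _ => Fin.elim0⟩
  obtain ⟨φ, hφ⟩ := C.criterion (B := id) fun _ => rfl
  exact ⟨φ, fun B => (hφ B).trans (allCyclicallyRegular_iff_criterion B).symm⟩

end CyclicRegularity

theorem corollary3 :
    ∃ f : List CyclicRegularity.Identity → Bool,
      (∀ B : List CyclicRegularity.Identity,
        f B = true ↔ CyclicRegularity.AllCyclicallyRegular.{u} B) ∧
      Nonempty (Turing.TM2ComputableInPolyTime
        CyclicRegularity.encodeBasis Computability.encodeBool f) := by
  obtain ⟨φ, hφ⟩ := CyclicRegularity.exists_formula.{u}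
  exact ⟨_, fun B => by simpa using hφ B, φ.computableInPolyTime⟩
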